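/- Fix an integer $k\ge 0$. **Data.** Let $A[M_k]$ be the commutative $\mathbb{C}$-algebra generated by the entries of matrices $M^j=(M^j_{ab})$ of size $(2k+2)\times k$ and $N^j=(N^j_{dc})$ of size $k\times(2k+2)$, $j=1,\dots,4$, with the relations $N^jM^l+N^lM^j=0$ for all $j,l$; write $M^{1\dagger}=-N^2$, $M^{2\dagger}=N^1$, $M^{3\dagger}=-N^4$, $M^{4\dagger}=N^3$. Let $A_0[\mathbb{C}^4]$ be $\mathbb{C}[z_j,z_j^*:1\le j\le 4]$ with $r=z_1z_1^*+z_2z_2^*$ inverted, $A[\mathbb{R}^4]=\mathbb{C}[\zeta_1,\zeta_1^*,\zeta_2,\zeta_2^*]$ and $\Omega(\mathbb{R}^4)=A[\mathbb{R}^4]\otimes\Lambda(d\zeta_i,d\zeta_i^*)$. Consider a commutative, cocommutative Hopf algebra $H$ with a Hopf bicharacter $F$ and a coaction $z_i\mapsto\sum_j A_{ij}\otimes z_j$, $z_i^*\mapsto\sum_j A_{ij}^*\otimes z_j^*$, in one of the following two cases. * *Moyal case* ($\hbar\in\mathbb{R}$, $\alpha,\beta\in\mathbb{C}$): $H=\mathbb{C}[t_1,t_1^*,t_2,t_2^*]$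 with primitive generators; $F(t_1^*,t_1)=-F(t_1,t_1^*)=\tfrac12 i\hbar\alpha$, $F(t_2,t_2^*)=-F(t_2^*,t_2)=\tfrac12 i\hbar\beta$, and $F=0$ on the other pairs of generators; $z_1,z_2$ are coinvariant, $z_3\mapsto 1\otimes z_3+t_1^*\otimes z_1+t_2^*\otimes z_2$, $z_4\mapsto 1\otimes z_4-t_2\otimes z_1+t_1\otimes z_2$, and conjugately for the $z_j^*$. On $A[\mathbb{R}^4]$: $\zeta_i\mapsto 1\otimes\zeta_i+t_i\otimes 1$, $\zeta_i^*\mapsto 1\otimes\zeta_i^*+t_i^*\otimes 1$. * *Toric case* ($\theta\in\mathbb{R}$): $H=\mathbb{C}[s_1^{\pm1},s_2^{\pm1}]$ with group-like $s_j$; $F(s_j,s_l)=e^{i\pi\Theta_{jl}}$, $\Theta=\tfrac12\begin{pmatrix}0&\theta\\-\theta&0\end{pmatrix}$; $(A_{ij})=\mathrm{diag}(s_1,s_1^{-1},s_2,s_2^{-1})$ with $s_j^*=s_j^{-1}$. On $A[\mathbb{R}^4]$: $\zeta_1\mapsto s_1s_2^{-1}\otimes\zeta_1$, $\zeta_2\mapsto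 s_1^{-1}s_2^{-1}\otimes\zeta_2$, and conjugately. $H$ coacts on $A[M_k]$ by $M^j_{ab}\mapsto\sum_r S(A_{rj})\otimes M^r_{ab}$, likewise on the $N^j$, and on $\Omega(\mathbb{R}^4)$ so that $d$ is equivariant. Write $a\mapsto a_{-1}\otimes a_0$ for coactions and $h\mapsto h_1\otimes h_2$ for the coproduct. For a comodule algebra $A$ let $A_F$ be the space $A$ with the product $a\cdot_F b=F(a_{-1},b_{-1})\,a_0b_0$, and let $A[M_k]_F\rtimes H$ be the smash product $(a\otimes h)(b\otimes g)=a(h_1\triangleright b)\otimes h_2g$, where $h\triangleright a=R(a_{-1},h)a_0$ and $R(h,g)=F(g_1,h_1)F^{-1}(h_2,g_2)$. Let $\mu(m\otimes c)=m\otimes c_{-1}\otimes c_0$ be the bosonisation map $A[M_k]\otimes A_0[\mathbb{C}^4]\to(A[M_k]_F\rtimes H)\otimes A_0[\mathbb{C}^4]_F$. Put $J(z)=(-z_2^*,z_1^*,-z_4^*,z_3^*)$, $J(z)^*=(-z_2,z_1,-z_4,z_3)$ and, for $w=z$ and $w=J(z)$, $$\tilde\sigma_w=\mu\Big(\sum_j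 M^j\otimes w_j\Big),\qquad \tilde\sigma_w^*=\mu\Big(\sum_j M^{j\dagger}\otimes w_j^*\Big),$$ $$\tilde V=\big(\tilde\sigma_z\ \ \tilde\sigma_{J(z)}\big),\qquad \tilde V^*=\begin{pmatrix}\tilde\sigma_z^*\\ \tilde\sigma_{J(z)}^*\end{pmatrix},\qquad \tilde\rho^2=\tilde\sigma_z^*\tilde\sigma_z .$$ Adjoin universally the entries of an inverse $\tilde\rho^{-2}$ of the $k\times k$ matrix $\tilde\rho^2$, and put $\tilde P=1-\tilde V\,\mathrm{diag}(\tilde\rho^{-2},\tilde\rho^{-2})\,\tilde V^*$. In both cases the following hold. **1. A family of rank-two bundles.** $\tilde V^*\tilde V=\mathrm{diag}(\tilde\rho^2,\tilde\rho^2)$, $\tilde P^2=\tilde P$ and $\operatorname{tr}\tilde P=2$. The entries of $\tilde P$ are functions on the quantised $\mathbb{R}^4$, as follows. Identify $\zeta_1=r^{-1}(z_1z_3^*+z_2^*z_4)$, $\zeta_2=r^{-1}(z_2z_3^*-z_1^*z_4)$, and put $v_1=M^1+M^3\zeta_1^*-M^4\zeta_2$, $v_2=M^2+M^3\zeta_2^*+M^4\zeta_1$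 (so that $\sigma_z=v_1z_1+v_2z_2$ and $\sigma_{J(z)}=-v_1z_2^*+v_2z_1^*$), with adjoints $v_1^*=M^{1\dagger}+M^{3\dagger}\zeta_1-M^{4\dagger}\zeta_2^*$, $v_2^*=M^{2\dagger}+M^{3\dagger}\zeta_2+M^{4\dagger}\zeta_1^*$. Let $\tilde v_i,\tilde v_i^*$ be their images under $m\otimes c\mapsto F^{-1}(m_{-1},c_{-1})\,\mu(m_0\otimes c_0)$ in $(A[M_k]_F\rtimes H)\otimes A[\mathbb{R}^4]_F$, let $\hat g=\tilde v_1^*\tilde v_1$, and let $\mathcal R$ be $(A[M_k]_F\rtimes H)\otimes A[\mathbb{R}^4]_F$ with an inverse of the matrix $\hat g$ universally adjoined. Then there is an algebra map from $\mathcal R$ to the algebra containing the entries of $\tilde P$ that is the identity on $A[M_k]_F\rtimes H$, is given on the $\zeta_i,\zeta_i^*$ by the identification above, satisfies $\hat g\, r=\tilde\rho^2$, and sends the matrix $1-\sum_{i=1,2}\tilde v_i\hat g^{-1}\tilde v_i^*$ to $\tilde P$. This matrix over $\mathcal R$, again denoted $\tilde P$, is an idempotent of trace $2$, and $\mathcal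 E=\tilde P\,\mathcal R^{2k+2}$ is a finitely generated projective right $\mathcal R$-module: a family of rank-two bundles over the quantised $\mathbb{R}^4$ parameterised by $A[M_k]_F\rtimes H$. **2. Anti-self-duality.** Let $\Omega$ be $(A[M_k]_F\rtimes H)\otimes\Omega(\mathbb{R}^4)_F$ with an inverse of $\hat g$ universally adjoined. The differential $\mathrm{id}\otimes d$ and the grading involution extend to $\Omega$, the former by the graded Leibniz rule and the latter multiplicatively. For any such extension, $\nabla\psi=\tilde P\,d\psi$ is a connection on $\mathcal E$, that is, $\nabla(\psi a)=(\nabla\psi)a+\psi\,da$ for $\psi\in\mathcal E$, $a\in\mathcal R$; its curvature is $\nabla^2\psi=\mathcal F\psi$ with $\mathcal F=\tilde P(d\tilde P)^2$; and $\mathcal F$ is anti-self-dual, $(\mathrm{id}\otimes *)\mathcal F=-\mathcal F$, in the sense that $\mathcal F$ is the image of a matrix $G$ over $\mathcal R\otimes\Lambda^2(d\zeta_i,d\zeta_i^*)$ with $(\mathrm{id}\otimes *)G=-G$. Here $*$ is the Euclidean Hodge operator for the orientation $dx_1\wedge dx_2\wedge dx_3\wedge dx_4$, where $\zeta_1^*=x_1+ix_2$,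 $\zeta_2=x_3+ix_4$. **3. Reality.** In the toric case, and in the Moyal case whenever $i\hbar\alpha$ and $i\hbar\beta$ are real, the algebra containing the entries of the original $\tilde P$ and the algebra $\mathcal R$ carry $*$-structures (conjugate-linear involutive anti-automorphisms) with $(M^j_{ab})^*=(M^{j\dagger})_{ba}$, $A_{ij}\mapsto A_{ij}^*$, $z_j\mapsto z_j^*$ on the former, and $(M^j_{ab})^*=(M^{j\dagger})_{ba}$, $A_{ij}\mapsto A_{ij}^*$, $\zeta_i\mapsto\zeta_i^*$ on the latter. For these, $\tilde V^*$ is the adjoint of $\tilde V$ and $\tilde P=\tilde P^*$ (both for the original $\tilde P$ and for the one over $\mathcal R$). -/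

import Mathlib

set_option linter.unusedSectionVars false

noncomputable section

open scoped TensorProduct Coalgebra

namespace ADHM

variable {H : Type} [CommRing H] [HopfAlgebra ℂ H] [Coalgebra.IsCocomm ℂ H]

/-! ### Bicharacters, coactions, twisted algebras -/

/-- A Hopf bicharacter `F : H ⊗ H → ℂ`, given by the two maps `h ↦ F(h,·)` and `g ↦ F(·,g)` into the
convolution algebra of functionals on `H`: these being algebra maps says
`F(hh',g) = F(h,g₁) F(h',g₂)` and `F(h,gg') = F(h₁,g) F(h₂,g')` (and unitality). -/
structure Bichar (H : Type) [CommRing H] [HopfAlgebra ℂ H] [Coalgebra.IsCocomm ℂ H] where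
  left : H →ₐ[ℂ] WithConv (H →ₗ[ℂ] ℂ)
  right : H →ₐ[ℂ] WithConv (H →ₗ[ℂ] ℂ)
  left_eq_right : ∀ h g, (left h).ofConv g = (right g).ofConv h

/-- The structure of a left `H`-comodule algebra on `A`. -/
structure Coaction (H A : Type) [CommRing H] [HopfAlgebra ℂ H] [Ring A] [Algebra ℂ A] where
  coact : A →ₐ[ℂ] H ⊗[ℂ] A
  coassoc : ((Algebra.TensorProduct.assoc ℂ ℂ ℂ H H A).toAlgHom.comp
      (Algebra.TensorProduct.map (Bialgebra.comulAlgHom ℂ H) (AlgHom.id ℂ A))).comp coact =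
    (Algebra.TensorProduct.map (AlgHom.id ℂ H) coact).comp coact
  counit : ((Algebra.TensorProduct.lid ℂ A).toAlgHom.comp
      (Algebra.TensorProduct.map (Bialgebra.counitAlgHom ℂ H) (AlgHom.id ℂ A))).comp coact =
    AlgHom.id ℂ A

lemma antipode_comul (h : H) : Coalgebra.comul (R := ℂ) (HopfAlgebra.antipode ℂ h) =
    TensorProduct.map (HopfAlgebra.antipode ℂ) (HopfAlgebra.antipode ℂ)
      (Coalgebra.comul (R := ℂ) h) := by
  have e : WithConv.toConv (Bialgebra.comulAlgHom ℂ H) =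
      WithConv.toConv (Algebra.TensorProduct.includeLeft : H →ₐ[ℂ] H ⊗[ℂ] H) *
        WithConv.toConv (Algebra.TensorProduct.includeRight : H →ₐ[ℂ] H ⊗[ℂ] H) := by
    apply WithConv.ofConv_injective
    ext x
    rw [AlgHom.convMul_apply]
    change Coalgebra.comul x = _
    generalize Coalgebra.comul (R := ℂ) x = y
    induction y with
    | zero => simp
    | add a b ha hb => rw [map_add, ← ha, ← hb]
    | tmul a b => simp
  have e2 := congrArg (fun f => (f⁻¹).ofConv h) e
  have e3 := mul_inv (WithConv.toConv (Algebra.TensorProduct.includeLeft : H →ₐ[ℂ] H ⊗[ℂ] H))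
    (WithConv.toConv (Algebra.TensorProduct.includeRight : H →ₐ[ℂ] H ⊗[ℂ] H))
  erw [e3] at e2
  change Coalgebra.comul (R := ℂ) (HopfAlgebra.antipode ℂ h) = _ at e2
  rw [e2, AlgHom.convMul_apply]
  generalize Coalgebra.comul (R := ℂ) h = y
  induction y with
  | zero => simp
  | add a b ha hb => rw [map_add, map_add, ← ha, ← hb]
  | tmul a b => 
    change (HopfAlgebra.antipode ℂ a ⊗ₜ[ℂ] (1:H)) * ((1:H) ⊗ₜ[ℂ] HopfAlgebra.antipode ℂ b) = _
    simp

namespace Bichar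

lemma left_one_apply (F : Bichar H) (g : H) : (F.left 1).ofConv g = Coalgebra.counit (R := ℂ) g := by
  rw [map_one]; simp [LinearMap.convOne_def]

/-- `F⁻¹(h,g) = F(S h, g)`. -/
def inv (F : Bichar H) : Bichar H where
  left := F.left.comp (HopfAlgebra.antipodeAlgHom ℂ H)
  right := AlgHom.ofLinearMap
    { toFun := fun g => WithConv.toConv ((F.right g).ofConv ∘ₗ HopfAlgebra.antipode ℂ)
      map_add' := by intros; ext; simp
      map_smul' := by intros; ext; simp }
    (by ext x; simp [LinearMap.convOne_def])
    (by
      intro x y; ext h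
      simp [LinearMap.convMul_apply, antipode_comul]
      generalize Coalgebra.comul (R := ℂ) h = z
      induction z with
      | zero => simp
      | add a b ha hb => simp only [map_add, ha, hb]
      | tmul a b => simp)
  left_eq_right h g := by
    simpa using F.left_eq_right _ _

/-- `F(g,h)`. -/
def flip (F : Bichar H) : Bichar H := ⟨F.right, F.left, fun h g => (F.left_eq_right g h).symm⟩

/-- convolution product `(F * G)(h,g) = F(h₁,g₁) G(h₂,g₂)`. -/
def conv (F G : Bichar H) : Bichar H where
  left := (WithConv.toConv F.left * WithConv.toConv G.left).ofConv
  right := (WithConv.toConv F.right * WithConv.toConv G.right).ofConv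
  left_eq_right h g := by
    have key : ∀ (P Q : H →ₐ[ℂ] WithConv (H →ₗ[ℂ] ℂ)) (x y : H),
        ((WithConv.toConv P * WithConv.toConv Q).ofConv x).ofConv y =
          ∑ i ∈ (ℛ ℂ x).index, ∑ j ∈ (ℛ ℂ y).index,
            (P ((ℛ ℂ x).left i)).ofConv ((ℛ ℂ y).left j) *
              (Q ((ℛ ℂ x).right i)).ofConv ((ℛ ℂ y).right j) := by
      intro P Q x y
      rw [AlgHom.convMul_apply]
      conv_lhs => rw [← (ℛ ℂ x).eq]
      simp only [map_sum, Algebra.TensorProduct.lift_tmul, WithConv.ofConv_sum,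
        LinearMap.sum_apply, (ℛ ℂ y).convMul_apply]
    rw [key, key, Finset.sum_comm]
    simp only [left_eq_right]
end Bichar

namespace Coaction
variable {A : Type} [Ring A] [Algebra ℂ A] (δ : Coaction H A)

lemma coassoc_apply (a : A) :
    TensorProduct.assoc ℂ H H A ((Coalgebra.comul (R := ℂ)).rTensor A (δ.coact a)) =
      (δ.coact.toLinearMap).lTensor H (δ.coact a) := by
  have := DFunLike.congr_fun δ.coassoc a
  exact this

/-- `φ ▷ a = φ(a₋₁) a₀`. -/
def lact (φ : WithConv (H →ₗ[ℂ] ℂ)) : A →ₗ[ℂ] A :=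
  (TensorProduct.lid ℂ A).toLinearMap ∘ₗ φ.ofConv.rTensor A ∘ₗ δ.coact.toLinearMap

lemma lact_apply (φ : WithConv (H →ₗ[ℂ] ℂ)) (a : A) :
    δ.lact φ a = TensorProduct.lid ℂ A (φ.ofConv.rTensor A (δ.coact a)) := rfl

lemma lact_one : δ.lact 1 = LinearMap.id := by
  ext a
  have := DFunLike.congr_fun δ.counit a
  exact this

lemma lact_mul (φ ψ : WithConv (H →ₗ[ℂ] ℂ)) : δ.lact (φ * ψ) = δ.lact ψ ∘ₗ δ.lact φ := by
  ext a
  let E : H ⊗[ℂ] (H ⊗[ℂ] A) →ₗ[ℂ] A :=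
    (TensorProduct.lid ℂ A).toLinearMap ∘ₗ TensorProduct.map φ.ofConv
      ((TensorProduct.lid ℂ A).toLinearMap ∘ₗ ψ.ofConv.rTensor A)
  have h1 : ∀ t : H ⊗[ℂ] A, TensorProduct.lid ℂ A ((φ * ψ).ofConv.rTensor A t) =
      E (TensorProduct.assoc ℂ H H A ((Coalgebra.comul (R := ℂ)).rTensor A t)) := by
    intro t
    induction t with
    | zero => simp
    | add x y hx hy => simp only [map_add, hx, hy]
    | tmul h a =>
      simp only [LinearMap.rTensor_tmul, LinearMap.convMul_apply, TensorProduct.lid_tmul]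
      generalize Coalgebra.comul (R := ℂ) h = z
      induction z with
      | zero => simp
      | add x y hx hy => simp only [map_add, add_smul, TensorProduct.add_tmul, hx, hy]
      | tmul x y => simpa [E, mul_smul] using smul_comm _ _ _
  have h2 : ∀ t : H ⊗[ℂ] A, δ.lact ψ (TensorProduct.lid ℂ A (φ.ofConv.rTensor A t)) =
      E ((δ.coact.toLinearMap).lTensor H t) := by
    intro t
    induction t with
    | zero => simp
    | add x y hx hy => simp only [map_add, hx, hy]
    | tmul h a => simp [E, lact_apply]
  rw [lact_apply, h1, coassoc_apply, ← h2]
  rfl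

lemma coact_lact (φ : WithConv (H →ₗ[ℂ] ℂ)) (a : A) :
    δ.coact (δ.lact φ a) = (δ.lact φ).lTensor H (δ.coact a) := by
  let E : (H ⊗[ℂ] H) ⊗[ℂ] A →ₗ[ℂ] H ⊗[ℂ] A :=
    (((TensorProduct.lid ℂ H).toLinearMap ∘ₗ φ.ofConv.rTensor H).rTensor A)
  let E' : (H ⊗[ℂ] H) ⊗[ℂ] A →ₗ[ℂ] H ⊗[ℂ] A :=
    (((TensorProduct.rid ℂ H).toLinearMap ∘ₗ φ.ofConv.lTensor H).rTensor A)
  have h1 : ∀ t : H ⊗[ℂ] A, δ.coact (TensorProduct.lid ℂ A (φ.ofConv.rTensor A t)) =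
      E ((TensorProduct.assoc ℂ H H A).symm ((δ.coact.toLinearMap).lTensor H t)) := by
    intro t
    induction t with
    | zero => simp
    | add x y hx hy => simp only [map_add, hx, hy]
    | tmul h a =>
      simp only [LinearMap.rTensor_tmul, LinearMap.lTensor_tmul, TensorProduct.lid_tmul, map_smul,
        AlgHom.toLinearMap_apply]
      generalize δ.coact a = z
      induction z with
      | zero => simp
      | add x y hx hy => simp only [map_add, smul_add, TensorProduct.tmul_add, hx, hy]
      | tmul x y => simp [E, TensorProduct.smul_tmul']
  have h2 : ∀ t : H ⊗[ℂ] A, (δ.lact φ).lTensor H t =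
      E' ((TensorProduct.assoc ℂ H H A).symm ((δ.coact.toLinearMap).lTensor H t)) := by
    intro t
    induction t with
    | zero => simp
    | add x y hx hy => simp only [map_add, hx, hy]
    | tmul h a =>
      simp only [LinearMap.lTensor_tmul, AlgHom.toLinearMap_apply, lact_apply]
      generalize δ.coact a = z
      induction z with
      | zero => simp
      | add x y hx hy => simp only [map_add, TensorProduct.tmul_add, hx, hy]
      | tmul x y => simp [E', TensorProduct.smul_tmul]
  have h3 : ∀ t : H ⊗[ℂ] A, E ((Coalgebra.comul (R := ℂ)).rTensor A t) =
      E' ((Coalgebra.comul (R := ℂ)).rTensor A t) := by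
    intro t
    induction t with
    | zero => simp
    | add x y hx hy => simp only [map_add, hx, hy]
    | tmul h a =>
      simp only [LinearMap.rTensor_tmul, E, E']
      congr 1
      have h5 : ∀ z : H ⊗[ℂ] H, TensorProduct.lid ℂ H (φ.ofConv.rTensor H z) =
          TensorProduct.rid ℂ H (φ.ofConv.lTensor H (TensorProduct.comm ℂ H H z)) := by
        intro z
        induction z with
        | zero => simp
        | add x y hx hy => simp only [map_add, hx, hy]
        | tmul x y => simp
      have h6 := h5 (Coalgebra.comul (R := ℂ) h)
      rw [Coalgebra.comm_comul ℂ h] at h6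
      exact h6
  have h4 := δ.coassoc_apply a
  rw [← LinearEquiv.eq_symm_apply] at h4
  rw [lact_apply, h1, h2, ← h4, h3]

lemma lact_mul_left (F : Bichar H) (h : H) (a b : A) :
    δ.lact (F.left h) (a * b) = ∑ i ∈ (ℛ ℂ h).index,
      δ.lact (F.left ((ℛ ℂ h).left i)) a * δ.lact (F.left ((ℛ ℂ h).right i)) b := by
  simp only [lact_apply, map_mul]
  generalize δ.coact a = s
  generalize δ.coact b = t
  induction s with
  | zero => simp
  | add x y hx hy => simp only [map_add, add_mul, hx, hy, Finset.sum_add_distrib]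
  | tmul x a =>
    induction t with
    | zero => simp
    | add x y hx hy => simp only [map_add, mul_add, hx, hy, Finset.sum_add_distrib]
    | tmul y b =>
      simp only [Algebra.TensorProduct.tmul_mul_tmul, LinearMap.rTensor_tmul,
        TensorProduct.lid_tmul, F.left_eq_right, map_mul, (ℛ ℂ h).convMul_apply, Finset.sum_smul,
        smul_mul_smul_comm]

lemma lact_left_one (F : Bichar H) (h : H) :
    δ.lact (F.left h) 1 = Coalgebra.counit (R := ℂ) h • (1 : A) := by
  rw [lact_apply, map_one, Algebra.TensorProduct.one_def, LinearMap.rTensor_tmul,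
    TensorProduct.lid_tmul, F.left_eq_right, map_one]
  simp [LinearMap.convOne_def]

/-- `h ⊗ a ↦ (b ↦ a · (F(·,h) ▷ b))` -/
def opT (F : Bichar H) : H ⊗[ℂ] A →ₗ[ℂ] A →ₗ[ℂ] A :=
  TensorProduct.lift (LinearMap.mk₂ ℂ (fun h a => LinearMap.mulLeft ℂ a ∘ₗ δ.lact (F.left h))
    (by intros; ext; simp [lact_apply, LinearMap.rTensor_add, mul_add])
    (by intros; ext; simp [lact_apply, LinearMap.rTensor_smul])
    (by intros; ext; simp [add_mul])
    (by intros; ext; simp))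

lemma opT_tmul (F : Bichar H) (h : H) (a b : A) :
    δ.opT F (h ⊗ₜ a) b = a * δ.lact (F.left h) b := rfl

/-- `a ·_F b = F(a₋₁,b₋₁) a₀ b₀`. -/
def twMul (F : Bichar H) : A →ₗ[ℂ] A →ₗ[ℂ] A := δ.opT F ∘ₗ δ.coact.toLinearMap

lemma twMul_apply (F : Bichar H) (a b : A) : δ.twMul F a b = δ.opT F (δ.coact a) b := rfl

lemma one_twMul (F : Bichar H) (a : A) : δ.twMul F 1 a = a := by
  rw [twMul_apply, map_one, Algebra.TensorProduct.one_def, opT_tmul, map_one, lact_one]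
  simp

lemma twMul_one (F : Bichar H) (a : A) : δ.twMul F a 1 = a := by
  have h : ∀ t : H ⊗[ℂ] A, δ.opT F t 1 =
      TensorProduct.lid ℂ A ((Coalgebra.counit (R := ℂ)).rTensor A t) := by
    intro t
    induction t with
    | zero => simp
    | add x y hx hy => simp only [map_add, LinearMap.add_apply, hx, hy]
    | tmul h a => simp [opT_tmul, lact_left_one]
  rw [twMul_apply, h]
  exact DFunLike.congr_fun δ.counit a

lemma twMul_assoc (F : Bichar H) (a b c : A) :
    δ.twMul F (δ.twMul F a b) c = δ.twMul F a (δ.twMul F b c) := by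
  obtain ⟨S, hS⟩ := TensorProduct.exists_finset (δ.coact b)
  let L : A → H →ₗ[ℂ] A := fun x =>
    { toFun := fun h => δ.lact (F.left h) x
      map_add' := by intros; simp [lact_apply, LinearMap.rTensor_add]
      map_smul' := by intros; simp [lact_apply, LinearMap.rTensor_smul] }
  let q : A ⊗[ℂ] (A ⊗[ℂ] A) →ₗ[ℂ] A := LinearMap.mul' ℂ A ∘ₗ
    (TensorProduct.comm ℂ A A).toLinearMap ∘ₗ (LinearMap.mul' ℂ A).rTensor A ∘ₗ
      (TensorProduct.assoc ℂ A A A).symm.toLinearMap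
  let E : H × A → H ⊗[ℂ] (H ⊗[ℂ] A) →ₗ[ℂ] A := fun p =>
    q ∘ₗ TensorProduct.map (L p.2) ((L (δ.lact (F.left p.1) c)).rTensor A)
  have h1 : ∀ s : H ⊗[ℂ] A, δ.opT F (δ.coact (δ.opT F s b)) c =
      ∑ p ∈ S, E p ((δ.coact.toLinearMap).lTensor H s) := by
    intro s
    induction s with
    | zero => simp
    | add x y hx hy => simp only [map_add, LinearMap.add_apply, hx, hy, Finset.sum_add_distrib]
    | tmul h a =>
      simp only [opT_tmul, map_mul, coact_lact, hS, map_sum, LinearMap.lTensor_tmul,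
        AlgHom.toLinearMap_apply]
      generalize δ.coact a = z
      induction z with
      | zero => simp
      | add x y hx hy =>
        simp only [map_add, LinearMap.add_apply, hx, hy, Finset.sum_add_distrib, add_mul,
          TensorProduct.tmul_add]
      | tmul x y =>
        simp only [Finset.mul_sum, map_sum, LinearMap.sum_apply,
          Algebra.TensorProduct.tmul_mul_tmul, opT_tmul]
        refine Finset.sum_congr rfl fun p _ => ?_
        rw [mul_comm x, map_mul, lact_mul]
        simp [E, q, L, mul_assoc]
        rfl
  have h2 : ∀ s : H ⊗[ℂ] A, δ.opT F s (δ.opT F (δ.coact b) c) =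
      ∑ p ∈ S, E p (TensorProduct.assoc ℂ H H A ((Coalgebra.comul (R := ℂ)).rTensor A s)) := by
    intro s
    induction s with
    | zero => simp
    | add x y hx hy => simp only [map_add, LinearMap.add_apply, hx, hy, Finset.sum_add_distrib]
    | tmul h a =>
      rw [hS]
      simp only [opT_tmul, map_sum, LinearMap.sum_apply, LinearMap.rTensor_tmul]
      refine Finset.sum_congr rfl fun p _ => ?_
      rw [lact_mul_left]
      conv_rhs => rw [← (ℛ ℂ h).eq]
      simp only [TensorProduct.sum_tmul, map_sum, Finset.mul_sum]
      simp [E, q, L]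
      rfl
  rw [twMul_apply, twMul_apply, h1, twMul_apply, twMul_apply, h2, coassoc_apply]

end Coaction

/-- The twisted comodule algebra `A_F`: the space `A` with the product
`a ·_F b = F(a₋₁,b₋₁) a₀ b₀`. -/
def Tw {A : Type} [Ring A] [Algebra ℂ A] (_F : Bichar H) (_δ : Coaction H A) : Type := A

namespace Tw
variable {A : Type} [Ring A] [Algebra ℂ A] (F : Bichar H) (δ : Coaction H A)

instance : AddCommGroup (Tw F δ) := inferInstanceAs (AddCommGroup A)
instance : Module ℂ (Tw F δ) := inferInstanceAs (Module ℂ A)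

/-- the identity map `A → A_F`. -/
def mk : A ≃ₗ[ℂ] Tw F δ := LinearEquiv.refl ℂ A

instance : Mul (Tw F δ) := ⟨fun a b => mk F δ (δ.twMul F ((mk F δ).symm a) ((mk F δ).symm b))⟩
instance : One (Tw F δ) := ⟨mk F δ 1⟩

lemma mul_def (a b : Tw F δ) :
    a * b = mk F δ (δ.twMul F ((mk F δ).symm a) ((mk F δ).symm b)) := rfl
lemma one_def : (1 : Tw F δ) = mk F δ 1 := rfl

instance : Ring (Tw F δ) where
  mul_assoc a b c := by simp [mul_def, Coaction.twMul_assoc]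
  one_mul a := by simp [mul_def, one_def, Coaction.one_twMul]
  mul_one a := by simp [mul_def, one_def, Coaction.twMul_one]
  left_distrib a b c := by simp [mul_def]
  right_distrib a b c := by simp [mul_def]
  zero_mul a := by simp [mul_def]
  mul_zero a := by simp [mul_def]
  zsmul := (· • ·)
  zsmul_zero' := zero_zsmul
  zsmul_succ' n a := SubNegMonoid.zsmul_succ' n a
  zsmul_neg' n a := SubNegMonoid.zsmul_neg' n a
  neg_add_cancel := neg_add_cancel
  sub_eq_add_neg := sub_eq_add_neg
  nsmul := (· • ·)
  nsmul_zero := zero_nsmul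
  nsmul_succ n a := AddMonoid.nsmul_succ n a
  

instance : Algebra ℂ (Tw F δ) := Algebra.ofModule
  (fun c a b => by simp [mul_def]) (fun c a b => by simp [mul_def])

end Tw

/-- `R(h,g) = F(g₁,h₁) F⁻¹(h₂,g₂)`. -/
def Bichar.R (F : Bichar H) : Bichar H := F.flip.conv F.inv

namespace Tw
variable {A : Type} [Ring A] [Algebra ℂ A] (F : Bichar H) (δ : Coaction H A)

lemma lact_twMul (G : Bichar H) (h : H) (a b : A) :
    δ.lact (G.left h) (δ.twMul F a b) = ∑ i ∈ (ℛ ℂ h).index,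
      δ.twMul F (δ.lact (G.left ((ℛ ℂ h).left i)) a) (δ.lact (G.left ((ℛ ℂ h).right i)) b) := by
  simp only [Coaction.twMul_apply, Coaction.coact_lact]
  generalize δ.coact a = t
  induction t with
  | zero => simp
  | add x y hx hy => simp only [map_add, LinearMap.add_apply, hx, hy, Finset.sum_add_distrib]
  | tmul g a =>
    simp only [LinearMap.lTensor_tmul, Coaction.opT_tmul, Coaction.lact_mul_left]
    refine Finset.sum_congr rfl fun i _ => ?_
    rw [← LinearMap.comp_apply (δ.lact (G.left _)) (δ.lact (F.left _)), ← Coaction.lact_mul,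
      mul_comm, Coaction.lact_mul]
    rfl

/-- The action `h ▷ a = R(a₋₁,h) a₀` of `H` on `A_F`. -/
def act : H →ₐ[ℂ] Module.End ℂ (Tw F δ) :=
  AlgHom.ofLinearMap
    { toFun := fun h => (mk F δ).toLinearMap ∘ₗ δ.lact (F.R.right h) ∘ₗ (mk F δ).symm.toLinearMap
      map_add' := by intros; ext; simp [Coaction.lact_apply, LinearMap.rTensor_add]
      map_smul' := by intros; ext; simp [Coaction.lact_apply, LinearMap.rTensor_smul] }
    (by ext; simp [Coaction.lact_one])
    (by
      intro x y
      rw [mul_comm]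
      ext a; simp [Coaction.lact_mul])

lemma act_mul (h : H) (a b : Tw F δ) : act F δ h (a * b) = ∑ i ∈ (ℛ ℂ h).index,
    act F δ ((ℛ ℂ h).left i) a * act F δ ((ℛ ℂ h).right i) b := by
  have := lact_twMul F δ F.R.flip h ((mk F δ).symm a) ((mk F δ).symm b)
  exact this

lemma act_one (h : H) : act F δ h (1 : Tw F δ) = Coalgebra.counit (R := ℂ) h • (1 : Tw F δ) :=
  Coaction.lact_left_one δ F.R.flip h

end Tw

/-- The smash product `A_F ⋊ H`: the space `A_F ⊗ H` with the product
`(a ⊗ h)(b ⊗ g) = a (h₁ ▷ b) ⊗ h₂ g`. -/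
def Smash {A : Type} [Ring A] [Algebra ℂ A] (F : Bichar H) (δ : Coaction H A) : Type :=
  Tw F δ ⊗[ℂ] H

namespace Smash
variable {A : Type} [Ring A] [Algebra ℂ A] (F : Bichar H) (δ : Coaction H A)

instance : AddCommGroup (Smash F δ) := inferInstanceAs (AddCommGroup (Tw F δ ⊗[ℂ] H))
instance : Module ℂ (Smash F δ) := inferInstanceAs (Module ℂ (Tw F δ ⊗[ℂ] H))

/-- the identity map `A_F ⊗ H → A_F ⋊ H`. -/
def mk : Tw F δ ⊗[ℂ] H ≃ₗ[ℂ] Smash F δ := LinearEquiv.refl ℂ _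

/-- `h ⊗ h' ↦ (b ⊗ g ↦ h ▷ b ⊗ h' g)`. -/
def opHH : H ⊗[ℂ] H →ₐ[ℂ] Module.End ℂ (Tw F δ ⊗[ℂ] H) :=
  Module.endTensorEndAlgHom.comp (Algebra.TensorProduct.map (Tw.act F δ) (Algebra.lmul ℂ H))

/-- `h ↦ (b ⊗ g ↦ h₁ ▷ b ⊗ h₂ g)`. -/
def opH : H →ₐ[ℂ] Module.End ℂ (Tw F δ ⊗[ℂ] H) :=
  (opHH F δ).comp (Bialgebra.comulAlgHom ℂ H)

lemma opHH_tmul (x y : H) (a : Tw F δ) (g : H) :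
    opHH F δ (x ⊗ₜ y) (a ⊗ₜ g) = Tw.act F δ x a ⊗ₜ (y * g) := rfl

/-- The product of the smash product. -/
def mulS : Tw F δ ⊗[ℂ] H →ₗ[ℂ] Tw F δ ⊗[ℂ] H →ₗ[ℂ] Tw F δ ⊗[ℂ] H :=
  TensorProduct.lift ((LinearMap.mul ℂ (Module.End ℂ (Tw F δ ⊗[ℂ] H))).compl₁₂
    ((Module.End.rTensorAlgHom ℂ (Tw F δ) H).comp (Algebra.lmul ℂ (Tw F δ))).toLinearMap
    (opH F δ).toLinearMap)

/-- left multiplication -/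
def opL (a : Tw F δ) : Module.End ℂ (Tw F δ ⊗[ℂ] H) := (LinearMap.mulLeft ℂ a).rTensor H

lemma mulS_tmul (a : Tw F δ) (h : H) : mulS F δ (a ⊗ₜ h) = opL F δ a * opH F δ h := rfl

lemma opL_mul (a b : Tw F δ) : opL F δ (a * b) = opL F δ a * opL F δ b := by
  ext x y; simp [opL]

lemma opH_apply (h : H) (a : Tw F δ) (g : H) : opH F δ h (a ⊗ₜ g) =
    ∑ i ∈ (ℛ ℂ h).index, (Tw.act F δ ((ℛ ℂ h).left i) a) ⊗ₜ ((ℛ ℂ h).right i * g) := by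
  change opHH F δ (Coalgebra.comul (R := ℂ) h) (a ⊗ₜ g) = _
  conv_lhs => rw [← (ℛ ℂ h).eq]
  simp [opHH_tmul]

lemma opH_opL (h : H) (b : Tw F δ) : opH F δ h * opL F δ b = ∑ i ∈ (ℛ ℂ h).index,
    opL F δ (Tw.act F δ ((ℛ ℂ h).left i) b) * opH F δ ((ℛ ℂ h).right i) := by
  ext c f
  let E : H ⊗[ℂ] (H ⊗[ℂ] H) →ₗ[ℂ] Tw F δ ⊗[ℂ] H :=
    (LinearMap.mul' ℂ (Tw F δ)).rTensor H ∘ₗ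
    (TensorProduct.assoc ℂ (Tw F δ) (Tw F δ) H).symm.toLinearMap ∘ₗ
    TensorProduct.map ((Tw.act F δ).toLinearMap.flip b)
      (TensorProduct.map ((Tw.act F δ).toLinearMap.flip c) (LinearMap.mulRight ℂ f))
  have hE : ∀ x y z, E (x ⊗ₜ (y ⊗ₜ z)) = (Tw.act F δ x b * Tw.act F δ y c) ⊗ₜ (z * f) :=
    fun x y z => rfl
  have h1 : ∀ t : H ⊗[ℂ] H, opHH F δ t ((b * c) ⊗ₜ f) =
      E (TensorProduct.assoc ℂ H H H ((Coalgebra.comul (R := ℂ)).rTensor H t)) := by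
    intro t
    induction t with
    | zero => simp
    | add x y hx hy => simp only [map_add, LinearMap.add_apply, hx, hy]
    | tmul x y =>
      simp only [opHH_tmul, Tw.act_mul, LinearMap.rTensor_tmul, TensorProduct.sum_tmul]
      conv_rhs => rw [← (ℛ ℂ x).eq]
      simp only [TensorProduct.sum_tmul, map_sum, TensorProduct.assoc_tmul, hE]
  have h2 : ∀ t : H ⊗[ℂ] H, E ((Coalgebra.comul (R := ℂ)).lTensor H t) =
      TensorProduct.lift ((LinearMap.mul ℂ (Module.End ℂ (Tw F δ ⊗[ℂ] H))).compl₁₂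
        (((Module.End.rTensorAlgHom ℂ (Tw F δ) H).comp (Algebra.lmul ℂ (Tw F δ))).toLinearMap ∘ₗ
          (Tw.act F δ).toLinearMap.flip b) (opH F δ).toLinearMap) t (c ⊗ₜ f) := by
    intro t
    induction t with
    | zero => simp
    | add x y hx hy => simp only [map_add, LinearMap.add_apply, hx, hy]
    | tmul x y =>
      change _ = opL F δ (Tw.act F δ x b) (opH F δ y (c ⊗ₜ f))
      rw [opH_apply]
      simp only [LinearMap.lTensor_tmul]
      conv_lhs => rw [← (ℛ ℂ y).eq]
      simp only [TensorProduct.tmul_sum, map_sum, hE]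
      rfl
  have h3 := h1 (Coalgebra.comul (R := ℂ) h)
  rw [Coalgebra.coassoc_apply, h2] at h3
  refine Eq.trans h3 ?_
  conv_lhs => rw [← (ℛ ℂ h).eq]
  simp only [map_sum, LinearMap.sum_apply]
  simp
  rfl

lemma mulS_assoc (x y z : Tw F δ ⊗[ℂ] H) :
    mulS F δ (mulS F δ x y) z = mulS F δ x (mulS F δ y z) := by
  have h1 : ∀ a y, mulS F δ (opL F δ a y) = opL F δ a * mulS F δ y := by
    intro a y
    induction y with
    | zero => simp
    | add x y hx hy => simp only [map_add, hx, hy, mul_add]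
    | tmul b h =>
      rw [mulS_tmul, ← mul_assoc, ← opL_mul]
      rfl
  have h2 : ∀ h y, mulS F δ (opH F δ h y) = opH F δ h * mulS F δ y := by
    intro h y
    induction y with
    | zero => simp
    | add x y hx hy => simp only [map_add, hx, hy, mul_add]
    | tmul b g =>
      rw [opH_apply, map_sum, mulS_tmul, ← mul_assoc, opH_opL, Finset.sum_mul]
      refine Finset.sum_congr rfl fun i _ => ?_
      rw [mulS_tmul, map_mul, mul_assoc]
  induction x with
  | zero => simp
  | add x y hx hy => simp only [map_add, LinearMap.add_apply, hx, hy]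
  | tmul a h =>
    rw [mulS_tmul, Module.End.mul_apply, h1, h2, ← mul_assoc]
    rfl

lemma one_mulS (x : Tw F δ ⊗[ℂ] H) : mulS F δ (1 ⊗ₜ 1) x = x := by
  rw [mulS_tmul, map_one, mul_one]
  simp [opL, LinearMap.mulLeft_one]

lemma mulS_one (x : Tw F δ ⊗[ℂ] H) : mulS F δ x (1 ⊗ₜ 1) = x := by
  induction x with
  | zero => simp
  | add x y hx hy => simp only [map_add, LinearMap.add_apply, hx, hy]
  | tmul a h =>
    rw [mulS_tmul, Module.End.mul_apply, opH_apply]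
    simp only [Tw.act_one, TensorProduct.smul_tmul, mul_one, ← TensorProduct.tmul_sum]
    rw [Coalgebra.sum_counit_smul]
    simp [opL]

instance : Mul (Smash F δ) :=
  ⟨fun a b => mk F δ (mulS F δ ((mk F δ).symm a) ((mk F δ).symm b))⟩
instance : One (Smash F δ) := ⟨mk F δ (1 ⊗ₜ 1)⟩

lemma mul_def (a b : Smash F δ) :
    a * b = mk F δ (mulS F δ ((mk F δ).symm a) ((mk F δ).symm b)) := rfl
lemma one_def : (1 : Smash F δ) = mk F δ (1 ⊗ₜ 1) := rfl

instance : Ring (Smash F δ) where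
  mul_assoc a b c := by simp [mul_def, mulS_assoc]
  one_mul a := by simp [mul_def, one_def, one_mulS]
  mul_one a := by simp [mul_def, one_def, mulS_one]
  left_distrib a b c := by simp [mul_def]
  right_distrib a b c := by simp [mul_def]
  zero_mul a := by simp [mul_def]
  mul_zero a := by simp [mul_def]
  zsmul := (· • ·)
  zsmul_zero' := zero_zsmul
  zsmul_succ' n a := SubNegMonoid.zsmul_succ' n a
  zsmul_neg' n a := SubNegMonoid.zsmul_neg' n a
  neg_add_cancel := neg_add_cancel
  sub_eq_add_neg := sub_eq_add_neg
  nsmul := (· • ·)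
  nsmul_zero := zero_nsmul
  nsmul_succ n a := AddMonoid.nsmul_succ n a

instance : Algebra ℂ (Smash F δ) := Algebra.ofModule
  (fun c a b => by simp [mul_def]) (fun c a b => by simp [mul_def])

end Smash

/-- The map of twisted algebras induced by a map of comodule algebras. -/
def Tw.map {A A' : Type} [Ring A] [Algebra ℂ A] [Ring A'] [Algebra ℂ A'] (F : Bichar H)
    (δ : Coaction H A) (δ' : Coaction H A') (f : A →ₐ[ℂ] A')
    (hf : ∀ a, δ'.coact (f a) = f.toLinearMap.lTensor H (δ.coact a)) : Tw F δ →ₐ[ℂ] Tw F δ' :=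
  AlgHom.ofLinearMap ((mk F δ').toLinearMap ∘ₗ f.toLinearMap ∘ₗ (mk F δ).symm.toLinearMap)
    (by simp [one_def])
    (by
      intro x y
      have h1 : ∀ φ b, f (δ.lact φ b) = δ'.lact φ (f b) := by
        intro φ b
        rw [Coaction.lact_apply, Coaction.lact_apply, hf]
        generalize δ.coact b = t
        induction t with
        | zero => simp
        | add x y hx hy => simp only [map_add, hx, hy]
        | tmul h a => simp
      have h2 : ∀ a b, f (δ.twMul F a b) = δ'.twMul F (f a) (f b) := by
        intro a b
        rw [Coaction.twMul_apply, Coaction.twMul_apply, hf]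
        generalize δ.coact a = t
        induction t with
        | zero => simp
        | add x y hx hy => simp only [map_add, LinearMap.add_apply, hx, hy]
        | tmul h a => simp [Coaction.opT_tmul, h1]
      simp [mul_def, h2])

/-- `(A_F ⋊ H) ⊗ C_F`. -/
abbrev Big {A C : Type} [Ring A] [Algebra ℂ A] [Ring C] [Algebra ℂ C] (F : Bichar H)
    (δA : Coaction H A) (δC : Coaction H C) : Type := Smash F δA ⊗[ℂ] Tw F δC

section mu
variable {A C : Type} [Ring A] [Algebra ℂ A] [Ring C] [Algebra ℂ C] (F : Bichar H)
    (δA : Coaction H A) (δC : Coaction H C)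

/-- The bosonisation map `μ(a ⊗ c) = a ⊗ c₋₁ ⊗ c₀`. -/
def mu : A ⊗[ℂ] C →ₗ[ℂ] Big F δA δC :=
  TensorProduct.map ((Smash.mk F δA).toLinearMap ∘ₗ (Tw.mk F δA).toLinearMap.rTensor H)
      (Tw.mk F δC).toLinearMap ∘ₗ
    (TensorProduct.assoc ℂ A H C).symm.toLinearMap ∘ₗ δC.coact.toLinearMap.lTensor A

/-- `(a ⊗ h) ↦ F⁻¹(a₋₁,h) a₀`. -/
def invAct : A ⊗[ℂ] H →ₗ[ℂ] A :=
  TensorProduct.lift (LinearMap.mk₂ ℂ (fun a h => δA.lact (F.inv.right h) a)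
    (by intros; simp)
    (by intros; simp)
    (by intros; simp [Coaction.lact_apply, LinearMap.rTensor_add])
    (by intros; simp [Coaction.lact_apply, LinearMap.rTensor_smul]))

/-- `a ⊗ c ↦ F⁻¹(a₋₁,c₋₁) a₀ ⊗ c₀`. As `a c = F⁻¹(a₋₁,c₋₁) a₀ ·_F c₀` in `(A ⊗ C)_F`, this writes
an element of `A ⊗ C` in the normally ordered form `∑ a' ·_F c'`. -/
def normalOrder : A ⊗[ℂ] C →ₗ[ℂ] A ⊗[ℂ] C :=
  (invAct F δA).rTensor C ∘ₗ (TensorProduct.assoc ℂ A H C).symm.toLinearMap ∘ₗ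
    δC.coact.toLinearMap.lTensor A

end mu

namespace Coaction

/-- Build a coaction on a polynomial algebra from its values on the generators. -/
def mv {σ : Type} (f : σ → H ⊗[ℂ] MvPolynomial σ ℂ)
    (h1 : ∀ i, TensorProduct.assoc ℂ H H _ ((Coalgebra.comul (R := ℂ)).rTensor _ (f i)) =
      (MvPolynomial.aeval f).toLinearMap.lTensor H (f i))
    (h2 : ∀ i, TensorProduct.lid ℂ _ ((Coalgebra.counit (R := ℂ)).rTensor _ (f i)) =
      MvPolynomial.X i) : Coaction H (MvPolynomial σ ℂ) where
  coact := MvPolynomial.aeval f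
  coassoc := by
    apply MvPolynomial.algHom_ext
    intro i
    simp only [AlgHom.comp_apply, MvPolynomial.aeval_X]
    exact h1 i
  counit := by
    apply MvPolynomial.algHom_ext
    intro i
    simp only [AlgHom.comp_apply, MvPolynomial.aeval_X]
    exact h2 i

/-- The coaction `X_{j,t} ↦ ∑ᵣ T_{jr} ⊗ X_{r,t}`. -/
def mat {σ : Type} (T : σ → Matrix (Fin 4) (Fin 4) H)
    (h1 : ∀ t i j, Coalgebra.comul (R := ℂ) (T t i j) = ∑ s, T t i s ⊗ₜ[ℂ] T t s j)
    (h2 : ∀ t i j, Coalgebra.counit (R := ℂ) (T t i j) = if i = j then 1 else 0) :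
    Coaction H (MvPolynomial (Fin 4 × σ) ℂ) :=
  mv (fun p => ∑ r, T p.2 p.1 r ⊗ₜ[ℂ] MvPolynomial.X (r, p.2))
    (by
      rintro ⟨j, t⟩
      simp only [map_sum, LinearMap.rTensor_tmul, h1, TensorProduct.sum_tmul,
        TensorProduct.assoc_tmul, LinearMap.lTensor_tmul, AlgHom.toLinearMap_apply,
        MvPolynomial.aeval_X, TensorProduct.tmul_sum]
      rw [Finset.sum_comm])
    (by
      rintro ⟨j, t⟩
      simp [h2])

/-- The coaction `X_i ↦ g_i ⊗ X_i + t_i ⊗ 1`. -/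
def aff {σ : Type} (g t : σ → H)
    (h1 : ∀ i, Coalgebra.comul (R := ℂ) (g i) = g i ⊗ₜ[ℂ] g i)
    (h2 : ∀ i, Coalgebra.counit (R := ℂ) (g i) = 1)
    (h3 : ∀ i, Coalgebra.comul (R := ℂ) (t i) = t i ⊗ₜ[ℂ] 1 + g i ⊗ₜ[ℂ] t i)
    (h4 : ∀ i, Coalgebra.counit (R := ℂ) (t i) = 0) : Coaction H (MvPolynomial σ ℂ) :=
  mv (fun i => g i ⊗ₜ[ℂ] MvPolynomial.X i + t i ⊗ₜ[ℂ] 1)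
    (by
      intro i
      simp [h1, h3, TensorProduct.tmul_add, TensorProduct.add_tmul, Algebra.TensorProduct.one_def]
      abel)
    (by intro i; simp [h2, h4])

section push
variable {A A' : Type} [Ring A] [Algebra ℂ A] [Ring A'] [Algebra ℂ A'] (δ : Coaction H A)
  (p : A →ₐ[ℂ] A') (c : A' →ₐ[ℂ] H ⊗[ℂ] A')

lemma push_coassoc
    (hc : c.comp p = (Algebra.TensorProduct.map (AlgHom.id ℂ H) p).comp δ.coact) :
    (((Algebra.TensorProduct.assoc ℂ ℂ ℂ H H A').toAlgHom.comp
      (Algebra.TensorProduct.map (Bialgebra.comulAlgHom ℂ H) (AlgHom.id ℂ A'))).comp c).comp p =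
    ((Algebra.TensorProduct.map (AlgHom.id ℂ H) c).comp c).comp p := by
  have hc' := fun a => DFunLike.congr_fun hc a
  simp only [AlgHom.comp_apply] at hc'
  refine AlgHom.ext fun a => ?_
  have h1 : ∀ t : H ⊗[ℂ] A, Algebra.TensorProduct.assoc ℂ ℂ ℂ H H A'
      (Algebra.TensorProduct.map (Bialgebra.comulAlgHom ℂ H) (AlgHom.id ℂ A')
        (Algebra.TensorProduct.map (AlgHom.id ℂ H) p t)) =
      (p.toLinearMap.lTensor H).lTensor H
        (TensorProduct.assoc ℂ H H A ((Coalgebra.comul (R := ℂ)).rTensor A t)) := by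
    intro t
    induction t with
    | zero => simp
    | add x y hx hy => simp only [map_add, hx, hy]
    | tmul h a =>
      simp only [Algebra.TensorProduct.map_tmul, LinearMap.rTensor_tmul,
        Bialgebra.comulAlgHom_apply, AlgHom.id_apply]
      generalize Coalgebra.comul (R := ℂ) h = z
      induction z with
      | zero => simp
      | add x y hx hy => simp only [map_add, TensorProduct.add_tmul, hx, hy]
      | tmul x y => simp
  have h2 : ∀ t : H ⊗[ℂ] A, Algebra.TensorProduct.map (AlgHom.id ℂ H) c
        (Algebra.TensorProduct.map (AlgHom.id ℂ H) p t) =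
      (p.toLinearMap.lTensor H).lTensor H (δ.coact.toLinearMap.lTensor H t) := by
    intro t
    induction t with
    | zero => simp
    | add x y hx hy => simp only [map_add, hx, hy]
    | tmul h a =>
      simp only [Algebra.TensorProduct.map_tmul, LinearMap.lTensor_tmul, AlgHom.id_apply, hc']
      rfl
  change Algebra.TensorProduct.assoc ℂ ℂ ℂ H H A' (Algebra.TensorProduct.map _ _ (c (p a))) =
    Algebra.TensorProduct.map _ _ (c (p a))
  rw [hc', h1, h2, δ.coassoc_apply]

lemma push_counit
    (hc : c.comp p = (Algebra.TensorProduct.map (AlgHom.id ℂ H) p).comp δ.coact) :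
    (((Algebra.TensorProduct.lid ℂ A').toAlgHom.comp
      (Algebra.TensorProduct.map (Bialgebra.counitAlgHom ℂ H) (AlgHom.id ℂ A'))).comp c).comp p =
    (AlgHom.id ℂ A').comp p := by
  have hc' := fun a => DFunLike.congr_fun hc a
  simp only [AlgHom.comp_apply] at hc'
  refine AlgHom.ext fun a => ?_
  have h1 : ∀ t : H ⊗[ℂ] A, Algebra.TensorProduct.lid ℂ A'
      (Algebra.TensorProduct.map (Bialgebra.counitAlgHom ℂ H) (AlgHom.id ℂ A')
        (Algebra.TensorProduct.map (AlgHom.id ℂ H) p t)) =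
      p (Algebra.TensorProduct.lid ℂ A
        (Algebra.TensorProduct.map (Bialgebra.counitAlgHom ℂ H) (AlgHom.id ℂ A) t)) := by
    intro t
    induction t with
    | zero => simp
    | add x y hx hy => simp only [map_add, hx, hy]
    | tmul h a => simp
  change Algebra.TensorProduct.lid ℂ A' (Algebra.TensorProduct.map _ _ (c (p a))) = p a
  rw [hc', h1]
  exact congrArg p (DFunLike.congr_fun δ.counit a)

end push

/-- The induced coaction on the quotient by an invariant ideal. -/
def quot {A : Type} [CommRing A] [Algebra ℂ A] (δ : Coaction H A) (I : Ideal A)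
    (hI : ∀ a ∈ I, Algebra.TensorProduct.map (AlgHom.id ℂ H) (Ideal.Quotient.mkₐ ℂ I)
      (δ.coact a) = 0) : Coaction H (A ⧸ I) :=
  { coact := Ideal.Quotient.liftₐ I
      ((Algebra.TensorProduct.map (AlgHom.id ℂ H) (Ideal.Quotient.mkₐ ℂ I)).comp δ.coact) hI
    coassoc := Ideal.Quotient.algHom_ext _ (push_coassoc δ _ _ (Ideal.Quotient.liftₐ_comp _ _ _))
    counit := Ideal.Quotient.algHom_ext _ (push_counit δ _ _ (Ideal.Quotient.liftₐ_comp _ _ _)) }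

/-- The coaction map on the localisation at an invariant element. -/
def locMap {A : Type} [CommRing A] [Algebra ℂ A] (δ : Coaction H A) (r : A)
    (hr : δ.coact r = 1 ⊗ₜ r) : Localization.Away r →ₐ[ℂ] H ⊗[ℂ] Localization.Away r :=
  IsLocalization.liftAlgHom (M := Submonoid.powers r)
    (f := (Algebra.TensorProduct.map (AlgHom.id ℂ H)
      (IsScalarTower.toAlgHom ℂ A (Localization.Away r))).comp δ.coact)
    (by
      rintro ⟨_, n, rfl⟩
      have h : IsUnit (algebraMap A (Localization.Away r) r) :=
        IsLocalization.Away.algebraMap_isUnit r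
      have h2 := h.map (Algebra.TensorProduct.includeRight :
        Localization.Away r →ₐ[ℂ] H ⊗[ℂ] Localization.Away r)
      simpa [hr] using h2.pow n)

lemma locMap_comp {A : Type} [CommRing A] [Algebra ℂ A] (δ : Coaction H A) (r : A)
    (hr : δ.coact r = 1 ⊗ₜ r) : (δ.locMap r hr).comp
      (IsScalarTower.toAlgHom ℂ A (Localization.Away r)) =
    (Algebra.TensorProduct.map (AlgHom.id ℂ H)
      (IsScalarTower.toAlgHom ℂ A (Localization.Away r))).comp δ.coact :=
  AlgHom.ext fun a => by simp [locMap]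

/-- The induced coaction on the localisation at an invariant element. -/
def loc {A : Type} [CommRing A] [Algebra ℂ A] (δ : Coaction H A) (r : A)
    (hr : δ.coact r = 1 ⊗ₜ r) : Coaction H (Localization.Away r) where
  coact := δ.locMap r hr
  coassoc := IsLocalization.algHom_ext (Submonoid.powers r)
    (AlgHom.ext fun a => DFunLike.congr_fun (push_coassoc δ _ _ (δ.locMap_comp r hr)) a)
  counit := IsLocalization.algHom_ext (Submonoid.powers r)
    (AlgHom.ext fun a => DFunLike.congr_fun (push_counit δ _ _ (δ.locMap_comp r hr)) a)

section tensor
variable {A C : Type} [CommRing A] [Algebra ℂ A] [Ring C] [Algebra ℂ C] (δ : Coaction H A)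
    (ε : Coaction H C)

/-- `a ⊗ c ↦ a₋₁ c₋₁ ⊗ (a₀ ⊗ c₀)`. -/
def tensorMap : A ⊗[ℂ] C →ₐ[ℂ] H ⊗[ℂ] (A ⊗[ℂ] C) :=
  ((Algebra.TensorProduct.map (Algebra.TensorProduct.lmul' ℂ) (AlgHom.id ℂ _)).comp
    (Algebra.TensorProduct.tensorTensorTensorComm ℂ ℂ ℂ ℂ H A H C).toAlgHom).comp
    (Algebra.TensorProduct.map δ.coact ε.coact)

lemma tensorMap_left : (tensorMap δ ε).comp Algebra.TensorProduct.includeLeft =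
    (Algebra.TensorProduct.map (AlgHom.id ℂ H) Algebra.TensorProduct.includeLeft).comp δ.coact := by
  refine AlgHom.ext fun a => ?_
  simp only [tensorMap, AlgHom.comp_apply, Algebra.TensorProduct.includeLeft_apply,
    Algebra.TensorProduct.map_tmul, map_one]
  generalize δ.coact a = t
  induction t with
  | zero => simp
  | add x y hx hy => simp only [map_add, TensorProduct.add_tmul, hx, hy]
  | tmul h a => simp [Algebra.TensorProduct.one_def]

lemma tensorMap_right : (tensorMap δ ε).comp Algebra.TensorProduct.includeRight =
    (Algebra.TensorProduct.map (AlgHom.id ℂ H) Algebra.TensorProduct.includeRight).comp ε.coact := by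
  refine AlgHom.ext fun a => ?_
  simp only [tensorMap, AlgHom.comp_apply, Algebra.TensorProduct.includeRight_apply,
    Algebra.TensorProduct.map_tmul, map_one]
  generalize ε.coact a = t
  induction t with
  | zero => simp
  | add x y hx hy => simp only [map_add, TensorProduct.tmul_add, hx, hy]
  | tmul h a => simp [Algebra.TensorProduct.one_def]

/-- The coaction on the tensor product of two comodule algebras. -/
def tensor : Coaction H (A ⊗[ℂ] C) where
  coact := tensorMap δ ε
  coassoc := Algebra.TensorProduct.ext (push_coassoc δ _ _ (tensorMap_left δ ε))
    (push_coassoc ε _ _ (tensorMap_right δ ε))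
  counit := Algebra.TensorProduct.ext (push_counit δ _ _ (tensorMap_left δ ε))
    (push_counit ε _ _ (tensorMap_right δ ε))

end tensor

/-- `∑ vᵢ eᵢ ↦ ∑ vᵢ gᵢ ⊗ eᵢ`. -/
def extLin (g : Fin 4 → H) : (Fin 4 → ℂ) →ₗ[ℂ] H ⊗[ℂ] ExteriorAlgebra ℂ (Fin 4 → ℂ) :=
  Fintype.linearCombination ℂ fun i => g i ⊗ₜ ExteriorAlgebra.ι ℂ (Pi.single i 1)

lemma extLin_sq (g : Fin 4 → H) (v : Fin 4 → ℂ) : extLin g v * extLin g v = 0 := by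
  have h0 : ∀ i j, (g i ⊗ₜ[ℂ] ExteriorAlgebra.ι ℂ (Pi.single i 1 : Fin 4 → ℂ)) *
      (g j ⊗ₜ[ℂ] ExteriorAlgebra.ι ℂ (Pi.single j 1 : Fin 4 → ℂ)) =
      - ((g j ⊗ₜ[ℂ] ExteriorAlgebra.ι ℂ (Pi.single j 1 : Fin 4 → ℂ)) *
      (g i ⊗ₜ[ℂ] ExteriorAlgebra.ι ℂ (Pi.single i 1 : Fin 4 → ℂ))) := by
    intro i j
    rw [Algebra.TensorProduct.tmul_mul_tmul, Algebra.TensorProduct.tmul_mul_tmul, mul_comm (g i),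
      eq_neg_of_add_eq_zero_left (ExteriorAlgebra.ι_add_mul_swap _ _), TensorProduct.tmul_neg]
  have h1 : extLin g v * extLin g v = - (extLin g v * extLin g v) := by
    simp only [extLin, Fintype.linearCombination_apply, Finset.sum_mul_sum]
    conv_lhs => rw [Finset.sum_comm]
    rw [← Finset.sum_neg_distrib]
    refine Finset.sum_congr rfl fun i _ => ?_
    rw [← Finset.sum_neg_distrib]
    refine Finset.sum_congr rfl fun j _ => ?_
    rw [smul_mul_smul_comm, smul_mul_smul_comm, h0 j i, mul_comm (v j), smul_neg]
  have h2 : (2 : ℂ) • (extLin g v * extLin g v) = 0 := by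
    rw [two_smul]
    nth_rewrite 1 [h1]
    simp
  exact (smul_eq_zero.mp h2).resolve_left two_ne_zero

/-- The coaction `eᵢ ↦ gᵢ ⊗ eᵢ` on an exterior algebra. -/
def ext (g : Fin 4 → H)
    (h1 : ∀ i, Coalgebra.comul (R := ℂ) (g i) = g i ⊗ₜ[ℂ] g i)
    (h2 : ∀ i, Coalgebra.counit (R := ℂ) (g i) = 1) :
    Coaction H (ExteriorAlgebra ℂ (Fin 4 → ℂ)) where
  coact := ExteriorAlgebra.lift ℂ ⟨extLin g, extLin_sq g⟩
  coassoc := by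
    apply ExteriorAlgebra.hom_ext
    ext i : 2
    simp [extLin, h1]
  counit := by
    apply ExteriorAlgebra.hom_ext
    ext i : 2
    simp [extLin, h2]

end Coaction

/-! ### Adjoining an inverse matrix -/

/-- Relations of the algebra obtained from `B` by adjoining the entries of an inverse of `ρ`. -/
inductive AdjRel {B : Type} [Ring B] [Algebra ℂ B] {n : ℕ} (ρ : Matrix (Fin n) (Fin n) B) :
    FreeAlgebra ℂ (B ⊕ (Fin n × Fin n)) → FreeAlgebra ℂ (B ⊕ (Fin n × Fin n)) → Prop
  | add (x y : B) : AdjRel ρ (FreeAlgebra.ι ℂ (Sum.inl (x + y)))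
      (FreeAlgebra.ι ℂ (Sum.inl x) + FreeAlgebra.ι ℂ (Sum.inl y))
  | mul (x y : B) : AdjRel ρ (FreeAlgebra.ι ℂ (Sum.inl (x * y)))
      (FreeAlgebra.ι ℂ (Sum.inl x) * FreeAlgebra.ι ℂ (Sum.inl y))
  | scalar (c : ℂ) : AdjRel ρ (FreeAlgebra.ι ℂ (Sum.inl (algebraMap ℂ B c))) (algebraMap ℂ _ c)
  | right (i j : Fin n) : AdjRel ρ
      (∑ l, FreeAlgebra.ι ℂ (Sum.inl (ρ i l)) * FreeAlgebra.ι ℂ (Sum.inr (l, j)))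
      (if i = j then 1 else 0)
  | left (i j : Fin n) : AdjRel ρ
      (∑ l, FreeAlgebra.ι ℂ (Sum.inr (i, l)) * FreeAlgebra.ι ℂ (Sum.inl (ρ l j)))
      (if i = j then 1 else 0)

/-- The algebra obtained from `B` by universally adjoining an inverse of the matrix `ρ`. -/
def Adj {B : Type} [Ring B] [Algebra ℂ B] {n : ℕ} (ρ : Matrix (Fin n) (Fin n) B) : Type :=
  RingQuot (AdjRel ρ)

namespace Adj
variable {B B' : Type} [Ring B] [Algebra ℂ B] [Ring B'] [Algebra ℂ B'] {n : ℕ}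

instance (ρ : Matrix (Fin n) (Fin n) B) : Ring (Adj ρ) := inferInstanceAs (Ring (RingQuot _))
instance (ρ : Matrix (Fin n) (Fin n) B) : Algebra ℂ (Adj ρ) :=
  inferInstanceAs (Algebra ℂ (RingQuot _))

/-- The quotient map. -/
def mk (ρ : Matrix (Fin n) (Fin n) B) : FreeAlgebra ℂ (B ⊕ (Fin n × Fin n)) →ₐ[ℂ] Adj ρ :=
  RingQuot.mkAlgHom ℂ (AdjRel ρ)

lemma mk_rel (ρ : Matrix (Fin n) (Fin n) B) {x y} (h : AdjRel ρ x y) : mk ρ x = mk ρ y :=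
  RingQuot.mkAlgHom_rel ℂ h

/-- The structure map `B → B[ρ⁻¹]`. -/
def of (ρ : Matrix (Fin n) (Fin n) B) : B →ₐ[ℂ] Adj ρ :=
  AlgHom.ofLinearMap
    { toFun := fun x => mk ρ (FreeAlgebra.ι ℂ (Sum.inl x))
      map_add' := fun x y => (mk_rel ρ (AdjRel.add x y)).trans (map_add _ _ _)
      map_smul' := fun c x => by
        rw [Algebra.smul_def, mk_rel ρ (AdjRel.mul _ _), map_mul,
          mk_rel ρ (AdjRel.scalar _), AlgHom.commutes, RingHom.id_apply,
          Algebra.smul_def] }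
    (by
      have := mk_rel ρ (AdjRel.scalar (ρ := ρ) 1)
      rw [map_one, map_one, map_one] at this
      exact this)
    (fun x y => (mk_rel ρ (AdjRel.mul x y)).trans (map_mul _ _ _))

/-- The adjoined inverse matrix. -/
def inv (ρ : Matrix (Fin n) (Fin n) B) : Matrix (Fin n) (Fin n) (Adj ρ) :=
  Matrix.of fun i j => mk ρ (FreeAlgebra.ι ℂ (Sum.inr (i, j)))

lemma mul_inv (ρ : Matrix (Fin n) (Fin n) B) : ρ.map (of ρ) * inv ρ = 1 := by
  ext i j
  have := mk_rel ρ (AdjRel.right (ρ := ρ) i j)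
  simp only [map_sum, map_mul] at this
  rw [Matrix.mul_apply, Matrix.one_apply]
  refine this.trans ?_
  split_ifs
  · exact map_one _
  · exact map_zero _

lemma inv_mul (ρ : Matrix (Fin n) (Fin n) B) : inv ρ * ρ.map (of ρ) = 1 := by
  ext i j
  have := mk_rel ρ (AdjRel.left (ρ := ρ) i j)
  simp only [map_sum, map_mul] at this
  rw [Matrix.mul_apply, Matrix.one_apply]
  refine this.trans ?_
  split_ifs
  · exact map_one _
  · exact map_zero _

/-- The universal property. -/
def lift (ρ : Matrix (Fin n) (Fin n) B) (f : B →ₐ[ℂ] B') (X : Matrix (Fin n) (Fin n) B')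
    (h1 : ρ.map f * X = 1) (h2 : X * ρ.map f = 1) : Adj ρ →ₐ[ℂ] B' :=
  RingQuot.liftAlgHom ℂ
    ⟨FreeAlgebra.lift ℂ (Sum.elim f fun p => X p.1 p.2), by
      intro x y h
      induction h with
      | add x y => simp
      | mul x y => simp
      | scalar c => simp
      | right i j =>
        have := congrFun (congrFun h1 i) j
        rw [Matrix.mul_apply, Matrix.one_apply] at this
        simp only [map_sum, map_mul, FreeAlgebra.lift_ι_apply, Sum.elim_inl, Sum.elim_inr]
        refine Eq.trans this ?_
        split_ifs <;> simp
      | left i j =>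
        have := congrFun (congrFun h2 i) j
        rw [Matrix.mul_apply, Matrix.one_apply] at this
        simp only [map_sum, map_mul, FreeAlgebra.lift_ι_apply, Sum.elim_inl, Sum.elim_inr]
        refine Eq.trans this ?_
        split_ifs <;> simp⟩

/-- Functoriality. -/
def map (ρ : Matrix (Fin n) (Fin n) B) (f : B →ₐ[ℂ] B') : Adj ρ →ₐ[ℂ] Adj (ρ.map f) :=
  lift ρ ((of (ρ.map f)).comp f) (inv (ρ.map f))
    (by simpa [Matrix.map_map] using mul_inv (ρ.map f))
    (by simpa [Matrix.map_map] using inv_mul (ρ.map f))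

end Adj

/-! ### The classical comodule algebras -/

/-- A commutative Hopf algebra with a bicharacter, together with its coaction matrix on
`A[ℂ⁴]` (`z_j ↦ ∑ᵣ A_{jr} ⊗ z_r`, `z_j* ↦ ∑ᵣ As_{jr} ⊗ z_r*`) and its coaction
`ζ_i ↦ g_i ⊗ ζ_i + t_i ⊗ 1` on `A[ℝ⁴]`. -/
structure Symm (H : Type) [CommRing H] [HopfAlgebra ℂ H] [Coalgebra.IsCocomm ℂ H] where
  F : Bichar H
  A : Matrix (Fin 4) (Fin 4) H
  As : Matrix (Fin 4) (Fin 4) H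
  comul_A : ∀ i j, Coalgebra.comul (R := ℂ) (A i j) = ∑ s, A i s ⊗ₜ[ℂ] A s j
  counit_A : ∀ i j, Coalgebra.counit (R := ℂ) (A i j) = if i = j then 1 else 0
  comul_As : ∀ i j, Coalgebra.comul (R := ℂ) (As i j) = ∑ s, As i s ⊗ₜ[ℂ] As s j
  counit_As : ∀ i j, Coalgebra.counit (R := ℂ) (As i j) = if i = j then 1 else 0
  unit_A : ∀ a b, A 0 a * As 0 b + A 1 a * As 1 b = if a = b ∧ (a = 0 ∨ a = 1) then 1 else 0
  g : Fin 4 → H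
  t : Fin 4 → H
  comul_g : ∀ i, Coalgebra.comul (R := ℂ) (g i) = g i ⊗ₜ[ℂ] g i
  counit_g : ∀ i, Coalgebra.counit (R := ℂ) (g i) = 1
  comul_t : ∀ i, Coalgebra.comul (R := ℂ) (t i) = t i ⊗ₜ[ℂ] 1 + g i ⊗ₜ[ℂ] t i
  counit_t : ∀ i, Coalgebra.counit (R := ℂ) (t i) = 0

/-- Index set of the entries of `M^j` (left) and `N^j` (right). -/
abbrev Gen (k : ℕ) : Type := (Fin (2 * k + 2) × Fin k) ⊕ (Fin k × Fin (2 * k + 2))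

/-- The free commutative algebra on the `M^j_{ab}`, `N^j_{dc}`. -/
abbrev MPoly (k : ℕ) : Type := MvPolynomial (Fin 4 × Gen k) ℂ

/-- The left-hand side of the monad equations. -/
def monadRel (k : ℕ) (j l : Fin 4) (d b : Fin k) : MPoly k :=
  ∑ r, (MvPolynomial.X (j, Sum.inr (d, r)) * MvPolynomial.X (l, Sum.inl (r, b)) +
    MvPolynomial.X (l, Sum.inr (d, r)) * MvPolynomial.X (j, Sum.inl (r, b)))

/-- The ideal of the monad equations. -/
def monadIdeal (k : ℕ) : Ideal (MPoly k) :=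
  Ideal.span {p | ∃ j l d b, p = monadRel k j l d b}

/-- `A[M_k]`. -/
abbrev AM (k : ℕ) : Type := MPoly k ⧸ monadIdeal k

/-- The matrices `M^j` of generators. -/
def Mmat (k : ℕ) (j : Fin 4) : Matrix (Fin (2 * k + 2)) (Fin k) (AM k) :=
  Matrix.of fun a b => Ideal.Quotient.mk _ (MvPolynomial.X (j, Sum.inl (a, b)))

/-- The matrices `N^j` of generators. -/
def Nmat (k : ℕ) (j : Fin 4) : Matrix (Fin k) (Fin (2 * k + 2)) (AM k) :=
  Matrix.of fun d c => Ideal.Quotient.mk _ (MvPolynomial.X (j, Sum.inr (d, c)))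

/-- The adjoints `M^j†`, given by the reality conditions
`N¹ = M²†`, `N² = -M¹†`, `N³ = M⁴†`, `N⁴ = -M³†`. -/
def Mdag (k : ℕ) : Fin 4 → Matrix (Fin k) (Fin (2 * k + 2)) (AM k) :=
  ![-Nmat k 1, Nmat k 0, -Nmat k 3, Nmat k 2]

/-- `A[ℂ⁴]`, with `X (j, false) = z_j` and `X (j, true) = z_j*`. -/
abbrev C4 : Type := MvPolynomial (Fin 4 × Bool) ℂ

/-- `z_j` -/
def z (j : Fin 4) : C4 := MvPolynomial.X (j, false)
/-- `z_j*` -/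
def zs (j : Fin 4) : C4 := MvPolynomial.X (j, true)

/-- `r = z₁z₁* + z₂z₂*` -/
def rr : C4 := z 0 * zs 0 + z 1 * zs 1

/-- `A₀[ℂ⁴]`, the localisation of `A[ℂ⁴]` away from the zero set of `r`. -/
abbrev C4loc : Type := Localization.Away rr

/-- `A[ℝ⁴]`, generated by `(ζ₁, ζ₁*, ζ₂, ζ₂*)`. -/
abbrev R4 : Type := MvPolynomial (Fin 4) ℂ

/-- The exterior algebra on `(dζ₁, dζ₁*, dζ₂, dζ₂*)`. -/
abbrev Lam : Type := ExteriorAlgebra ℂ (Fin 4 → ℂ)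

/-- `Ω(ℝ⁴)`. -/
abbrev Om : Type := R4 ⊗[ℂ] Lam

namespace Symm
variable (D : Symm H) (k : ℕ)

lemma comul_S (i j : Fin 4) : Coalgebra.comul (R := ℂ) (HopfAlgebra.antipode ℂ (D.A j i)) =
    ∑ s, HopfAlgebra.antipode ℂ (D.A s i) ⊗ₜ[ℂ] HopfAlgebra.antipode ℂ (D.A j s) := by
  rw [antipode_comul, ← Coalgebra.comm_comul, D.comul_A]
  simp

/-- The coaction `M^j_{ab} ↦ ∑ᵣ S(A_{rj}) ⊗ M^r_{ab}` on the free algebra, and likewise on the `N^j_{dc}`. -/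
def coMPoly : Coaction H (MPoly k) :=
  Coaction.mat (fun _ => Matrix.of fun j r => HopfAlgebra.antipode ℂ (D.A r j))
    (by intro _ i j; simpa using D.comul_S i j)
    (by intro _ i j; simp [D.counit_A, eq_comm])

/-- The coaction on `A[M_k]`. -/
def coM : Coaction H (AM k) :=
  (D.coMPoly k).quot (monadIdeal k) (by
    intro a ha
    refine Submodule.span_induction ?_ (by simp) (fun x y _ _ hx hy => by simp [hx, hy])
      (fun c x _ hx => by simp [hx]) ha
    rintro _ ⟨j, l, d, b, rfl⟩
    have h0 : ∀ p q, Ideal.Quotient.mkₐ ℂ (monadIdeal k) (monadRel k p q d b) = 0 :=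
      fun p q => Ideal.Quotient.eq_zero_iff_mem.mpr (Ideal.subset_span ⟨p, q, d, b, rfl⟩)
    have h1 : (D.coMPoly k).coact (monadRel k j l d b) =
        ∑ p, ∑ q, (HopfAlgebra.antipode ℂ (D.A p j) * HopfAlgebra.antipode ℂ (D.A q l)) ⊗ₜ[ℂ]
          monadRel k p q d b := by
      simp only [monadRel, coMPoly, Coaction.mat, Coaction.mv, map_sum, map_add, map_mul,
        MvPolynomial.aeval_X, Matrix.of_apply, Finset.sum_mul_sum,
        Algebra.TensorProduct.tmul_mul_tmul, TensorProduct.tmul_sum, TensorProduct.tmul_add,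
        Finset.sum_add_distrib]
      congr 1
      · rw [Finset.sum_comm]
        exact Finset.sum_congr rfl fun p _ => Finset.sum_comm
      · rw [Finset.sum_comm]
        rw [Finset.sum_congr rfl fun p _ => Finset.sum_comm]
        rw [Finset.sum_comm]
        refine Finset.sum_congr rfl fun p _ => Finset.sum_congr rfl fun q _ =>
          Finset.sum_congr rfl fun r _ => ?_
        rw [mul_comm (HopfAlgebra.antipode ℂ (D.A q l))]
    rw [h1]
    simp [h0])

/-- The coaction on `A[ℂ⁴]`. -/
def coC4 : Coaction H C4 :=
  Coaction.mat (fun b => cond b D.As D.A)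
    (by rintro (_ | _) i j <;> simp [D.comul_A, D.comul_As])
    (by rintro (_ | _) i j <;> simp [D.counit_A, D.counit_As])

/-- The coaction on `A₀[ℂ⁴]`. -/
def coC : Coaction H C4loc :=
  D.coC4.loc rr (by
    have h : D.coC4.coact rr = ∑ a, ∑ b, (D.A 0 a * D.As 0 b + D.A 1 a * D.As 1 b) ⊗ₜ[ℂ]
        (z a * zs b) := by
      simp only [rr, z, zs, map_add, map_mul, coC4, Coaction.mat, Coaction.mv,
        MvPolynomial.aeval_X, cond_true, cond_false, Finset.sum_mul_sum,
        Algebra.TensorProduct.tmul_mul_tmul, TensorProduct.add_tmul, Finset.sum_add_distrib]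
    rw [h]
    simp only [D.unit_A, Fin.sum_univ_four]
    simp [rr, TensorProduct.tmul_add])

/-- The coaction on `A[ℝ⁴]`. -/
def coR : Coaction H R4 := Coaction.aff D.g D.t D.comul_g D.counit_g D.comul_t D.counit_t

/-- The coaction on `Ω(ℝ⁴)`, commuting with `d`. -/
def coOm : Coaction H Om := D.coR.tensor (Coaction.ext D.g D.comul_g D.counit_g)

lemma coOm_incl (a : R4) : D.coOm.coact ((Algebra.TensorProduct.includeLeft : R4 →ₐ[ℂ] Om) a) =
    (Algebra.TensorProduct.includeLeft : R4 →ₐ[ℂ] Om).toLinearMap.lTensor H (D.coR.coact a) :=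
  DFunLike.congr_fun (Coaction.tensorMap_left D.coR _) a

end Symm

/-- A bicharacter from its left half. -/
def Bichar.ofLeft (L : H →ₐ[ℂ] WithConv (H →ₗ[ℂ] ℂ))
    (h1 : ∀ h, (L h).ofConv 1 = Coalgebra.counit (R := ℂ) h)
    (h2 : ∀ h g g', (L h).ofConv (g * g') = ∑ i ∈ (ℛ ℂ h).index,
      (L ((ℛ ℂ h).left i)).ofConv g * (L ((ℛ ℂ h).right i)).ofConv g') : Bichar H where
  left := L
  right := AlgHom.ofLinearMap
    { toFun := fun g => WithConv.toConv
        { toFun := fun h => (L h).ofConv g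
          map_add' := by simp
          map_smul' := by simp }
      map_add' := by intros; ext; simp
      map_smul' := by intros; ext; simp }
    (by ext h; simp [LinearMap.convOne_def, h1])
    (by intro g g'; ext h; simp [(ℛ ℂ h).convMul_apply, h2])
  left_eq_right _ _ := rfl

/-! ### The two symmetry Hopf algebras -/

/-- The algebra of polynomial functions on the additive group `ℝ⁴`. -/
abbrev HMoy : Type := SymmetricAlgebra ℂ (Fin 4 → ℂ)

instance : HopfAlgebra ℂ HMoy := HopfAlgebra.ofAlgHom
  (SymmetricAlgebra.lift (-SymmetricAlgebra.ι ℂ (Fin 4 → ℂ)))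
  (by
    refine SymmetricAlgebra.algHom_ext (LinearMap.ext fun v => ?_)
    change Algebra.TensorProduct.lift _ _ (fun _ _ => Commute.all _ _) (Coalgebra.comul (R := ℂ)
      (SymmetricAlgebra.ι ℂ (Fin 4 → ℂ) v)) = algebraMap ℂ HMoy (Coalgebra.counit (R := ℂ)
        (SymmetricAlgebra.ι ℂ (Fin 4 → ℂ) v))
    rw [SymmetricAlgebra.comul_ι, SymmetricAlgebra.counit_ι, map_add]
    erw [Algebra.TensorProduct.lift_tmul, Algebra.TensorProduct.lift_tmul]
    simp)
  (by
    refine SymmetricAlgebra.algHom_ext (LinearMap.ext fun v => ?_)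
    change Algebra.TensorProduct.lift _ _ (fun _ _ => Commute.all _ _) (Coalgebra.comul (R := ℂ)
      (SymmetricAlgebra.ι ℂ (Fin 4 → ℂ) v)) = algebraMap ℂ HMoy (Coalgebra.counit (R := ℂ)
        (SymmetricAlgebra.ι ℂ (Fin 4 → ℂ) v))
    rw [SymmetricAlgebra.comul_ι, SymmetricAlgebra.counit_ι, map_add]
    erw [Algebra.TensorProduct.lift_tmul, Algebra.TensorProduct.lift_tmul]
    simp)

/-- The coordinate functions `(t₁, t₁*, t₂, t₂*)`. -/
def tau (i : Fin 4) : HMoy := SymmetricAlgebra.ι ℂ (Fin 4 → ℂ) (Pi.single i 1)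

/-- The algebra map `τ_j ↦ (0, b_{ij})` to the dual numbers. -/
def dualMap (b : Matrix (Fin 4) (Fin 4) ℂ) (i : Fin 4) : HMoy →ₐ[ℂ] TrivSqZeroExt ℂ ℂ :=
  SymmetricAlgebra.lift (TrivSqZeroExt.inrHom ℂ ℂ ∘ₗ Fintype.linearCombination ℂ (b i))

lemma fst_dualMap (b : Matrix (Fin 4) (Fin 4) ℂ) (i : Fin 4) (x : HMoy) :
    (dualMap b i x).fst = Coalgebra.counit (R := ℂ) x := by
  have : (TrivSqZeroExt.fstHom ℂ ℂ ℂ).comp (dualMap b i) = Bialgebra.counitAlgHom ℂ HMoy := by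
    apply SymmetricAlgebra.algHom_ext
    ext i
    simp [dualMap, SymmetricAlgebra.algebraMapInv_ι]
  exact DFunLike.congr_fun this x

/-- The functional `F(τ_i, ·)`: the `ε`-derivation with value `b_{ij}` on `τ_j`. -/
def primFun (b : Matrix (Fin 4) (Fin 4) ℂ) (i : Fin 4) : HMoy →ₗ[ℂ] ℂ :=
  TrivSqZeroExt.sndHom ℂ ℂ ∘ₗ (dualMap b i).toLinearMap

lemma primFun_mul (b : Matrix (Fin 4) (Fin 4) ℂ) (i : Fin 4) (x y : HMoy) :
    primFun b i (x * y) = Coalgebra.counit (R := ℂ) x * primFun b i y +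
      primFun b i x * Coalgebra.counit (R := ℂ) y := by
  simp [primFun, fst_dualMap, mul_comm]

lemma primFun_one (b : Matrix (Fin 4) (Fin 4) ℂ) (i : Fin 4) : primFun b i 1 = 0 := by
  simp [primFun]

/-- The left half of the bicharacter with `F(τ_i, τ_j) = b_{ij}`. -/
def moyLeft (b : Matrix (Fin 4) (Fin 4) ℂ) : HMoy →ₐ[ℂ] WithConv (HMoy →ₗ[ℂ] ℂ) :=
  SymmetricAlgebra.lift (Fintype.linearCombination ℂ fun i => WithConv.toConv (primFun b i))

lemma moyLeft_ι (b : Matrix (Fin 4) (Fin 4) ℂ) (v : Fin 4 → ℂ) (x : HMoy) :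
    (moyLeft b (SymmetricAlgebra.ι ℂ _ v)).ofConv x = ∑ i, v i * primFun b i x := by
  simp [moyLeft, Fintype.linearCombination_apply]


/-- `x ⊗ y ↦ L(x)(g) L(y)(g')`. -/
def pairTwo (L : H →ₐ[ℂ] WithConv (H →ₗ[ℂ] ℂ)) (g g' : H) : H ⊗[ℂ] H →ₗ[ℂ] ℂ :=
  LinearMap.mul' ℂ ℂ ∘ₗ TensorProduct.map
    { toFun := fun x => (L x).ofConv g
      map_add' := by simp
      map_smul' := by simp }
    { toFun := fun x => (L x).ofConv g'
      map_add' := by simp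
      map_smul' := by simp }

lemma pairTwo_tmul (L : H →ₐ[ℂ] WithConv (H →ₗ[ℂ] ℂ)) (g g' x y : H) :
    pairTwo L g g' (x ⊗ₜ y) = (L x).ofConv g * (L y).ofConv g' := rfl

lemma pairTwo_repr (L : H →ₐ[ℂ] WithConv (H →ₗ[ℂ] ℂ)) (g g' h : H) :
    pairTwo L g g' (Coalgebra.comul (R := ℂ) h) = ∑ i ∈ (ℛ ℂ h).index,
      (L ((ℛ ℂ h).left i)).ofConv g * (L ((ℛ ℂ h).right i)).ofConv g' := by
  conv_lhs => rw [← (ℛ ℂ h).eq]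
  simp [pairTwo_tmul]

/-- The set of `h` for which `L(h)` satisfies the bicharacter property is closed under products. -/
lemma pair_mul (L : H →ₐ[ℂ] WithConv (H →ₗ[ℂ] ℂ)) (h h' : H)
    (hh : ∀ g g', (L h).ofConv (g * g') = pairTwo L g g' (Coalgebra.comul (R := ℂ) h))
    (hh' : ∀ g g', (L h').ofConv (g * g') = pairTwo L g g' (Coalgebra.comul (R := ℂ) h')) (g g' : H) :
    (L (h * h')).ofConv (g * g') = pairTwo L g g' (Coalgebra.comul (R := ℂ) (h * h')) := by
  rw [map_mul L, LinearMap.convMul_apply, Bialgebra.comul_mul, Bialgebra.comul_mul]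
  conv_lhs => rw [← (ℛ ℂ g).eq, ← (ℛ ℂ g').eq]
  conv_rhs => rw [← (ℛ ℂ h).eq, ← (ℛ ℂ h').eq]
  simp only [Finset.sum_mul_sum, map_sum, Algebra.TensorProduct.tmul_mul_tmul,
    TensorProduct.map_tmul, LinearMap.mul'_apply, hh, hh', pairTwo_repr, pairTwo_tmul, map_mul,
    (ℛ ℂ g).convMul_apply, (ℛ ℂ g').convMul_apply]
  calc _ = ∑ i ∈ (ℛ ℂ g).index, ∑ a ∈ (ℛ ℂ h).index, ∑ j ∈ (ℛ ℂ g').index, ∑ b ∈ (ℛ ℂ h').index,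
        _ := Finset.sum_congr rfl fun i _ => Finset.sum_comm
    _ = ∑ a ∈ (ℛ ℂ h).index, ∑ i ∈ (ℛ ℂ g).index, ∑ j ∈ (ℛ ℂ g').index, ∑ b ∈ (ℛ ℂ h').index,
        _ := Finset.sum_comm
    _ = ∑ a ∈ (ℛ ℂ h).index, ∑ i ∈ (ℛ ℂ g).index, ∑ b ∈ (ℛ ℂ h').index, ∑ j ∈ (ℛ ℂ g').index,
        _ := Finset.sum_congr rfl fun a _ => Finset.sum_congr rfl fun i _ => Finset.sum_comm
    _ = ∑ a ∈ (ℛ ℂ h).index, ∑ b ∈ (ℛ ℂ h').index, ∑ i ∈ (ℛ ℂ g).index, ∑ j ∈ (ℛ ℂ g').index,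
        _ := Finset.sum_congr rfl fun a _ => Finset.sum_comm
    _ = _ := Finset.sum_congr rfl fun a _ => Finset.sum_congr rfl fun b _ =>
      Finset.sum_congr rfl fun i _ => Finset.sum_congr rfl fun j _ => by ring

/-- The bicharacter with `F(τ_i, τ_j) = b_{ij}`. -/
def moyBichar (b : Matrix (Fin 4) (Fin 4) ℂ) : Bichar HMoy :=
  Bichar.ofLeft (moyLeft b)
    (by
      intro h
      induction h using SymmetricAlgebra.induction with
      | algebraMap r => simp [LinearMap.convOne_def, Algebra.algebraMap_eq_smul_one]
      | ι v => simp [moyLeft_ι, primFun_one]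
      | mul x y hx hy =>
        rw [map_mul, LinearMap.convMul_apply, Bialgebra.comul_one]
        simp [Algebra.TensorProduct.one_def, hx, hy]
      | add x y hx hy => simp [hx, hy])
    (by
      intro h g g'
      rw [← pairTwo_repr]
      revert g g'
      induction h using SymmetricAlgebra.induction with
      | algebraMap r => 
        intro g g'
        simp [LinearMap.convOne_def, Algebra.algebraMap_eq_smul_one, 
           Algebra.TensorProduct.one_def, pairTwo_tmul]
      | ι v =>
        intro g g'
        rw [SymmetricAlgebra.comul_ι, map_add, pairTwo_tmul, pairTwo_tmul]
        simp [moyLeft_ι, primFun_mul, LinearMap.convOne_def, mul_add, Finset.sum_add_distrib,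
          Finset.sum_mul, Finset.mul_sum]
        rw [add_comm]
        congr 1 <;> exact Finset.sum_congr rfl fun i _ => by ring
      | mul x y hx hy => exact pair_mul _ x y hx hy
      | add x y hx hy => intro g g'; simp [hx, hy])

/-- The algebra `A[𝕋²]` of Laurent polynomials in `s₁, s₂`; the basis element at `(m,n)` is
`s₁^m s₂^n`. -/
abbrev HTor : Type := AddMonoidAlgebra ℂ (Fin 2 → ℤ)


namespace Tor

/-- The bicharacter `F(s^m, s^n) = e^{iπ ∑ Θ_{jl} m_j n_l}`, as a function of the exponents. -/
def chi (Θ : Matrix (Fin 2) (Fin 2) ℝ) (m n : Fin 2 → ℤ) : ℂ :=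
  Complex.exp (Complex.I * Real.pi * ∑ j, ∑ l, (Θ j l : ℂ) * m j * n l)

lemma chi_add_left (Θ : Matrix (Fin 2) (Fin 2) ℝ) (m m' n : Fin 2 → ℤ) :
    chi Θ (m + m') n = chi Θ m n * chi Θ m' n := by
  rw [chi, chi, chi, ← Complex.exp_add]
  congr 1
  simp [Fin.sum_univ_two]
  ring

lemma chi_add_right (Θ : Matrix (Fin 2) (Fin 2) ℝ) (m n n' : Fin 2 → ℤ) :
    chi Θ m (n + n') = chi Θ m n * chi Θ m n' := by
  rw [chi, chi, chi, ← Complex.exp_add]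
  congr 1
  simp [Fin.sum_univ_two]
  ring

lemma chi_zero_left (Θ : Matrix (Fin 2) (Fin 2) ℝ) (n : Fin 2 → ℤ) : chi Θ 0 n = 1 := by
  simp [chi]

lemma chi_zero_right (Θ : Matrix (Fin 2) (Fin 2) ℝ) (n : Fin 2 → ℤ) : chi Θ n 0 = 1 := by
  simp [chi]

/-- The character `F(s^m, ·)`. -/
def char (Θ : Matrix (Fin 2) (Fin 2) ℝ) (m : Fin 2 → ℤ) : HTor →ₐ[ℂ] ℂ :=
  AddMonoidAlgebra.lift ℂ ℂ (Fin 2 → ℤ)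
    { toFun := fun n => chi Θ m n.toAdd
      map_one' := chi_zero_right Θ m
      map_mul' := fun x y => chi_add_right Θ m x.toAdd y.toAdd }

lemma char_single (Θ : Matrix (Fin 2) (Fin 2) ℝ) (m n : Fin 2 → ℤ) :
    char Θ m (AddMonoidAlgebra.single n 1) = chi Θ m n := by
  simp [char]

lemma comul_single (m : Fin 2 → ℤ) : Coalgebra.comul (R := ℂ)
    (AddMonoidAlgebra.single m 1 : HTor) =
      AddMonoidAlgebra.single m 1 ⊗ₜ[ℂ] AddMonoidAlgebra.single m 1 := by
  simp

lemma counit_single (m : Fin 2 → ℤ) : Coalgebra.counit (R := ℂ)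
    (AddMonoidAlgebra.single m 1 : HTor) = 1 := by
  simp

/-- The left half of the bicharacter. -/
def left (Θ : Matrix (Fin 2) (Fin 2) ℝ) : HTor →ₐ[ℂ] WithConv (HTor →ₗ[ℂ] ℂ) :=
  AddMonoidAlgebra.lift ℂ _ (Fin 2 → ℤ)
    { toFun := fun m => WithConv.toConv (char Θ m.toAdd).toLinearMap
      map_one' := by
        apply WithConv.ofConv_injective
        apply AddMonoidAlgebra.lhom_ext'
        intro n
        ext
        simp [LinearMap.convOne_def, char_single, chi_zero_left]
      map_mul' := fun x y => by
        apply WithConv.ofConv_injective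
        apply AddMonoidAlgebra.lhom_ext'
        intro n
        ext
        simp [LinearMap.convMul_apply, char_single, chi_add_left] }

lemma left_single (Θ : Matrix (Fin 2) (Fin 2) ℝ) (m : Fin 2 → ℤ) (x : HTor) :
    (left Θ (AddMonoidAlgebra.single m 1)).ofConv x = char Θ m x := by
  simp [left]

/-- The bicharacter with `F(s_j, s_l) = e^{iπΘ_{jl}}`. -/
def bichar (Θ : Matrix (Fin 2) (Fin 2) ℝ) : Bichar HTor :=
  Bichar.ofLeft (left Θ)
    (by
      intro h
      have : ∀ φ ψ : HTor →ₗ[ℂ] ℂ, (∀ m, φ (AddMonoidAlgebra.single m 1) =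
          ψ (AddMonoidAlgebra.single m 1)) → φ h = ψ h := by
        intro φ ψ hm
        have : φ = ψ := AddMonoidAlgebra.lhom_ext' fun m => by ext; simpa using hm m
        rw [this]
      refine this
        { toFun := fun x => (left Θ x).ofConv 1
          map_add' := by simp
          map_smul' := by simp } (Coalgebra.counit (R := ℂ)) fun m => ?_
      rw [counit_single]
      simp [left_single])
    (by
      intro h g g'
      rw [← pairTwo_repr]
      have : ∀ φ ψ : HTor →ₗ[ℂ] ℂ, (∀ m, φ (AddMonoidAlgebra.single m 1) =
          ψ (AddMonoidAlgebra.single m 1)) → φ h = ψ h := by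
        intro φ ψ hm
        have : φ = ψ := AddMonoidAlgebra.lhom_ext' fun m => by ext; simpa using hm m
        rw [this]
      refine this
        { toFun := fun x => (left Θ x).ofConv (g * g')
          map_add' := by simp
          map_smul' := by simp }
        (pairTwo (left Θ) g g' ∘ₗ Coalgebra.comul (R := ℂ)) fun m => ?_
      rw [LinearMap.comp_apply, comul_single, pairTwo_tmul]
      simp [left_single])

end Tor

lemma comul_tau (i : Fin 4) : Coalgebra.comul (R := ℂ) (tau i) =
    tau i ⊗ₜ[ℂ] 1 + 1 ⊗ₜ[ℂ] tau i := SymmetricAlgebra.comul_ι ℂ (Fin 4 → ℂ) _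

lemma counit_tau (i : Fin 4) : Coalgebra.counit (R := ℂ) (tau i) = 0 :=
  SymmetricAlgebra.counit_ι ℂ (Fin 4 → ℂ) _

/-- The values of the Moyal bicharacter on the generators `(t₁, t₁*, t₂, t₂*)`. -/
def moyMatrix (ħ : ℝ) (α β : ℂ) : Matrix (Fin 4) (Fin 4) ℂ :=
  !![0, -(Complex.I * ħ * α / 2), 0, 0;
     Complex.I * ħ * α / 2, 0, 0, 0;
     0, 0, 0, Complex.I * ħ * β / 2;
     0, 0, -(Complex.I * ħ * β / 2), 0]

lemma tau_values (b : Matrix (Fin 4) (Fin 4) ℂ) (i j : Fin 4) :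
    ((moyBichar b).left (tau i)).ofConv (tau j) = b i j := by
  change ((moyLeft b) (tau i)).ofConv (tau j) = b i j
  simp [tau, moyLeft_ι, primFun, dualMap, Pi.single_apply]

/-- The translation group of `ℝ⁴` with the Moyal bicharacter. -/
def moyal (ħ : ℝ) (α β : ℂ) : Symm HMoy where
  F := moyBichar (moyMatrix ħ α β)
  A := !![1, 0, 0, 0; 0, 1, 0, 0; tau 1, tau 3, 1, 0; -tau 2, tau 0, 0, 1]
  As := !![1, 0, 0, 0; 0, 1, 0, 0; tau 0, tau 2, 1, 0; -tau 3, tau 1, 0, 1]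
  comul_A := by
    intro i j
    fin_cases i <;> fin_cases j <;>
      simp [Fin.sum_univ_four, comul_tau, Algebra.TensorProduct.one_def, TensorProduct.neg_tmul,
        TensorProduct.tmul_neg, add_comm]
  counit_A := by
    intro i j
    fin_cases i <;> fin_cases j <;> simp [counit_tau]
  comul_As := by
    intro i j
    fin_cases i <;> fin_cases j <;>
      simp [Fin.sum_univ_four, comul_tau, Algebra.TensorProduct.one_def, TensorProduct.neg_tmul,
        TensorProduct.tmul_neg, add_comm]
  counit_As := by
    intro i j
    fin_cases i <;> fin_cases j <;> simp [counit_tau]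
  unit_A := by
    intro a b
    fin_cases a <;> fin_cases b <;> simp
  g := 1
  t := tau
  comul_g := by intro i; simp [Algebra.TensorProduct.one_def]
  counit_g := by intro i; simp
  comul_t := by intro i; simp [comul_tau]
  counit_t := counit_tau

/-- The monomial `s₁^m s₂^n`. -/
def smon (m n : ℤ) : HTor := AddMonoidAlgebra.single ![m, n] 1

lemma comul_smon (m n : ℤ) : Coalgebra.comul (R := ℂ) (smon m n) = smon m n ⊗ₜ[ℂ] smon m n :=
  Tor.comul_single _

lemma counit_smon (m n : ℤ) : Coalgebra.counit (R := ℂ) (smon m n) = 1 := Tor.counit_single _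

lemma smon_mul (m n m' n' : ℤ) : smon m n * smon m' n' = smon (m + m') (n + n') := by
  simp [smon, AddMonoidAlgebra.single_mul_single]

lemma smon_zero : smon 0 0 = 1 := by
  rw [smon, AddMonoidAlgebra.one_def]
  congr 1
  simp

/-- The two-torus with the toric bicharacter, `Θ = ½ (0 θ; -θ 0)`. -/
def toric (θ : ℝ) : Symm HTor where
  F := Tor.bichar !![0, θ / 2; -(θ / 2), 0]
  A := Matrix.diagonal ![smon 1 0, smon (-1) 0, smon 0 1, smon 0 (-1)]
  As := Matrix.diagonal ![smon (-1) 0, smon 1 0, smon 0 (-1), smon 0 1]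
  comul_A := by
    intro i j
    fin_cases i <;> fin_cases j <;> simp [Fin.sum_univ_four, comul_smon]
  counit_A := by
    intro i j
    fin_cases i <;> fin_cases j <;> simp [counit_smon]
  comul_As := by
    intro i j
    fin_cases i <;> fin_cases j <;> simp [Fin.sum_univ_four, comul_smon]
  counit_As := by
    intro i j
    fin_cases i <;> fin_cases j <;> simp [counit_smon]
  unit_A := by
    intro a b
    fin_cases a <;> fin_cases b <;> simp [smon_mul, smon_zero]
  g := ![smon 1 (-1), smon (-1) 1, smon (-1) (-1), smon 1 1]
  t := 0
  comul_g := by intro i; fin_cases i <;> simp [comul_smon]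
  counit_g := by intro i; fin_cases i <;> simp [counit_smon]
  comul_t := by simp
  counit_t := by simp

/-! ### Forms on `ℝ⁴` -/

/-- The generators `(ζ₁, ζ₁*, ζ₂, ζ₂*)`. -/
def zeta (i : Fin 4) : R4 := MvPolynomial.X i

/-- The one-forms `(dζ₁, dζ₁*, dζ₂, dζ₂*)`. -/
def dzeta (i : Fin 4) : Lam := ExteriorAlgebra.ι ℂ (Pi.single i 1)

/-- The exterior derivative on `Ω(ℝ⁴)`: `d(f ω) = ∑ᵢ (∂f/∂ζᵢ) dζᵢ ∧ ω` for constant `ω`. -/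
def dOm : Om →ₗ[ℂ] Om :=
  ∑ i, TensorProduct.map (MvPolynomial.pderiv i).toLinearMap (LinearMap.mulLeft ℂ (dzeta i))

/-- The grading involution `ω ↦ (-1)^{deg ω} ω` of `Ω(ℝ⁴)`. -/
def parityOm : Om →ₗ[ℂ] Om :=
  (ExteriorAlgebra.map (-LinearMap.id : (Fin 4 → ℂ) →ₗ[ℂ] (Fin 4 → ℂ))).toLinearMap.lTensor R4

/-- The real coframe `dx₁, …, dx₄`, where `ζ₁* = x₁ + i x₂` and `ζ₂ = x₃ + i x₄`. -/
def dx : Fin 4 → Lam :=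
  ![(2⁻¹ : ℂ) • (dzeta 1 + dzeta 0), (2 * Complex.I)⁻¹ • (dzeta 1 - dzeta 0),
    (2⁻¹ : ℂ) • (dzeta 2 + dzeta 3), (2 * Complex.I)⁻¹ • (dzeta 2 - dzeta 3)]

/-- The coordinates of a one-form in the coframe `dx₁, …, dx₄`. -/
def realCoord : (Fin 4 → ℂ) →ₗ[ℂ] (Fin 4 → ℂ) :=
  Matrix.mulVecLin !![1, 1, 0, 0; -Complex.I, Complex.I, 0, 0;
    0, 0, 1, 1; 0, 0, Complex.I, -Complex.I]

/-- The coefficient of `dx_p ∧ dx_q` in `v ∧ w`. -/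
def minor (p q : Fin 4) : (Fin 4 → ℂ) [⋀^Fin 2]→ₗ[ℂ] ℂ :=
  (Matrix.detRowAlternating (n := Fin 2) (R := ℂ)).compLinearMap
    ((LinearMap.pi ![LinearMap.proj p, LinearMap.proj q]) ∘ₗ realCoord)

/-- The Hodge star operator on two-forms with constant coefficients for the Euclidean metric and
the orientation `dx₁ ∧ dx₂ ∧ dx₃ ∧ dx₄` (and zero in the degrees other than two). -/
def hodge : Lam →ₗ[ℂ] Lam :=
  ExteriorAlgebra.liftAlternating fun
    | 2 => (LinearMap.toSpanSingleton ℂ Lam (dx 2 * dx 3)).compAlternatingMap (minor 0 1)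
        - (LinearMap.toSpanSingleton ℂ Lam (dx 1 * dx 3)).compAlternatingMap (minor 0 2)
        + (LinearMap.toSpanSingleton ℂ Lam (dx 1 * dx 2)).compAlternatingMap (minor 0 3)
        + (LinearMap.toSpanSingleton ℂ Lam (dx 0 * dx 3)).compAlternatingMap (minor 1 2)
        - (LinearMap.toSpanSingleton ℂ Lam (dx 0 * dx 2)).compAlternatingMap (minor 1 3)
        + (LinearMap.toSpanSingleton ℂ Lam (dx 0 * dx 1)).compAlternatingMap (minor 2 3)
    | _ => 0

lemma hodge_mul (v w : Fin 4 → ℂ) : hodge (ExteriorAlgebra.ι ℂ v * ExteriorAlgebra.ι ℂ w) =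
    minor 0 1 ![v, w] • (dx 2 * dx 3) - minor 0 2 ![v, w] • (dx 1 * dx 3) +
    minor 0 3 ![v, w] • (dx 1 * dx 2) + minor 1 2 ![v, w] • (dx 0 * dx 3) -
    minor 1 3 ![v, w] • (dx 0 * dx 2) + minor 2 3 ![v, w] • (dx 0 * dx 1) := by
  have : ExteriorAlgebra.ι ℂ v * ExteriorAlgebra.ι ℂ w = ExteriorAlgebra.ιMulti ℂ 2 ![v, w] := by
    simp [ExteriorAlgebra.ιMulti_apply]
  rw [this, hodge, ExteriorAlgebra.liftAlternating_apply_ιMulti]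
  rfl

/-- The right module `P Rⁿ`, for an idempotent matrix `P` over `R`. -/
def rangeModule {R : Type} [Ring R] {n : ℕ} (P : Matrix (Fin n) (Fin n) R) :
    Submodule Rᵐᵒᵖ (Fin n → R) where
  carrier := {ψ | P.mulVec ψ = ψ}
  add_mem' := by
    intro x y hx hy
    simp only [Set.mem_ofPred_eq] at *
    rw [Matrix.mulVec_add, hx, hy]
  zero_mem' := by simp
  smul_mem' := by
    intro c x hx
    simp only [Set.mem_ofPred_eq] at *
    funext i
    have := congrFun hx i
    simp only [Matrix.mulVec, dotProduct, Pi.smul_apply, MulOpposite.smul_eq_mul_unop] at *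
    rw [← this, Finset.sum_mul]
    exact Finset.sum_congr rfl fun j _ => (mul_assoc _ _ _).symm

/-- A conjugate-linear involutive anti-automorphism. -/
structure IsStar {B : Type} [Ring B] [Algebra ℂ B] (s : B → B) : Prop where
  add : ∀ x y, s (x + y) = s x + s y
  smul : ∀ (c : ℂ) x, s (c • x) = (starRingEnd ℂ c) • s x
  mul : ∀ x y, s (x * y) = s y * s x
  invol : ∀ x, s (s x) = x

/-! ### The instanton construction -/

namespace Symm
variable (D : Symm H) (k : ℕ)

/-- `(A[M_k]_F ⋊ H) ⊗ A₀[ℂ⁴]_F` -/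
abbrev BC : Type := Big D.F (D.coM k) D.coC

/-- `(A[M_k]_F ⋊ H) ⊗ A[ℝ⁴]_F` -/
abbrev BR : Type := Big D.F (D.coM k) D.coR

/-- `(A[M_k]_F ⋊ H) ⊗ Ω(ℝ⁴)_F` -/
abbrev BOm : Type := Big D.F (D.coM k) D.coOm

/-- `σ̃_w = μ(∑ⱼ M^j ⊗ w_j)` -/
def sigma (w : Fin 4 → C4) : Matrix (Fin (2 * k + 2)) (Fin k) (D.BC k) :=
  Matrix.of fun a b => ∑ j, mu D.F (D.coM k) D.coC (Mmat k j a b ⊗ₜ algebraMap C4 C4loc (w j))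

/-- `μ(∑ⱼ M^j† ⊗ w_j)` -/
def sigmaStar (w : Fin 4 → C4) : Matrix (Fin k) (Fin (2 * k + 2)) (D.BC k) :=
  Matrix.of fun b a => ∑ j, mu D.F (D.coM k) D.coC (Mdag k j b a ⊗ₜ algebraMap C4 C4loc (w j))

/-- `J(z) = (-z₂*, z₁*, -z₄*, z₃*)` -/
def Jz : Fin 4 → C4 := ![-zs 1, zs 0, -zs 3, zs 2]

/-- `J(z)* = (-z₂, z₁, -z₄, z₃)` -/
def Jzs : Fin 4 → C4 := ![-z 1, z 0, -z 3, z 2]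

/-- `Ṽ = (σ̃_z σ̃_{J(z)})` -/
def V : Matrix (Fin (2 * k + 2)) (Fin k ⊕ Fin k) (D.BC k) :=
  Matrix.fromCols (D.sigma k z) (D.sigma k Jz)

/-- `Ṽ*` -/
def Vs : Matrix (Fin k ⊕ Fin k) (Fin (2 * k + 2)) (D.BC k) :=
  Matrix.fromRows (D.sigmaStar k zs) (D.sigmaStar k Jzs)

/-- `ρ̃² = σ̃_z* σ̃_z` -/
def rhoSq : Matrix (Fin k) (Fin k) (D.BC k) := D.sigmaStar k zs * D.sigma k z

/-- `(A[M_k]_F ⋊ H) ⊗ A₀[ℂ⁴]_F` with the matrix `ρ̃⁻²` adjoined. -/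
abbrev LocC : Type := Adj (D.rhoSq k)

/-- The inclusion of `(A[M_k]_F ⋊ H) ⊗ A₀[ℂ⁴]_F`. -/
abbrev ofC : D.BC k →ₐ[ℂ] D.LocC k := Adj.of (D.rhoSq k)

/-- `Q̃ = Ṽ ρ̃⁻² Ṽ*` -/
def Qt : Matrix (Fin (2 * k + 2)) (Fin (2 * k + 2)) (D.LocC k) :=
  (D.V k).map (D.ofC k) * Matrix.fromBlocks (Adj.inv (D.rhoSq k)) 0 0 (Adj.inv (D.rhoSq k)) *
    (D.Vs k).map (D.ofC k)

/-- `P̃ = 1 - Q̃` -/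
def Pt : Matrix (Fin (2 * k + 2)) (Fin (2 * k + 2)) (D.LocC k) := 1 - D.Qt k

/-- The coordinates of `ℝ⁴` as functions on the twistor space, multiplied by `r`:
`ζ₁ = r⁻¹ (z₁z₃* + z₂*z₄)`, `ζ₂ = r⁻¹ (z₂z₃* - z₁*z₄)` and conjugates. -/
def quad : Fin 4 → C4 :=
  ![z 0 * zs 2 + zs 1 * z 3, zs 0 * z 2 + z 1 * zs 3,
    z 1 * zs 2 - zs 0 * z 3, zs 1 * z 2 - z 0 * zs 3]

/-- `ζ_i` as an element of `A₀[ℂ⁴]`. -/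
def zetaC (i : Fin 4) : C4loc := Localization.mk (quad i) ⟨rr, Submonoid.mem_powers rr⟩

/-- `μ` applied to the classical element of `A[M_k] ⊗ A[ℝ⁴]`. -/
def bosR : AM k ⊗[ℂ] R4 →ₗ[ℂ] D.BR k :=
  mu D.F (D.coM k) D.coR ∘ₗ normalOrder D.F (D.coM k) D.coR

/-- In the chart `ℝ⁴` one has `σ_z = v₁ z₁ + v₂ z₂` and `σ_{J(z)} = - v₁ z₂* + v₂ z₁*` with
`v₁ = M¹ + M³ ζ₁* - M⁴ ζ₂` and `v₂ = M² + M³ ζ₂* + M⁴ ζ₁`. -/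
def vec : Fin 2 → Matrix (Fin (2 * k + 2)) (Fin k) (AM k ⊗[ℂ] R4) :=
  ![Matrix.of fun a b => Mmat k 0 a b ⊗ₜ 1 + Mmat k 2 a b ⊗ₜ zeta 1 - Mmat k 3 a b ⊗ₜ zeta 2,
    Matrix.of fun a b => Mmat k 1 a b ⊗ₜ 1 + Mmat k 2 a b ⊗ₜ zeta 3 + Mmat k 3 a b ⊗ₜ zeta 0]

/-- The adjoints `v₁*`, `v₂*`. -/
def vecStar : Fin 2 → Matrix (Fin k) (Fin (2 * k + 2)) (AM k ⊗[ℂ] R4) :=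
  ![Matrix.of fun b a => Mdag k 0 b a ⊗ₜ 1 + Mdag k 2 b a ⊗ₜ zeta 0 - Mdag k 3 b a ⊗ₜ zeta 3,
    Matrix.of fun b a => Mdag k 1 b a ⊗ₜ 1 + Mdag k 2 b a ⊗ₜ zeta 2 + Mdag k 3 b a ⊗ₜ zeta 1]

/-- `r⁻¹ ρ̃²`, as a function on `ℝ⁴`. -/
def ghat : Matrix (Fin k) (Fin k) (D.BR k) :=
  (vecStar k 0).map (D.bosR k) * (vec k 0).map (D.bosR k)

/-- `(A[M_k]_F ⋊ H) ⊗ A[ℝ⁴]_F` with the inverse of `r⁻¹ ρ̃²` adjoined. -/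
abbrev LocR : Type := Adj (D.ghat k)

/-- The inclusion of `(A[M_k]_F ⋊ H) ⊗ A[ℝ⁴]_F`. -/
abbrev ofR : D.BR k →ₐ[ℂ] D.LocR k := Adj.of (D.ghat k)

/-- The projection `P̃` as a matrix of functions on `ℝ⁴`. -/
def PR : Matrix (Fin (2 * k + 2)) (Fin (2 * k + 2)) (D.LocR k) :=
  1 - ∑ i, ((vec k i).map (D.bosR k)).map (D.ofR k) * Adj.inv (D.ghat k) *
    ((vecStar k i).map (D.bosR k)).map (D.ofR k)

/-- `(A[M_k]_F ⋊ H) ⊗ A[ℝ⁴]_F → (A[M_k]_F ⋊ H) ⊗ Ω(ℝ⁴)_F` -/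
def inclBig : D.BR k →ₐ[ℂ] D.BOm k :=
  Algebra.TensorProduct.map (AlgHom.id ℂ _) (Tw.map D.F D.coR D.coOm _ D.coOm_incl)

/-- `(A[M_k]_F ⋊ H) ⊗ Ω(ℝ⁴)_F` with the inverse of `r⁻¹ ρ̃²` adjoined. -/
abbrev LocOm : Type := Adj ((D.ghat k).map (D.inclBig k))

/-- The inclusion of `(A[M_k]_F ⋊ H) ⊗ Ω(ℝ⁴)_F`. -/
abbrev ofOm : D.BOm k →ₐ[ℂ] D.LocOm k := Adj.of ((D.ghat k).map (D.inclBig k))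

/-- The inclusion of functions into forms. -/
def incl : D.LocR k →ₐ[ℂ] D.LocOm k := Adj.map (D.ghat k) (D.inclBig k)

/-- The map `x ⊗ ω ↦ x ω` into forms, for `ω` with constant coefficients. -/
def constForms : D.LocR k ⊗[ℂ] Lam →ₗ[ℂ] D.LocOm k :=
  LinearMap.mul' ℂ (D.LocOm k) ∘ₗ TensorProduct.map (D.incl k).toLinearMap
    ((D.ofOm k).toLinearMap ∘ₗ TensorProduct.mk ℂ (Smash D.F (D.coM k)) (Tw D.F D.coOm) 1 ∘ₗ
      (Tw.mk D.F D.coOm).toLinearMap ∘ₗ TensorProduct.mk ℂ R4 Lam 1)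

/-- The operator `id ⊗ *`. -/
def hodgeId : D.LocR k ⊗[ℂ] Lam →ₗ[ℂ] D.LocR k ⊗[ℂ] Lam := hodge.lTensor (D.LocR k)

/-- `(γ, d)` are the grading involution and the exterior derivative `id ⊗ d`, extended to the
algebra with the inverse of `r⁻¹ ρ̃²` adjoined by multiplicativity and by the graded Leibniz rule
(which determine them). -/
structure IsDeRham (γ : D.LocOm k →ₐ[ℂ] D.LocOm k) (d : D.LocOm k →ₗ[ℂ] D.LocOm k) : Prop where
  parity : ∀ (x : Smash D.F (D.coM k)) (ω : Om), γ (D.ofOm k (x ⊗ₜ Tw.mk D.F D.coOm ω)) =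
    D.ofOm k (x ⊗ₜ Tw.mk D.F D.coOm (parityOm ω))
  d_of : ∀ (x : Smash D.F (D.coM k)) (ω : Om), d (D.ofOm k (x ⊗ₜ Tw.mk D.F D.coOm ω)) =
    D.ofOm k (x ⊗ₜ Tw.mk D.F D.coOm (dOm ω))
  leibniz : ∀ x y, d (x * y) = d x * y + γ x * d y

/-- `P̃` as a matrix of zero-forms. -/
def POm : Matrix (Fin (2 * k + 2)) (Fin (2 * k + 2)) (D.LocOm k) := (D.PR k).map (D.incl k)

/-- The Grassmann connection `∇ψ = P̃ dψ`. -/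
def nabla (d : D.LocOm k →ₗ[ℂ] D.LocOm k) (ψ : Fin (2 * k + 2) → D.LocOm k) :
    Fin (2 * k + 2) → D.LocOm k := (D.POm k).mulVec fun i => d (ψ i)

/-- The curvature `F = P̃ (dP̃)²`. -/
def curvature (d : D.LocOm k →ₗ[ℂ] D.LocOm k) :
    Matrix (Fin (2 * k + 2)) (Fin (2 * k + 2)) (D.LocOm k) :=
  D.POm k * ((D.POm k).map d * (D.POm k).map d)

end Symm

namespace Symm
variable (D : Symm H) (k : ℕ)

/-- A matrix of forms is anti-self-dual: it lies in `R ⊗ Ω²₋`, that is, it is given by a matrix `G`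
over `R ⊗ Λ` with `(id ⊗ *) G = -G`. (As `*` vanishes outside degree two, `G` is a two-form.) -/
def IsASD (F : Matrix (Fin (2 * k + 2)) (Fin (2 * k + 2)) (D.LocOm k)) : Prop :=
  ∃ G : Matrix (Fin (2 * k + 2)) (Fin (2 * k + 2)) (D.LocR k ⊗[ℂ] Lam),
    G.map (D.constForms k) = F ∧ G.map (D.hodgeId k) = -G

/-- `P̃` is a family of rank-two bundles over the quantised `ℝ⁴` parameterised by `A[M_k]_F ⋊ H`
and its Grassmann connection is anti-self-dual. -/
structure IsInstantonFamily : Prop where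
  /-- `Ṽ* Ṽ = diag(ρ̃², ρ̃²)`. -/
  Vs_mul_V : D.Vs k * D.V k = Matrix.fromBlocks (D.rhoSq k) 0 0 (D.rhoSq k)
  idempotent : D.Pt k * D.Pt k = D.Pt k
  trace : (D.Pt k).trace = 2
  /-- The entries of `P̃` are functions on `ℝ⁴`. -/
  descends : ∃ j : D.LocR k →ₐ[ℂ] D.LocC k,
    (∀ x : Smash D.F (D.coM k), j (D.ofR k (x ⊗ₜ 1)) = D.ofC k (x ⊗ₜ 1)) ∧
    (∀ i, j (D.ofR k (1 ⊗ₜ Tw.mk D.F D.coR (zeta i))) =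
      D.ofC k (1 ⊗ₜ Tw.mk D.F D.coC (zetaC i))) ∧
    (∀ a b, j (D.ofR k (D.ghat k a b)) *
      D.ofC k (1 ⊗ₜ Tw.mk D.F D.coC (algebraMap C4 C4loc rr)) = D.ofC k (D.rhoSq k a b)) ∧
    (D.PR k).map j = D.Pt k
  idempotentR : D.PR k * D.PR k = D.PR k
  traceR : (D.PR k).trace = 2
  /-- The bundle `P̃ Rⁿ` is a finitely generated projective right module. -/
  finite : Module.Finite (D.LocR k)ᵐᵒᵖ (rangeModule (D.PR k))
  projective : Module.Projective (D.LocR k)ᵐᵒᵖ (rangeModule (D.PR k))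
  exists_d : ∃ γ d, D.IsDeRham k γ d
  /-- `∇` is a connection. -/
  connection : ∀ γ d, D.IsDeRham k γ d → ∀ ψ ∈ rangeModule (D.PR k), ∀ a : D.LocR k,
    D.nabla k d (fun i => D.incl k (ψ i * a)) = fun i =>
      D.nabla k d (fun l => D.incl k (ψ l)) i * D.incl k a + D.incl k (ψ i) * d (D.incl k a)
  /-- `F` is the curvature of `∇`. -/
  curv : ∀ γ d, D.IsDeRham k γ d → ∀ ψ, (D.POm k).mulVec ψ = ψ →
    D.nabla k d (D.nabla k d ψ) = (D.curvature k d).mulVec ψ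
  asd : ∀ γ d, D.IsDeRham k γ d → D.IsASD k (D.curvature k d)

/-- `m ⊗ h ∈ A[M_k]_F ⋊ H`. -/
def par (m : AM k) (h : H) : Smash D.F (D.coM k) :=
  Smash.mk D.F (D.coM k) (Tw.mk D.F (D.coM k) m ⊗ₜ h)

/-- There are `*`-structures, given on the generators by `(M^j_{ab})* = (M^j†)_{ba}`,
`(A_{ij})* = (As)_{ij}`, `z_j ↔ z_j*`, `ζ_i ↔ ζ_i*`, for which `P̃` is self-adjoint. -/
structure HasStar : Prop where
  onC : ∃ s : D.LocC k → D.LocC k, IsStar s ∧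
    (∀ j a b, s (D.ofC k (D.par k (Mmat k j a b) 1 ⊗ₜ 1)) =
      D.ofC k (D.par k (Mdag k j b a) 1 ⊗ₜ 1)) ∧
    (∀ i l, s (D.ofC k (D.par k 1 (D.A i l) ⊗ₜ 1)) = D.ofC k (D.par k 1 (D.As i l) ⊗ₜ 1)) ∧
    (∀ i, s (D.ofC k (1 ⊗ₜ Tw.mk D.F D.coC (algebraMap C4 C4loc (z i)))) =
      D.ofC k (1 ⊗ₜ Tw.mk D.F D.coC (algebraMap C4 C4loc (zs i)))) ∧
    (∀ a b, s (D.ofC k (D.V k a b)) = D.ofC k (D.Vs k b a)) ∧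
    (∀ a b, s (D.Pt k a b) = D.Pt k b a)
  onR : ∃ s : D.LocR k → D.LocR k, IsStar s ∧
    (∀ j a b, s (D.ofR k (D.par k (Mmat k j a b) 1 ⊗ₜ 1)) =
      D.ofR k (D.par k (Mdag k j b a) 1 ⊗ₜ 1)) ∧
    (∀ i l, s (D.ofR k (D.par k 1 (D.A i l) ⊗ₜ 1)) = D.ofR k (D.par k 1 (D.As i l) ⊗ₜ 1)) ∧
    (s (D.ofR k (1 ⊗ₜ Tw.mk D.F D.coR (zeta 0))) = D.ofR k (1 ⊗ₜ Tw.mk D.F D.coR (zeta 1))) ∧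
    (s (D.ofR k (1 ⊗ₜ Tw.mk D.F D.coR (zeta 2))) = D.ofR k (1 ⊗ₜ Tw.mk D.F D.coR (zeta 3))) ∧
    (∀ a b, s (D.PR k a b) = D.PR k b a)

end Symm

end ADHM

end

set_option linter.unusedSectionVars false
set_option linter.unusedSimpArgs false

noncomputable section

open scoped TensorProduct Coalgebra

namespace ADHM

variable {H : Type} [CommRing H] [HopfAlgebra ℂ H] [Coalgebra.IsCocomm ℂ H]

/-! ### The convolution group of bicharacters -/

namespace Bichar

/-! One algebra map reduces everything to the classical monad. In the twisted tensor product `(A ⊗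
C)_F` and in `(A_F ⋊ H) ⊗ C_F` the images of `A_F` and `C_F` satisfy the same exchange rule: moving
`c` past `a` costs `R(a₋₁,c₋₁)`. In the first algebra this is because `R` is the convolution
quotient of the flip of `F` by `F`; in the second it is the relation `h a = (h₁ ▷ a) h₂`. Hence
normal ordering followed by `μ` is an algebra map `bos` on `(A ⊗ C)_F` (`bosLin_mul`).

In both cases `H` contains a subalgebra `K` on which `F` is trivial: the scalars for Moyal, the
Laurent polynomials in `s₁` for the torus. The entries of `v_i`, `v_i*`, `dv_i`, `dv_i*` and the
functions `z₁, z₂, z₁*, z₂*` have their `H`-legs in `K` (`admissible_moyal`, `admissible_toric`). On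
such elements the twisted product is the untwisted one (`twMul_kPart`), so `bos` restricts to an
algebra map `phi` from an untwisted algebra, which for functions is commutative. Identities between
these elements may therefore be checked classically.

Classically, let `n_i` be `v_i` with `N` in place of `M`. The reality conditions read `v₁* = -n₂`,
`v₂* = n₁`, and the monad equations read `n_i v_j = -n_j v_i`; hence `v_i* v_j = δ_ij g`
(`vecStar_mul_vec`). The entries of `ĝ` lie in the commutative image of `phi`, so those of `ĝ⁻¹`
commute with that image (`commute_inv_entry`). It follows that the `v_i ĝ⁻¹ v_i*` are two orthogonal
idempotents of trace `k`, and `P̃` is an idempotent of trace `2k + 2 - 2k = 2`. On twistor space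
`σ_z` and `σ_{J(z)}` are quaternionic combinations of `v₁` and `v₂` (`zc_relations`). This gives
`Ṽ*Ṽ` and `ρ² = r g`, and it collapses `Ṽ ρ⁻² Ṽ*` to `∑ v_i (r ρ⁻²) v_i*` (`twistor_sandwich`),
which is the image of a matrix over `ℝ⁴`.

The differential extends to the localisation because a skew derivation is the same as an algebra map
into triangular matrices, to which the universal property of the adjoined inverse applies. Since `P̃
v_i = 0` and `v_i* P̃ = 0`, the curvature is `∑ P̃ dv_i ĝ⁻¹ dv_i* P̃` (`curvature_eq`). The entries
of `P̃` and `ĝ⁻¹` commute with those of `dv_i` and `dv_i*` and may be moved to the left. What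
remains, `∑ dv_i dv_i*`, is classically a combination of three constant anti-self-dual forms, each
homogeneous for the coaction, so that bosonisation alters only its coefficient (`locOm_mem`).

For reality, a Hopf `*`-structure with `conj F(g*,h*) = F(h,g)` turns `A_F`, the smash product and
`(A_F ⋊ H) ⊗ C_F` into `*`-algebras and `bos` into a `*`-map (`big_bos`), so adjoints too are
computed classically. The condition on `F` holds for the torus because `Θ` is antisymmetric, and for
Moyal when `iħα` and `iħβ` are real. -/

@[ext] lemma ext {F G : Bichar H} (h : F.left = G.left) : F = G := by
  have h2 : F.right = G.right := by
    apply AlgHom.ext; intro g; apply WithConv.ofConv_injective; ext x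
    rw [← F.left_eq_right, ← G.left_eq_right, h]
  cases F; cases G; cases h; cases h2; rfl

/-- The trivial bicharacter `ε ⊗ ε`. -/
def triv (H : Type) [CommRing H] [HopfAlgebra ℂ H] [Coalgebra.IsCocomm ℂ H] : Bichar H where
  left := (Algebra.ofId ℂ _).comp (Bialgebra.counitAlgHom ℂ H)
  right := (Algebra.ofId ℂ _).comp (Bialgebra.counitAlgHom ℂ H)
  left_eq_right h g := by simp [Algebra.ofId_apply, Algebra.algebraMap_eq_smul_one, mul_comm]

lemma triv_left (h : H) : (triv H).left h = Coalgebra.counit (R := ℂ) h • 1 := by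
  simp [triv, Algebra.ofId_apply, Algebra.algebraMap_eq_smul_one]

lemma triv_right (h : H) : (triv H).right h = Coalgebra.counit (R := ℂ) h • 1 := by
  simp [triv, Algebra.ofId_apply, Algebra.algebraMap_eq_smul_one]

/-- Algebra maps from a cocommutative Hopf algebra to a commutative algebra form an abelian group
under convolution. The target here, the dual of `H`, is commutative because `H` is cocommutative. -/
lemma conv_comm (F G : Bichar H) : F.conv G = G.conv F := by
  ext1
  exact congrArg WithConv.ofConv (mul_comm (WithConv.toConv F.left) (WithConv.toConv G.left))

lemma conv_assoc (F G K : Bichar H) : (F.conv G).conv K = F.conv (G.conv K) := by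
  ext1
  exact congrArg WithConv.ofConv
    (mul_assoc (WithConv.toConv F.left) (WithConv.toConv G.left) (WithConv.toConv K.left))

/-- Composition with the algebra map `F.left` respects convolution, so the antipode axiom `S * id =
η ε` is carried over to bicharacters. -/
lemma conv_inv (F : Bichar H) : F.conv F.inv = triv H := by
  ext1
  have h1 := AlgHom.comp_convMul_distrib F.left
    (WithConv.toConv (HopfAlgebra.antipodeAlgHom ℂ H)) (WithConv.toConv (AlgHom.id ℂ H))
  rw [AlgHom.antipode_id_cancel] at h1
  rw [conv_comm]
  refine h1.symm.trans ?_
  ext1 h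
  change F.left (algebraMap ℂ H _) = _
  rw [AlgHom.commutes]
  rfl

lemma conv_triv (F : Bichar H) : F.conv (triv H) = F := by
  ext1
  exact congrArg WithConv.ofConv (mul_one (WithConv.toConv F.left))

lemma conv_right (F G : Bichar H) (h : H) : (F.conv G).right h =
    ∑ i ∈ (ℛ ℂ h).index, F.right ((ℛ ℂ h).left i) * G.right ((ℛ ℂ h).right i) := by
  change (WithConv.toConv F.right * WithConv.toConv G.right).ofConv h = _
  rw [AlgHom.convMul_apply]
  conv_lhs => rw [← (ℛ ℂ h).eq]
  simp
end Bichar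

/-! ### The normally ordered product and the bosonisation map -/

namespace Coaction
variable {A C : Type} [CommRing A] [Algebra ℂ A] [Ring C] [Algebra ℂ C] (δ : Coaction H A)
  (ε : Coaction H C)

/-- The action of the functionals on a comodule. -/
def lactHom {A : Type} [Ring A] [Algebra ℂ A] (δ : Coaction H A) :
    WithConv (H →ₗ[ℂ] ℂ) →ₗ[ℂ] A →ₗ[ℂ] A where
  toFun := δ.lact
  map_add' := by intros; ext; simp [lact_apply, LinearMap.rTensor_add]
  map_smul' := by intros; ext; simp [lact_apply, LinearMap.rTensor_smul]

lemma lactHom_apply {A : Type} [Ring A] [Algebra ℂ A] (δ : Coaction H A)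
    (φ : WithConv (H →ₗ[ℂ] ℂ)) : δ.lactHom φ = δ.lact φ := rfl

/-- `h ↦ G(a₋₁,h) a₀`. -/
def lactR (G : Bichar H) (a : A) : H →ₗ[ℂ] A where
  toFun h := δ.lact (G.right h) a
  map_add' := by intros; simp [← lactHom_apply]
  map_smul' := by intros; simp [← lactHom_apply]

lemma lactR_apply (G : Bichar H) (a : A) (h : H) : δ.lactR G a h = δ.lact (G.right h) a := rfl

/-- `a ⊗ h ↦ G(a₋₁,h) a₀`. -/
def pairAct (G : Bichar H) : A ⊗[ℂ] H →ₗ[ℂ] A :=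
  TensorProduct.lift (LinearMap.mk₂ ℂ (fun a h => δ.lact (G.right h) a)
    (by intros; simp)
    (by intros; simp)
    (by intros; simp [Coaction.lact_apply, LinearMap.rTensor_add])
    (by intros; simp [Coaction.lact_apply, LinearMap.rTensor_smul]))

/-- `a ⊗ c ↦ G(a₋₁,c₋₁) a₀ ⊗ c₀`. -/
def ord (G : Bichar H) : A ⊗[ℂ] C →ₗ[ℂ] A ⊗[ℂ] C :=
  (δ.pairAct G).rTensor C ∘ₗ (TensorProduct.assoc ℂ A H C).symm.toLinearMap ∘ₗ
    ε.coact.toLinearMap.lTensor A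

lemma ord_tmul (G : Bichar H) (a : A) (c : C) :
    ord δ ε G (a ⊗ₜ c) = (δ.lactR G a).rTensor C (ε.coact c) := by
  simp only [ord, LinearMap.comp_apply, LinearMap.lTensor_tmul, AlgHom.toLinearMap_apply]
  generalize ε.coact c = t
  induction t with
  | zero => simp
  | add x y hx hy => simp only [map_add, TensorProduct.tmul_add, hx, hy]
  | tmul h c => rfl

/-- Coassociativity of `ε` replaces the two successive coactions on `c` by a comultiplication of its
`H`-leg, and `lact_mul` turns the convolution product of functionals into a composition of actions
on `a`. -/
lemma ord_ord (G G' : Bichar H) (t : A ⊗[ℂ] C) :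
    ord δ ε G (ord δ ε G' t) = ord δ ε (G'.conv G) t := by
  induction t with
  | zero => simp
  | add x y hx hy => simp only [map_add, hx, hy]
  | tmul a c =>
    -- In `B` the bicharacter `G'` pairs with the first leg and `G` with the second; `E` does this
    -- on `H ⊗ (H ⊗ C)`, where the two sides of coassociativity can be compared.
    let B : H →ₗ[ℂ] H →ₗ[ℂ] A := LinearMap.mk₂ ℂ (fun x y => δ.lactR G (δ.lactR G' a x) y)
      (by intros; simp only [map_add]; rw [lactR_apply, map_add]; rfl)
      (by intros; simp only [map_smul]; rw [lactR_apply, map_smul]; rfl)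
      (by intros; simp) (by intros; simp)
    let E : H ⊗[ℂ] (H ⊗[ℂ] C) →ₗ[ℂ] A ⊗[ℂ] C :=
      (TensorProduct.lift B).rTensor C ∘ₗ (TensorProduct.assoc ℂ H H C).symm.toLinearMap
    have hE : ∀ x y c, E (x ⊗ₜ (y ⊗ₜ c)) = δ.lactR G (δ.lactR G' a x) y ⊗ₜ c := fun _ _ _ => rfl
    have h1 : ∀ t : H ⊗[ℂ] C, ord δ ε G ((δ.lactR G' a).rTensor C t) =
        E (ε.coact.toLinearMap.lTensor H t) := by
      intro t
      induction t with
      | zero => simp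
      | add x y hx hy => simp only [map_add, hx, hy]
      | tmul h c =>
        simp only [LinearMap.rTensor_tmul, ord_tmul, LinearMap.lTensor_tmul,
          AlgHom.toLinearMap_apply]
        generalize ε.coact c = u
        induction u with
        | zero => simp
        | add x y hx hy => simp only [map_add, TensorProduct.tmul_add, hx, hy]
        | tmul y c => simp [hE]
    have h2 : ∀ t : H ⊗[ℂ] C, (δ.lactR (G'.conv G) a).rTensor C t =
        E (TensorProduct.assoc ℂ H H C ((Coalgebra.comul (R := ℂ)).rTensor C t)) := by
      intro t
      induction t with
      | zero => simp
      | add x y hx hy => simp only [map_add, hx, hy]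
      | tmul h c =>
        simp only [LinearMap.rTensor_tmul]
        conv_rhs => rw [← (ℛ ℂ h).eq]
        have h3 : δ.lactR (G'.conv G) a h = ∑ i ∈ (ℛ ℂ h).index,
            δ.lactR G (δ.lactR G' a ((ℛ ℂ h).left i)) ((ℛ ℂ h).right i) := by
          rw [lactR_apply, Bichar.conv_right, ← lactHom_apply, map_sum, LinearMap.sum_apply]
          simp only [lactR_apply, ← LinearMap.comp_apply, ← lact_mul]
          rfl
        simp only [h3, TensorProduct.sum_tmul, map_sum, TensorProduct.assoc_tmul, hE]
    rw [ord_tmul, h1, ord_tmul, h2, ε.coassoc_apply]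

lemma ord_triv (t : A ⊗[ℂ] C) : ord δ ε (Bichar.triv H) t = t := by
  induction t with
  | zero => simp
  | add x y hx hy => simp only [map_add, hx, hy]
  | tmul a c =>
    have h1 : ∀ t : H ⊗[ℂ] C, (δ.lactR (Bichar.triv H) a).rTensor C t =
        a ⊗ₜ TensorProduct.lid ℂ C ((Coalgebra.counit (R := ℂ)).rTensor C t) := by
      intro t
      induction t with
      | zero => simp
      | add x y hx hy => simp only [map_add, TensorProduct.tmul_add, hx, hy]
      | tmul h c =>
        have : δ.lact (Coalgebra.counit (R := ℂ) h • 1) a = Coalgebra.counit (R := ℂ) h • a := by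
          have := DFunLike.congr_fun δ.lact_one a
          simp only [lact_apply] at this ⊢
          simp [LinearMap.rTensor_smul, this]
        simp [lactR_apply, Bichar.triv_right, this, TensorProduct.smul_tmul]
    rw [ord_tmul, h1]
    exact congrArg _ (DFunLike.congr_fun ε.counit c)

/-- With `ord_ord_inv`, this makes `ord F` bijective, so every element of `A ⊗ C` has a normally
ordered form. -/
lemma ord_inv_ord (F : Bichar H) (t : A ⊗[ℂ] C) : ord δ ε F.inv (ord δ ε F t) = t := by
  rw [ord_ord, Bichar.conv_inv, ord_triv]

lemma ord_ord_inv (F : Bichar H) (t : A ⊗[ℂ] C) : ord δ ε F (ord δ ε F.inv t) = t := by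
  rw [ord_ord, Bichar.conv_comm, Bichar.conv_inv, ord_triv]

/-- As `R` is the convolution of the flip of `F` with `F⁻¹`, the factors `F` and `F⁻¹` cancel. This
will show that `R` governs the exchange of `a` and `c` in the twisted tensor product. -/
lemma ord_ord_R (F : Bichar H) (t : A ⊗[ℂ] C) :
    ord δ ε F (ord δ ε F.R t) = ord δ ε F.flip t := by
  rw [ord_ord, Bichar.R, Bichar.conv_assoc, F.inv.conv_comm, Bichar.conv_inv, Bichar.conv_triv]

lemma tensor_coact_left (a : A) : (δ.tensor ε).coact (a ⊗ₜ 1) =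
    (Algebra.TensorProduct.includeLeft : A →ₐ[ℂ] A ⊗[ℂ] C).toLinearMap.lTensor H (δ.coact a) :=
  DFunLike.congr_fun (tensorMap_left δ ε) a

lemma tensor_coact_right (c : C) : (δ.tensor ε).coact (1 ⊗ₜ c) =
    (Algebra.TensorProduct.includeRight : C →ₐ[ℂ] A ⊗[ℂ] C).toLinearMap.lTensor H (ε.coact c) :=
  DFunLike.congr_fun (tensorMap_right δ ε) c

/-- The operator `ord F` is thus the passage from a formal ordered word `a c` to its value in the
twisted tensor product. -/
lemma twMul_tensor_left_right (F : Bichar H) (a : A) (c : C) :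
    (δ.tensor ε).twMul F (a ⊗ₜ 1) (1 ⊗ₜ c) = ord δ ε F (a ⊗ₜ c) := by
  rw [twMul_apply, tensor_coact_left, ord_tmul]
  simp only [lactR, lact_apply]
  -- Both coactions are replaced by arbitrary tensors `s`, `t`, so that one can argue on pure
  -- tensors; `L` and `c'`, which depend on `s` and `t`, enter only through their characterising
  -- equations.
  have : ∀ (s : H ⊗[ℂ] A) (t : H ⊗[ℂ] C) (L : H →ₗ[ℂ] A) (_ : ∀ h, L h =
      TensorProduct.lid ℂ A ((F.right h).ofConv.rTensor A s)) (c' : A ⊗[ℂ] C)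
      (_ : (δ.tensor ε).coact c' = (Algebra.TensorProduct.includeRight :
        C →ₐ[ℂ] A ⊗[ℂ] C).toLinearMap.lTensor H t),
      (δ.tensor ε).opT F ((Algebra.TensorProduct.includeLeft :
        A →ₐ[ℂ] A ⊗[ℂ] C).toLinearMap.lTensor H s) c' = L.rTensor C t := by
    intro s
    induction s with
    | zero =>
      intro t L hL c' hc
      have : L = 0 := by ext; simp [hL]
      simp [this]
    | add x y hx hy =>
      intro t L hL c' hc
      let M : (H ⊗[ℂ] A) → H →ₗ[ℂ] A := fun s =>
        { toFun := fun h => TensorProduct.lid ℂ A ((F.right h).ofConv.rTensor A s)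
          map_add' := by intros; simp [LinearMap.rTensor_add]
          map_smul' := by intros; simp [LinearMap.rTensor_smul] }
      have : L = M x + M y := by ext h; simp [hL, M]
      rw [map_add, map_add, LinearMap.add_apply, hx t (M x) (fun _ => rfl) c' hc,
        hy t (M y) (fun _ => rfl) c' hc, this, LinearMap.rTensor_add, LinearMap.add_apply]
    | tmul h a =>
      intro t L hL c' hc
      rw [LinearMap.lTensor_tmul, opT_tmul, lact_apply, hc]
      clear hc
      induction t with
      | zero => simp
      | add x y hx hy => simp only [map_add, mul_add, hx, hy]
      | tmul g c => simp [hL, F.left_eq_right, TensorProduct.smul_tmul']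
  exact this (δ.coact a) (ε.coact c) _ (fun _ => rfl) _ (tensor_coact_right δ ε c)

/-- Here the leg of `c` occupies the first slot of `F`, which is why the flip appears. -/
lemma twMul_tensor_right_left (F : Bichar H) (a : A) (c : C) :
    (δ.tensor ε).twMul F (1 ⊗ₜ c) (a ⊗ₜ 1) = ord δ ε F.flip (a ⊗ₜ c) := by
  rw [twMul_apply, tensor_coact_right, ord_tmul]
  have h0 : ∀ φ, (δ.tensor ε).lact φ (a ⊗ₜ 1) = δ.lact φ a ⊗ₜ 1 := by
    intro φ
    rw [lact_apply, tensor_coact_left, lact_apply]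
    generalize δ.coact a = s
    induction s with
    | zero => simp
    | add x y hx hy => simp only [map_add, TensorProduct.add_tmul, hx, hy]
    | tmul h a => simp [TensorProduct.smul_tmul']
  generalize ε.coact c = t
  induction t with
  | zero => simp
  | add x y hx hy => simp only [map_add, LinearMap.add_apply, hx, hy]
  | tmul h c =>
    rw [LinearMap.lTensor_tmul, opT_tmul, h0]
    simp [lactR_apply, Bichar.flip]

end Coaction

/-! ### The smash product as generated by its two factors -/

namespace Smash
variable {A : Type} [Ring A] [Algebra ℂ A] (F : Bichar H) (δ : Coaction H A)

/-- The inclusion of `A_F` into the smash product. -/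
def inA : Tw F δ →ₐ[ℂ] Smash F δ :=
  AlgHom.ofLinearMap ((mk F δ).toLinearMap ∘ₗ (TensorProduct.mk ℂ (Tw F δ) H).flip 1)
    (by simp [one_def])
    (by
      intro x y
      simp only [LinearMap.comp_apply, LinearMap.flip_apply, TensorProduct.mk_apply, mul_def,
        LinearEquiv.coe_coe, LinearEquiv.symm_apply_apply, mulS_tmul, map_one, mul_one]
      rfl)

/-- The inclusion of `H` into the smash product. -/
def inH : H →ₐ[ℂ] Smash F δ :=
  AlgHom.ofLinearMap ((mk F δ).toLinearMap ∘ₗ TensorProduct.mk ℂ (Tw F δ) H 1)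
    (by simp [one_def])
    (by
      intro x y
      simp only [LinearMap.comp_apply, TensorProduct.mk_apply, mul_def,
        LinearEquiv.coe_coe, LinearEquiv.symm_apply_apply, mulS_tmul, Module.End.mul_apply,
        opH_apply, Tw.act_one, TensorProduct.smul_tmul, ← TensorProduct.tmul_sum]
      simp only [← smul_mul_assoc, ← Finset.sum_mul, Coalgebra.sum_counit_smul]
      simp [opL])

lemma inA_mul_inH (a : Tw F δ) (h : H) : inA F δ a * inH F δ h = mk F δ (a ⊗ₜ h) := by
  change mk F δ (mulS F δ (a ⊗ₜ 1) (1 ⊗ₜ h)) = _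
  rw [mulS_tmul, map_one, mul_one]
  simp [opL]

lemma inH_mul_inA (a : Tw F δ) (h : H) : inH F δ h * inA F δ a = ∑ i ∈ (ℛ ℂ h).index,
    mk F δ (Tw.act F δ ((ℛ ℂ h).left i) a ⊗ₜ (ℛ ℂ h).right i) := by
  change mk F δ (mulS F δ (1 ⊗ₜ h) (a ⊗ₜ 1)) = _
  rw [mulS_tmul, Module.End.mul_apply, opH_apply]
  simp [opL]

lemma induction_mul {p : Smash F δ → Prop} (h0 : p 0) (hadd : ∀ x y, p x → p y → p (x + y))
    (hmul : ∀ a h, p (inA F δ a * inH F δ h)) (x : Smash F δ) : p x := by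
  change Tw F δ ⊗[ℂ] H at x
  induction x with
  | zero => exact h0
  | add x y hx hy => exact hadd x y hx hy
  | tmul a h =>
    have := hmul a h
    rw [inA_mul_inH] at this
    exact this

end Smash

/-! ### The coaction on a twisted algebra -/

namespace Tw
variable {C : Type} [Ring C] [Algebra ℂ C] (F : Bichar H) (ε : Coaction H C)

lemma mk_mul (a b : C) : mk F ε a * mk F ε b = mk F ε (ε.twMul F a b) := rfl

/-- The coaction as a linear map `C → H ⊗ C_F`. -/
def coactLin : Tw F ε →ₗ[ℂ] H ⊗[ℂ] Tw F ε :=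
  (mk F ε).toLinearMap.lTensor H ∘ₗ ε.coact.toLinearMap ∘ₗ (mk F ε).symm.toLinearMap

/-- Twisting does not spoil the multiplicativity of the coaction. The factor `F(a₋₁,b₋₁)` is
evaluated on outer legs on one side and on inner legs on the other, and cocommutativity identifies
the two. -/
lemma coact_twMul (a b : C) : coactLin F ε (mk F ε (ε.twMul F a b)) =
    coactLin F ε (mk F ε a) * coactLin F ε (mk F ε b) := by
  obtain ⟨S, hS⟩ := TensorProduct.exists_finset (ε.coact b)
  have hb : coactLin F ε (mk F ε b) = ∑ p ∈ S, p.1 ⊗ₜ mk F ε p.2 := by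
    simp [coactLin, hS]
  let L : C → H →ₗ[ℂ] C := fun x =>
    { toFun := fun h => ε.lact (F.left h) x
      map_add' := by intros; simp [← Coaction.lactHom_apply]
      map_smul' := by intros; simp [← Coaction.lactHom_apply] }
  let E : H ⊗[ℂ] (H ⊗[ℂ] C) →ₗ[ℂ] H ⊗[ℂ] Tw F ε := ∑ p ∈ S,
    TensorProduct.map (LinearMap.mulRight ℂ p.1) ((mk F ε).toLinearMap ∘ₗ LinearMap.mul' ℂ C ∘ₗ
      (TensorProduct.comm ℂ C C).toLinearMap) ∘ₗ
      (TensorProduct.assoc ℂ H C C).toLinearMap ∘ₗ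
      (TensorProduct.map ((TensorProduct.comm ℂ C H).toLinearMap ∘ₗ (L p.2).rTensor H)
        LinearMap.id) ∘ₗ (TensorProduct.assoc ℂ H H C).symm.toLinearMap
  have hE : ∀ x y c, E (x ⊗ₜ (y ⊗ₜ c)) =
      ∑ p ∈ S, (y * p.1) ⊗ₜ mk F ε (c * ε.lact (F.left x) p.2) := by
    intro x y c
    simp [E, L]
    rfl
  have h1 : ∀ t : H ⊗[ℂ] C, coactLin F ε (mk F ε (ε.opT F t b)) =
      E (ε.coact.toLinearMap.lTensor H t) := by
    intro t
    induction t with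
    | zero => simp
    | add x y hx hy => simp only [map_add, LinearMap.add_apply, hx, hy]
    | tmul h c =>
      simp only [coactLin, LinearMap.comp_apply, LinearEquiv.coe_coe,
        LinearEquiv.symm_apply_apply, Coaction.opT_tmul, AlgHom.toLinearMap_apply, map_mul,
        Coaction.coact_lact, hS, map_sum, LinearMap.lTensor_tmul]
      generalize ε.coact c = u
      induction u with
      | zero => simp
      | add x y hx hy =>
        simp only [map_add, add_mul, hx, hy, TensorProduct.tmul_add]
      | tmul y c => simp [hE, Finset.mul_sum]
  have h2 : ∀ t : H ⊗[ℂ] C, (mk F ε).toLinearMap.lTensor H t * coactLin F ε (mk F ε b) =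
      E (TensorProduct.assoc ℂ H H C ((TensorProduct.comm ℂ H H).toLinearMap.rTensor C
        ((TensorProduct.assoc ℂ H H C).symm (ε.coact.toLinearMap.lTensor H t)))) := by
    intro t
    induction t with
    | zero => simp
    | add x y hx hy => simp only [map_add, add_mul, hx, hy]
    | tmul h c =>
      simp only [LinearMap.lTensor_tmul, hb, Finset.mul_sum, Algebra.TensorProduct.tmul_mul_tmul,
        LinearEquiv.coe_coe, mk_mul, Coaction.twMul_apply, AlgHom.toLinearMap_apply]
      generalize ε.coact c = u
      induction u with
      | zero => simp
      | add x y hx hy =>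
        simp only [map_add, LinearMap.add_apply, TensorProduct.tmul_add, Finset.sum_add_distrib,
          hx, hy]
      | tmul y c => simp [hE, Coaction.opT_tmul]
  -- Cocommutativity removes the swap of the two `H`-legs by which `h1` and `h2` differ.
  have h3 : ∀ t : H ⊗[ℂ] C, (TensorProduct.comm ℂ H H).toLinearMap.rTensor C
      ((Coalgebra.comul (R := ℂ)).rTensor C t) = (Coalgebra.comul (R := ℂ)).rTensor C t := by
    intro t
    induction t with
    | zero => simp
    | add x y hx hy => simp only [map_add, hx, hy]
    | tmul h c =>
      simp only [LinearMap.rTensor_tmul, LinearEquiv.coe_coe]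
      rw [Coalgebra.comm_comul]
  rw [Coaction.twMul_apply, h1]
  refine Eq.trans ?_ (h2 (ε.coact a)).symm
  rw [← ε.coassoc_apply, LinearEquiv.symm_apply_apply, h3]

/-- The coaction `C_F → H ⊗ C_F`. -/
def coact : Tw F ε →ₐ[ℂ] H ⊗[ℂ] Tw F ε :=
  AlgHom.ofLinearMap (coactLin F ε)
    (by simp [coactLin, one_def, Algebra.TensorProduct.one_def])
    (fun x y => coact_twMul F ε ((mk F ε).symm x) ((mk F ε).symm y))

end Tw

/-! ### Bosonisation as an algebra map on the twisted tensor product -/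

section
variable {A C : Type} [CommRing A] [Algebra ℂ A] [Ring C] [Algebra ℂ C] (F : Bichar H)
    (δ : Coaction H A) (ε : Coaction H C)

/-- The algebra map `C_F → (A_F ⋊ H) ⊗ C_F`, `c ↦ 1 ⊗ c₋₁ ⊗ c₀`. -/
def bosC : Tw F ε →ₐ[ℂ] Big F δ ε :=
  (Algebra.TensorProduct.map (Smash.inH F δ) (AlgHom.id ℂ (Tw F ε))).comp (Tw.coact F ε)

/-- The algebra map `A_F → (A_F ⋊ H) ⊗ C_F`. -/
def bosA : Tw F δ →ₐ[ℂ] Big F δ ε :=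
  (Algebra.TensorProduct.includeLeft : Smash F δ →ₐ[ℂ] Big F δ ε).comp (Smash.inA F δ)

lemma mu_tmul_aux (a : A) (t : H ⊗[ℂ] C) :
    TensorProduct.map ((Smash.mk F δ).toLinearMap ∘ₗ (Tw.mk F δ).toLinearMap.rTensor H)
      (Tw.mk F ε).toLinearMap ((TensorProduct.assoc ℂ A H C).symm (a ⊗ₜ t)) =
    bosA F δ ε (Tw.mk F δ a) * Algebra.TensorProduct.map (Smash.inH F δ)
      (AlgHom.id ℂ (Tw F ε)) ((Tw.mk F ε).toLinearMap.lTensor H t) := by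
  induction t with
  | zero => simp
  | add x y hx hy => simp only [map_add, TensorProduct.tmul_add, hx, hy, mul_add]
  | tmul h c => simp [bosA, Smash.inA_mul_inH]

/-- Writing `μ` as a product of two algebra maps leaves only the exchange of the two factors to be
understood. -/
lemma mu_tmul (a : A) (c : C) :
    mu F δ ε (a ⊗ₜ c) = bosA F δ ε (Tw.mk F δ a) * bosC F δ ε (Tw.mk F ε c) :=
  mu_tmul_aux F δ ε a (ε.coact c)

/-- In the smash product `h a = (h₁ ▷ a) h₂`, and `▷` is defined by `R`. By coassociativity the leg
`h₁` of `c₋₁` produces the factor `R`, while `h₂` stays as the leg that `μ` inserts. -/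
lemma bosC_mul_bosA (a : A) (c : C) :
    bosC F δ ε (Tw.mk F ε c) * bosA F δ ε (Tw.mk F δ a) =
      mu F δ ε (Coaction.ord δ ε F.R (a ⊗ₜ c)) := by
  let B : H →ₗ[ℂ] Tw F δ :=
    { toFun := fun h => Tw.act F δ h (Tw.mk F δ a)
      map_add' := by simp
      map_smul' := by simp }
  let E : H ⊗[ℂ] (H ⊗[ℂ] C) →ₗ[ℂ] Big F δ ε :=
    TensorProduct.map ((Smash.mk F δ).toLinearMap ∘ₗ B.rTensor H) (Tw.mk F ε).toLinearMap ∘ₗ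
      (TensorProduct.assoc ℂ H H C).symm.toLinearMap
  have h1 : ∀ t : H ⊗[ℂ] C, Algebra.TensorProduct.map (Smash.inH F δ)
      (AlgHom.id ℂ (Tw F ε)) ((Tw.mk F ε).toLinearMap.lTensor H t) * bosA F δ ε (Tw.mk F δ a) =
      E (TensorProduct.assoc ℂ H H C ((Coalgebra.comul (R := ℂ)).rTensor C t)) := by
    intro t
    induction t with
    | zero => simp
    | add x y hx hy => simp only [map_add, add_mul, hx, hy]
    | tmul h c =>
      simp only [LinearMap.lTensor_tmul, Algebra.TensorProduct.map_tmul, bosA, AlgHom.comp_apply,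
        Algebra.TensorProduct.includeLeft_apply, Algebra.TensorProduct.tmul_mul_tmul, mul_one,
        Smash.inH_mul_inA, LinearMap.rTensor_tmul]
      conv_rhs => rw [← (ℛ ℂ h).eq]
      simp [TensorProduct.sum_tmul, E, B]
  have h2 : ∀ t : H ⊗[ℂ] C, mu F δ ε ((δ.lactR F.R a).rTensor C t) =
      E (ε.coact.toLinearMap.lTensor H t) := by
    intro t
    induction t with
    | zero => simp
    | add x y hx hy => simp only [map_add, hx, hy]
    | tmul h c =>
      simp only [mu, LinearMap.comp_apply, LinearMap.lTensor_tmul, LinearMap.rTensor_tmul,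
        AlgHom.toLinearMap_apply]
      generalize ε.coact c = u
      induction u with
      | zero => simp
      | add x y hx hy => simp only [map_add, TensorProduct.tmul_add, hx, hy]
      | tmul y c => rfl
  rw [Coaction.ord_tmul, h2, ← ε.coassoc_apply, ← h1]
  rfl

/-- The map `A_F → (A ⊗ C)_F`. -/
def twA : Tw F δ →ₐ[ℂ] Tw F (δ.tensor ε) :=
  Tw.map F δ _ Algebra.TensorProduct.includeLeft (Coaction.tensor_coact_left δ ε)

/-- The map `C_F → (A ⊗ C)_F`. -/
def twC : Tw F ε →ₐ[ℂ] Tw F (δ.tensor ε) :=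
  Tw.map F ε _ Algebra.TensorProduct.includeRight (Coaction.tensor_coact_right δ ε)

lemma twA_mul_twC (a : A) (c : C) : twA F δ ε (Tw.mk F δ a) * twC F δ ε (Tw.mk F ε c) =
    Tw.mk F _ (Coaction.ord δ ε F (a ⊗ₜ c)) :=
  congrArg (Tw.mk F _) (Coaction.twMul_tensor_left_right δ ε F a c)

/-- The counterpart of `bosC_mul_bosA` in the twisted tensor product: the exchange of `c` and `a` is
again governed by `R`. -/
lemma twC_mul_twA (a : A) (c : C) : twC F δ ε (Tw.mk F ε c) * twA F δ ε (Tw.mk F δ a) =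
    Tw.mk F _ (Coaction.ord δ ε F (Coaction.ord δ ε F.R (a ⊗ₜ c))) := by
  rw [Coaction.ord_ord_R]
  exact congrArg (Tw.mk F _) (Coaction.twMul_tensor_right_left δ ε F a c)

/-- The linear map `(A ⊗ C)_F → (A_F ⋊ H) ⊗ C_F` underlying `bos`. -/
def bosLin : Tw F (δ.tensor ε) →ₗ[ℂ] Big F δ ε :=
  mu F δ ε ∘ₗ Coaction.ord δ ε F.inv ∘ₗ (Tw.mk F (δ.tensor ε)).symm.toLinearMap

lemma bosLin_ord (t : A ⊗[ℂ] C) :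
    bosLin F δ ε (Tw.mk F _ (Coaction.ord δ ε F t)) = mu F δ ε t := by
  simp [bosLin, Coaction.ord_inv_ord]

/-- Multiplying a normally ordered element by `A_F` on the left and by `C_F` on the right keeps it
normally ordered, so no exchange is needed. -/
lemma bosLin_mul_aux (a : A) (u : A ⊗[ℂ] C) (c : C) :
    bosLin F δ ε (twA F δ ε (Tw.mk F δ a) * Tw.mk F _ (Coaction.ord δ ε F u) *
      twC F δ ε (Tw.mk F ε c)) =
    bosA F δ ε (Tw.mk F δ a) * mu F δ ε u * bosC F δ ε (Tw.mk F ε c) := by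
  induction u with
  | zero => simp
  | add x y hx hy => simp only [map_add, mul_add, add_mul, hx, hy]
  | tmul b d =>
    rw [← twA_mul_twC, ← mul_assoc, mul_assoc, ← map_mul (twA F δ ε),
      ← map_mul (twC F δ ε), Tw.mk_mul, Tw.mk_mul,
      twA_mul_twC, bosLin_ord, mu_tmul, mu_tmul, ← Tw.mk_mul, ← Tw.mk_mul, map_mul, map_mul]
    simp only [mul_assoc]

/-- Put both factors in normally ordered form. In `(a c)(b d)` only the middle product `c b` is out
of order, and it is reordered by `R` in source and target alike; the outer factors are handled by
`bosLin_mul_aux`. -/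
lemma bosLin_mul (x y : Tw F (δ.tensor ε)) :
    bosLin F δ ε (x * y) = bosLin F δ ε x * bosLin F δ ε y := by
  obtain ⟨s, rfl⟩ : ∃ s, Tw.mk F _ (Coaction.ord δ ε F s) = x :=
    ⟨Coaction.ord δ ε F.inv ((Tw.mk F _).symm x), by rw [Coaction.ord_ord_inv]; simp⟩
  obtain ⟨t, rfl⟩ : ∃ s, Tw.mk F _ (Coaction.ord δ ε F s) = y :=
    ⟨Coaction.ord δ ε F.inv ((Tw.mk F _).symm y), by rw [Coaction.ord_ord_inv]; simp⟩
  induction s with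
  | zero => simp
  | add x y hx hy => simp only [map_add, add_mul, hx, hy]
  | tmul a c =>
    induction t with
    | zero => simp
    | add x y hx hy => simp only [map_add, mul_add, hx, hy]
    | tmul b d =>
      rw [bosLin_ord, bosLin_ord, mu_tmul, mu_tmul, ← mul_assoc, mul_assoc _ (bosC F δ ε _),
        bosC_mul_bosA, ← bosLin_mul_aux, ← twA_mul_twC, ← twA_mul_twC, ← twC_mul_twA]
      simp only [mul_assoc]

/-- The bosonisation map as an algebra map from the twisted tensor product. -/
def bos : Tw F (δ.tensor ε) →ₐ[ℂ] Big F δ ε :=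
  AlgHom.ofLinearMap (bosLin F δ ε)
    (by
      have := bosLin_ord F δ ε 1
      rw [show Coaction.ord δ ε F (1 : A ⊗[ℂ] C) = 1 by
        rw [Algebra.TensorProduct.one_def, Coaction.ord_tmul, map_one]
        simp [Coaction.lactR_apply, Coaction.lact_one, Algebra.TensorProduct.one_def]] at this
      rw [Tw.one_def, this, Algebra.TensorProduct.one_def, mu_tmul, ← Tw.one_def, ← Tw.one_def]
      simp)
    (bosLin_mul F δ ε)

lemma bos_mk (t : A ⊗[ℂ] C) :
    bos F δ ε (Tw.mk F _ t) = mu F δ ε (normalOrder F δ ε t) := rfl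

lemma bos_ord (t : A ⊗[ℂ] C) :
    bos F δ ε (Tw.mk F _ (Coaction.ord δ ε F t)) = mu F δ ε t := bosLin_ord F δ ε t

lemma bos_twC (c : Tw F ε) : bos F δ ε (twC F δ ε c) = bosC F δ ε c := by
  have := twA_mul_twC F δ ε 1 ((Tw.mk F ε).symm c)
  rw [← Tw.one_def, map_one, one_mul] at this
  rw [LinearEquiv.apply_symm_apply] at this
  rw [this, bos_ord, mu_tmul, ← Tw.one_def, map_one, one_mul]
  simp

end

/-! ### Functoriality of the bosonisation map -/

section
variable {A C C' : Type} [CommRing A] [Algebra ℂ A] [Ring C] [Algebra ℂ C] [Ring C']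
    [Algebra ℂ C'] (F : Bichar H) (δ : Coaction H A) (ε : Coaction H C) (ε' : Coaction H C')
    (f : C →ₐ[ℂ] C') (hf : ∀ a, ε'.coact (f a) = f.toLinearMap.lTensor H (ε.coact a))

/-- The map `(A_F ⋊ H) ⊗ C_F → (A_F ⋊ H) ⊗ C'_F` induced by a map of comodule algebras. -/
def bigMap : Big F δ ε →ₐ[ℂ] Big F δ ε' :=
  Algebra.TensorProduct.map (AlgHom.id ℂ _) (Tw.map F ε ε' f hf)

/-- The map `A ⊗ C → A ⊗ C'`. -/
abbrev tenMap (A : Type) [CommRing A] [Algebra ℂ A] (f : C →ₐ[ℂ] C') : A ⊗[ℂ] C →ₐ[ℂ] A ⊗[ℂ] C' :=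
  Algebra.TensorProduct.map (AlgHom.id ℂ A) f

lemma ord_tenMap (hf : ∀ a, ε'.coact (f a) = f.toLinearMap.lTensor H (ε.coact a))
    (G : Bichar H) (t : A ⊗[ℂ] C) :
    Coaction.ord δ ε' G (tenMap A f t) = tenMap A f (Coaction.ord δ ε G t) := by
  induction t with
  | zero => simp
  | add x y hx hy => simp only [map_add, hx, hy]
  | tmul a c =>
    simp only [Algebra.TensorProduct.map_tmul, AlgHom.id_apply, Coaction.ord_tmul, hf]
    generalize ε.coact c = t
    induction t with
    | zero => simp
    | add x y hx hy => simp only [map_add, hx, hy]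
    | tmul h c => simp

lemma bigMap_mu (t : A ⊗[ℂ] C) :
    bigMap F δ ε ε' f hf (mu F δ ε t) = mu F δ ε' (tenMap A f t) := by
  induction t with
  | zero => simp
  | add x y hx hy => simp only [map_add, hx, hy]
  | tmul a c =>
    simp only [Algebra.TensorProduct.map_tmul, AlgHom.id_apply, mu, LinearMap.comp_apply,
      LinearMap.lTensor_tmul, AlgHom.toLinearMap_apply, hf]
    generalize ε.coact c = t
    induction t with
    | zero => simp
    | add x y hx hy => simp only [map_add, TensorProduct.tmul_add, hx, hy]
    | tmul h c => simp [bigMap, Tw.map]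

lemma bigMap_bos (t : A ⊗[ℂ] C) : bigMap F δ ε ε' f hf (bos F δ ε (Tw.mk F _ t)) =
    bos F δ ε' (Tw.mk F _ (tenMap A f t)) := by
  rw [bos_mk, bos_mk, bigMap_mu]
  exact congrArg _ (ord_tenMap δ ε ε' f hf F.inv t).symm

lemma tensor_coact_tenMap (hf : ∀ a, ε'.coact (f a) = f.toLinearMap.lTensor H (ε.coact a))
    (t : A ⊗[ℂ] C) : (δ.tensor ε').coact (tenMap A f t) =
    (tenMap A f).toLinearMap.lTensor H ((δ.tensor ε).coact t) := by
  induction t with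
  | zero => simp
  | add x y hx hy => simp only [map_add, hx, hy]
  | tmul a c =>
    simp only [Algebra.TensorProduct.map_tmul, AlgHom.id_apply, Coaction.tensor,
      Coaction.tensorMap, AlgHom.comp_apply, hf]
    generalize ε.coact c = t
    generalize δ.coact a = s
    induction s with
    | zero => simp
    | add x y hx hy => simp only [map_add, TensorProduct.add_tmul, hx, hy]
    | tmul g a =>
      induction t with
      | zero => simp
      | add x y hx hy => simp only [map_add, TensorProduct.tmul_add, hx, hy]
      | tmul h c => simp

end

/-! ### The part of a comodule algebra on which the twist is trivial -/

/-- The elements `c` with `c₋₁ ⊗ c₀ ∈ K ⊗ C`. -/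
def kPart {C : Type} [Ring C] [Algebra ℂ C] (K : Subalgebra ℂ H) (ε : Coaction H C) :
    Subalgebra ℂ C :=
  (Algebra.TensorProduct.map K.val (AlgHom.id ℂ C)).range.comap ε.coact

/-- `F = ε ⊗ ε` on `K ⊗ K`. -/
def TrivialOn (F : Bichar H) (K : Subalgebra ℂ H) : Prop :=
  ∀ h ∈ K, ∀ g ∈ K, (F.left h).ofConv g = Coalgebra.counit (R := ℂ) h * Coalgebra.counit (R := ℂ) g

section
variable {C C' : Type} [Ring C] [Algebra ℂ C] [Ring C'] [Algebra ℂ C'] {K : Subalgebra ℂ H}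
  {ε : Coaction H C} {ε' : Coaction H C'}

lemma mem_kPart_of_weight {h : H} (hh : h ∈ K) {c : C} (hc : ε.coact c = h ⊗ₜ c) :
    c ∈ kPart K ε :=
  ⟨⟨h, hh⟩ ⊗ₜ c, by simp [hc]⟩

lemma map_mem_kPart (f : C →ₐ[ℂ] C')
    (hf : ∀ a, ε'.coact (f a) = f.toLinearMap.lTensor H (ε.coact a)) {c : C}
    (hc : c ∈ kPart K ε) : f c ∈ kPart K ε' := by
  obtain ⟨t, ht⟩ := hc
  refine ⟨Algebra.TensorProduct.map (AlgHom.id ℂ K) f t, ?_⟩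
  rw [RingHom.coe_coe] at ht ⊢
  rw [hf, show ε.coact c = _ from ht.symm]
  clear ht
  induction t with
  | zero => simp
  | add x y hx hy => simp only [map_add, hx, hy]
  | tmul h c => simp

/-- All legs of `c` lie in `K`, where `F(h,·)` is `ε(h) ε`; the counit axiom then gives back `c`. -/
lemma lact_kPart {F : Bichar H} (hF : TrivialOn F K) {h : H} (hh : h ∈ K) {c : C}
    (hc : c ∈ kPart K ε) : ε.lact (F.left h) c = Coalgebra.counit (R := ℂ) h • c := by
  obtain ⟨t, ht⟩ := hc
  have h1 := DFunLike.congr_fun ε.counit c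
  change TensorProduct.lid ℂ C ((Coalgebra.counit (R := ℂ)).rTensor C (ε.coact c)) = c at h1
  rw [RingHom.coe_coe] at ht
  rw [Coaction.lact_apply]
  conv_rhs => rw [← h1]
  rw [show ε.coact c = _ from ht.symm]
  clear ht h1
  induction t with
  | zero => simp
  | add x y hx hy => simp only [map_add, smul_add, hx, hy]
  | tmul g c => simp [hF h hh g g.2, mul_smul]

/-- The twist factor `F(b₋₁,c₋₁)` sees only `K ⊗ K`, where it is `ε ⊗ ε`. This is the reason why the
quantised identities below follow from classical ones. -/
lemma twMul_kPart {F : Bichar H} (hF : TrivialOn F K) {b c : C} (hb : b ∈ kPart K ε)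
    (hc : c ∈ kPart K ε) : ε.twMul F b c = b * c := by
  obtain ⟨t, ht⟩ := hb
  have h1 := DFunLike.congr_fun ε.counit b
  change TensorProduct.lid ℂ C ((Coalgebra.counit (R := ℂ)).rTensor C (ε.coact b)) = b at h1
  rw [RingHom.coe_coe] at ht
  rw [Coaction.twMul_apply]
  conv_rhs => rw [← h1]
  rw [show ε.coact b = _ from ht.symm]
  clear ht h1
  induction t with
  | zero => simp
  | add x y hx hy => simp only [map_add, add_mul, LinearMap.add_apply, hx, hy]
  | tmul g b => simp [Coaction.opT_tmul, lact_kPart hF g.2 hc]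

end

section
variable {A C C' : Type} [CommRing A] [Algebra ℂ A] [Ring C] [Algebra ℂ C] [Ring C']
    [Algebra ℂ C'] {F : Bichar H} {K : Subalgebra ℂ H} (hF : TrivialOn F K) (δ : Coaction H A)
    (ε : Coaction H C)

/-- The restriction of the bosonisation map to the part with trivial twist, as an algebra map from
a subalgebra of the classical algebra. -/
def phi : kPart K (δ.tensor ε) →ₐ[ℂ] Big F δ ε :=
  AlgHom.ofLinearMap ((bos F δ ε).toLinearMap ∘ₗ (Tw.mk F (δ.tensor ε)).toLinearMap ∘ₗ
      (kPart K (δ.tensor ε)).val.toLinearMap)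
    (by
      change bos F δ ε 1 = 1
      exact map_one _)
    (by
      intro x y
      change bos F δ ε (Tw.mk F _ (x.1 * y.1)) = bos F δ ε (Tw.mk F _ x.1) * bos F δ ε (Tw.mk F _ y.1)
      rw [← map_mul, Tw.mk_mul, twMul_kPart hF x.2 y.2])

lemma phi_apply (x : kPart K (δ.tensor ε)) : phi hF δ ε x = bos F δ ε (Tw.mk F _ x.1) := rfl

end

/-! ### Matrices over a ring with an adjoined inverse -/

section
variable {R : Type} [Ring R] {m n : Type} [Fintype m] [Fintype n] [DecidableEq m] [DecidableEq n]

/-- If `G` commutes with the scalar matrix of `x`, then so does its inverse. -/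
lemma commute_inv_entry {G Gi : Matrix n n R} (h1 : G * Gi = 1) (h2 : Gi * G = 1) {x : R}
    (hx : ∀ i j, Commute (G i j) x) (i j : n) : Commute (Gi i j) x := by
  have h3 : G * Matrix.diagonal (fun _ => x) = Matrix.diagonal (fun _ => x) * G := by
    ext i j
    simpa using (hx i j).eq
  have h4 : Gi * Matrix.diagonal (fun _ => x) = Matrix.diagonal (fun _ => x) * Gi := by
    calc Gi * Matrix.diagonal (fun _ => x)
        = Gi * (Matrix.diagonal (fun _ => x) * G) * Gi := by
          rw [mul_assoc, mul_assoc, h1, mul_one]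
      _ = (Gi * G) * Matrix.diagonal (fun _ => x) * Gi := by rw [← h3]; simp only [mul_assoc]
      _ = _ := by rw [h2, one_mul]
  exact (by simpa using congrFun (congrFun h4 i) j : Gi i j * x = x * Gi i j)

variable {E : Type} [Ring E] {S : Type} [FunLike S E R] [RingHomClass S E R] (φ : S)

/-- Once the entries of `Gi` are collected on the left, the rest is the image of a product formed in
`E`, where it can be manipulated classically. -/
lemma sandwich {Gi : Matrix n n R} (h : ∀ i j x, Commute (Gi i j) (φ x)) (X : Matrix m n E)
    {l : Type} (Y : Matrix n l E) (a : m) (d : l) : (X.map φ * Gi * Y.map φ) a d =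
      ∑ b, ∑ c, Gi b c * φ (X a b * Y c d) := by
  simp only [Matrix.mul_apply, Matrix.map_apply, Finset.sum_mul]
  rw [Finset.sum_comm]
  refine Finset.sum_congr rfl fun b _ => Finset.sum_congr rfl fun c _ => ?_
  rw [← (h b c _).eq, mul_assoc, ← map_mul]

/-- Cyclicity of the trace fails over a noncommutative ring. Here it holds because `Gi` can be moved
to the left and the entries of `X` and `Y` commute in `E`, which turns the trace into that of `Gi (Y
X) = 1`. -/
lemma trace_sandwich {Gi : Matrix n n R} (h : ∀ i j x, Commute (Gi i j) (φ x))
    (hE : ∀ x y : E, x * y = y * x) (X : Matrix m n E) (Y : Matrix n m E)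
    (h2 : Gi * (Y * X).map φ = 1) : (X.map φ * Gi * Y.map φ).trace = (Fintype.card n : R) := by
  rw [← Matrix.trace_one, ← h2]
  simp only [Matrix.trace, Matrix.diag, sandwich φ h]
  rw [Finset.sum_comm]
  refine Finset.sum_congr rfl fun b _ => ?_
  rw [Finset.sum_comm, Matrix.mul_apply]
  refine Finset.sum_congr rfl fun c _ => ?_
  rw [← Finset.mul_sum, ← map_sum, Matrix.map_apply, Matrix.mul_apply]
  simp only [hE (X _ _)]

/-- The relation `w_i v_j = δ_ij G` makes the summands `v_i Gi w_i` mutually orthogonal idempotents.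
-/
lemma projection_idempotent {ι : Type} [Fintype ι] [DecidableEq ι] (v : ι → Matrix m n R)
    (w : ι → Matrix n m R) {G Gi : Matrix n n R}
    (h1 : Gi * G = 1) (h : ∀ i j, w i * v j = if i = j then G else 0) :
    (1 - ∑ i, v i * Gi * w i) * (1 - ∑ i, v i * Gi * w i) = 1 - ∑ i, v i * Gi * w i := by
  have : (∑ i, v i * Gi * w i) * (∑ i, v i * Gi * w i) = ∑ i, v i * Gi * w i := by
    rw [Finset.sum_mul_sum]
    refine Finset.sum_congr rfl fun i _ => ?_
    rw [Finset.sum_eq_single i]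
    · calc _ = v i * Gi * (w i * v i) * Gi * w i := by simp only [Matrix.mul_assoc]
        _ = v i * (Gi * G) * Gi * w i := by rw [h, if_pos rfl]; simp only [Matrix.mul_assoc]
        _ = _ := by rw [h1, Matrix.mul_one]
    · intro j _ hj
      calc _ = v i * Gi * (w i * v j) * Gi * w j := by simp only [Matrix.mul_assoc]
        _ = 0 := by rw [h, if_neg hj.symm]; simp
    · simp
  rw [sub_mul, mul_sub, mul_sub, this]
  simp

end

/-! ### The classical monad -/

section
variable {A C : Type} [CommRing A] [Algebra ℂ A] [Ring C] [Algebra ℂ C] {l m n : Type}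

/-- The matrix with entries `X_{ab} ⊗ c`. -/
def tenMat (X : Matrix m n A) (c : C) : Matrix m n (A ⊗[ℂ] C) := X.map fun x => x ⊗ₜ c

lemma tenMat_apply (X : Matrix m n A) (c : C) (a : m) (b : n) : tenMat X c a b = X a b ⊗ₜ c := rfl

lemma tenMat_mul [Fintype m] (X : Matrix l m A) (Y : Matrix m n A) (c d : C) :
    tenMat X c * tenMat Y d = tenMat (X * Y) (c * d) := by
  ext a b
  simp [Matrix.mul_apply, tenMat_apply, TensorProduct.sum_tmul]

lemma tenMat_neg (X : Matrix m n A) (c : C) : tenMat (-X) c = -tenMat X c := by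
  ext a b
  simp [tenMat_apply, TensorProduct.neg_tmul]

lemma tenMat_zero (c : C) : tenMat (0 : Matrix m n A) c = 0 := by
  ext a b
  simp [tenMat_apply]

end

namespace Symm

lemma Nmat_mul_Mmat (k : ℕ) (j l : Fin 4) : Nmat k j * Mmat k l = -(Nmat k l * Mmat k j) := by
  rw [eq_neg_iff_add_eq_zero]
  ext d b
  have h : Ideal.Quotient.mk (monadIdeal k) (monadRel k j l d b) = 0 :=
    Ideal.Quotient.eq_zero_iff_mem.mpr (Ideal.subset_span ⟨j, l, d, b, rfl⟩)
  simpa [monadRel, Finset.sum_add_distrib, Matrix.mul_apply, Nmat, Mmat] using h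

lemma Nmat_mul_Mmat_self (k : ℕ) (j : Fin 4) : Nmat k j * Mmat k j = 0 := by
  ext d b
  have h := congrFun (congrFun (Nmat_mul_Mmat k j j) d) b
  rw [Matrix.neg_apply, eq_neg_iff_add_eq_zero, ← two_smul ℂ] at h
  exact (smul_eq_zero.mp h).resolve_left two_ne_zero

lemma vec_eq (k : ℕ) : vec k =
    ![tenMat (Mmat k 0) 1 + tenMat (Mmat k 2) (zeta 1) - tenMat (Mmat k 3) (zeta 2),
      tenMat (Mmat k 1) 1 + tenMat (Mmat k 2) (zeta 3) + tenMat (Mmat k 3) (zeta 0)] := rfl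

lemma vecStar_eq (k : ℕ) : vecStar k =
    ![tenMat (Mdag k 0) 1 + tenMat (Mdag k 2) (zeta 0) - tenMat (Mdag k 3) (zeta 3),
      tenMat (Mdag k 1) 1 + tenMat (Mdag k 2) (zeta 2) + tenMat (Mdag k 3) (zeta 1)] := rfl

lemma Mdag_eq (k : ℕ) : Mdag k 0 = -Nmat k 1 ∧ Mdag k 1 = Nmat k 0 ∧ Mdag k 2 = -Nmat k 3 ∧
    Mdag k 3 = Nmat k 2 := ⟨rfl, rfl, rfl, rfl⟩

/-- Let `n_i` be `v_i` with `N` for `M`. Then `v₁* = -n₂`, `v₂* = n₁`, and the monad equations give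
`n_i v_j = -n_j v_i`. So the mixed products are `∓ n_i v_i = 0`, while `v₁* v₁ = -n₂ v₁ = n₁ v₂ =
v₂* v₂`. The computation expands and brings each `N^j M^l` with `j > l` to `-N^l M^j`. -/
lemma vecStar_mul_vec (k : ℕ) (i j : Fin 2) :
    vecStar k i * vec k j = if i = j then vecStar k 0 * vec k 0 else 0 := by
  obtain ⟨h0, h1, h2, h3⟩ := Mdag_eq k
  have e10 := Nmat_mul_Mmat k 1 0
  have e20 := Nmat_mul_Mmat k 2 0
  have e30 := Nmat_mul_Mmat k 3 0
  have e21 := Nmat_mul_Mmat k 2 1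
  have e31 := Nmat_mul_Mmat k 3 1
  have e32 := Nmat_mul_Mmat k 3 2
  fin_cases i <;> fin_cases j <;>
  simp only [vec_eq, vecStar_eq, h0, h1, h2, h3, tenMat_neg, Matrix.cons_val_zero,
    Matrix.cons_val_one, Matrix.add_mul, Matrix.mul_add, Matrix.sub_mul, Matrix.mul_sub,
    Matrix.neg_mul, tenMat_mul,
    Nmat_mul_Mmat_self, tenMat_zero, e10, e20, e30, e21, e31, e32, mul_one, one_mul, Fin.zero_eta,
    Fin.mk_one, if_true, zero_ne_one, one_ne_zero, if_false, Fin.isValue,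
    mul_comm (zeta 1) (zeta 0), mul_comm (zeta 2) (zeta 0), mul_comm (zeta 3) (zeta 0),
    mul_comm (zeta 2) (zeta 1), mul_comm (zeta 3) (zeta 1), mul_comm (zeta 3) (zeta 2)] <;>
  abel

lemma coC4_coact_rr (D : Symm H) : D.coC4.coact rr = 1 ⊗ₜ rr := by
  have h : D.coC4.coact rr = ∑ a, ∑ b, (D.A 0 a * D.As 0 b + D.A 1 a * D.As 1 b) ⊗ₜ[ℂ]
      (z a * zs b) := by
    simp only [rr, z, zs, map_add, map_mul, coC4, Coaction.mat, Coaction.mv,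
      MvPolynomial.aeval_X, cond_true, cond_false, Finset.sum_mul_sum,
      Algebra.TensorProduct.tmul_mul_tmul, TensorProduct.add_tmul, Finset.sum_add_distrib]
  rw [h]
  simp only [D.unit_A, Fin.sum_univ_four]
  simp [rr, TensorProduct.tmul_add]

lemma coC_coact_algebraMap (D : Symm H) (x : C4) : D.coC.coact (algebraMap C4 C4loc x) =
    (IsScalarTower.toAlgHom ℂ C4 C4loc).toLinearMap.lTensor H (D.coC4.coact x) :=
  DFunLike.congr_fun (D.coC4.locMap_comp rr D.coC4_coact_rr) x

lemma coC_coact_rr (D : Symm H) : D.coC.coact (algebraMap C4 C4loc rr) =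
    1 ⊗ₜ algebraMap C4 C4loc rr := by
  simp [coC_coact_algebraMap, coC4_coact_rr]

/-- The map `A[ℝ⁴] → A₀[ℂ⁴]`. -/
def toC4 : R4 →ₐ[ℂ] C4loc := MvPolynomial.aeval zetaC

lemma toC4_zeta (i : Fin 4) : toC4 (zeta i) = zetaC i := MvPolynomial.aeval_X _ _

/-- The one-forms `dv_i` and `dv_i*`. -/
def dvec (k : ℕ) : Fin 2 → Matrix (Fin (2 * k + 2)) (Fin k) (AM k ⊗[ℂ] Om) :=
  ![tenMat (Mmat k 2) (1 ⊗ₜ dzeta 1) - tenMat (Mmat k 3) (1 ⊗ₜ dzeta 2),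
    tenMat (Mmat k 2) (1 ⊗ₜ dzeta 3) + tenMat (Mmat k 3) (1 ⊗ₜ dzeta 0)]

/-- The one-forms `dv_i*`. -/
def dvecStar (k : ℕ) : Fin 2 → Matrix (Fin k) (Fin (2 * k + 2)) (AM k ⊗[ℂ] Om) :=
  ![tenMat (Mdag k 2) (1 ⊗ₜ dzeta 0) - tenMat (Mdag k 3) (1 ⊗ₜ dzeta 3),
    tenMat (Mdag k 2) (1 ⊗ₜ dzeta 2) + tenMat (Mdag k 3) (1 ⊗ₜ dzeta 1)]

/-- The properties of the Moyal and the toric symmetry which make the instanton construction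
work: there is a subalgebra `K` of `H` on which the bicharacter is trivial and such that the
coordinates `z₁, z₂` and the vectors `v₁, v₂` lie in the parts over `K` of the comodules. -/
structure Admissible (D : Symm H) (k : ℕ) (K : Subalgebra ℂ H) : Prop where
  triv : TrivialOn D.F K
  vec_mem : ∀ i a b, vec k i a b ∈ kPart K ((D.coM k).tensor D.coR)
  vecStar_mem : ∀ i a b, vecStar k i a b ∈ kPart K ((D.coM k).tensor D.coR)
  dvec_mem : ∀ i a b, dvec k i a b ∈ kPart K ((D.coM k).tensor D.coOm)
  dvecStar_mem : ∀ i a b, dvecStar k i a b ∈ kPart K ((D.coM k).tensor D.coOm)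
  z0_mem : algebraMap C4 C4loc (z 0) ∈ kPart K D.coC
  z1_mem : algebraMap C4 C4loc (z 1) ∈ kPart K D.coC
  zs0_mem : algebraMap C4 C4loc (zs 0) ∈ kPart K D.coC
  zs1_mem : algebraMap C4 C4loc (zs 1) ∈ kPart K D.coC
  zetaC_coact : ∀ i, D.coC.coact (zetaC i) = D.g i ⊗ₜ zetaC i + D.t i ⊗ₜ 1
  order_z : ∀ j a b, normalOrder D.F (D.coM k) D.coC (Mmat k j a b ⊗ₜ algebraMap C4 C4loc (z j)) =
    Mmat k j a b ⊗ₜ algebraMap C4 C4loc (z j)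
  order_Jz : ∀ j a b, normalOrder D.F (D.coM k) D.coC
    (Mmat k j a b ⊗ₜ algebraMap C4 C4loc (Jz j)) = Mmat k j a b ⊗ₜ algebraMap C4 C4loc (Jz j)
  order_zs : ∀ j a b, normalOrder D.F (D.coM k) D.coC
    (Mdag k j a b ⊗ₜ algebraMap C4 C4loc (zs j)) = Mdag k j a b ⊗ₜ algebraMap C4 C4loc (zs j)
  order_Jzs : ∀ j a b, normalOrder D.F (D.coM k) D.coC
    (Mdag k j a b ⊗ₜ algebraMap C4 C4loc (Jzs j)) = Mdag k j a b ⊗ₜ algebraMap C4 C4loc (Jzs j)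
  g_rel : D.g 1 * D.g 0 = D.g 3 * D.g 2

lemma rr_mul_zetaC (i : Fin 4) :
    algebraMap C4 C4loc rr * zetaC i = algebraMap C4 C4loc (quad i) := by
  rw [zetaC, Localization.mk_eq_mk', mul_comm]
  exact IsLocalization.mk'_spec C4loc (quad i) ⟨rr, Submonoid.mem_powers rr⟩

lemma rr_cancel {x y : C4loc} (h : algebraMap C4 C4loc rr * x = algebraMap C4 C4loc rr * y) :
    x = y :=
  (IsLocalization.Away.algebraMap_isUnit (S := C4loc) rr).mul_left_cancel h

/-- The coordinate functions `z_j` on `A₀[ℂ⁴]` -/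
abbrev zc (x : C4) : C4loc := algebraMap C4 C4loc x

/-- These are the incidence relations of the twistor fibration: over the functions on `ℝ⁴` the last
two coordinates are linear in the first two. They become polynomial identities after multiplication
by the unit `r`. -/
lemma zc_relations :
    zc (z 2) = zetaC 1 * zc (z 0) + zetaC 3 * zc (z 1) ∧
    zc (z 3) = zetaC 0 * zc (z 1) - zetaC 2 * zc (z 0) ∧
    zc (zs 2) = zetaC 0 * zc (zs 0) + zetaC 2 * zc (zs 1) ∧
    zc (zs 3) = zetaC 1 * zc (zs 1) - zetaC 3 * zc (zs 0) ∧
    zc (Jz 2) = zetaC 3 * zc (zs 0) - zetaC 1 * zc (zs 1) ∧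
    zc (Jz 3) = zetaC 2 * zc (zs 1) + zetaC 0 * zc (zs 0) ∧
    zc (Jzs 2) = zetaC 2 * zc (z 0) - zetaC 0 * zc (z 1) ∧
    zc (Jzs 3) = zetaC 3 * zc (z 1) + zetaC 1 * zc (z 0) := by
  refine ⟨?_, ?_, ?_, ?_, ?_, ?_, ?_, ?_⟩ <;> apply rr_cancel <;>
  simp only [mul_add, mul_sub, ← mul_assoc, rr_mul_zetaC, ← map_mul, ← map_add, ← map_sub] <;>
  congr 1 <;> simp [quad, rr, Jz, Jzs] <;> ring

/-- The incidence relations eliminate the third and fourth coordinates; the coefficients of `z₁` and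
`z₂` that arise are `v₁` and `v₂`. -/
lemma sigma_classical (k : ℕ) (a : Fin (2 * k + 2)) (b : Fin k) :
    ∑ j, Mmat k j a b ⊗ₜ[ℂ] zc (z j) =
      tenMap _ toC4 (vec k 0 a b) * (1 ⊗ₜ zc (z 0)) +
      tenMap _ toC4 (vec k 1 a b) * (1 ⊗ₜ zc (z 1)) := by
  obtain ⟨h1, h2, h3, h4, h5, h6, h7, h8⟩ := zc_relations
  simp [Fin.sum_univ_four, vec, toC4_zeta, h1, h2, TensorProduct.tmul_add, TensorProduct.tmul_sub,
    add_mul, sub_mul]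
  abel

lemma sigma_J_classical (k : ℕ) (a : Fin (2 * k + 2)) (b : Fin k) :
    ∑ j, Mmat k j a b ⊗ₜ[ℂ] zc (Jz j) =
      tenMap _ toC4 (vec k 1 a b) * (1 ⊗ₜ zc (zs 0)) -
      tenMap _ toC4 (vec k 0 a b) * (1 ⊗ₜ zc (zs 1)) := by
  obtain ⟨h1, h2, h3, h4, h5, h6, h7, h8⟩ := zc_relations
  have e0 : zc (Jz 0) = -zc (zs 1) := by simp [Jz]
  have e1 : zc (Jz 1) = zc (zs 0) := by simp [Jz]
  simp [Fin.sum_univ_four, vec, toC4_zeta, h5, h6, e0, e1, TensorProduct.tmul_add,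
    TensorProduct.tmul_sub, TensorProduct.tmul_neg, add_mul, sub_mul]
  abel

lemma sigmaStar_classical (k : ℕ) (b : Fin k) (a : Fin (2 * k + 2)) :
    ∑ j, Mdag k j b a ⊗ₜ[ℂ] zc (zs j) =
      tenMap _ toC4 (vecStar k 0 b a) * (1 ⊗ₜ zc (zs 0)) +
      tenMap _ toC4 (vecStar k 1 b a) * (1 ⊗ₜ zc (zs 1)) := by
  obtain ⟨h1, h2, h3, h4, h5, h6, h7, h8⟩ := zc_relations
  simp [Fin.sum_univ_four, vecStar, toC4_zeta, h3, h4, TensorProduct.tmul_add,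
    TensorProduct.tmul_sub, add_mul, sub_mul]
  abel

lemma sigmaStar_J_classical (k : ℕ) (b : Fin k) (a : Fin (2 * k + 2)) :
    ∑ j, Mdag k j b a ⊗ₜ[ℂ] zc (Jzs j) =
      tenMap _ toC4 (vecStar k 1 b a) * (1 ⊗ₜ zc (z 0)) -
      tenMap _ toC4 (vecStar k 0 b a) * (1 ⊗ₜ zc (z 1)) := by
  obtain ⟨h1, h2, h3, h4, h5, h6, h7, h8⟩ := zc_relations
  have e0 : zc (Jzs 0) = -zc (z 1) := by simp [Jzs]
  have e1 : zc (Jzs 1) = zc (z 0) := by simp [Jzs]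
  simp [Fin.sum_univ_four, vecStar, toC4_zeta, h7, h8, e0, e1, TensorProduct.tmul_add,
    TensorProduct.tmul_sub, TensorProduct.tmul_neg, add_mul, sub_mul]
  abel

end Symm

section
variable {A C C' : Type} [CommRing A] [Algebra ℂ A] [Ring C] [Algebra ℂ C] [Ring C']
    [Algebra ℂ C'] {F : Bichar H} {K : Subalgebra ℂ H} (hF : TrivialOn F K) (δ : Coaction H A)
    (ε : Coaction H C) (ε' : Coaction H C')
    (f : C →ₐ[ℂ] C') (hf : ∀ a, ε'.coact (f a) = f.toLinearMap.lTensor H (ε.coact a))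

/-- The map between the parts with trivial twist induced by a map of comodule algebras. -/
def kMap : kPart K (δ.tensor ε) →ₐ[ℂ] kPart K (δ.tensor ε') :=
  AlgHom.codRestrict ((tenMap A f).comp (kPart K (δ.tensor ε)).val) _
    (fun x => map_mem_kPart (tenMap A f) (tensor_coact_tenMap δ ε ε' f hf) x.2)

lemma phi_kMap (x : kPart K (δ.tensor ε)) :
    phi hF δ ε' (kMap δ ε ε' f hf x) = bigMap F δ ε ε' f hf (phi hF δ ε x) :=
  (bigMap_bos F δ ε ε' f hf x.1).symm

end

/-- The matrix with entries `x M_{ab}`. -/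
def scaleMat {E m n : Type} [Mul E] (x : E) (M : Matrix m n E) : Matrix m n E :=
  Matrix.of fun a b => x * M a b

/-- The off-diagonal products vanish because, for instance, `(z̄₁ v₁* + z̄₂ v₂*)(z̄₁ v₂ - z̄₂ v₁) =
(z̄₂ z̄₁ - z̄₁ z̄₂) g`; in the diagonal ones the two terms add up to `r g`. -/
lemma quaternionic_products {E m n : Type} [Ring E] (hE : ∀ x y : E, x * y = y * x) [Fintype m]
    (z0 z1 zs0 zs1 : E)
    (v : Fin 2 → Matrix m n E) (vs : Fin 2 → Matrix n m E) (g : Matrix n n E)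
    (h : ∀ i j, vs i * v j = if i = j then g else 0) :
    (scaleMat zs0 (vs 0) + scaleMat zs1 (vs 1)) * (scaleMat z0 (v 0) + scaleMat z1 (v 1)) =
      scaleMat (z0 * zs0 + z1 * zs1) g ∧
    (scaleMat zs0 (vs 0) + scaleMat zs1 (vs 1)) * (scaleMat zs0 (v 1) - scaleMat zs1 (v 0)) = 0 ∧
    (scaleMat z0 (vs 1) - scaleMat z1 (vs 0)) * (scaleMat z0 (v 0) + scaleMat z1 (v 1)) = 0 ∧
    (scaleMat z0 (vs 1) - scaleMat z1 (vs 0)) * (scaleMat zs0 (v 1) - scaleMat zs1 (v 0)) =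
      scaleMat (z0 * zs0 + z1 * zs1) g := by
  -- Commutativity enters as a hypothesis because it will be applied to a subalgebra which carries
  -- only a ring structure; as an instance it lets scalars move through matrix products.
  let : CommRing E := { ‹Ring E› with mul_comm := hE }
  have hs : ∀ {m n : Type} (x : E) (M : Matrix m n E), scaleMat x M = x • M := fun _ _ => rfl
  simp only [Matrix.add_mul, Matrix.mul_add, Matrix.sub_mul, Matrix.mul_sub, Matrix.smul_mul,
    Matrix.mul_smul, hs, h]
  refine ⟨?_, ?_, ?_, ?_⟩ <;> simp [add_smul, smul_smul, mul_comm]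

/-! ### The monad in terms of elements with trivial twist -/

namespace Symm
namespace Admissible
variable {D : Symm H} {k : ℕ} {K : Subalgebra ℂ H} (hD : D.Admissible k K)

/-- The functions on `ℝ⁴` with trivial twist. -/
abbrev TR (D : Symm H) (k : ℕ) (K : Subalgebra ℂ H) := kPart K ((D.coM k).tensor D.coR)
/-- The functions on twistor space with trivial twist. -/
abbrev TC (D : Symm H) (k : ℕ) (K : Subalgebra ℂ H) := kPart K ((D.coM k).tensor D.coC)

/-- `v_i`, as a matrix of elements with trivial twist. -/
def v (i : Fin 2) : Matrix (Fin (2 * k + 2)) (Fin k) (TR D k K) :=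
  Matrix.of fun a b => ⟨vec k i a b, hD.vec_mem i a b⟩
/-- `v_i*`, as a matrix of elements with trivial twist. -/
def vs (i : Fin 2) : Matrix (Fin k) (Fin (2 * k + 2)) (TR D k K) :=
  Matrix.of fun a b => ⟨vecStar k i a b, hD.vecStar_mem i a b⟩

lemma vs_mul_v (i j : Fin 2) : hD.vs i * hD.v j = if i = j then hD.vs 0 * hD.v 0 else 0 := by
  have h : ∀ i j, (hD.vs i * hD.v j).map (TR D k K).val = vecStar k i * vec k j := by
    intro i j
    rw [Matrix.map_mul]
    rfl
  apply Matrix.map_injective (f := (TR D k K).val) Subtype.val_injective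
  beta_reduce
  rw [h, vecStar_mul_vec]
  split_ifs
  · rw [h]
  · ext; simp

include hD in
lemma toC4_coact (a : R4) :
    D.coC.coact (toC4 a) = toC4.toLinearMap.lTensor H (D.coR.coact a) := by
  have : D.coC.coact.comp toC4 = (Algebra.TensorProduct.map (AlgHom.id ℂ H) toC4).comp D.coR.coact := by
    apply MvPolynomial.algHom_ext
    intro i
    change D.coC.coact (toC4 (zeta i)) = Algebra.TensorProduct.map _ _ (D.coR.coact (zeta i))
    rw [toC4_zeta, hD.zetaC_coact]
    simp only [coR, Coaction.aff, Coaction.mv, zeta, MvPolynomial.aeval_X, map_add,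
      Algebra.TensorProduct.map_tmul, map_one, AlgHom.id_apply]
    rw [← toC4_zeta]
    rfl
  exact DFunLike.congr_fun this a

/-- The map from functions on `ℝ⁴` to functions on twistor space. -/
def toTC : TR D k K →ₐ[ℂ] TC D k K := kMap (D.coM k) D.coR D.coC toC4 hD.toC4_coact

/-- The bosonisation map on functions on `ℝ⁴` with trivial twist. -/
def phiR : TR D k K →ₐ[ℂ] D.BR k := phi hD.triv (D.coM k) D.coR
/-- The bosonisation map on functions on twistor space with trivial twist. -/
def phiC : TC D k K →ₐ[ℂ] D.BC k := phi hD.triv (D.coM k) D.coC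
/-- The map from functions on the quantised `ℝ⁴` to functions on the quantised twistor space. -/
def bigC : D.BR k →ₐ[ℂ] D.BC k := bigMap D.F (D.coM k) D.coR D.coC toC4 hD.toC4_coact

lemma phiC_toTC (x : TR D k K) : hD.phiC (hD.toTC x) = hD.bigC (hD.phiR x) :=
  phi_kMap hD.triv _ _ _ _ _ x

lemma map_vec (i : Fin 2) : (vec k i).map (D.bosR k) = (hD.v i).map hD.phiR := rfl
lemma map_vecStar (i : Fin 2) : (vecStar k i).map (D.bosR k) = (hD.vs i).map hD.phiR := rfl

lemma ghat_eq : D.ghat k = (hD.vs 0 * hD.v 0).map hD.phiR := by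
  rw [Matrix.map_mul]
  rfl

/-- A coordinate on twistor space as an element with trivial twist. -/
def coord (c : C4loc) (h : c ∈ kPart K D.coC) : TC D k K :=
  ⟨1 ⊗ₜ c, map_mem_kPart (Algebra.TensorProduct.includeRight : C4loc →ₐ[ℂ] AM k ⊗[ℂ] C4loc)
    (Coaction.tensor_coact_right _ _) h⟩

/-- `z₁` -/
def z0 : TC D k K := coord _ hD.z0_mem
/-- `z₂` -/
def z1 : TC D k K := coord _ hD.z1_mem
/-- `z₁*` -/
def zs0 : TC D k K := coord _ hD.zs0_mem
/-- `z₂*` -/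
def zs1 : TC D k K := coord _ hD.zs1_mem
/-- `r` -/
def r : TC D k K := hD.z0 * hD.zs0 + hD.z1 * hD.zs1

lemma r_val : hD.r.1 = 1 ⊗ₜ zc rr := by
  simp [r, z0, z1, zs0, zs1, coord, rr, TensorProduct.tmul_add]

/-- As `r` is coinvariant, bosonisation adds no leg in `H`. -/
lemma phiC_r : hD.phiC hD.r = 1 ⊗ₜ Tw.mk D.F D.coC (zc rr) := by
  rw [phiC, phi_apply, r_val]
  change bos _ _ _ (twC D.F (D.coM k) D.coC (Tw.mk _ _ (zc rr))) = _
  rw [bos_twC]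
  simp [bosC, Tw.coact, Tw.coactLin, coC_coact_rr]

/-- The matrices `σ̃` are defined by `μ`, which is not multiplicative on the classical algebra. On
elements fixed by normal ordering it agrees with the algebra map `bos`. -/
lemma mu_sum (x : Fin 4 → AM k ⊗[ℂ] C4loc)
    (hx : ∀ j, normalOrder D.F (D.coM k) D.coC (x j) = x j) :
    ∑ j, mu D.F (D.coM k) D.coC (x j) = bos D.F (D.coM k) D.coC (Tw.mk _ _ (∑ j, x j)) := by
  rw [map_sum, map_sum]
  refine Finset.sum_congr rfl fun j _ => ?_
  rw [bos_mk, hx]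

lemma sigma_z : D.sigma k z = (scaleMat hD.z0 ((hD.v 0).map hD.toTC) + scaleMat hD.z1 ((hD.v 1).map hD.toTC)).map
    hD.phiC := by
  ext a b
  refine (mu_sum _ fun j => hD.order_z j a b).trans ?_
  rw [sigma_classical, mul_comm, mul_comm (tenMap _ toC4 (vec k 1 a b))]
  rfl

lemma sigma_J : D.sigma k Jz =
    (scaleMat hD.zs0 ((hD.v 1).map hD.toTC) - scaleMat hD.zs1 ((hD.v 0).map hD.toTC)).map hD.phiC := by
  ext a b
  refine (mu_sum _ fun j => hD.order_Jz j a b).trans ?_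
  rw [sigma_J_classical, mul_comm, mul_comm (tenMap _ toC4 (vec k 0 a b))]
  rfl

lemma sigmaStar_z : D.sigmaStar k zs =
    (scaleMat hD.zs0 ((hD.vs 0).map hD.toTC) + scaleMat hD.zs1 ((hD.vs 1).map hD.toTC)).map hD.phiC := by
  ext a b
  refine (mu_sum _ fun j => hD.order_zs j a b).trans ?_
  rw [sigmaStar_classical, mul_comm, mul_comm (tenMap _ toC4 (vecStar k 1 a b))]
  rfl

lemma sigmaStar_J : D.sigmaStar k Jzs =
    (scaleMat hD.z0 ((hD.vs 1).map hD.toTC) - scaleMat hD.z1 ((hD.vs 0).map hD.toTC)).map hD.phiC := by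
  ext a b
  refine (mu_sum _ fun j => hD.order_Jzs j a b).trans ?_
  rw [sigmaStar_J_classical, mul_comm, mul_comm (tenMap _ toC4 (vecStar k 0 a b))]
  rfl

/-- `g = v₁* v₁` on twistor space. -/
def gC : Matrix (Fin k) (Fin k) (TC D k K) := (hD.vs 0).map hD.toTC * (hD.v 0).map hD.toTC

lemma vs_mul_v_C (i j : Fin 2) : (hD.vs i).map hD.toTC * (hD.v j).map hD.toTC =
    if i = j then hD.gC else 0 := by
  rw [gC, ← Matrix.map_mul, vs_mul_v]
  split_ifs
  · rw [Matrix.map_mul]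
  · ext; simp

lemma TC_comm (x y : TC D k K) : x * y = y * x := Subtype.ext (mul_comm x.1 y.1)

lemma TR_comm (x y : TR D k K) : x * y = y * x := Subtype.ext (mul_comm x.1 y.1)

lemma sigma_products :
    D.sigmaStar k zs * D.sigma k z = (scaleMat hD.r hD.gC).map hD.phiC ∧
    D.sigmaStar k zs * D.sigma k Jz = 0 ∧
    D.sigmaStar k Jzs * D.sigma k z = 0 ∧
    D.sigmaStar k Jzs * D.sigma k Jz = (scaleMat hD.r hD.gC).map hD.phiC := by
  rw [hD.sigma_z, hD.sigma_J, hD.sigmaStar_z, hD.sigmaStar_J, ← Matrix.map_mul, ← Matrix.map_mul,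
    ← Matrix.map_mul, ← Matrix.map_mul]
  obtain ⟨h1, h2, h3, h4⟩ := quaternionic_products TC_comm hD.z0 hD.z1 hD.zs0 hD.zs1
    (fun i => (hD.v i).map hD.toTC) (fun i => (hD.vs i).map hD.toTC) hD.gC hD.vs_mul_v_C
  exact ⟨congrArg (Matrix.map · hD.phiC) h1,
    (congrArg (Matrix.map · hD.phiC) h2).trans (Matrix.map_zero _ (map_zero _)),
    (congrArg (Matrix.map · hD.phiC) h3).trans (Matrix.map_zero _ (map_zero _)),
    congrArg (Matrix.map · hD.phiC) h4⟩

lemma rhoSq_eq : D.rhoSq k = (scaleMat hD.r hD.gC).map hD.phiC := hD.sigma_products.1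

include hD in
lemma Vs_mul_V : D.Vs k * D.V k = Matrix.fromBlocks (D.rhoSq k) 0 0 (D.rhoSq k) := by
  obtain ⟨h1, h2, h3, h4⟩ := hD.sigma_products
  rw [Vs, V, Matrix.fromRows_mul_fromCols, h1, h2, h3, h4, hD.rhoSq_eq]

end Admissible
end Symm

/-! ### From the projection on twistor space to the one on the base -/

section
variable {R R' : Type} [Ring R] [Ring R'] {m n : Type} [Fintype m] [Fintype n] [DecidableEq m]
  [DecidableEq n] {S : Type} [FunLike S R R'] [RingHomClass S R R']

lemma map_projection (f : S) {ι : Type} [Fintype ι] (v : ι → Matrix m n R)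
    (w : ι → Matrix n m R) (Gi : Matrix n n R) : (1 - ∑ i, v i * Gi * w i).map f =
      1 - ∑ i, (v i).map f * Gi.map f * (w i).map f := by
  simp only [← Matrix.map_mul]
  ext a b
  simp only [Matrix.map_apply, Matrix.sub_apply, map_sub, Matrix.sum_apply, map_sum,
    Matrix.one_apply]
  split_ifs <;> simp

/-- In the sum of the two sandwiches the coefficient of `v_i, v_i*` is `z₁ z̄₁ + z₂ z̄₂`, and that
of `v_i, v_j*` with `i ≠ j` cancels. So the dependence on the point of the twistor fibre enters only
through `r`, which is absorbed into the inverse matrix. -/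
lemma twistor_sandwich (φ : S) {Ri : Matrix n n R'} (h : ∀ i j x, Commute (Ri i j) (φ x))
    (hE : ∀ x y : R, x * y = y * x) (z0 z1 zs0 zs1 : R) (v : Fin 2 → Matrix m n R)
    (vs : Fin 2 → Matrix n m R) :
    (scaleMat z0 (v 0) + scaleMat z1 (v 1)).map φ * Ri *
      (scaleMat zs0 (vs 0) + scaleMat zs1 (vs 1)).map φ +
    (scaleMat zs0 (v 1) - scaleMat zs1 (v 0)).map φ * Ri *
      (scaleMat z0 (vs 1) - scaleMat z1 (vs 0)).map φ =
    ∑ i, (v i).map φ * scaleMat (φ (z0 * zs0 + z1 * zs1)) Ri * (vs i).map φ := by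
  let : CommRing R := { ‹Ring R› with mul_comm := hE }
  have h' : ∀ i j x, Commute (scaleMat (φ (z0 * zs0 + z1 * zs1)) Ri i j) (φ x) := by
    intro i j x
    refine Commute.mul_left ?_ (h i j x)
    change φ _ * φ _ = φ _ * φ _
    rw [← map_mul, ← map_mul, mul_comm]
  ext a d
  rw [Matrix.add_apply, sandwich φ h, sandwich φ h, Matrix.sum_apply,
    Finset.sum_congr rfl fun i _ => sandwich φ h' (v i) (vs i) a d]
  simp only [Fin.sum_univ_two, ← Finset.sum_add_distrib]
  refine Finset.sum_congr rfl fun b _ => Finset.sum_congr rfl fun c _ => ?_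
  simp only [scaleMat, Matrix.of_apply, Matrix.add_apply, Matrix.sub_apply]
  rw [← (h b c _).eq, mul_assoc, mul_assoc, ← mul_add, ← mul_add, ← map_mul, ← map_mul, ← map_add,
    ← map_add]
  congr 2
  ring

end

namespace Symm
namespace Admissible
variable {D : Symm H} {k : ℕ} {K : Subalgebra ℂ H} (hD : D.Admissible k K)

/-! ### The projection over `ℝ⁴` -/

/-- The functions on `ℝ⁴` with trivial twist, in the algebra where `g` is invertible. -/
def locR : TR D k K →ₐ[ℂ] D.LocR k := (D.ofR k).comp hD.phiR

lemma ghat_map_ofR : (D.ghat k).map (D.ofR k) = (hD.vs 0 * hD.v 0).map hD.locR := by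
  refine (congrArg (Matrix.map · (D.ofR k)) hD.ghat_eq).trans ?_
  exact Matrix.map_map

/-- The entries of `ĝ` are images of elements of the commutative algebra `TR`, hence commute with
its image; `commute_inv_entry` passes this on to the inverse. -/
lemma commute_inv_locR (i j : Fin k) (x : TR D k K) :
    Commute (Adj.inv (D.ghat k) i j) (hD.locR x) := by
  refine commute_inv_entry (Adj.mul_inv _) (Adj.inv_mul _) (fun i j => ?_) i j
  rw [hD.ghat_map_ofR, Matrix.map_apply]
  change hD.locR _ * hD.locR _ = hD.locR _ * hD.locR _
  rw [← map_mul, ← map_mul, TR_comm]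

lemma PR_eq : D.PR k =
    1 - ∑ i, (hD.v i).map hD.locR * Adj.inv (D.ghat k) * (hD.vs i).map hD.locR := by
  simp only [PR, hD.map_vec, hD.map_vecStar, Matrix.map_map]
  rfl

lemma locR_vs_mul_v (i j : Fin 2) : (hD.vs i).map hD.locR * (hD.v j).map hD.locR =
    if i = j then (D.ghat k).map (D.ofR k) else 0 := by
  rw [← Matrix.map_mul, hD.vs_mul_v, hD.ghat_map_ofR]
  split_ifs
  · rfl
  · exact Matrix.map_zero _ (map_zero _)

include hD in
lemma idempotentR : D.PR k * D.PR k = D.PR k := by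
  rw [hD.PR_eq]
  exact projection_idempotent _ _ (Adj.inv_mul _) hD.locR_vs_mul_v

include hD in
-- Each of the two subtracted idempotents has trace `k` by `trace_sandwich`, leaving `(2k + 2) -
-- 2k`.
lemma traceR : (D.PR k).trace = 2 := by
  have h : ∀ i, ((hD.v i).map hD.locR * Adj.inv (D.ghat k) * (hD.vs i).map hD.locR).trace =
      ((Fintype.card (Fin k) : ℕ) : D.LocR k) := by
    intro i
    refine trace_sandwich hD.locR hD.commute_inv_locR TR_comm _ _ ?_
    rw [hD.vs_mul_v, if_pos rfl, ← hD.ghat_map_ofR]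
    exact Adj.inv_mul _
  rw [hD.PR_eq, Matrix.trace_sub, Matrix.trace_sum, Finset.sum_congr rfl fun i _ => h i,
    Matrix.trace_one]
  simp [two_mul]

/-! ### The projection over twistor space -/

/-- The functions on twistor space with trivial twist, in the algebra where `ρ²` is invertible. -/
def locC : TC D k K →ₐ[ℂ] D.LocC k := (D.ofC k).comp hD.phiC

lemma rhoSq_map_ofC : (D.rhoSq k).map (D.ofC k) = (scaleMat hD.r hD.gC).map hD.locC := by
  refine (congrArg (Matrix.map · (D.ofC k)) hD.rhoSq_eq).trans ?_
  exact Matrix.map_map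

lemma commute_inv_locC (i j : Fin k) (x : TC D k K) :
    Commute (Adj.inv (D.rhoSq k) i j) (hD.locC x) := by
  refine commute_inv_entry (Adj.mul_inv _) (Adj.inv_mul _) (fun i j => ?_) i j
  rw [hD.rhoSq_map_ofC, Matrix.map_apply]
  change hD.locC _ * hD.locC _ = hD.locC _ * hD.locC _
  rw [← map_mul, ← map_mul, TC_comm]

/-- The inverse of `g` on twistor space. -/
def gInvC : Matrix (Fin k) (Fin k) (D.LocC k) := scaleMat (hD.locC hD.r) (Adj.inv (D.rhoSq k))

lemma ghat_map_bigC : (D.ghat k).map ((D.ofC k).comp hD.bigC) = hD.gC.map hD.locC := by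
  rw [hD.ghat_eq, Matrix.map_map, gC, ← Matrix.map_mul, Matrix.map_map]
  ext a b
  simp only [Matrix.map_apply, Function.comp_apply, locC, AlgHom.comp_apply, phiC_toTC]

/-- Since `ρ² = r g` and `r` commutes with the entries of `g`, the matrix `r ρ⁻²` is inverse to `g`.
This is what makes `descent` exist. -/
lemma mul_gInvC : (D.ghat k).map ((D.ofC k).comp hD.bigC) * hD.gInvC = 1 := by
  rw [← Adj.mul_inv, hD.rhoSq_map_ofC, hD.ghat_map_bigC]
  ext i j
  simp only [Matrix.mul_apply, gInvC, scaleMat, Matrix.of_apply, Matrix.map_apply, map_mul,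
    ← mul_assoc]
  simp only [← map_mul, TC_comm]

lemma gInvC_mul : hD.gInvC * (D.ghat k).map ((D.ofC k).comp hD.bigC) = 1 := by
  rw [← Adj.inv_mul, hD.rhoSq_map_ofC, hD.ghat_map_bigC]
  ext i j
  simp only [Matrix.mul_apply, gInvC, scaleMat, Matrix.of_apply, Matrix.map_apply, map_mul]
  simp only [← mul_assoc, (hD.commute_inv_locC _ _ _).eq]

/-- The algebra map expressing functions on `ℝ⁴` as functions on twistor space. -/
def descent : D.LocR k →ₐ[ℂ] D.LocC k :=
  Adj.lift (D.ghat k) ((D.ofC k).comp hD.bigC) hD.gInvC hD.mul_gInvC hD.gInvC_mul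

end Admissible
end Symm

/-! ### Generators of the algebra with an adjoined inverse -/

namespace Adj
variable {B B' : Type} [Ring B] [Algebra ℂ B] [Ring B'] [Algebra ℂ B'] {n : ℕ}
  (ρ : Matrix (Fin n) (Fin n) B) (f : B →ₐ[ℂ] B') (X : Matrix (Fin n) (Fin n) B')
    (h1 : ρ.map f * X = 1) (h2 : X * ρ.map f = 1)

lemma lift_of (x : B) : lift ρ f X h1 h2 (of ρ x) = f x := by
  change RingQuot.liftAlgHom ℂ _ (RingQuot.mkAlgHom ℂ (AdjRel ρ) (FreeAlgebra.ι ℂ (Sum.inl x))) = _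
  rw [RingQuot.liftAlgHom_mkAlgHom_apply]
  simp

lemma lift_inv (i j : Fin n) : lift ρ f X h1 h2 (inv ρ i j) = X i j := by
  change RingQuot.liftAlgHom ℂ _ (RingQuot.mkAlgHom ℂ (AdjRel ρ) (FreeAlgebra.ι ℂ (Sum.inr (i, j)))) = _
  rw [RingQuot.liftAlgHom_mkAlgHom_apply]
  simp

/-- A subalgebra containing the image of `B` and the entries of the inverse is everything. -/
lemma mem_of_generators (S : Subalgebra ℂ (Adj ρ)) (hof : ∀ x, of ρ x ∈ S)
    (hinv : ∀ i j, inv ρ i j ∈ S) (x : Adj ρ) : x ∈ S := by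
  obtain ⟨y, rfl⟩ := RingQuot.mkAlgHom_surjective ℂ (AdjRel ρ) x
  change mk ρ y ∈ S
  induction y using FreeAlgebra.induction with
  | grade0 c => rw [AlgHom.commutes]; exact S.algebraMap_mem c
  | grade1 t =>
    rcases t with x | ⟨i, j⟩
    · exact hof x
    · exact hinv i j
  | mul a b ha hb => rw [map_mul]; exact S.mul_mem ha hb
  | add a b ha hb => rw [map_add]; exact S.add_mem ha hb

end Adj

namespace Symm
namespace Admissible
variable {D : Symm H} {k : ℕ} {K : Subalgebra ℂ H} (hD : D.Admissible k K)

lemma descent_ofR (x : D.BR k) : hD.descent (D.ofR k x) = D.ofC k (hD.bigC x) :=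
  Adj.lift_of _ _ _ _ _ x

lemma descent_inv (i j : Fin k) : hD.descent (Adj.inv (D.ghat k) i j) = hD.gInvC i j :=
  Adj.lift_inv _ _ _ _ _ i j

lemma descent_locR (x : TR D k K) : hD.descent (hD.locR x) = hD.locC (hD.toTC x) := by
  rw [locR, AlgHom.comp_apply, descent_ofR, locC, AlgHom.comp_apply, phiC_toTC]

lemma ghat_mul_r (a b : Fin k) : hD.descent (D.ofR k (D.ghat k a b)) *
    D.ofC k (1 ⊗ₜ Tw.mk D.F D.coC (zc rr)) = D.ofC k (D.rhoSq k a b) := by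
  have h1 := congrFun (congrFun hD.ghat_map_bigC a) b
  have h2 := congrFun (congrFun hD.rhoSq_map_ofC a) b
  rw [descent_ofR, ← hD.phiC_r]
  refine Eq.trans ?_ h2.symm
  change ((D.ofC k).comp hD.bigC) (D.ghat k a b) * hD.locC hD.r = _
  rw [show ((D.ofC k).comp hD.bigC) (D.ghat k a b) = _ from h1, Matrix.map_apply, ← map_mul,
    TC_comm]
  rfl

/-- Both sides are sums of sandwiches: on twistor space over the two columns `σ_z` and `σ_{J(z)}`,
on `ℝ⁴` over `v₁` and `v₂`. `twistor_sandwich` identifies them. -/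
lemma PR_map_descent : (D.PR k).map hD.descent = D.Pt k := by
  have hQ : D.Qt k = (D.sigma k z).map (D.ofC k) * Adj.inv (D.rhoSq k) *
      (D.sigmaStar k zs).map (D.ofC k) + (D.sigma k Jz).map (D.ofC k) * Adj.inv (D.rhoSq k) *
      (D.sigmaStar k Jzs).map (D.ofC k) := by
    rw [Qt, V, Vs, Matrix.fromCols_map, Matrix.fromRows_map, Matrix.fromCols_mul_fromBlocks,
      Matrix.fromCols_mul_fromRows]
    simp
  have hd : (D.PR k).map hD.descent = 1 - ∑ i, ((hD.v i).map hD.toTC).map hD.locC * hD.gInvC *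
      ((hD.vs i).map hD.toTC).map hD.locC := by
    refine (congrArg (Matrix.map · hD.descent) hD.PR_eq).trans ?_
    refine (map_projection hD.descent _ _ _).trans ?_
    congr 1
    refine Finset.sum_congr rfl fun i _ => ?_
    simp only [Matrix.map_map]
    congr 1
    · congr 1
      · ext a b
        exact hD.descent_locR _
      · ext a b
        exact hD.descent_inv _ _
    · ext a b
      exact hD.descent_locR _
  refine hd.trans ?_
  rw [Pt, hQ]
  refine congrArg (1 - ·) ((twistor_sandwich hD.locC hD.commute_inv_locC TC_comm hD.z0 hD.z1 hD.zs0
    hD.zs1 (fun i => (hD.v i).map hD.toTC) (fun i => (hD.vs i).map hD.toTC)).symm.trans ?_)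
  rw [hD.sigma_z, hD.sigma_J, hD.sigmaStar_z, hD.sigmaStar_J]
  simp only [Matrix.map_map]
  rfl

include hD in
lemma descends : ∃ j : D.LocR k →ₐ[ℂ] D.LocC k,
    (∀ x : Smash D.F (D.coM k), j (D.ofR k (x ⊗ₜ 1)) = D.ofC k (x ⊗ₜ 1)) ∧
    (∀ i, j (D.ofR k (1 ⊗ₜ Tw.mk D.F D.coR (zeta i))) =
      D.ofC k (1 ⊗ₜ Tw.mk D.F D.coC (zetaC i))) ∧
    (∀ a b, j (D.ofR k (D.ghat k a b)) *
      D.ofC k (1 ⊗ₜ Tw.mk D.F D.coC (algebraMap C4 C4loc rr)) = D.ofC k (D.rhoSq k a b)) ∧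
    (D.PR k).map j = D.Pt k := by
  refine ⟨hD.descent, fun x => ?_, fun i => ?_, hD.ghat_mul_r, hD.PR_map_descent⟩
  · rw [hD.descent_ofR, bigC, bigMap, Algebra.TensorProduct.map_tmul, map_one]
    rfl
  · rw [hD.descent_ofR, bigC, bigMap, Algebra.TensorProduct.map_tmul, map_one]
    change D.ofC k (1 ⊗ₜ Tw.mk D.F D.coC (toC4 (zeta i))) = _
    rw [toC4_zeta]

include hD in
-- Transported from `ℝ⁴` along `descent`; the trace is obtained in the same way.
lemma idempotent : D.Pt k * D.Pt k = D.Pt k := by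
  rw [← hD.PR_map_descent, ← Matrix.map_mul, hD.idempotentR]

include hD in
lemma trace : (D.Pt k).trace = 2 := by
  rw [← hD.PR_map_descent]
  refine (AddMonoidHom.map_trace hD.descent (D.PR k)).symm.trans ?_
  rw [hD.traceR, map_ofNat]

end Admissible
end Symm

/-! ### Finiteness and projectivity -/

section
variable {R : Type} [Ring R] {n : ℕ} (P : Matrix (Fin n) (Fin n) R) (hP : P * P = P)

/-- `R` is free of rank one as a right module. -/
def opEquiv (R : Type) [Ring R] : Rᵐᵒᵖ ≃ₗ[Rᵐᵒᵖ] R where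
  toFun := MulOpposite.unop
  invFun := MulOpposite.op
  map_add' _ _ := rfl
  map_smul' _ _ := rfl
  left_inv _ := rfl
  right_inv _ := rfl

/-- The projection of `Rⁿ` onto `P Rⁿ`. -/
def toRange : (Fin n → R) →ₗ[Rᵐᵒᵖ] rangeModule P where
  toFun ψ := ⟨P.mulVec ψ, by
    change P.mulVec (P.mulVec ψ) = _
    rw [Matrix.mulVec_mulVec, hP]⟩
  map_add' x y := Subtype.ext (Matrix.mulVec_add P x y)
  map_smul' c x := by
    apply Subtype.ext
    funext i
    simp [Matrix.mulVec, dotProduct, Finset.sum_mul, mul_assoc]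

lemma toRange_coe (ψ : rangeModule P) : toRange P hP ψ = ψ := Subtype.ext ψ.2

include hP in
lemma rangeModule_finite : Module.Finite Rᵐᵒᵖ (rangeModule P) :=
  have : Module.Finite Rᵐᵒᵖ R := Module.Finite.equiv (opEquiv R)
  Module.Finite.of_surjective (toRange P hP) fun ψ => ⟨ψ, toRange_coe P hP ψ⟩

include hP in
lemma rangeModule_projective : Module.Projective Rᵐᵒᵖ (rangeModule P) :=
  have : Module.Free Rᵐᵒᵖ R := Module.Free.of_equiv (opEquiv R)
  Module.Projective.of_split (rangeModule P).subtype (toRange P hP)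
    (LinearMap.ext fun ψ => toRange_coe P hP ψ)

end

/-! ### Skew derivations of a ring with an adjoined inverse -/

namespace Adj
section
variable {B B' L : Type} [Ring B] [Algebra ℂ B] [Ring L] [Algebra ℂ L] {n : ℕ}
  (ρ : Matrix (Fin n) (Fin n) B)

end

section
variable {B : Type} [Ring B] [Algebra ℂ B] {n : ℕ} (ρ : Matrix (Fin n) (Fin n) B)
  (γ : B →ₐ[ℂ] B) (hγ : ρ.map γ = ρ) (d : B →ₗ[ℂ] B)
  (hd : ∀ x y, d (x * y) = d x * y + γ x * d y)

/-- The extension of an algebra map fixing `ρ`. -/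
def extend : Adj ρ →ₐ[ℂ] Adj ρ :=
  lift ρ ((of ρ).comp γ) (inv ρ)
    (by rw [AlgHom.coe_comp, ← Matrix.map_map, hγ, mul_inv])
    (by rw [AlgHom.coe_comp, ← Matrix.map_map, hγ, inv_mul])

lemma extend_of (x : B) : extend ρ γ hγ (of ρ x) = of ρ (γ x) := lift_of _ _ _ _ _ _

lemma extend_inv (i j : Fin n) : extend ρ γ hγ (inv ρ i j) = inv ρ i j := lift_inv _ _ _ _ _ _ _

/-- The algebra map `x ↦ (γ x, d x; 0, x)` to the triangular matrices. -/
def triangular : B →ₐ[ℂ] Matrix (Fin 2) (Fin 2) (Adj ρ) :=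
  AlgHom.ofLinearMap
    { toFun := fun x => !![of ρ (γ x), of ρ (d x); 0, of ρ x]
      map_add' := by intros; ext i j; fin_cases i <;> fin_cases j <;> simp
      map_smul' := by intros; ext i j; fin_cases i <;> fin_cases j <;> simp }
    (by
      have h1 : d 1 = 0 := by simpa using hd 1 1
      ext i j; fin_cases i <;> fin_cases j <;> simp [h1])
    (by
      intro x y
      ext i j; fin_cases i <;> fin_cases j <;> simp [Matrix.mul_apply, Fin.sum_univ_two, hd, add_comm])

lemma triangular_apply (x : B) :
    triangular ρ γ d hd x = !![of ρ (γ x), of ρ (d x); 0, of ρ x] := rfl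

/-- The inverse of the image of `ρ` under `triangular`. -/
def triangularInv : Matrix (Fin n) (Fin n) (Matrix (Fin 2) (Fin 2) (Adj ρ)) :=
  Matrix.of fun i j =>
    !![inv ρ i j, -(inv ρ * (ρ.map d).map (of ρ) * inv ρ) i j; 0, inv ρ i j]

include hγ in
-- The block matrix `(ρ, dρ; 0, ρ)`, whose first diagonal block is `ρ` because `γ` fixes `ρ`, has
-- the inverse `(ρ⁻¹, -ρ⁻¹ dρ ρ⁻¹; 0, ρ⁻¹)`.
lemma triangular_mul : ρ.map (triangular ρ γ d hd) * triangularInv ρ d = 1 := by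
  have h2 : ρ.map (of ρ) * (inv ρ * (ρ.map d).map (of ρ) * inv ρ) =
      (ρ.map d).map (of ρ) * inv ρ := by
    rw [← mul_assoc, ← mul_assoc, mul_inv, one_mul]
  have hγ' : ∀ i j, γ (ρ i j) = ρ i j := fun i j => congrFun (congrFun hγ i) j
  ext i j p q
  have h1' := congrFun (congrFun (mul_inv ρ) i) j
  have h2' := congrFun (congrFun h2 i) j
  rw [Matrix.mul_apply] at h1' h2'
  rw [Matrix.mul_apply (M := (ρ.map d).map (of ρ))] at h2'
  simp only [Matrix.map_apply] at h1' h2'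
  -- The conditional defining an entry of the outer identity matrix is pushed into the `2 × 2`
  -- blocks, so that the four block entries can be compared separately.
  have h3 : ∀ c : Prop, ∀ _ : Decidable c,
      (if c then (1 : Matrix (Fin 2) (Fin 2) (Adj ρ)) else 0) =
        !![if c then 1 else 0, 0; 0, if c then 1 else 0] := by
    intro c _; split_ifs <;> ext p q <;> fin_cases p <;> fin_cases q <;> rfl
  rw [Matrix.mul_apply, Matrix.sum_apply, Matrix.one_apply, h3, ← Matrix.one_apply, ← h1']
  fin_cases p <;> fin_cases q
  · simp [triangular_apply, triangularInv, Matrix.mul_apply (n := Fin 2), Fin.sum_univ_two, hγ']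
  · simp [triangular_apply, triangularInv, Matrix.mul_apply (n := Fin 2), Fin.sum_univ_two, hγ',
      Finset.sum_add_distrib, h2', -Matrix.map_map]
  · simp [triangular_apply, triangularInv, Matrix.mul_apply (n := Fin 2), Fin.sum_univ_two]
  · simp [triangular_apply, triangularInv, Matrix.mul_apply (n := Fin 2), Fin.sum_univ_two]

include hγ in
lemma mul_triangular : triangularInv ρ d * ρ.map (triangular ρ γ d hd) = 1 := by
  have h2 : inv ρ * (ρ.map d).map (of ρ) * inv ρ * ρ.map (of ρ) =
      inv ρ * (ρ.map d).map (of ρ) := by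
    rw [mul_assoc, inv_mul, mul_one]
  have hγ' : ∀ i j, γ (ρ i j) = ρ i j := fun i j => congrFun (congrFun hγ i) j
  ext i j p q
  have h1' := congrFun (congrFun (inv_mul ρ) i) j
  have h2' := congrFun (congrFun h2 i) j
  rw [Matrix.mul_apply] at h1' h2'
  rw [Matrix.mul_apply (M := inv ρ)] at h2'
  simp only [Matrix.map_apply] at h1' h2'
  have h3 : ∀ c : Prop, ∀ _ : Decidable c,
      (if c then (1 : Matrix (Fin 2) (Fin 2) (Adj ρ)) else 0) =
        !![if c then 1 else 0, 0; 0, if c then 1 else 0] := by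
    intro c _; split_ifs <;> ext p q <;> fin_cases p <;> fin_cases q <;> rfl
  rw [Matrix.mul_apply, Matrix.sum_apply, Matrix.one_apply, h3, ← Matrix.one_apply, ← h1']
  fin_cases p <;> fin_cases q
  · simp [triangular_apply, triangularInv, Matrix.mul_apply (n := Fin 2), Fin.sum_univ_two, hγ']
  · simp [triangular_apply, triangularInv, Matrix.mul_apply (n := Fin 2), Fin.sum_univ_two, hγ',
      Finset.sum_add_distrib, h2', -Matrix.map_map]
  · simp [triangular_apply, triangularInv, Matrix.mul_apply (n := Fin 2), Fin.sum_univ_two]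
  · simp [triangular_apply, triangularInv, Matrix.mul_apply (n := Fin 2), Fin.sum_univ_two]

/-- The algebra map to triangular matrices combining `γ` and `d`. -/
def triangularLift : Adj ρ →ₐ[ℂ] Matrix (Fin 2) (Fin 2) (Adj ρ) :=
  lift ρ (triangular ρ γ d hd) (triangularInv ρ d) (triangular_mul ρ γ hγ d hd)
    (mul_triangular ρ γ hγ d hd)

/-- The three conditions cut out a subalgebra, because the matrices are triangular, and they hold on
the generators. -/
lemma triangularLift_spec (x : Adj ρ) : triangularLift ρ γ hγ d hd x 0 0 = extend ρ γ hγ x ∧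
    triangularLift ρ γ hγ d hd x 1 0 = 0 ∧ triangularLift ρ γ hγ d hd x 1 1 = x := by
  let S : Subalgebra ℂ (Adj ρ) :=
    { carrier := {x | triangularLift ρ γ hγ d hd x 0 0 = extend ρ γ hγ x ∧
        triangularLift ρ γ hγ d hd x 1 0 = 0 ∧ triangularLift ρ γ hγ d hd x 1 1 = x}
      mul_mem' := by
        rintro x y ⟨h1, h2, h3⟩ ⟨h4, h5, h6⟩
        refine ⟨?_, ?_, ?_⟩ <;>
        simp [Matrix.mul_apply, Fin.sum_univ_two, h1, h2, h3, h4, h5, h6]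
      add_mem' := by
        rintro x y ⟨h1, h2, h3⟩ ⟨h4, h5, h6⟩
        refine ⟨?_, ?_, ?_⟩ <;> simp [h1, h2, h3, h4, h5, h6]
      algebraMap_mem' := by
        intro c
        refine ⟨?_, ?_, ?_⟩ <;> simp [Matrix.algebraMap_matrix_apply] }
  refine mem_of_generators ρ S (fun x => ?_) (fun i j => ?_) x
  · change _ ∧ _ ∧ _
    rw [triangularLift, lift_of, extend_of]
    exact ⟨rfl, rfl, rfl⟩
  · change _ ∧ _ ∧ _
    rw [triangularLift, lift_inv, extend_inv]
    exact ⟨rfl, rfl, rfl⟩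

/-- The extension of a skew derivation. -/
def extendD : Adj ρ →ₗ[ℂ] Adj ρ where
  toFun x := triangularLift ρ γ hγ d hd x 0 1
  map_add' := by simp
  map_smul' := by simp

lemma extendD_of (x : B) : extendD ρ γ hγ d hd (of ρ x) = of ρ (d x) := by
  change triangularLift ρ γ hγ d hd _ 0 1 = _
  rw [triangularLift, lift_of]
  rfl

/-- The upper right entry of a product of triangular matrices with diagonal `(γ x, x)` is precisely
the skew Leibniz rule. -/
lemma extendD_mul (x y : Adj ρ) : extendD ρ γ hγ d hd (x * y) =
    extendD ρ γ hγ d hd x * y + extend ρ γ hγ x * extendD ρ γ hγ d hd y := by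
  obtain ⟨h1, h2, h3⟩ := triangularLift_spec ρ γ hγ d hd x
  obtain ⟨h4, h5, h6⟩ := triangularLift_spec ρ γ hγ d hd y
  change triangularLift ρ γ hγ d hd (x * y) 0 1 = _
  rw [map_mul, Matrix.mul_apply, Fin.sum_univ_two, h1, h6, add_comm]
  rfl

end
end Adj

/-! ### The exterior derivative on the twisted algebra of forms -/

lemma map_lact {C C' : Type} [Ring C] [Algebra ℂ C] [Ring C'] [Algebra ℂ C'] (ε : Coaction H C)
    (ε' : Coaction H C') (f : C →ₗ[ℂ] C') (hf : ∀ c, ε'.coact (f c) = f.lTensor H (ε.coact c))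
    (φ : WithConv (H →ₗ[ℂ] ℂ)) (c : C) : f (ε.lact φ c) = ε'.lact φ (f c) := by
  rw [Coaction.lact_apply, Coaction.lact_apply, hf]
  generalize ε.coact c = t
  induction t with
  | zero => simp
  | add x y hx hy => simp only [map_add, hx, hy]
  | tmul h a => simp

/-- The grading involution of the exterior algebra. -/
def parityLam : Lam →ₐ[ℂ] Lam := ExteriorAlgebra.map (-LinearMap.id : (Fin 4 → ℂ) →ₗ[ℂ] (Fin 4 → ℂ))

/-- A one-form passes `a` at the cost of `(-1)^deg a`, that is, of the grading involution. This is
the source of the sign in the Leibniz rule for `dOm`. -/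
lemma parityLam_mul_ι (a : Lam) (v : Fin 4 → ℂ) :
    parityLam a * ExteriorAlgebra.ι ℂ v = ExteriorAlgebra.ι ℂ v * a := by
  induction a using ExteriorAlgebra.induction with
  | algebraMap r => rw [AlgHom.commutes, Algebra.commutes]
  | ι w =>
    rw [parityLam, ExteriorAlgebra.map_apply_ι]
    simp only [LinearMap.neg_apply, LinearMap.id_apply, map_neg, neg_mul]
    rw [neg_eq_iff_add_eq_zero, ExteriorAlgebra.ι_add_mul_swap]
  | mul a b ha hb => rw [map_mul, mul_assoc, hb, ← mul_assoc, ha, mul_assoc]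
  | add a b ha hb => rw [map_add, add_mul, ha, hb, mul_add]

/-- The grading involution of `Ω(ℝ⁴)`, as an algebra map. -/
def parityHom : Om →ₐ[ℂ] Om := Algebra.TensorProduct.map (AlgHom.id ℂ R4) parityLam

lemma dOm_tmul (f : R4) (a : Lam) : dOm (f ⊗ₜ a) =
    ∑ i, MvPolynomial.pderiv i f ⊗ₜ (dzeta i * a) := by
  simp [dOm]

lemma dOm_mul (x y : Om) : dOm (x * y) = dOm x * y + parityHom x * dOm y := by
  induction x using TensorProduct.induction_on with
  | zero => simp
  | add x x' hx hx' => simp only [add_mul, map_add, hx, hx']; abel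
  | tmul f a =>
    induction y using TensorProduct.induction_on with
    | zero => simp
    | add y y' hy hy' => simp only [mul_add, map_add, hy, hy']; abel
    | tmul g b =>
      simp only [Algebra.TensorProduct.tmul_mul_tmul, dOm_tmul, parityHom,
        Algebra.TensorProduct.map_tmul, Finset.sum_mul, Finset.mul_sum, AlgHom.id_apply,
        ← Finset.sum_add_distrib]
      refine Finset.sum_congr rfl fun i _ => ?_
      rw [Derivation.leibniz, ← mul_assoc (parityLam a), dzeta, parityLam_mul_ι, mul_assoc,
        TensorProduct.add_tmul, add_comm]
      simp [mul_comm g]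

lemma dOm_one : dOm 1 = 0 := by simpa using dOm_mul 1 1

lemma pderiv_comm (i j : Fin 4) (f : R4) : MvPolynomial.pderiv j (MvPolynomial.pderiv i f) =
    MvPolynomial.pderiv i (MvPolynomial.pderiv j f) := by
  induction f using MvPolynomial.induction_on with
  | C c => simp
  | add p q hp hq => simp only [map_add, hp, hq]
  | mul_X p l hp =>
    have h : ∀ i j, MvPolynomial.pderiv j (MvPolynomial.pderiv i (MvPolynomial.X l : R4)) = 0 := by
      intro i j
      rw [MvPolynomial.pderiv_X]
      by_cases hl : l = i
      · subst hl; simp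
      · simp [Pi.single_eq_of_ne hl]
    simp only [Derivation.leibniz, map_add, smul_eq_mul, h, hp]
    ring

lemma dOm_dOm (x : Om) : dOm (dOm x) = 0 := by
  induction x using TensorProduct.induction_on with
  | zero => simp
  | add x x' hx hx' => simp only [map_add, hx, hx', add_zero]
  | tmul f a =>
    simp only [dOm_tmul, map_sum]
    -- The double sum is added to itself with `i` and `j` interchanged: second derivatives are
    -- symmetric and the products `dζ_j dζ_i` antisymmetric, so the terms cancel in pairs.
    have h : (2 : ℂ) • (∑ i, ∑ j, MvPolynomial.pderiv j (MvPolynomial.pderiv i f) ⊗ₜ[ℂ]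
        (dzeta j * (dzeta i * a))) = 0 := by
      rw [two_smul]
      nth_rewrite 2 [Finset.sum_comm]
      rw [← Finset.sum_add_distrib]
      refine Finset.sum_eq_zero fun i _ => ?_
      rw [← Finset.sum_add_distrib]
      refine Finset.sum_eq_zero fun j _ => ?_
      rw [pderiv_comm, ← TensorProduct.tmul_add, ← mul_assoc, ← mul_assoc,
        ← add_mul, dzeta, dzeta, ExteriorAlgebra.ι_add_mul_swap]
      simp
    exact (smul_eq_zero.mp h).resolve_left two_ne_zero

lemma dOm_zeta (i : Fin 4) : dOm (zeta i ⊗ₜ 1) = 1 ⊗ₜ dzeta i := by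
  rw [dOm_tmul, Finset.sum_eq_single i]
  · simp [zeta]
  · intro j _ hj
    simp [zeta, MvPolynomial.pderiv_X_of_ne hj.symm]
  · simp

lemma dOm_const (a : Lam) : dOm (1 ⊗ₜ a) = 0 := by simp [dOm_tmul]

/-- An equivariant skew derivation of a comodule algebra is one of the twisted algebra. -/
lemma twMul_leibniz {C : Type} [Ring C] [Algebra ℂ C] (F : Bichar H) (ε : Coaction H C)
    (d γ : C →ₗ[ℂ] C) (h : ∀ x y, d (x * y) = d x * y + γ x * d y)
    (hd : ∀ x, ε.coact (d x) = d.lTensor H (ε.coact x))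
    (hγ : ∀ x, ε.coact (γ x) = γ.lTensor H (ε.coact x)) (x y : C) :
    d (ε.twMul F x y) = ε.twMul F (d x) y + ε.twMul F (γ x) (d y) := by
  rw [Coaction.twMul_apply, Coaction.twMul_apply, Coaction.twMul_apply, hd, hγ]
  generalize ε.coact x = t
  induction t with
  | zero => simp
  | add s t hs ht => simp only [map_add, LinearMap.add_apply, hs, ht]; abel
  | tmul g a => simp [Coaction.opT_tmul, h, map_lact ε ε d hd]

namespace Symm
variable (D : Symm H) (k : ℕ)

lemma coOm_zeta (i : Fin 4) : D.coOm.coact (zeta i ⊗ₜ 1) =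
    D.g i ⊗ₜ (zeta i ⊗ₜ 1) + D.t i ⊗ₜ 1 := by
  have := D.coOm_incl (zeta i)
  refine this.trans ?_
  have h2 : D.coR.coact (zeta i) = D.g i ⊗ₜ zeta i + D.t i ⊗ₜ 1 := MvPolynomial.aeval_X _ _
  rw [h2]
  simp [Algebra.TensorProduct.one_def]

lemma coOm_dzeta (i : Fin 4) : D.coOm.coact (1 ⊗ₜ dzeta i) = D.g i ⊗ₜ (1 ⊗ₜ dzeta i) := by
  have := DFunLike.congr_fun (Coaction.tensorMap_right D.coR
    (Coaction.ext D.g D.comul_g D.counit_g)) (dzeta i)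
  refine this.trans ?_
  have h2 : (Coaction.ext D.g D.comul_g D.counit_g).coact (dzeta i) = D.g i ⊗ₜ dzeta i := by
    simp [Coaction.ext, dzeta, Coaction.extLin]
  rw [AlgHom.comp_apply, h2]
  rfl

/-- Forms are generated by the coordinates and their differentials. -/
lemma om_mem (S : Subalgebra ℂ Om) (h1 : ∀ i, zeta i ⊗ₜ 1 ∈ S) (h2 : ∀ i, 1 ⊗ₜ dzeta i ∈ S)
    (ω : Om) : ω ∈ S := by
  have hf : ∀ f : R4, f ⊗ₜ[ℂ] (1 : Lam) ∈ S := by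
    intro f
    induction f using MvPolynomial.induction_on with
    | C c =>
      have := S.algebraMap_mem c
      rwa [Algebra.TensorProduct.algebraMap_apply] at this
    | add p q hp hq => rw [TensorProduct.add_tmul]; exact S.add_mem hp hq
    | mul_X p i hp => simpa [zeta] using S.mul_mem hp (h1 i)
  have ha : ∀ a : Lam, (1 : R4) ⊗ₜ[ℂ] a ∈ S := by
    intro a
    induction a using ExteriorAlgebra.induction with
    | algebraMap r =>
      have := S.algebraMap_mem r
      rwa [Algebra.TensorProduct.algebraMap_apply'] at this
    | ι v =>
      have : v = ∑ i, v i • (Pi.single i 1 : Fin 4 → ℂ) := by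
        ext j; simp [Pi.single_apply]
      rw [this, map_sum, TensorProduct.tmul_sum]
      refine S.sum_mem fun i _ => ?_
      rw [map_smul, TensorProduct.tmul_smul]
      exact S.smul_mem (h2 i) _
    | mul a b ha hb => simpa using S.mul_mem ha hb
    | add a b ha hb => rw [TensorProduct.tmul_add]; exact S.add_mem ha hb
  induction ω using TensorProduct.induction_on with
  | zero => exact S.zero_mem
  | add x y hx hy => exact S.add_mem hx hy
  | tmul f a => simpa using S.mul_mem (hf f) (ha a)

lemma parityHom_zeta (i : Fin 4) : parityHom (zeta i ⊗ₜ 1) = zeta i ⊗ₜ 1 := by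
  simp [parityHom]

lemma parityHom_dzeta (i : Fin 4) : parityHom (1 ⊗ₜ dzeta i) = -(1 ⊗ₜ dzeta i) := by
  simp [parityHom, parityLam, dzeta, TensorProduct.tmul_neg]

/-- Both sides are algebra maps in `ω`, so it is enough to compare them on the `ζ_i` and `dζ_i`. -/
lemma parityHom_coact (ω : Om) : D.coOm.coact (parityHom ω) =
    parityHom.toLinearMap.lTensor H (D.coOm.coact ω) := by
  refine om_mem (AlgHom.equalizer (D.coOm.coact.comp parityHom)
    ((Algebra.TensorProduct.map (AlgHom.id ℂ H) parityHom).comp D.coOm.coact)) ?_ ?_ ω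
  · intro i
    change D.coOm.coact (parityHom _) = Algebra.TensorProduct.map _ _ (D.coOm.coact _)
    rw [parityHom_zeta, coOm_zeta, map_add, Algebra.TensorProduct.map_tmul,
      Algebra.TensorProduct.map_tmul, parityHom_zeta, map_one]
    rfl
  · intro i
    change D.coOm.coact (parityHom _) = Algebra.TensorProduct.map _ _ (D.coOm.coact _)
    rw [parityHom_dzeta, map_neg, coOm_dzeta, Algebra.TensorProduct.map_tmul, parityHom_dzeta,
      TensorProduct.tmul_neg]
    rfl

lemma lTensor_leibniz {C : Type} [Ring C] [Algebra ℂ C] (d : C →ₗ[ℂ] C) (γ : C →ₐ[ℂ] C)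
    (h : ∀ x y, d (x * y) = d x * y + γ x * d y) {S : Type} [Ring S] [Algebra ℂ S]
    (x y : S ⊗[ℂ] C) : d.lTensor S (x * y) =
      d.lTensor S x * y + Algebra.TensorProduct.map (AlgHom.id ℂ S) γ x * d.lTensor S y := by
  induction x using TensorProduct.induction_on with
  | zero => simp
  | add x x' hx hx' => simp only [add_mul, map_add, hx, hx']; abel
  | tmul f a =>
    induction y using TensorProduct.induction_on with
    | zero => simp
    | add y y' hy hy' => simp only [mul_add, map_add, hy, hy']; abel
    | tmul g b => simp [h, TensorProduct.tmul_add]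

/-- On generators this holds since `dζ_i` has the weight `g_i` of `ζ_i` and the translation term
`t_i ⊗ 1` is killed by `d`. It spreads to products by the Leibniz rule, the grading involution being
equivariant. -/
lemma dOm_coact (ω : Om) : D.coOm.coact (dOm ω) = dOm.lTensor H (D.coOm.coact ω) := by
  let S : Subalgebra ℂ Om :=
    { carrier := {ω | D.coOm.coact (dOm ω) = dOm.lTensor H (D.coOm.coact ω)}
      mul_mem' := by
        intro x y (hx : _ = _) (hy : _ = _)
        change _ = _
        rw [dOm_mul, map_add, map_mul, map_mul, hx, hy, parityHom_coact, map_mul,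
          lTensor_leibniz dOm parityHom dOm_mul]
        rfl
      add_mem' := by
        intro x y (hx : _ = _) (hy : _ = _)
        change _ = _
        simp only [map_add, hx, hy]
      algebraMap_mem' := by
        intro c
        change _ = _
        rw [AlgHom.commutes, Algebra.algebraMap_eq_smul_one, Algebra.algebraMap_eq_smul_one,
          map_smul, map_smul, dOm_one, map_smul, Algebra.TensorProduct.one_def,
          LinearMap.lTensor_tmul, dOm_one]
        simp }
  refine om_mem S ?_ ?_ ω
  · intro i
    change _ = _
    rw [dOm_zeta, coOm_zeta, coOm_dzeta, map_add, LinearMap.lTensor_tmul, LinearMap.lTensor_tmul,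
      dOm_zeta, dOm_one]
    simp
  · intro i
    change _ = _
    rw [dOm_const, coOm_dzeta, LinearMap.lTensor_tmul, dOm_const]
    simp

/-- The exterior derivative on the twisted algebra of forms. -/
def dTw : Tw D.F D.coOm →ₗ[ℂ] Tw D.F D.coOm :=
  (Tw.mk D.F D.coOm).toLinearMap ∘ₗ dOm ∘ₗ (Tw.mk D.F D.coOm).symm.toLinearMap

/-- The grading involution on the twisted algebra of forms. -/
def parityTw : Tw D.F D.coOm →ₐ[ℂ] Tw D.F D.coOm :=
  Tw.map D.F D.coOm D.coOm parityHom D.parityHom_coact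

lemma dTw_mul (x y : Tw D.F D.coOm) :
    D.dTw (x * y) = D.dTw x * y + D.parityTw x * D.dTw y :=
  twMul_leibniz D.F D.coOm dOm parityHom.toLinearMap dOm_mul D.dOm_coact D.parityHom_coact x y

/-- The grading involution on `(A[M_k]_F ⋊ H) ⊗ Ω(ℝ⁴)_F`. -/
def parityBig : D.BOm k →ₐ[ℂ] D.BOm k := Algebra.TensorProduct.map (AlgHom.id ℂ _) D.parityTw

lemma parityBig_inclBig (x : D.BR k) : D.parityBig k (D.inclBig k x) = D.inclBig k x := by
  induction x using TensorProduct.induction_on with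
  | zero => simp
  | add x y hx hy => simp only [map_add, hx, hy]
  | tmul x f =>
    rw [inclBig, Algebra.TensorProduct.map_tmul, parityBig, Algebra.TensorProduct.map_tmul]
    congr 1
    exact (Algebra.TensorProduct.map_tmul _ _ _ _).trans (by rw [map_one]; rfl)

/-- The twisted `d` is still a skew derivation, by equivariance. The entries of `ĝ` have degree
zero, hence are fixed by the grading involution, which is what the extension to the adjoined inverse
requires. -/
lemma exists_isDeRham : ∃ γ d, D.IsDeRham k γ d := by
  have hγ : ((D.ghat k).map (D.inclBig k)).map (D.parityBig k) = (D.ghat k).map (D.inclBig k) := by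
    ext i j
    exact D.parityBig_inclBig k _
  have hd := lTensor_leibniz D.dTw D.parityTw D.dTw_mul (S := Smash D.F (D.coM k))
  refine ⟨Adj.extend _ (D.parityBig k) hγ, Adj.extendD _ (D.parityBig k) hγ (D.dTw.lTensor _) hd,
    ⟨fun x ω => ?_, fun x ω => ?_, Adj.extendD_mul _ _ _ _ _⟩⟩
  · exact Adj.extend_of _ _ _ _
  · exact Adj.extendD_of _ _ _ _ _ _

end Symm

/-! ### The Grassmann connection and its curvature -/

section
variable {E : Type} [Ring E] [Algebra ℂ E] (γ : E →ₐ[ℂ] E) (d : E →ₗ[ℂ] E)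
  (h : ∀ x y, d (x * y) = d x * y + γ x * d y)
include h

lemma skew_one : d 1 = 0 := by simpa using h 1 1

lemma skew_matrix_mul {l m n : Type} [Fintype m] (X : Matrix l m E) (Y : Matrix m n E) :
    (X * Y).map d = X.map d * Y + X.map γ * Y.map d := by
  ext i j
  simp only [Matrix.map_apply, Matrix.mul_apply, map_sum, h, Finset.sum_add_distrib,
    Matrix.add_apply]

/-- The elements on which a skew derivation squares to zero and anticommutes with the grading. -/
def flatSubalgebra : Subalgebra ℂ E where
  carrier := {x | d (γ x) = -γ (d x) ∧ d (d x) = 0 ∧ γ (γ x) = x}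
  mul_mem' := by
    rintro x y ⟨h1, h2, h3⟩ ⟨h4, h5, h6⟩
    refine ⟨?_, ?_, ?_⟩
    · simp only [h, map_mul, map_add, h1, h3, h4]
      noncomm_ring
    · simp only [h, map_add, h1, h2, h3, h5]
      noncomm_ring
    · simp only [map_mul, h3, h6]
  add_mem' := by
    rintro x y ⟨h1, h2, h3⟩ ⟨h4, h5, h6⟩
    refine ⟨?_, ?_, ?_⟩
    · simp only [map_add, h1, h4, neg_add]
    · simp only [map_add, h2, h5, add_zero]
    · simp only [map_add, h3, h6]
  algebraMap_mem' c := by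
    have h1 := skew_one γ d h
    refine ⟨?_, ?_, ?_⟩ <;> simp [Algebra.algebraMap_eq_smul_one, h1]

/-- Differentiate `X Y = 1` and multiply by `Y` on the left. -/
lemma skew_inverse {n : Type} [Fintype n] [DecidableEq n] {X Y : Matrix n n E} (hXY : X * Y = 1)
    (hYX : Y * X = 1) (hγ : X.map γ = X) : Y.map d = -(Y * X.map d * Y) := by
  have h1 := skew_matrix_mul γ d h X Y
  have h2 : (1 : Matrix n n E).map d = 0 := by
    ext i j
    rw [Matrix.map_apply, Matrix.one_apply]
    split_ifs
    · exact skew_one γ d h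
    · exact map_zero d
  rw [hXY, hγ, h2] at h1
  calc Y.map d = Y * (X * Y.map d) := by rw [← mul_assoc, hYX, one_mul]
    _ = -(Y * X.map d * Y) := by
      rw [eq_neg_of_add_eq_zero_right h1.symm, mul_neg, mul_assoc]

/-- From `dY = -Y dX Y` and `d²X = 0` one finds that `d(Y dX Y) = dY dX Y - Y dX dY`, and the two
terms cancel after substituting `dY`. The minus sign comes from `dX` being odd. -/
lemma flat_inverse {n : Type} [Fintype n] [DecidableEq n] {X Y : Matrix n n E} (hXY : X * Y = 1)
    (hYX : Y * X = 1) (hγ : X.map γ = X) (hX : ∀ i j, X i j ∈ flatSubalgebra γ d h) (i j : n) :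
    Y i j ∈ flatSubalgebra γ d h := by
  have h0 := skew_inverse γ d h hXY hYX hγ
  have hY : Y.map γ = Y := by
    have h1 : Y.map γ * X = 1 := by
      have := congrArg (fun M : Matrix n n E => M.map γ) hYX
      simp only [Matrix.map_mul, hγ] at this
      rw [this]
      exact Matrix.map_one _ (map_zero γ) (map_one γ)
    calc Y.map γ = Y.map γ * (X * Y) := by rw [hXY, mul_one]
      _ = Y := by rw [← mul_assoc, h1, one_mul]
  have hdX : (X.map d).map γ = -X.map d := by
    ext i j
    have := (hX i j).1
    rw [show γ (X i j) = X i j from congrFun (congrFun hγ i) j] at this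
    exact (neg_eq_iff_eq_neg.mpr this).symm
  have hddX : (X.map d).map d = 0 := by
    ext i j
    exact (hX i j).2.1
  have h1 : (Y.map d).map γ = -Y.map d := by
    rw [h0, Matrix.map_neg _ (map_neg γ), Matrix.map_mul, Matrix.map_mul, hY, hdX]
    noncomm_ring
  have h2 : (Y.map d).map d = 0 := by
    have h3 : (Y.map d).map d = -((Y * (X.map d * Y)).map d) := by
      conv_lhs => rw [h0, mul_assoc]
      exact Matrix.map_neg _ (map_neg d) _
    rw [h3, skew_matrix_mul γ d h, skew_matrix_mul γ d h, hY, hdX, hddX, h0]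
    noncomm_ring
  refine ⟨?_, congrFun (congrFun h2 i) j, ?_⟩
  · rw [show γ (Y i j) = Y i j from congrFun (congrFun hY i) j]
    have := congrFun (congrFun h1 i) j
    simp only [Matrix.map_apply, Matrix.neg_apply] at this
    rw [this, neg_neg]
  · have h4 : ∀ i j, γ (Y i j) = Y i j := fun i j => congrFun (congrFun hY i) j
    rw [h4, h4]

end

lemma parityHom_dOm (x : Om) : dOm (parityHom x) = -parityHom (dOm x) := by
  induction x using TensorProduct.induction_on with
  | zero => simp
  | add x x' hx hx' => simp only [map_add, hx, hx', neg_add]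
  | tmul f a =>
    simp only [parityHom, Algebra.TensorProduct.map_tmul, dOm_tmul, map_sum, map_mul,
      ← Finset.sum_neg_distrib, AlgHom.id_apply]
    refine Finset.sum_congr rfl fun i _ => ?_
    simp [parityLam, dzeta, TensorProduct.tmul_neg]

lemma parityHom_parityHom (x : Om) : parityHom (parityHom x) = x := by
  refine Symm.om_mem (AlgHom.equalizer (parityHom.comp parityHom) (AlgHom.id ℂ Om)) ?_ ?_ x
  · intro i
    change parityHom (parityHom (zeta i ⊗ₜ 1)) = zeta i ⊗ₜ 1
    rw [Symm.parityHom_zeta, Symm.parityHom_zeta]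
  · intro i
    change parityHom (parityHom (1 ⊗ₜ dzeta i)) = 1 ⊗ₜ dzeta i
    rw [Symm.parityHom_dzeta, map_neg, Symm.parityHom_dzeta, neg_neg]

/-! ### The connection and its curvature for an arbitrary extension of the differential -/

namespace Symm
namespace IsDeRham
variable {D : Symm H} {k : ℕ} {γ : D.LocOm k →ₐ[ℂ] D.LocOm k} {d : D.LocOm k →ₗ[ℂ] D.LocOm k}
  (hd : D.IsDeRham k γ d)
include hd

lemma parity_ofOm (x : D.BOm k) : γ (D.ofOm k x) = D.ofOm k (D.parityBig k x) := by
  induction x using TensorProduct.induction_on with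
  | zero => simp
  | add x x' hx hx' => simp only [map_add, hx, hx']
  | tmul x ω => exact hd.parity x ω

lemma d_ofOm (x : D.BOm k) : d (D.ofOm k x) = D.ofOm k (D.dTw.lTensor _ x) := by
  induction x using TensorProduct.induction_on with
  | zero => simp
  | add x x' hx hx' => simp only [map_add, hx, hx']
  | tmul x ω => exact hd.d_of x ω

lemma ofOm_mem (x : D.BOm k) : D.ofOm k x ∈ flatSubalgebra γ d hd.leibniz := by
  induction x using TensorProduct.induction_on with
  | zero => rw [map_zero]; exact Subalgebra.zero_mem _
  | add x x' hx hx' => rw [map_add]; exact Subalgebra.add_mem _ hx hx'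
  | tmul x ω =>
    have h1 : ∀ ω : Om, γ (D.ofOm k (x ⊗ₜ Tw.mk D.F D.coOm ω)) =
        D.ofOm k (x ⊗ₜ Tw.mk D.F D.coOm (parityHom ω)) := hd.parity x
    have h2 := hd.d_of x
    change _ ∧ _ ∧ _
    obtain ⟨ω, rfl⟩ := (Tw.mk D.F D.coOm).surjective ω
    rw [h1, h2, h2, h1, h2, h1, parityHom_dOm, dOm_dOm, parityHom_parityHom, map_neg,
      TensorProduct.tmul_neg, map_neg, map_zero, TensorProduct.tmul_zero, map_zero]
    exact ⟨rfl, rfl, rfl⟩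

lemma parity_ghat : (((D.ghat k).map (D.inclBig k)).map (D.ofOm k)).map γ =
    ((D.ghat k).map (D.inclBig k)).map (D.ofOm k) := by
  ext i j
  simp only [Matrix.map_apply]
  rw [hd.parity_ofOm, parityBig_inclBig]

/-- That `d² = 0` is not part of `IsDeRham`. It is known on forms before localisation, passes to the
entries of `ĝ⁻¹` by `flat_inverse`, and hence holds on everything they generate. -/
lemma d_d (x : D.LocOm k) : d (d x) = 0 :=
  (Adj.mem_of_generators _ (flatSubalgebra γ d hd.leibniz) hd.ofOm_mem
    (flat_inverse γ d hd.leibniz (Adj.mul_inv _) (Adj.inv_mul _) hd.parity_ghat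
      fun _ _ => hd.ofOm_mem _) x).2.1

lemma parity_inv : (Adj.inv ((D.ghat k).map (D.inclBig k))).map γ =
    Adj.inv ((D.ghat k).map (D.inclBig k)) := by
  have h1 := congrArg (fun M => M.map γ) (Adj.inv_mul ((D.ghat k).map (D.inclBig k)))
  simp only [Matrix.map_mul, hd.parity_ghat] at h1
  rw [Matrix.map_one _ (map_zero γ) (map_one γ)] at h1
  calc _ = (Adj.inv ((D.ghat k).map (D.inclBig k))).map γ *
        (((D.ghat k).map (D.inclBig k)).map (D.ofOm k) * Adj.inv _) := by
          rw [Adj.mul_inv, mul_one]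
    _ = _ := by rw [← mul_assoc, h1, one_mul]

lemma parity_incl (x : D.LocR k) : γ (D.incl k x) = D.incl k x := by
  refine Adj.mem_of_generators _ (AlgHom.equalizer (γ.comp (D.incl k)) (D.incl k)) ?_ ?_ x
  · intro x
    change γ (D.incl k _) = D.incl k _
    rw [incl, Adj.map, Adj.lift_of, AlgHom.comp_apply, hd.parity_ofOm, parityBig_inclBig]
  · intro i j
    change γ (D.incl k _) = D.incl k _
    rw [incl, Adj.map, Adj.lift_inv]
    exact congrFun (congrFun hd.parity_inv i) j

/-- Functions are even, so no sign occurs in `d(ψ a)`, and `P̃` acts trivially on the term `ψ da`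
because `P̃ ψ = ψ`. -/
lemma connection (ψ : Fin (2 * k + 2) → D.LocR k) (hψ : (D.PR k).mulVec ψ = ψ) (a : D.LocR k) :
    D.nabla k d (fun i => D.incl k (ψ i * a)) = fun i =>
      D.nabla k d (fun l => D.incl k (ψ l)) i * D.incl k a + D.incl k (ψ i) * d (D.incl k a) := by
  funext i
  have h1 : ∀ j, d (D.incl k (ψ j * a)) =
      d (D.incl k (ψ j)) * D.incl k a + D.incl k (ψ j) * d (D.incl k a) := by
    intro j
    rw [map_mul, hd.leibniz, hd.parity_incl]
  have h2 : ∑ j, D.POm k i j * D.incl k (ψ j) = D.incl k (ψ i) := by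
    have := congrArg (D.incl k) (congrFun hψ i)
    rwa [Matrix.mulVec, dotProduct, map_sum, Finset.sum_congr rfl fun j _ => map_mul _ _ _] at this
  simp only [nabla, Matrix.mulVec, dotProduct, h1, mul_add, Finset.sum_add_distrib, ← mul_assoc,
    ← Finset.sum_mul, h2]

/-- By `d² = 0` one has `∇²ψ = P dP dψ`. Inserting `dψ = dP ψ + P dψ`, obtained from `ψ = Pψ`,
leaves `P dP dP ψ` because `P dP P = 0`. -/
lemma curv (hP : D.PR k * D.PR k = D.PR k) (ψ : Fin (2 * k + 2) → D.LocOm k)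
    (hψ : (D.POm k).mulVec ψ = ψ) :
    D.nabla k d (D.nabla k d ψ) = (D.curvature k d).mulVec ψ := by
  have hPγ : (D.POm k).map γ = D.POm k := by
    ext i j
    exact hd.parity_incl _
  have hvec : ∀ (X : Matrix (Fin (2 * k + 2)) (Fin (2 * k + 2)) (D.LocOm k)) φ,
      (fun i => d (X.mulVec φ i)) = (X.map d).mulVec φ + (X.map γ).mulVec fun i => d (φ i) := by
    intro X φ
    funext i
    simp only [Matrix.mulVec, dotProduct, map_sum, hd.leibniz, Finset.sum_add_distrib,
      Pi.add_apply, Matrix.map_apply]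
  have hPP : D.POm k * D.POm k = D.POm k := by
    rw [POm, ← Matrix.map_mul, hP]
  have h1 := skew_matrix_mul γ d hd.leibniz (D.POm k) (D.POm k)
  rw [hPγ, hPP] at h1
  -- Multiply `dP = dP P + P dP` by `P` on the left and cancel `P dP`.
  have h2 : D.POm k * (D.POm k).map d * D.POm k = 0 := by
    have := congrArg (fun M => D.POm k * M) h1
    simp only [mul_add] at this
    rw [← mul_assoc, ← mul_assoc, hPP] at this
    exact left_eq_add.mp (this.trans (add_comm _ _))
  have h3 : (fun i => d (ψ i)) = ((D.POm k).map d).mulVec ψ +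
      (D.POm k).mulVec fun i => d (ψ i) := by
    have := hvec (D.POm k) ψ
    rwa [hψ, hPγ] at this
  have h4 : (fun i => d (d (ψ i))) = 0 := funext fun i => hd.d_d (ψ i)
  calc D.nabla k d (D.nabla k d ψ) =
      (D.POm k * (D.POm k).map d).mulVec fun i => d (ψ i) := by
        have h5 := hvec (D.POm k) fun i => d (ψ i)
        rw [hPγ, h4, Matrix.mulVec_zero, add_zero] at h5
        exact (congrArg (D.POm k).mulVec h5).trans (Matrix.mulVec_mulVec _ _ _)
    _ = _ := by
        rw [h3, Matrix.mulVec_add, Matrix.mulVec_mulVec, Matrix.mulVec_mulVec, h2,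
          Matrix.zero_mulVec, add_zero, curvature, mul_assoc]

end IsDeRham
end Symm

/-! ### Anti-self-dual two-forms -/

lemma dzeta_sq (i : Fin 4) : dzeta i * dzeta i = 0 := ExteriorAlgebra.ι_sq_zero _

lemma dzeta_swap (i j : Fin 4) : dzeta i * dzeta j = -(dzeta j * dzeta i) :=
  eq_neg_of_add_eq_zero_left (ExteriorAlgebra.ι_add_mul_swap _ _)

lemma hodge_dzeta (i j : Fin 4) : hodge (dzeta i * dzeta j) =
    minor 0 1 ![Pi.single i 1, Pi.single j 1] • (dx 2 * dx 3) -
    minor 0 2 ![Pi.single i 1, Pi.single j 1] • (dx 1 * dx 3) +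
    minor 0 3 ![Pi.single i 1, Pi.single j 1] • (dx 1 * dx 2) +
    minor 1 2 ![Pi.single i 1, Pi.single j 1] • (dx 0 * dx 3) -
    minor 1 3 ![Pi.single i 1, Pi.single j 1] • (dx 0 * dx 2) +
    minor 2 3 ![Pi.single i 1, Pi.single j 1] • (dx 0 * dx 1) := hodge_mul _ _

lemma minor_single (p q i j : Fin 4) : minor p q ![Pi.single i 1, Pi.single j 1] =
    realCoord (Pi.single i 1) p * realCoord (Pi.single j 1) q -
      realCoord (Pi.single i 1) q * realCoord (Pi.single j 1) p := by
  have h : ∀ u : Fin 2 → Fin 2 → ℂ, (Matrix.detRowAlternating (n := Fin 2) (R := ℂ)) u =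
      u 0 0 * u 1 1 - u 0 1 * u 1 0 := fun u => Matrix.det_fin_two u
  rw [minor, AlternatingMap.compLinearMap_apply, h]
  simp

lemma realCoord_single (i : Fin 4) : realCoord (Pi.single i 1) =
    ![![1, -Complex.I, 0, 0], ![1, Complex.I, 0, 0], ![0, 0, 1, Complex.I],
      ![0, 0, 1, -Complex.I]] i := by
  funext p
  fin_cases i <;> fin_cases p <;> simp [realCoord]

/-- The products of the real coframe in terms of `dζ`. -/
lemma dx_mul : dx 0 * dx 1 = (Complex.I / 2) • (dzeta 1 * dzeta 0) ∧
    dx 2 * dx 3 = (Complex.I / 2) • (dzeta 2 * dzeta 3) := by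
  have hI : (2 * Complex.I)⁻¹ = -(Complex.I / 2) := by
    rw [mul_inv, Complex.inv_I]; ring
  constructor
  · simp only [dx, hI, Matrix.cons_val_zero, Matrix.cons_val_one, smul_mul_smul_comm, add_mul, mul_sub,
      dzeta_sq, dzeta_swap 0 1]
    module
  · simp only [dx, hI, Matrix.cons_val, smul_mul_smul_comm, add_mul, mul_sub,
      dzeta_sq, dzeta_swap 3 2]
    module

/-- The two-forms `dζ₁* dζ₁ + dζ₂* dζ₂`, `dζ₁* dζ₂*` and `dζ₁ dζ₂` are anti-self-dual. -/
lemma hodge_form0 : hodge (dzeta 1 * dzeta 0 + dzeta 3 * dzeta 2) =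
    -(dzeta 1 * dzeta 0 + dzeta 3 * dzeta 2) := by
  rw [map_add, hodge_dzeta, hodge_dzeta]
  simp only [minor_single, realCoord_single, dx_mul.1, dx_mul.2]
  simp [dzeta_swap 2 3, smul_smul]
  match_scalars <;> linear_combination Complex.I_sq

lemma hodge_form1 : hodge (dzeta 1 * dzeta 3) = -(dzeta 1 * dzeta 3) := by
  have hI : (2 * Complex.I)⁻¹ = -(Complex.I / 2) := by
    rw [mul_inv, Complex.inv_I]; ring
  rw [hodge_dzeta]
  simp [minor_single, realCoord_single]
  simp only [dx, hI, Matrix.cons_val_zero, Matrix.cons_val_one, Matrix.cons_val, smul_mul_smul_comm,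
    add_mul, mul_sub, mul_add, sub_mul]
  match_scalars <;> first
    | linear_combination (-1 / 4 : ℂ) * Complex.I_sq
    | linear_combination (3 / 4 : ℂ) * Complex.I_sq

lemma hodge_form2 : hodge (dzeta 0 * dzeta 2) = -(dzeta 0 * dzeta 2) := by
  have hI : (2 * Complex.I)⁻¹ = -(Complex.I / 2) := by
    rw [mul_inv, Complex.inv_I]; ring
  rw [hodge_dzeta]
  simp [minor_single, realCoord_single]
  simp only [dx, hI, Matrix.cons_val_zero, Matrix.cons_val_one, Matrix.cons_val, smul_mul_smul_comm,
    add_mul, mul_sub, mul_add, sub_mul]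
  match_scalars <;> first
    | linear_combination (-1 / 4 : ℂ) * Complex.I_sq
    | linear_combination (3 / 4 : ℂ) * Complex.I_sq

/-! ### The curvature of a Grassmann connection -/

section
variable {E : Type} [Ring E] [Algebra ℂ E] (γ : E →ₐ[ℂ] E) (d : E →ₗ[ℂ] E)
  (h : ∀ x y, d (x * y) = d x * y + γ x * d y)
  {m n ι : Type} [Fintype m] [Fintype n] [DecidableEq m] [DecidableEq n] [Fintype ι] [DecidableEq ι]
  (v : ι → Matrix m n E) (w : ι → Matrix n m E) {G Gi : Matrix n n E}
  (h1 : Gi * G = 1) (h1' : G * Gi = 1) (h2 : ∀ i j, w i * v j = if i = j then G else 0)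
  (hv : ∀ i, (v i).map γ = v i) (hG : Gi.map γ = Gi)
include h h1 h1' h2 hv hG

/-- Since `P v_i = 0`, only the term with `dv_i` survives in `P dP`; since `w_i P = 0`, only the one
with `dw_i` survives in `dP P`. Multiplying the two and using `w_i v_j = δ_ij G` gives the formula;
the derivative of `Gi` never contributes. -/
lemma curvature_eq {P : Matrix m m E} (hP : P = 1 - ∑ i, v i * Gi * w i) (hPγ : P.map γ = P) :
    P * (P.map d * P.map d) = ∑ i, P * (v i).map d * Gi * (w i).map d * P := by
  have hPP : P * P = P := by rw [hP]; exact projection_idempotent v w h1 h2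
  have hd := skew_matrix_mul γ d h P P
  rw [hPγ, hPP] at hd
  have hPdP : P * P.map d * P = 0 := by
    have := congrArg (fun M => P * M) hd
    simp only [mul_add] at this
    rw [← mul_assoc, ← mul_assoc, hPP] at this
    exact left_eq_add.mp (this.trans (add_comm _ _))
  have hsv : ∀ j, (∑ i, v i * Gi * w i) * v j = v j := by
    intro j
    rw [Matrix.sum_mul, Finset.sum_eq_single j]
    · rw [Matrix.mul_assoc, h2, if_pos rfl, Matrix.mul_assoc, h1, Matrix.mul_one]
    · intro i _ hi
      rw [Matrix.mul_assoc, h2, if_neg hi, Matrix.mul_zero]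
    · simp
  have hws : ∀ j, w j * (∑ i, v i * Gi * w i) = w j := by
    intro j
    rw [Matrix.mul_sum, Finset.sum_eq_single j]
    · rw [← Matrix.mul_assoc, ← Matrix.mul_assoc, h2, if_pos rfl, h1', Matrix.one_mul]
    · intro i _ hi
      rw [← Matrix.mul_assoc, ← Matrix.mul_assoc, h2, if_neg hi.symm, Matrix.zero_mul,
        Matrix.zero_mul]
    · simp
  have hPv : ∀ j, P * v j = 0 := fun j => by
    rw [hP, Matrix.sub_mul, hsv, Matrix.one_mul, sub_self]
  have hwP : ∀ j, w j * P = 0 := fun j => by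
    rw [hP, Matrix.mul_sub, hws, Matrix.mul_one, sub_self]
  have hone : (1 : Matrix m m E).map d = 0 := by
    ext i j
    rw [Matrix.map_apply, Matrix.one_apply]
    split_ifs
    · exact skew_one γ d h
    · exact map_zero d
  have hdP : P.map d = -∑ i, ((v i).map d * Gi * w i + v i * Gi.map d * w i +
      v i * Gi * (w i).map d) := by
    have h5 : (1 - ∑ i, v i * Gi * w i).map d = (1 : Matrix m m E).map d -
        ∑ i, (v i * Gi * w i).map d := by
      ext a b
      simp [Matrix.sum_apply]
    rw [hP, h5, hone, zero_sub]
    congr 1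
    refine Finset.sum_congr rfl fun i _ => ?_
    rw [skew_matrix_mul γ d h, skew_matrix_mul γ d h, Matrix.map_mul, hv, hG, Matrix.add_mul]
  have hL : P * P.map d = -∑ i, P * (v i).map d * Gi * w i := by
    rw [hdP, Matrix.mul_neg, Matrix.mul_sum]
    congr 1
    refine Finset.sum_congr rfl fun i _ => ?_
    simp only [Matrix.mul_add, ← Matrix.mul_assoc, hPv, Matrix.zero_mul, add_zero]
  have hR : P.map d * P = -∑ i, v i * Gi * (w i).map d * P := by
    rw [hdP, Matrix.neg_mul, Matrix.sum_mul]
    congr 1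
    refine Finset.sum_congr rfl fun i _ => ?_
    simp only [Matrix.add_mul, Matrix.mul_assoc, hwP, Matrix.mul_zero, zero_add]
  -- The second `dP` is replaced by `dP P + P dP`; the summand containing `P dP P` vanishes.
  calc P * (P.map d * P.map d) = P * P.map d * (P.map d * P) + P * P.map d * P * P.map d := by
        conv_lhs => rw [← Matrix.mul_assoc]
        conv_lhs => enter [2]; rw [hd]
        rw [Matrix.mul_add, Matrix.mul_assoc _ P]
    _ = P * P.map d * (P.map d * P) := by rw [hPdP, Matrix.zero_mul, add_zero]
    _ = ∑ i, P * (v i).map d * Gi * (w i).map d * P := by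
      rw [hL, hR, Matrix.neg_mul, Matrix.mul_neg, neg_neg, Matrix.sum_mul]
      refine Finset.sum_congr rfl fun i _ => ?_
      rw [Matrix.mul_sum, Finset.sum_eq_single i]
      · calc _ = P * (v i).map d * Gi * (w i * v i) * Gi * (w i).map d * P := by
              simp only [Matrix.mul_assoc]
          _ = P * (v i).map d * (Gi * G) * Gi * (w i).map d * P := by
              rw [h2, if_pos rfl]; simp only [Matrix.mul_assoc]
          _ = _ := by rw [h1, Matrix.mul_one]
      · intro j _ hj
        calc _ = P * (v i).map d * Gi * (w i * v j) * Gi * (w j).map d * P := by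
              simp only [Matrix.mul_assoc]
          _ = 0 := by rw [h2, if_neg hj.symm]; simp
      · simp

end

section
variable {A C C' : Type} [CommRing A] [Algebra ℂ A] [Ring C] [Algebra ℂ C] [Ring C']
    [Algebra ℂ C'] (F : Bichar H) (δ : Coaction H A) (ε : Coaction H C) (ε' : Coaction H C')
    (f : C →ₗ[ℂ] C') (hf : ∀ a, ε'.coact (f a) = f.lTensor H (ε.coact a))
include hf

/-- Naturality of the bosonisation map for linear maps of comodules. -/
lemma lTensor_bos (t : A ⊗[ℂ] C) :
    ((Tw.mk F ε').toLinearMap ∘ₗ f ∘ₗ (Tw.mk F ε).symm.toLinearMap).lTensor (Smash F δ)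
      (bos F δ ε (Tw.mk F _ t)) = bos F δ ε' (Tw.mk F _ (f.lTensor A t)) := by
  have h1 : ∀ t : A ⊗[ℂ] C,
      Coaction.ord δ ε' F.inv (f.lTensor A t) = f.lTensor A (Coaction.ord δ ε F.inv t) := by
    intro t
    induction t with
    | zero => simp
    | add x y hx hy => simp only [map_add, hx, hy]
    | tmul a c =>
      simp only [LinearMap.lTensor_tmul, Coaction.ord_tmul, hf]
      generalize ε.coact c = t
      induction t with
      | zero => simp
      | add x y hx hy => simp only [map_add, hx, hy]
      | tmul h c => simp
  have h2 : ∀ t : A ⊗[ℂ] C,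
      ((Tw.mk F ε').toLinearMap ∘ₗ f ∘ₗ (Tw.mk F ε).symm.toLinearMap).lTensor (Smash F δ)
        (mu F δ ε t) = mu F δ ε' (f.lTensor A t) := by
    intro t
    induction t with
    | zero => simp
    | add x y hx hy => simp only [map_add, hx, hy]
    | tmul a c =>
      simp only [mu, LinearMap.comp_apply,
        LinearMap.lTensor_tmul, AlgHom.toLinearMap_apply, hf]
      generalize ε.coact c = t
      induction t with
      | zero => simp
      | add x y hx hy => simp only [map_add, TensorProduct.tmul_add, hx, hy]
      | tmul h c => simp
  rw [bos_mk, bos_mk, h2]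
  exact congrArg _ (h1 t).symm

end

section
variable {A C : Type} [CommRing A] [Algebra ℂ A] [Ring C] [Algebra ℂ C] (F : Bichar H)
    (δ : Coaction H A) (ε : Coaction H C)

/-- The bosonisation map on `a ⊗ c` for `c` of weight `h`. -/
lemma bos_weight {h : H} {c : C} (hc : ε.coact c = h ⊗ₜ c) (a : A) :
    ∃ y, bos F δ ε (Tw.mk F _ (a ⊗ₜ c)) = y ⊗ₜ Tw.mk F ε c := by
  rw [bos_mk]
  change ∃ y, mu F δ ε (Coaction.ord δ ε F.inv (a ⊗ₜ c)) = _
  rw [Coaction.ord_tmul, hc]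
  refine ⟨Smash.mk F δ (Tw.mk F δ (δ.lact (F.inv.right h) a) ⊗ₜ h), ?_⟩
  simp [mu, hc, Coaction.lactR_apply]

end

/-! ### Anti-self-duality -/

/-- Applied to the `dζ`, this displays `∑ dv_i dv_i*` as a combination of the three anti-self-dual
forms: antisymmetry joins the mixed terms in pairs and gives the first form the coefficient `m m' -
n n'`. -/
lemma tmul_products {A C : Type} [CommRing A] [Algebra ℂ A] [Ring C] [Algebra ℂ C]
    (m n m' n' : A) (e₀ e₁ e₂ e₃ : C) (h0 : e₀ * e₁ = -(e₁ * e₀)) (h1 : e₂ * e₃ = -(e₃ * e₂))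
    (h2 : e₃ * e₁ = -(e₁ * e₃)) (h3 : e₂ * e₀ = -(e₀ * e₂)) :
    (m ⊗ₜ[ℂ] e₁ - n ⊗ₜ[ℂ] e₂) * (m' ⊗ₜ[ℂ] e₀ - n' ⊗ₜ[ℂ] e₃) +
      (m ⊗ₜ[ℂ] e₃ + n ⊗ₜ[ℂ] e₀) * (m' ⊗ₜ[ℂ] e₂ + n' ⊗ₜ[ℂ] e₁) =
    (m * m' - n * n') ⊗ₜ (e₁ * e₀ + e₃ * e₂) - (2 * (m * n')) ⊗ₜ (e₁ * e₃) +
      (2 * (n * m')) ⊗ₜ (e₀ * e₂) := by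
  simp only [sub_mul, mul_sub, add_mul, mul_add, Algebra.TensorProduct.tmul_mul_tmul, two_mul,
    TensorProduct.sub_tmul, TensorProduct.tmul_add, TensorProduct.add_tmul, h0, h1, h2, h3,
    TensorProduct.tmul_neg]
  abel

namespace Symm

/-- The anti-self-dual two-forms. -/
def asdForms (D : Symm H) (k : ℕ) : AddSubgroup (D.LocOm k) :=
  ((D.hodgeId k).toAddMonoidHom + AddMonoidHom.id _).ker.map (D.constForms k).toAddMonoidHom

section
variable {D : Symm H} {k : ℕ}

lemma mem_asdForms {x : D.LocOm k} : x ∈ D.asdForms k ↔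
    ∃ t, D.constForms k t = x ∧ D.hodgeId k t = -t := by
  simp only [asdForms, AddSubgroup.mem_map, AddMonoidHom.mem_ker]
  constructor
  · rintro ⟨t, h1, h2⟩
    exact ⟨t, h2, eq_neg_of_add_eq_zero_left h1⟩
  · rintro ⟨t, h1, h2⟩
    exact ⟨t, by change D.hodgeId k t + t = 0; rw [h2, neg_add_cancel], h1⟩

/-- The Hodge operator acts on the constant forms only, so it commutes with left multiplication by
functions. -/
lemma incl_mul_mem (y : D.LocR k) {x : D.LocOm k} (hx : x ∈ D.asdForms k) :
    D.incl k y * x ∈ D.asdForms k := by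
  rw [mem_asdForms] at hx ⊢
  obtain ⟨t, rfl, ht⟩ := hx
  refine ⟨(LinearMap.mulLeft ℂ y).rTensor Lam t, ?_, ?_⟩
  · clear ht
    induction t with
    | zero => simp
    | add a b ha hb => simp only [map_add, ha, hb, mul_add]
    | tmul a b => simp [constForms, mul_assoc]
  · have h1 : ∀ t, D.hodgeId k ((LinearMap.mulLeft ℂ y).rTensor Lam t) =
        (LinearMap.mulLeft ℂ y).rTensor Lam (D.hodgeId k t) := by
      intro t
      induction t with
      | zero => simp
      | add a b ha hb => simp only [map_add, ha, hb]
      | tmul a b => simp [hodgeId]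
    rw [h1, ht, map_neg]

lemma const_mem (y : Smash D.F (D.coM k)) {η : Lam} (hη : hodge η = -η) :
    D.ofOm k (y ⊗ₜ Tw.mk D.F D.coOm (1 ⊗ₜ η)) ∈ D.asdForms k := by
  rw [mem_asdForms]
  refine ⟨D.ofR k (y ⊗ₜ 1) ⊗ₜ η, ?_, ?_⟩
  · have h1 : D.incl k (D.ofR k (y ⊗ₜ 1)) = D.ofOm k (y ⊗ₜ 1) := by
      rw [incl, Adj.map, Adj.lift_of, AlgHom.comp_apply]
      exact congrArg (D.ofOm k) ((Algebra.TensorProduct.map_tmul _ _ _ _).trans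
        (by rw [map_one]; rfl))
    simp only [constForms, LinearMap.comp_apply, TensorProduct.map_tmul, AlgHom.toLinearMap_apply,
      h1, LinearMap.mul'_apply, TensorProduct.mk_apply, LinearEquiv.coe_coe]
    rw [← map_mul, Algebra.TensorProduct.tmul_mul_tmul, mul_one, one_mul]
  · simp [hodgeId, hη, TensorProduct.tmul_neg]

lemma coOm_const_mul {g g' : H} {a b : Lam} (ha : D.coOm.coact (1 ⊗ₜ a) = g ⊗ₜ (1 ⊗ₜ a))
    (hb : D.coOm.coact (1 ⊗ₜ b) = g' ⊗ₜ (1 ⊗ₜ b)) :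
    D.coOm.coact (1 ⊗ₜ (a * b)) = (g * g') ⊗ₜ (1 ⊗ₜ (a * b)) := by
  have h : (1 : R4) ⊗ₜ[ℂ] (a * b) = (1 ⊗ₜ a) * (1 ⊗ₜ b) := by simp
  rw [h, map_mul, ha, hb]
  simp

end

namespace Admissible
variable {D : Symm H} {k : ℕ} {K : Subalgebra ℂ H} (hD : D.Admissible k K)

/-- The part of `A[M_k] ⊗ Ω(ℝ⁴)` with trivial twist. -/
abbrev TOm (D : Symm H) (k : ℕ) (K : Subalgebra ℂ H) := kPart K ((D.coM k).tensor D.coOm)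

/-- The inclusion of functions into forms. -/
def toTOm : TR D k K →ₐ[ℂ] TOm D k K :=
  kMap (D.coM k) D.coR D.coOm Algebra.TensorProduct.includeLeft D.coOm_incl

/-- The forms with trivial twist, in the algebra where `g` is invertible. -/
def locOm : TOm D k K →ₐ[ℂ] D.LocOm k := (D.ofOm k).comp (phi hD.triv (D.coM k) D.coOm)

lemma incl_locR (x : TR D k K) : D.incl k (hD.locR x) = hD.locOm (toTOm x) := by
  rw [incl, Adj.map, locR, AlgHom.comp_apply, Adj.lift_of, AlgHom.comp_apply, locOm,
    AlgHom.comp_apply, toTOm, phi_kMap]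
  rfl

/-- Forms do not commute with each other, but functions are central among the classical forms, and
on the part with trivial twist this survives quantisation. -/
lemma toTOm_comm (x : TR D k K) (y : TOm D k K) : toTOm x * y = y * toTOm x := by
  apply Subtype.ext
  change tenMap (AM k) _ x.1 * y.1 = y.1 * tenMap (AM k) _ x.1
  generalize x.1 = s
  generalize y.1 = t
  induction s with
  | zero => simp
  | add a b ha hb => simp only [map_add, add_mul, mul_add, ha, hb]
  | tmul a f =>
    induction t with
    | zero => simp
    | add a b ha hb => simp only [add_mul, mul_add, ha, hb]
    | tmul b ω =>
      simp only [Algebra.TensorProduct.map_tmul, AlgHom.id_apply,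
        Algebra.TensorProduct.tmul_mul_tmul, mul_comm a, Algebra.TensorProduct.includeLeft_apply]
      congr 1
      induction ω using TensorProduct.induction_on with
      | zero => simp
      | add a b ha hb => simp only [add_mul, mul_add, ha, hb]
      | tmul g b => simp [mul_comm f]

lemma commute_incl_locR (x : TR D k K) (y : TOm D k K) :
    Commute (D.incl k (hD.locR x)) (hD.locOm y) := by
  rw [incl_locR]
  change _ * _ = _ * _
  rw [← map_mul, ← map_mul, toTOm_comm]

lemma commute_incl_inv (i j : Fin k) (y : TOm D k K) :
    Commute (D.incl k (Adj.inv (D.ghat k) i j)) (hD.locOm y) := by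
  have h1 := congrArg (fun M => M.map (D.incl k)) (Adj.mul_inv (D.ghat k))
  have h2 := congrArg (fun M => M.map (D.incl k)) (Adj.inv_mul (D.ghat k))
  simp only [Matrix.map_mul] at h1 h2
  rw [Matrix.map_one _ (map_zero (D.incl k)) (map_one (D.incl k))] at h1 h2
  refine commute_inv_entry h1 h2 (fun i j => ?_) i j
  rw [hD.ghat_map_ofR]
  exact hD.commute_incl_locR _ y

/-- The entries of `P̃` are polynomials in those of `v_i`, `v_i*` and `ĝ⁻¹`, all of which lie in the
centraliser of the image of `y`. -/
lemma commute_POm (a e : Fin (2 * k + 2)) (y : TOm D k K) :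
    Commute (D.POm k a e) (hD.locOm y) := by
  let C : Subalgebra ℂ (D.LocR k) := (Subalgebra.centralizer ℂ {hD.locOm y}).comap (D.incl k)
  have hC : ∀ x, x ∈ C ↔ Commute (D.incl k x) (hD.locOm y) := by
    intro x
    rw [Subalgebra.mem_comap, Subalgebra.mem_centralizer_iff]
    simp only [Set.mem_singleton_iff, forall_eq]
    exact ⟨fun h => h.symm, fun h => h.symm⟩
  have h1 : ∀ x, hD.locR x ∈ C := fun x => (hC _).mpr (hD.commute_incl_locR x y)
  have h2 : ∀ i j, Adj.inv (D.ghat k) i j ∈ C := fun i j => (hC _).mpr (hD.commute_incl_inv i j y)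
  refine (hC _).mp ?_
  rw [hD.PR_eq, Matrix.sub_apply, Matrix.sum_apply]
  refine C.sub_mem ?_ (C.sum_mem fun i _ => ?_)
  · rw [Matrix.one_apply]
    split_ifs
    · exact C.one_mem
    · exact C.zero_mem
  · rw [Matrix.mul_apply]
    refine C.sum_mem fun c _ => C.mul_mem ?_ (h1 _)
    rw [Matrix.mul_apply]
    exact C.sum_mem fun b _ => C.mul_mem (h1 _) (h2 _ _)

/-- The matrix `dv_i`. -/
def dv (i : Fin 2) : Matrix (Fin (2 * k + 2)) (Fin k) (TOm D k K) :=
  Matrix.of fun a b => ⟨dvec k i a b, hD.dvec_mem i a b⟩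

/-- The matrix `dv_i*`. -/
def dvs (i : Fin 2) : Matrix (Fin k) (Fin (2 * k + 2)) (TOm D k K) :=
  Matrix.of fun a b => ⟨dvecStar k i a b, hD.dvecStar_mem i a b⟩

/-- Because `d` is equivariant, bosonisation intertwines it with `id ⊗ d`. Hence `d` of a bosonised
function is the bosonisation of its classical differential. -/
lemma d_incl_locR {γ : D.LocOm k →ₐ[ℂ] D.LocOm k} {d : D.LocOm k →ₗ[ℂ] D.LocOm k}
    (hd : D.IsDeRham k γ d) (x : TR D k K) (y : TOm D k K)
    (h : y.1 = dOm.lTensor (AM k) (tenMap (AM k) Algebra.TensorProduct.includeLeft x.1)) :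
    d (D.incl k (hD.locR x)) = hD.locOm y := by
  rw [incl_locR, locOm, AlgHom.comp_apply, hd.d_ofOm, phi_apply, AlgHom.comp_apply, phi_apply, h]
  exact congrArg _ (lTensor_bos D.F (D.coM k) D.coOm D.coOm dOm D.dOm_coact _)

lemma dvec_eq (i : Fin 2) (a : Fin (2 * k + 2)) (b : Fin k) : dvec k i a b =
    dOm.lTensor (AM k) (tenMap (AM k) Algebra.TensorProduct.includeLeft (vec k i a b)) := by
  have h1 : ∀ (m : AM k) (i : Fin 4), dOm.lTensor (AM k) (tenMap (AM k)
      (Algebra.TensorProduct.includeLeft : R4 →ₐ[ℂ] Om) (m ⊗ₜ zeta i)) = m ⊗ₜ (1 ⊗ₜ dzeta i) := by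
    intro m i
    rw [Algebra.TensorProduct.map_tmul, LinearMap.lTensor_tmul,
      Algebra.TensorProduct.includeLeft_apply, dOm_zeta]
    rfl
  have h2 : ∀ m : AM k, dOm.lTensor (AM k) (tenMap (AM k)
      (Algebra.TensorProduct.includeLeft : R4 →ₐ[ℂ] Om) (m ⊗ₜ 1)) = 0 := by
    intro m
    rw [Algebra.TensorProduct.map_tmul, LinearMap.lTensor_tmul, map_one, dOm_one,
      TensorProduct.tmul_zero]
  fin_cases i <;> simp [dvec, vec, tenMat_apply, h1, h2, -Algebra.TensorProduct.map_tmul,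
    -LinearMap.lTensor_tmul]

lemma dvecStar_eq (i : Fin 2) (a : Fin k) (b : Fin (2 * k + 2)) : dvecStar k i a b =
    dOm.lTensor (AM k) (tenMap (AM k) Algebra.TensorProduct.includeLeft (vecStar k i a b)) := by
  have h1 : ∀ (m : AM k) (i : Fin 4), dOm.lTensor (AM k) (tenMap (AM k)
      (Algebra.TensorProduct.includeLeft : R4 →ₐ[ℂ] Om) (m ⊗ₜ zeta i)) = m ⊗ₜ (1 ⊗ₜ dzeta i) := by
    intro m i
    rw [Algebra.TensorProduct.map_tmul, LinearMap.lTensor_tmul,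
      Algebra.TensorProduct.includeLeft_apply, dOm_zeta]
    rfl
  have h2 : ∀ m : AM k, dOm.lTensor (AM k) (tenMap (AM k)
      (Algebra.TensorProduct.includeLeft : R4 →ₐ[ℂ] Om) (m ⊗ₜ 1)) = 0 := by
    intro m
    rw [Algebra.TensorProduct.map_tmul, LinearMap.lTensor_tmul, map_one, dOm_one,
      TensorProduct.tmul_zero]
  fin_cases i <;> simp [dvecStar, vecStar, tenMat_apply, h1, h2, -Algebra.TensorProduct.map_tmul,
    -LinearMap.lTensor_tmul]

lemma dvec_mul_dvecStar (a : Fin (2 * k + 2)) (b c : Fin k) (e : Fin (2 * k + 2)) :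
    ∑ i, dvec k i a b * dvecStar k i c e =
      (Mmat k 2 a b * Mdag k 2 c e - Mmat k 3 a b * Mdag k 3 c e) ⊗ₜ
        (1 ⊗ₜ (dzeta 1 * dzeta 0 + dzeta 3 * dzeta 2)) -
      (2 * (Mmat k 2 a b * Mdag k 3 c e)) ⊗ₜ (1 ⊗ₜ (dzeta 1 * dzeta 3)) +
      (2 * (Mmat k 3 a b * Mdag k 2 c e)) ⊗ₜ (1 ⊗ₜ (dzeta 0 * dzeta 2)) := by
  rw [Fin.sum_univ_two]
  have hs : ∀ i j, ((1 : R4) ⊗ₜ[ℂ] dzeta i) * (1 ⊗ₜ dzeta j) = 1 ⊗ₜ (dzeta i * dzeta j) := by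
    intro i j
    rw [Algebra.TensorProduct.tmul_mul_tmul, mul_one]
  have ha : ∀ i j, ((1 : R4) ⊗ₜ[ℂ] dzeta i) * (1 ⊗ₜ dzeta j) =
      -((1 ⊗ₜ dzeta j) * (1 ⊗ₜ dzeta i)) := by
    intro i j
    rw [hs, hs, dzeta_swap, TensorProduct.tmul_neg]
  have h := tmul_products (Mmat k 2 a b) (Mmat k 3 a b) (Mdag k 2 c e) (Mdag k 3 c e)
    ((1 : R4) ⊗ₜ[ℂ] dzeta 0) (1 ⊗ₜ dzeta 1) (1 ⊗ₜ dzeta 2) (1 ⊗ₜ dzeta 3) (ha 0 1) (ha 2 3) (ha 3 1)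
    (ha 2 0)
  rw [hs, hs, hs, hs, ← TensorProduct.tmul_add] at h
  exact h

/-- Each of the three anti-self-dual forms is homogeneous under the coaction. On `x ⊗ η` with `η`
homogeneous, bosonisation changes only the factor in the parameter algebra (`bos_weight`) and leaves
`η` as it is. -/
lemma locOm_mem (a : Fin (2 * k + 2)) (b c : Fin k) (e : Fin (2 * k + 2)) :
    hD.locOm (∑ i, hD.dv i a b * hD.dvs i c e) ∈ D.asdForms k := by
  have h1 : (∑ i, hD.dv i a b * hD.dvs i c e).1 = ∑ i, dvec k i a b * dvecStar k i c e := by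
    rw [Fin.sum_univ_two, Fin.sum_univ_two]
    rfl
  have key : ∀ (x : AM k) (h : H) (η : Lam), D.coOm.coact (1 ⊗ₜ η) = h ⊗ₜ (1 ⊗ₜ η) →
      hodge η = -η → D.ofOm k (bos D.F (D.coM k) D.coOm (Tw.mk D.F _ (x ⊗ₜ (1 ⊗ₜ η)))) ∈
        D.asdForms k := by
    intro x h η h1 h2
    obtain ⟨y, hy⟩ := bos_weight D.F (D.coM k) D.coOm h1 x
    rw [hy]
    exact const_mem y h2
  have hz := D.coOm_dzeta
  -- The summands `dζ₁* dζ₁` and `dζ₂* dζ₂` have the weights `g₁ g₀` and `g₃ g₂`; by `g_rel` these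
  -- agree, so the sum is homogeneous.
  have h0 : D.coOm.coact (1 ⊗ₜ (dzeta 1 * dzeta 0 + dzeta 3 * dzeta 2)) =
      (D.g 1 * D.g 0) ⊗ₜ (1 ⊗ₜ (dzeta 1 * dzeta 0 + dzeta 3 * dzeta 2)) := by
    rw [TensorProduct.tmul_add, map_add, coOm_const_mul (hz 1) (hz 0),
      coOm_const_mul (hz 3) (hz 2), ← hD.g_rel, TensorProduct.tmul_add]
  rw [locOm, AlgHom.comp_apply, phi_apply, h1, dvec_mul_dvecStar]
  simp only [map_add, map_sub]
  exact (D.asdForms k).add_mem ((D.asdForms k).sub_mem (key _ _ _ h0 hodge_form0)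
    (key _ _ _ (coOm_const_mul (hz 1) (hz 3)) hodge_form1))
    (key _ _ _ (coOm_const_mul (hz 0) (hz 2)) hodge_form2)

lemma curvature_formula {γ : D.LocOm k →ₐ[ℂ] D.LocOm k} {d : D.LocOm k →ₗ[ℂ] D.LocOm k}
    (hd : D.IsDeRham k γ d) : D.curvature k d = ∑ i, D.POm k * (hD.dv i).map hD.locOm *
      (Adj.inv (D.ghat k)).map (D.incl k) * (hD.dvs i).map hD.locOm * D.POm k := by
  have h1 := congrArg (fun M => M.map (D.incl k)) (Adj.mul_inv (D.ghat k))
  have h2 := congrArg (fun M => M.map (D.incl k)) (Adj.inv_mul (D.ghat k))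
  simp only [Matrix.map_mul] at h1 h2
  rw [Matrix.map_one _ (map_zero (D.incl k)) (map_one (D.incl k))] at h1 h2
  have h := curvature_eq γ d hd.leibniz (fun i => ((hD.v i).map hD.locR).map (D.incl k))
    (fun i => ((hD.vs i).map hD.locR).map (D.incl k)) h2 h1
    (fun i j => by
      rw [← Matrix.map_mul, hD.locR_vs_mul_v]
      split_ifs
      · rfl
      · exact Matrix.map_zero _ (map_zero _))
    (fun i => by ext a b; exact hd.parity_incl _)
    (by ext a b; exact hd.parity_incl _)
    (P := D.POm k)
    (by
      rw [POm, hD.PR_eq]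
      ext a b
      simp only [Matrix.map_apply, Matrix.sub_apply, Matrix.sum_apply, map_sub, map_sum,
        ← Matrix.map_mul]
      congr 1
      rw [Matrix.one_apply, Matrix.one_apply]
      split_ifs <;> simp)
    (by ext a b; exact hd.parity_incl _)
  refine h.trans (Finset.sum_congr rfl fun i _ => ?_)
  have e1 : (((hD.v i).map hD.locR).map (D.incl k)).map d = (hD.dv i).map hD.locOm := by
    ext a b
    exact hD.d_incl_locR hd _ _ (dvec_eq i a b)
  have e2 : (((hD.vs i).map hD.locR).map (D.incl k)).map d = (hD.dvs i).map hD.locOm := by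
    ext a b
    exact hD.d_incl_locR hd _ _ (dvecStar_eq i a b)
  rw [e1, e2]

include hD in
-- The curvature is a left multiple, by functions, of `∑ dv_i dv_i*`. Here it matters that the
-- functions can be moved to the left, since `*` has only been seen to commute with multiplication
-- on that side.
lemma curvature_mem {γ : D.LocOm k →ₐ[ℂ] D.LocOm k} {d : D.LocOm k →ₗ[ℂ] D.LocOm k}
    (hd : D.IsDeRham k γ d) (a e : Fin (2 * k + 2)) : D.curvature k d a e ∈ D.asdForms k := by
  have h : D.curvature k d a e = ∑ f, ∑ c, ∑ b, ∑ p,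
      D.incl k (D.PR k a p * Adj.inv (D.ghat k) b c * D.PR k f e) *
        hD.locOm (∑ i, hD.dv i p b * hD.dvs i c f) := by
    rw [hD.curvature_formula hd, Matrix.sum_apply]
    simp only [map_sum, map_mul, Finset.mul_sum, Matrix.mul_apply, Finset.sum_mul, Matrix.map_apply]
    rw [Finset.sum_comm]
    refine Finset.sum_congr rfl fun f _ => ?_
    rw [Finset.sum_comm]
    refine Finset.sum_congr rfl fun c _ => ?_
    rw [Finset.sum_comm]
    refine Finset.sum_congr rfl fun b _ => ?_
    rw [Finset.sum_comm]
    refine Finset.sum_congr rfl fun p _ => Finset.sum_congr rfl fun i _ => ?_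
    -- The right-hand factor of `P̃` is moved past `dv_i*` and then past `dv_i`, and `ĝ⁻¹` past
    -- `dv_i`.
    have c1 := (hD.commute_incl_inv b c (hD.dv i p b)).eq
    have c2 := (hD.commute_POm f e (hD.dv i p b)).eq
    have c3 := (hD.commute_POm f e (hD.dvs i c f)).eq
    change D.POm k a p * _ * _ * _ * D.POm k f e = D.POm k a p * _ * D.POm k f e * _
    simp only [mul_assoc]
    rw [← c3, ← mul_assoc (D.POm k f e), c2]
    simp only [← mul_assoc]
    rw [mul_assoc (D.POm k a p), ← c1]
    simp only [mul_assoc]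
  rw [h]
  exact sum_mem fun f _ => sum_mem fun c _ => sum_mem fun b _ => sum_mem fun p _ =>
    incl_mul_mem _ (hD.locOm_mem _ _ _ _)

include hD in
lemma asd {γ : D.LocOm k →ₐ[ℂ] D.LocOm k} {d : D.LocOm k →ₗ[ℂ] D.LocOm k}
    (hd : D.IsDeRham k γ d) : D.IsASD k (D.curvature k d) := by
  choose G h1 h2 using fun a e => mem_asdForms.mp (hD.curvature_mem hd a e)
  exact ⟨Matrix.of G, by ext a e; exact h1 a e, by ext a e; exact h2 a e⟩

include hD in
lemma isInstantonFamily : D.IsInstantonFamily k where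
  Vs_mul_V := hD.Vs_mul_V
  idempotent := hD.idempotent
  trace := hD.trace
  descends := hD.descends
  idempotentR := hD.idempotentR
  traceR := hD.traceR
  finite := rangeModule_finite _ hD.idempotentR
  projective := rangeModule_projective _ hD.idempotentR
  exists_d := D.exists_isDeRham k
  connection _ _ hd ψ hψ a := hd.connection ψ hψ a
  curv _ _ hd ψ hψ := hd.curv hD.idempotentR ψ hψ
  asd _ _ hd := hD.asd hd

end Admissible
end Symm

/-! ### Coactions on the generators -/

namespace Coaction
variable {A C : Type} [CommRing A] [Algebra ℂ A] [Ring C] [Algebra ℂ C] (δ : Coaction H A)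
  (ε : Coaction H C) (F : Bichar H)

lemma tensor_coact_weight {h h' : H} {a : A} {c : C} (ha : δ.coact a = h ⊗ₜ a)
    (hc : ε.coact c = h' ⊗ₜ c) : (δ.tensor ε).coact (a ⊗ₜ c) = (h * h') ⊗ₜ (a ⊗ₜ c) := by
  have h1 : a ⊗ₜ[ℂ] c = (a ⊗ₜ 1) * (1 ⊗ₜ c) := by simp
  rw [h1, map_mul, tensor_coact_left, tensor_coact_right, ha, hc]
  simp

/-- On homogeneous elements normal ordering is multiplication by the scalar `F(S h, h')`. -/
lemma normalOrder_weight {h h' : H} {a : A} {c : C} (ha : δ.coact a = h ⊗ₜ a)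
    (hc : ε.coact c = h' ⊗ₜ c) (hF : (F.left (HopfAlgebra.antipode ℂ h)).ofConv h' = 1) :
    normalOrder F δ ε (a ⊗ₜ c) = a ⊗ₜ c := by
  change ord δ ε F.inv (a ⊗ₜ c) = _
  rw [ord_tmul, hc, LinearMap.rTensor_tmul, lactR_apply, lact_apply, ha, LinearMap.rTensor_tmul,
    TensorProduct.lid_tmul, ← Bichar.left_eq_right]
  change (F.left (HopfAlgebra.antipode ℂ h)).ofConv h' • a ⊗ₜ[ℂ] c = _
  rw [hF, one_smul]

/-- A coinvariant factor pairs through `F⁻¹(·,1) = ε`; `normalOrder_left` rests on `F⁻¹(1,·) = ε`.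
-/
lemma normalOrder_right {a : A} {c : C} (hc : ε.coact c = 1 ⊗ₜ c) :
    normalOrder F δ ε (a ⊗ₜ c) = a ⊗ₜ c := by
  change ord δ ε F.inv (a ⊗ₜ c) = _
  rw [ord_tmul, hc, LinearMap.rTensor_tmul, lactR_apply, map_one, lact_one]
  rfl

lemma normalOrder_left {a : A} {c : C} (ha : δ.coact a = 1 ⊗ₜ a) :
    normalOrder F δ ε (a ⊗ₜ c) = a ⊗ₜ c := by
  change ord δ ε F.inv (a ⊗ₜ c) = _
  rw [ord_tmul]
  have h1 : ∀ t : H ⊗[ℂ] C, (δ.lactR F.inv a).rTensor C t =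
      a ⊗ₜ (TensorProduct.lid ℂ C ((Coalgebra.counit (R := ℂ)).rTensor C t)) := by
    intro t
    induction t with
    | zero => simp
    | add x y hx hy => simp only [map_add, TensorProduct.tmul_add, hx, hy]
    | tmul h c =>
      rw [LinearMap.rTensor_tmul, lactR_apply, lact_apply, ha, LinearMap.rTensor_tmul,
        TensorProduct.lid_tmul, ← Bichar.left_eq_right, Bichar.left_eq_right, ← Bichar.left_eq_right]
      have : (F.inv.left 1).ofConv h = Coalgebra.counit (R := ℂ) h := F.inv.left_one_apply h
      rw [this, LinearMap.rTensor_tmul, TensorProduct.lid_tmul, TensorProduct.tmul_smul,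
        TensorProduct.smul_tmul']
  rw [h1]
  exact congrArg _ (DFunLike.congr_fun ε.counit c)

end Coaction

namespace Symm
variable (D : Symm H) (k : ℕ)

lemma coM_Mmat (j : Fin 4) (a : Fin (2 * k + 2)) (b : Fin k) : (D.coM k).coact (Mmat k j a b) =
    ∑ r, HopfAlgebra.antipode ℂ (D.A r j) ⊗ₜ Mmat k r a b := by
  change Algebra.TensorProduct.map (AlgHom.id ℂ H) (Ideal.Quotient.mkₐ ℂ (monadIdeal k))
    (MvPolynomial.aeval _ (MvPolynomial.X (j, Sum.inl (a, b)))) = _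
  rw [MvPolynomial.aeval_X, map_sum]
  rfl

lemma coM_Nmat (j : Fin 4) (a : Fin k) (b : Fin (2 * k + 2)) : (D.coM k).coact (Nmat k j a b) =
    ∑ r, HopfAlgebra.antipode ℂ (D.A r j) ⊗ₜ Nmat k r a b := by
  change Algebra.TensorProduct.map (AlgHom.id ℂ H) (Ideal.Quotient.mkₐ ℂ (monadIdeal k))
    (MvPolynomial.aeval _ (MvPolynomial.X (j, Sum.inr (a, b)))) = _
  rw [MvPolynomial.aeval_X, map_sum]
  rfl

lemma coC4_z (j : Fin 4) : D.coC4.coact (z j) = ∑ r, D.A j r ⊗ₜ z r :=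
  MvPolynomial.aeval_X _ _

lemma coC4_zs (j : Fin 4) : D.coC4.coact (zs j) = ∑ r, D.As j r ⊗ₜ zs r :=
  MvPolynomial.aeval_X _ _

lemma coC_weight {h : H} {x : C4} (hx : D.coC4.coact x = h ⊗ₜ x) :
    D.coC.coact (zc x) = h ⊗ₜ zc x := by
  rw [D.coC_coact_algebraMap, hx]
  rfl

lemma coR_zeta (i : Fin 4) : D.coR.coact (zeta i) = D.g i ⊗ₜ zeta i + D.t i ⊗ₜ 1 :=
  MvPolynomial.aeval_X _ _

lemma dvec_apply (a : Fin (2 * k + 2)) (b : Fin k) :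
    dvec k 0 a b = Mmat k 2 a b ⊗ₜ (1 ⊗ₜ dzeta 1) - Mmat k 3 a b ⊗ₜ (1 ⊗ₜ dzeta 2) ∧
    dvec k 1 a b = Mmat k 2 a b ⊗ₜ (1 ⊗ₜ dzeta 3) + Mmat k 3 a b ⊗ₜ (1 ⊗ₜ dzeta 0) := by
  simp [dvec, tenMat_apply]

lemma dvecStar_apply (a : Fin k) (b : Fin (2 * k + 2)) :
    dvecStar k 0 a b = Mdag k 2 a b ⊗ₜ (1 ⊗ₜ dzeta 0) - Mdag k 3 a b ⊗ₜ (1 ⊗ₜ dzeta 3) ∧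
    dvecStar k 1 a b = Mdag k 2 a b ⊗ₜ (1 ⊗ₜ dzeta 2) + Mdag k 3 a b ⊗ₜ (1 ⊗ₜ dzeta 1) := by
  simp [dvecStar, tenMat_apply]

/-- As `r` is a coinvariant unit, the denominator can be cleared, and the coaction need only be
known on the quadratic numerators. -/
lemma zetaC_coact_of_quad (i : Fin 4)
    (h : D.coC4.coact (quad i) = D.g i ⊗ₜ quad i + D.t i ⊗ₜ rr) :
    D.coC.coact (zetaC i) = D.g i ⊗ₜ zetaC i + D.t i ⊗ₜ 1 := by
  have hu : IsUnit ((1 : H) ⊗ₜ[ℂ] zc rr) :=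
    (IsLocalization.Away.algebraMap_isUnit rr : IsUnit (zc rr)).map
      (Algebra.TensorProduct.includeRight : C4loc →ₐ[ℂ] H ⊗[ℂ] C4loc)
  refine hu.mul_left_cancel ?_
  conv_lhs => rw [← D.coC_coact_rr, ← map_mul, rr_mul_zetaC, D.coC_coact_algebraMap, h]
  rw [mul_add, Algebra.TensorProduct.tmul_mul_tmul, Algebra.TensorProduct.tmul_mul_tmul, one_mul,
    one_mul, mul_one, rr_mul_zetaC, map_add]
  rfl

end Symm

/-! ### The Moyal case -/

lemma antipode_tau (i : Fin 4) : HopfAlgebra.antipode ℂ (tau i) = -tau i := by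
  change SymmetricAlgebra.lift _ (SymmetricAlgebra.ι ℂ (Fin 4 → ℂ) (Pi.single i 1)) = _
  rw [SymmetricAlgebra.lift_ι_apply]
  rfl

/-- On scalars any bicharacter is trivial, by unitality. -/
lemma trivialOn_bot (F : Bichar H) : TrivialOn F ⊥ := by
  intro h hh g _
  obtain ⟨c, rfl⟩ := Algebra.mem_bot.mp hh
  rw [AlgHom.commutes, Bialgebra.counit_algebraMap, Algebra.algebraMap_eq_smul_one, ← map_one F.left]
  change c • (F.left 1).ofConv g = _
  rw [F.left_one_apply]
  rfl

section
variable (ħ : ℝ) (α β : ℂ) (k : ℕ)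

lemma moyal_Mmat (a : Fin (2 * k + 2)) (b : Fin k) :
    ((moyal ħ α β).coM k).coact (Mmat k 0 a b) = 1 ⊗ₜ Mmat k 0 a b -
      tau 1 ⊗ₜ Mmat k 2 a b + tau 2 ⊗ₜ Mmat k 3 a b ∧
    ((moyal ħ α β).coM k).coact (Mmat k 1 a b) = 1 ⊗ₜ Mmat k 1 a b -
      tau 3 ⊗ₜ Mmat k 2 a b - tau 0 ⊗ₜ Mmat k 3 a b ∧
    ((moyal ħ α β).coM k).coact (Mmat k 2 a b) = 1 ⊗ₜ Mmat k 2 a b ∧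
    ((moyal ħ α β).coM k).coact (Mmat k 3 a b) = 1 ⊗ₜ Mmat k 3 a b := by
  simp [Symm.coM_Mmat, Fin.sum_univ_four, moyal, antipode_tau, TensorProduct.neg_tmul,
    sub_eq_add_neg]

lemma moyal_Nmat (a : Fin k) (b : Fin (2 * k + 2)) :
    ((moyal ħ α β).coM k).coact (Nmat k 0 a b) = 1 ⊗ₜ Nmat k 0 a b -
      tau 1 ⊗ₜ Nmat k 2 a b + tau 2 ⊗ₜ Nmat k 3 a b ∧
    ((moyal ħ α β).coM k).coact (Nmat k 1 a b) = 1 ⊗ₜ Nmat k 1 a b -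
      tau 3 ⊗ₜ Nmat k 2 a b - tau 0 ⊗ₜ Nmat k 3 a b ∧
    ((moyal ħ α β).coM k).coact (Nmat k 2 a b) = 1 ⊗ₜ Nmat k 2 a b ∧
    ((moyal ħ α β).coM k).coact (Nmat k 3 a b) = 1 ⊗ₜ Nmat k 3 a b := by
  simp [Symm.coM_Nmat, Fin.sum_univ_four, moyal, antipode_tau, TensorProduct.neg_tmul,
    sub_eq_add_neg]

lemma mem_kPart_bot {C : Type} [Ring C] [Algebra ℂ C] {ε : Coaction H C} {c : C}
    (hc : ε.coact c = 1 ⊗ₜ c) : c ∈ kPart ⊥ ε :=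
  mem_kPart_of_weight (one_mem _) hc

lemma moyal_zeta (i : Fin 4) :
    (moyal ħ α β).coR.coact (zeta i) = 1 ⊗ₜ zeta i + tau i ⊗ₜ 1 :=
  (moyal ħ α β).coR_zeta i

lemma tensor_coact_tmul {A C : Type} [CommRing A] [Algebra ℂ A] [Ring C] [Algebra ℂ C]
    (δ : Coaction H A) (ε : Coaction H C) (x : A) (f : C) : (δ.tensor ε).coact (x ⊗ₜ f) =
      Algebra.TensorProduct.map (AlgHom.id ℂ H) Algebra.TensorProduct.includeLeft (δ.coact x) *
      Algebra.TensorProduct.map (AlgHom.id ℂ H) Algebra.TensorProduct.includeRight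
        (ε.coact f) := by
  have h1 : x ⊗ₜ[ℂ] f = (x ⊗ₜ 1) * (1 ⊗ₜ f) := by simp
  rw [h1, map_mul, Coaction.tensor_coact_left, Coaction.tensor_coact_right]
  rfl

/-- The vectors `v_i` are translation invariant: the shift `-t₁* ⊗ M³ + t₂ ⊗ M⁴` of `M¹` cancels the
shifts of `ζ₁*` and `ζ₂` in `M³ ζ₁* - M⁴ ζ₂`, and similarly for `v₂`. -/
lemma moyal_vec (i : Fin 2) (a : Fin (2 * k + 2)) (b : Fin k) :
    (((moyal ħ α β).coM k).tensor (moyal ħ α β).coR).coact (Symm.vec k i a b) =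
      1 ⊗ₜ Symm.vec k i a b := by
  obtain ⟨h0, h1, h2, h3⟩ := moyal_Mmat ħ α β k a b
  fin_cases i
  · simp only [Symm.vec, Fin.zero_eta, Matrix.cons_val, Matrix.of_apply, map_add, map_sub,
      tensor_coact_tmul, h0, h2, h3, moyal_zeta, map_one, Algebra.TensorProduct.map_tmul,
      AlgHom.id_apply, Algebra.TensorProduct.includeLeft_apply, mul_add,
      Algebra.TensorProduct.includeRight_apply, Algebra.TensorProduct.tmul_mul_tmul, mul_one, one_mul,
      TensorProduct.tmul_add, TensorProduct.tmul_sub]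
    abel
  · simp only [Symm.vec, Fin.mk_one, Matrix.cons_val, Matrix.of_apply, map_add, map_sub,
      tensor_coact_tmul, h1, h2, h3, moyal_zeta, map_one, Algebra.TensorProduct.map_tmul,
      AlgHom.id_apply, Algebra.TensorProduct.includeLeft_apply, mul_add,
      Algebra.TensorProduct.includeRight_apply, Algebra.TensorProduct.tmul_mul_tmul, mul_one, one_mul,
      TensorProduct.tmul_add, TensorProduct.tmul_sub]
    abel

lemma moyal_vecStar (i : Fin 2) (a : Fin k) (b : Fin (2 * k + 2)) :
    (((moyal ħ α β).coM k).tensor (moyal ħ α β).coR).coact (Symm.vecStar k i a b) =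
      1 ⊗ₜ Symm.vecStar k i a b := by
  obtain ⟨h0, h1, h2, h3⟩ := moyal_Nmat ħ α β k a b
  fin_cases i
  · simp only [Symm.vecStar, Fin.zero_eta, Matrix.cons_val, Matrix.of_apply, map_add, map_sub,
      Mdag, Matrix.cons_val, Matrix.neg_apply, TensorProduct.neg_tmul, map_neg,
      tensor_coact_tmul, h0, h1, h2, h3, moyal_zeta, map_one, Algebra.TensorProduct.map_tmul,
      AlgHom.id_apply, Algebra.TensorProduct.includeLeft_apply, mul_add,
      Algebra.TensorProduct.includeRight_apply, Algebra.TensorProduct.tmul_mul_tmul, mul_one, one_mul,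
      TensorProduct.tmul_add, TensorProduct.tmul_sub, TensorProduct.tmul_neg]
    abel
  · simp only [Symm.vecStar, Fin.mk_one, Matrix.cons_val, Matrix.of_apply, map_add, map_sub,
      Mdag, Matrix.cons_val, Matrix.neg_apply, TensorProduct.neg_tmul, map_neg,
      tensor_coact_tmul, h0, h1, h2, h3, moyal_zeta, map_one, Algebra.TensorProduct.map_tmul,
      AlgHom.id_apply, Algebra.TensorProduct.includeLeft_apply, mul_add,
      Algebra.TensorProduct.includeRight_apply, Algebra.TensorProduct.tmul_mul_tmul, mul_one, one_mul,
      TensorProduct.tmul_add, TensorProduct.tmul_sub, TensorProduct.tmul_neg]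
    abel

lemma moyal_z : (moyal ħ α β).coC4.coact (z 0) = 1 ⊗ₜ z 0 ∧
    (moyal ħ α β).coC4.coact (z 1) = 1 ⊗ₜ z 1 ∧
    (moyal ħ α β).coC4.coact (z 2) = tau 1 ⊗ₜ z 0 + tau 3 ⊗ₜ z 1 + 1 ⊗ₜ z 2 ∧
    (moyal ħ α β).coC4.coact (z 3) = -(tau 2 ⊗ₜ z 0) + tau 0 ⊗ₜ z 1 + 1 ⊗ₜ z 3 := by
  simp [Symm.coC4_z, Fin.sum_univ_four, moyal, TensorProduct.neg_tmul]

lemma moyal_zs : (moyal ħ α β).coC4.coact (zs 0) = 1 ⊗ₜ zs 0 ∧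
    (moyal ħ α β).coC4.coact (zs 1) = 1 ⊗ₜ zs 1 ∧
    (moyal ħ α β).coC4.coact (zs 2) = tau 0 ⊗ₜ zs 0 + tau 2 ⊗ₜ zs 1 + 1 ⊗ₜ zs 2 ∧
    (moyal ħ α β).coC4.coact (zs 3) = -(tau 3 ⊗ₜ zs 0) + tau 1 ⊗ₜ zs 1 + 1 ⊗ₜ zs 3 := by
  simp [Symm.coC4_zs, Fin.sum_univ_four, moyal, TensorProduct.neg_tmul]

lemma moyal_quad (i : Fin 4) : (moyal ħ α β).coC4.coact (Symm.quad i) =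
    1 ⊗ₜ Symm.quad i + tau i ⊗ₜ rr := by
  obtain ⟨h0, h1, h2, h3⟩ := moyal_z ħ α β
  obtain ⟨h0', h1', h2', h3'⟩ := moyal_zs ħ α β
  fin_cases i <;>
  simp only [Symm.quad, Matrix.cons_val, Fin.zero_eta, Fin.mk_one, Fin.reduceFinMk, map_add, map_sub, map_mul, h0, h1, h2, h3, h0', h1', h2',
      h3', mul_add, add_mul, Algebra.TensorProduct.tmul_mul_tmul, one_mul, mul_one, rr,
      TensorProduct.tmul_add, TensorProduct.tmul_sub, mul_neg, neg_mul, mul_comm (zs _) (z _)] <;>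
  abel

lemma moyal_tmul_dzeta {x : AM k} (i : Fin 4) (hx : ((moyal ħ α β).coM k).coact x = 1 ⊗ₜ x) :
    x ⊗ₜ (1 ⊗ₜ dzeta i) ∈ kPart ⊥ (((moyal ħ α β).coM k).tensor (moyal ħ α β).coOm) :=
  mem_kPart_bot ((Coaction.tensor_coact_weight _ _ hx ((moyal ħ α β).coOm_dzeta i)).trans
    (congrArg (· ⊗ₜ _) (one_mul 1)))

lemma moyal_dvec (i : Fin 2) (a : Fin (2 * k + 2)) (b : Fin k) : Symm.dvec k i a b ∈
    kPart ⊥ (((moyal ħ α β).coM k).tensor (moyal ħ α β).coOm) := by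
  obtain ⟨-, -, h2, h3⟩ := moyal_Mmat ħ α β k a b
  have h := fun i => moyal_tmul_dzeta ħ α β k i h2
  have h' := fun i => moyal_tmul_dzeta ħ α β k i h3
  obtain ⟨e0, e1⟩ := Symm.dvec_apply k a b
  revert i
  rw [Fin.forall_fin_two, e0, e1]
  exact ⟨Subalgebra.sub_mem _ (h 1) (h' 2), Subalgebra.add_mem _ (h 3) (h' 0)⟩

lemma moyal_dvecStar (i : Fin 2) (a : Fin k) (b : Fin (2 * k + 2)) : Symm.dvecStar k i a b ∈
    kPart ⊥ (((moyal ħ α β).coM k).tensor (moyal ħ α β).coOm) := by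
  obtain ⟨-, -, h2, h3⟩ := moyal_Nmat ħ α β k a b
  have h3' : ((moyal ħ α β).coM k).coact (-Nmat k 3 a b) = 1 ⊗ₜ (-Nmat k 3 a b) := by
    rw [map_neg, h3, TensorProduct.tmul_neg]
  have h := fun i => moyal_tmul_dzeta ħ α β k i h2
  have h' := fun i => moyal_tmul_dzeta ħ α β k i h3'
  obtain ⟨e0, e1⟩ := Symm.dvecStar_apply k a b
  revert i
  rw [Fin.forall_fin_two, e0, e1]
  exact ⟨Subalgebra.sub_mem _ (h' 0) (h 3), Subalgebra.add_mem _ (h' 2) (h 1)⟩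

/-- All the elements concerned are coinvariant, so `K` can be the scalars. Normal ordering fixes
each summand of `σ` because one of its factors is coinvariant: the twistor coordinate for the first
two indices, the matrix `M^j` or `M^j†` for the last two. -/
lemma admissible_moyal : (moyal ħ α β).Admissible k ⊥ where
  triv := trivialOn_bot _
  vec_mem i a b := mem_kPart_bot (moyal_vec ħ α β k i a b)
  vecStar_mem i a b := mem_kPart_bot (moyal_vecStar ħ α β k i a b)
  dvec_mem := moyal_dvec ħ α β k
  dvecStar_mem := moyal_dvecStar ħ α β k
  z0_mem := mem_kPart_bot ((moyal ħ α β).coC_weight (moyal_z ħ α β).1)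
  z1_mem := mem_kPart_bot ((moyal ħ α β).coC_weight (moyal_z ħ α β).2.1)
  zs0_mem := mem_kPart_bot ((moyal ħ α β).coC_weight (moyal_zs ħ α β).1)
  zs1_mem := mem_kPart_bot ((moyal ħ α β).coC_weight (moyal_zs ħ α β).2.1)
  zetaC_coact i := (moyal ħ α β).zetaC_coact_of_quad i (moyal_quad ħ α β i)
  order_z j a b := by
    obtain ⟨-, -, h2, h3⟩ := moyal_Mmat ħ α β k a b
    fin_cases j
    · exact Coaction.normalOrder_right _ _ _ ((moyal ħ α β).coC_weight (moyal_z ħ α β).1)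
    · exact Coaction.normalOrder_right _ _ _ ((moyal ħ α β).coC_weight (moyal_z ħ α β).2.1)
    · exact Coaction.normalOrder_left _ _ _ h2
    · exact Coaction.normalOrder_left _ _ _ h3
  order_Jz j a b := by
    obtain ⟨-, -, h2, h3⟩ := moyal_Mmat ħ α β k a b
    fin_cases j
    · exact Coaction.normalOrder_right _ _ _ ((moyal ħ α β).coC_weight (x := -zs 1)
        (by rw [map_neg, (moyal_zs ħ α β).2.1, TensorProduct.tmul_neg]))
    · exact Coaction.normalOrder_right _ _ _ ((moyal ħ α β).coC_weight (moyal_zs ħ α β).1)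
    · exact Coaction.normalOrder_left _ _ _ h2
    · exact Coaction.normalOrder_left _ _ _ h3
  order_zs j a b := by
    obtain ⟨-, -, h2, h3⟩ := moyal_Nmat ħ α β k a b
    have h3' : ((moyal ħ α β).coM k).coact (-Nmat k 3 a b) = 1 ⊗ₜ (-Nmat k 3 a b) := by
      rw [map_neg, h3, TensorProduct.tmul_neg]
    fin_cases j
    · exact Coaction.normalOrder_right _ _ _ ((moyal ħ α β).coC_weight (moyal_zs ħ α β).1)
    · exact Coaction.normalOrder_right _ _ _ ((moyal ħ α β).coC_weight (moyal_zs ħ α β).2.1)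
    · exact Coaction.normalOrder_left _ _ _ h3'
    · exact Coaction.normalOrder_left _ _ _ h2
  order_Jzs j a b := by
    obtain ⟨-, -, h2, h3⟩ := moyal_Nmat ħ α β k a b
    have h3' : ((moyal ħ α β).coM k).coact (-Nmat k 3 a b) = 1 ⊗ₜ (-Nmat k 3 a b) := by
      rw [map_neg, h3, TensorProduct.tmul_neg]
    fin_cases j
    · exact Coaction.normalOrder_right _ _ _ ((moyal ħ α β).coC_weight (x := -z 1)
        (by rw [map_neg, (moyal_z ħ α β).2.1, TensorProduct.tmul_neg]))
    · exact Coaction.normalOrder_right _ _ _ ((moyal ħ α β).coC_weight (moyal_z ħ α β).1)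
    · exact Coaction.normalOrder_left _ _ _ h3'
    · exact Coaction.normalOrder_left _ _ _ h2
  g_rel := rfl

end

/-! ### The toric case -/

lemma antipode_smon (m n : ℤ) : HopfAlgebra.antipode ℂ (smon m n) = smon (-m) (-n) := by
  rw [smon, smon, AddMonoidAlgebra.antipode_single]
  simp

/-- The subalgebra of `A[𝕋²]` generated by `s₁` and `s₁⁻¹`. -/
def circleSubalgebra : Subalgebra ℂ HTor :=
  (Submodule.span ℂ (Set.range fun n : ℤ => smon n 0)).toSubalgebra
    (Submodule.subset_span ⟨0, smon_zero⟩)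
    (by
      intro x y hx hy
      induction hx using Submodule.span_induction with
      | zero => rw [zero_mul]; exact Submodule.zero_mem _
      | add x x' _ _ h h' => rw [add_mul]; exact Submodule.add_mem _ h h'
      | smul c x _ h => rw [smul_mul_assoc]; exact Submodule.smul_mem _ _ h
      | mem x hx =>
        obtain ⟨m, rfl⟩ := hx
        induction hy using Submodule.span_induction with
        | zero => rw [mul_zero]; exact Submodule.zero_mem _
        | add x x' _ _ h h' => rw [mul_add]; exact Submodule.add_mem _ h h'
        | smul c x _ h => rw [mul_smul_comm]; exact Submodule.smul_mem _ _ h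
        | mem y hy =>
          obtain ⟨n, rfl⟩ := hy
          exact Submodule.subset_span ⟨m + n, by simp [smon_mul]⟩)

lemma smon_mem (n : ℤ) : smon n 0 ∈ circleSubalgebra := Submodule.subset_span ⟨n, rfl⟩

lemma Symm.vec_apply (k : ℕ) (a : Fin (2 * k + 2)) (b : Fin k) :
    vec k 0 a b = Mmat k 0 a b ⊗ₜ 1 + Mmat k 2 a b ⊗ₜ zeta 1 - Mmat k 3 a b ⊗ₜ zeta 2 ∧
    vec k 1 a b = Mmat k 1 a b ⊗ₜ 1 + Mmat k 2 a b ⊗ₜ zeta 3 + Mmat k 3 a b ⊗ₜ zeta 0 := by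
  simp [vec]

lemma Symm.vecStar_apply (k : ℕ) (a : Fin k) (b : Fin (2 * k + 2)) :
    vecStar k 0 a b = Mdag k 0 a b ⊗ₜ 1 + Mdag k 2 a b ⊗ₜ zeta 0 - Mdag k 3 a b ⊗ₜ zeta 3 ∧
    vecStar k 1 a b = Mdag k 1 a b ⊗ₜ 1 + Mdag k 2 a b ⊗ₜ zeta 2 + Mdag k 3 a b ⊗ₜ zeta 1 := by
  simp [vecStar]

section
variable (θ : ℝ) (k : ℕ)

lemma toric_F (m n m' n' : ℤ) : ((toric θ).F.left (smon m n)).ofConv (smon m' n') =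
    Complex.exp (Complex.I * Real.pi * (θ / 2 * (m * n' - n * m'))) := by
  change (Tor.left _ (AddMonoidAlgebra.single ![m, n] 1)).ofConv (AddMonoidAlgebra.single _ 1) = _
  rw [Tor.left_single, Tor.char_single, Tor.chi]
  congr 2
  simp [Fin.sum_univ_two]
  ring

/-- The exponent of `F` is an antisymmetric form on `ℤ²`, which vanishes on the line spanned by
`(1,0)`. -/
lemma trivialOn_circle : TrivialOn (toric θ).F circleSubalgebra := by
  intro h hh g hg
  induction hh using Submodule.span_induction with
  | zero => simp
  | add x x' _ _ h h' => simp only [map_add, WithConv.ofConv_add, LinearMap.add_apply, h, h', add_mul]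
  | smul c x _ h => simp only [map_smul, WithConv.ofConv_smul, LinearMap.smul_apply, h, smul_eq_mul,
      mul_assoc]
  | mem x hx =>
    obtain ⟨m, rfl⟩ := hx
    induction hg using Submodule.span_induction with
    | zero => simp
    | add x x' _ _ h h' => simp only [map_add, h, h', mul_add]
    | smul c x _ h => simp only [map_smul, h, smul_eq_mul]; ring
    | mem y hy =>
      obtain ⟨n, rfl⟩ := hy
      simp [toric_F, counit_smon]

/-- The exponents of the weights of the `M^j` and `N^j`. -/
lemma toric_Mmat (a : Fin (2 * k + 2)) (b : Fin k) :
    ((toric θ).coM k).coact (Mmat k 0 a b) = smon (-1) 0 ⊗ₜ Mmat k 0 a b ∧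
    ((toric θ).coM k).coact (Mmat k 1 a b) = smon 1 0 ⊗ₜ Mmat k 1 a b ∧
    ((toric θ).coM k).coact (Mmat k 2 a b) = smon 0 (-1) ⊗ₜ Mmat k 2 a b ∧
    ((toric θ).coM k).coact (Mmat k 3 a b) = smon 0 1 ⊗ₜ Mmat k 3 a b := by
  have h : ∀ j, ((toric θ).coM k).coact (Mmat k j a b) =
      HopfAlgebra.antipode ℂ ((toric θ).A j j) ⊗ₜ Mmat k j a b := by
    intro j
    have hA : (toric θ).A = Matrix.diagonal ![smon 1 0, smon (-1) 0, smon 0 1, smon 0 (-1)] := rfl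
    rw [Symm.coM_Mmat, Finset.sum_eq_single j]
    · intro i _ hi
      rw [hA, Matrix.diagonal_apply_ne _ hi, map_zero, TensorProduct.zero_tmul]
    · simp
  refine ⟨(h 0).trans ?_, (h 1).trans ?_, (h 2).trans ?_, (h 3).trans ?_⟩ <;>
  exact congrArg (· ⊗ₜ _) (antipode_smon _ _)

lemma toric_Nmat (a : Fin k) (b : Fin (2 * k + 2)) :
    ((toric θ).coM k).coact (Nmat k 0 a b) = smon (-1) 0 ⊗ₜ Nmat k 0 a b ∧
    ((toric θ).coM k).coact (Nmat k 1 a b) = smon 1 0 ⊗ₜ Nmat k 1 a b ∧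
    ((toric θ).coM k).coact (Nmat k 2 a b) = smon 0 (-1) ⊗ₜ Nmat k 2 a b ∧
    ((toric θ).coM k).coact (Nmat k 3 a b) = smon 0 1 ⊗ₜ Nmat k 3 a b := by
  have h : ∀ j, ((toric θ).coM k).coact (Nmat k j a b) =
      HopfAlgebra.antipode ℂ ((toric θ).A j j) ⊗ₜ Nmat k j a b := by
    intro j
    have hA : (toric θ).A = Matrix.diagonal ![smon 1 0, smon (-1) 0, smon 0 1, smon 0 (-1)] := rfl
    rw [Symm.coM_Nmat, Finset.sum_eq_single j]
    · intro i _ hi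
      rw [hA, Matrix.diagonal_apply_ne _ hi, map_zero, TensorProduct.zero_tmul]
    · simp
  refine ⟨(h 0).trans ?_, (h 1).trans ?_, (h 2).trans ?_, (h 3).trans ?_⟩ <;>
  exact congrArg (· ⊗ₜ _) (antipode_smon _ _)

lemma toric_Mdag (a : Fin k) (b : Fin (2 * k + 2)) :
    ((toric θ).coM k).coact (Mdag k 0 a b) = smon 1 0 ⊗ₜ Mdag k 0 a b ∧
    ((toric θ).coM k).coact (Mdag k 1 a b) = smon (-1) 0 ⊗ₜ Mdag k 1 a b ∧
    ((toric θ).coM k).coact (Mdag k 2 a b) = smon 0 1 ⊗ₜ Mdag k 2 a b ∧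
    ((toric θ).coM k).coact (Mdag k 3 a b) = smon 0 (-1) ⊗ₜ Mdag k 3 a b := by
  obtain ⟨h0, h1, h2, h3⟩ := toric_Nmat θ k a b
  have hneg : ∀ {w : HTor} {x : AM k}, ((toric θ).coM k).coact x = w ⊗ₜ x →
      ((toric θ).coM k).coact (-x) = w ⊗ₜ (-x) := by
    intro w x hx
    rw [map_neg, hx, TensorProduct.tmul_neg]
  exact ⟨hneg h1, h0, hneg h3, h2⟩

lemma toric_z (j : Fin 4) : (toric θ).coC4.coact (z j) =
    ![smon 1 0, smon (-1) 0, smon 0 1, smon 0 (-1)] j ⊗ₜ z j := by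
  have hA : (toric θ).A = Matrix.diagonal ![smon 1 0, smon (-1) 0, smon 0 1, smon 0 (-1)] := rfl
  rw [Symm.coC4_z, Finset.sum_eq_single j, hA, Matrix.diagonal_apply_eq]
  · intro i _ hi
    rw [hA, Matrix.diagonal_apply_ne _ hi.symm, TensorProduct.zero_tmul]
  · simp

lemma toric_zs (j : Fin 4) : (toric θ).coC4.coact (zs j) =
    ![smon (-1) 0, smon 1 0, smon 0 (-1), smon 0 1] j ⊗ₜ zs j := by
  have hA : (toric θ).As = Matrix.diagonal ![smon (-1) 0, smon 1 0, smon 0 (-1), smon 0 1] := rfl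
  rw [Symm.coC4_zs, Finset.sum_eq_single j, hA, Matrix.diagonal_apply_eq]
  · intro i _ hi
    rw [hA, Matrix.diagonal_apply_ne _ hi.symm, TensorProduct.zero_tmul]
  · simp

lemma toric_g : (toric θ).g = ![smon 1 (-1), smon (-1) 1, smon (-1) (-1), smon 1 1] := rfl

lemma toric_t (i : Fin 4) : (toric θ).t i = 0 := rfl

lemma toric_zeta (i : Fin 4) : (toric θ).coR.coact (zeta i) =
    ![smon 1 (-1), smon (-1) 1, smon (-1) (-1), smon 1 1] i ⊗ₜ zeta i := by
  rw [Symm.coR_zeta, toric_t, TensorProduct.zero_tmul, add_zero]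
  rfl

lemma coact_mul_weight {C : Type} [Ring C] [Algebra ℂ C] {ε : Coaction HTor C} {x y : C}
    {p q p' q' p'' q'' : ℤ} (hx : ε.coact x = smon p q ⊗ₜ x) (hy : ε.coact y = smon p' q' ⊗ₜ y)
    (hp : p + p' = p'') (hq : q + q' = q'') : ε.coact (x * y) = smon p'' q'' ⊗ₜ (x * y) := by
  rw [map_mul, hx, hy, Algebra.TensorProduct.tmul_mul_tmul, smon_mul, hp, hq]

lemma toric_quad (i : Fin 4) : (toric θ).coC4.coact (Symm.quad i) =
    (toric θ).g i ⊗ₜ Symm.quad i + (toric θ).t i ⊗ₜ rr := by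
  rw [toric_t, TensorProduct.zero_tmul, add_zero, toric_g]
  have h := toric_z θ
  have h' := toric_zs θ
  have hadd : ∀ {w : HTor} {x y : C4}, (toric θ).coC4.coact x = w ⊗ₜ x →
      (toric θ).coC4.coact y = w ⊗ₜ y → (toric θ).coC4.coact (x + y) = w ⊗ₜ (x + y) := by
    intro w x y hx hy
    rw [map_add, hx, hy, TensorProduct.tmul_add]
  have hsub : ∀ {w : HTor} {x y : C4}, (toric θ).coC4.coact x = w ⊗ₜ x →
      (toric θ).coC4.coact y = w ⊗ₜ y → (toric θ).coC4.coact (x - y) = w ⊗ₜ (x - y) := by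
    intro w x y hx hy
    rw [map_sub, hx, hy, TensorProduct.tmul_sub]
  fin_cases i
  · exact hadd (coact_mul_weight (h 0) (h' 2) rfl rfl) (coact_mul_weight (h' 1) (h 3) rfl rfl)
  · exact hadd (coact_mul_weight (h' 0) (h 2) rfl rfl) (coact_mul_weight (h 1) (h' 3) rfl rfl)
  · exact hsub (coact_mul_weight (h 1) (h' 2) rfl rfl) (coact_mul_weight (h' 0) (h 3) rfl rfl)
  · exact hsub (coact_mul_weight (h' 1) (h 2) rfl rfl) (coact_mul_weight (h 0) (h' 3) rfl rfl)

/-- Only the power of `s₂` has to cancel, since all powers of `s₁` lie in `K`. -/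
lemma toric_mem {C : Type} [Ring C] [Algebra ℂ C] {ε : Coaction HTor C} {x : AM k} {c : C}
    {p q p' q' : ℤ} (hx : ((toric θ).coM k).coact x = smon p q ⊗ₜ x)
    (hc : ε.coact c = smon p' q' ⊗ₜ c) (h : q + q' = 0) :
    x ⊗ₜ c ∈ kPart circleSubalgebra (((toric θ).coM k).tensor ε) := by
  refine mem_kPart_of_weight (smon_mem (p + p')) ?_
  rw [Coaction.tensor_coact_weight _ _ hx hc, smon_mul, h]

lemma toric_mem_one {C : Type} [Ring C] [Algebra ℂ C] (ε : Coaction HTor C) {x : AM k}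
    {p : ℤ} (hx : ((toric θ).coM k).coact x = smon p 0 ⊗ₜ x) :
    x ⊗ₜ 1 ∈ kPart circleSubalgebra (((toric θ).coM k).tensor ε) :=
  toric_mem θ k (p' := 0) (q' := 0) hx (by rw [map_one, smon_zero]; rfl) rfl

/-- The pairing of two weights depends on their determinant, so parallel weights need no reordering.
-/
lemma toric_normalOrder {x : AM k} {y : C4} {p q p' q' : ℤ}
    (hx : ((toric θ).coM k).coact x = smon p q ⊗ₜ x)
    (hy : (toric θ).coC4.coact y = smon p' q' ⊗ₜ y) (h : p * q' = q * p') :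
    normalOrder (toric θ).F ((toric θ).coM k) (toric θ).coC (x ⊗ₜ Symm.zc y) =
      x ⊗ₜ Symm.zc y := by
  refine Coaction.normalOrder_weight _ _ _ hx ((toric θ).coC_weight hy) ?_
  rw [antipode_smon, toric_F]
  have h' : (p : ℂ) * q' = q * p' := by exact_mod_cast h
  have : ((-p : ℤ) : ℂ) * q' - (-q : ℤ) * p' = 0 := by
    push_cast
    linear_combination -h'
  rw [this]
  simp

lemma toric_neg {x : C4} {p q : ℤ} (hx : (toric θ).coC4.coact x = smon p q ⊗ₜ x) :
    (toric θ).coC4.coact (-x) = smon p q ⊗ₜ (-x) := by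
  rw [map_neg, hx, TensorProduct.tmul_neg]

lemma toric_vec (i : Fin 2) (a : Fin (2 * k + 2)) (b : Fin k) : Symm.vec k i a b ∈
    kPart circleSubalgebra (((toric θ).coM k).tensor (toric θ).coR) := by
  obtain ⟨h0, h1, h2, h3⟩ := toric_Mmat θ k a b
  have hz := toric_zeta θ
  obtain ⟨e0, e1⟩ := Symm.vec_apply k a b
  revert i
  rw [Fin.forall_fin_two, e0, e1]
  exact ⟨sub_mem (add_mem (toric_mem_one θ k _ h0) (toric_mem θ k h2 (hz 1) rfl))
    (toric_mem θ k h3 (hz 2) rfl), add_mem (add_mem (toric_mem_one θ k _ h1)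
    (toric_mem θ k h2 (hz 3) rfl)) (toric_mem θ k h3 (hz 0) rfl)⟩

lemma toric_vecStar (i : Fin 2) (a : Fin k) (b : Fin (2 * k + 2)) : Symm.vecStar k i a b ∈
    kPart circleSubalgebra (((toric θ).coM k).tensor (toric θ).coR) := by
  obtain ⟨h0, h1, h2, h3⟩ := toric_Mdag θ k a b
  have hz := toric_zeta θ
  obtain ⟨e0, e1⟩ := Symm.vecStar_apply k a b
  revert i
  rw [Fin.forall_fin_two, e0, e1]
  exact ⟨sub_mem (add_mem (toric_mem_one θ k _ h0) (toric_mem θ k h2 (hz 0) rfl))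
    (toric_mem θ k h3 (hz 3) rfl), add_mem (add_mem (toric_mem_one θ k _ h1)
    (toric_mem θ k h2 (hz 2) rfl)) (toric_mem θ k h3 (hz 1) rfl)⟩

lemma toric_dvec (i : Fin 2) (a : Fin (2 * k + 2)) (b : Fin k) : Symm.dvec k i a b ∈
    kPart circleSubalgebra (((toric θ).coM k).tensor (toric θ).coOm) := by
  obtain ⟨h0, h1, h2, h3⟩ := toric_Mmat θ k a b
  obtain ⟨e0, e1⟩ := Symm.dvec_apply k a b
  have hz := (toric θ).coOm_dzeta
  revert i
  rw [Fin.forall_fin_two, e0, e1]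
  exact ⟨sub_mem (toric_mem θ k h2 (hz 1) rfl) (toric_mem θ k h3 (hz 2) rfl),
    add_mem (toric_mem θ k h2 (hz 3) rfl) (toric_mem θ k h3 (hz 0) rfl)⟩

lemma toric_dvecStar (i : Fin 2) (a : Fin k) (b : Fin (2 * k + 2)) : Symm.dvecStar k i a b ∈
    kPart circleSubalgebra (((toric θ).coM k).tensor (toric θ).coOm) := by
  obtain ⟨h0, h1, h2, h3⟩ := toric_Mdag θ k a b
  obtain ⟨e0, e1⟩ := Symm.dvecStar_apply k a b
  have hz := (toric θ).coOm_dzeta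
  revert i
  rw [Fin.forall_fin_two, e0, e1]
  exact ⟨sub_mem (toric_mem θ k h2 (hz 0) rfl) (toric_mem θ k h3 (hz 3) rfl),
    add_mem (toric_mem θ k h2 (hz 2) rfl) (toric_mem θ k h3 (hz 1) rfl)⟩

/-- Here `v₁` and `v₂` are homogeneous of weights `s₁⁻¹` and `s₁`. They are not coinvariant, so the
scalars would not do for `K`. In every summand of `σ_w` and `σ_w*` the two factors have opposite
weights, hence parallel ones. -/
lemma admissible_toric : (toric θ).Admissible k circleSubalgebra where
  triv := trivialOn_circle θ
  vec_mem := toric_vec θ k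
  vecStar_mem := toric_vecStar θ k
  dvec_mem := toric_dvec θ k
  dvecStar_mem := toric_dvecStar θ k
  z0_mem := mem_kPart_of_weight (smon_mem 1) ((toric θ).coC_weight (toric_z θ 0))
  z1_mem := mem_kPart_of_weight (smon_mem (-1)) ((toric θ).coC_weight (toric_z θ 1))
  zs0_mem := mem_kPart_of_weight (smon_mem (-1)) ((toric θ).coC_weight (toric_zs θ 0))
  zs1_mem := mem_kPart_of_weight (smon_mem 1) ((toric θ).coC_weight (toric_zs θ 1))
  zetaC_coact i := (toric θ).zetaC_coact_of_quad i (toric_quad θ i)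
  order_z j a b := by
    obtain ⟨h0, h1, h2, h3⟩ := toric_Mmat θ k a b
    fin_cases j
    · exact toric_normalOrder θ k h0 (toric_z θ 0) rfl
    · exact toric_normalOrder θ k h1 (toric_z θ 1) rfl
    · exact toric_normalOrder θ k h2 (toric_z θ 2) rfl
    · exact toric_normalOrder θ k h3 (toric_z θ 3) rfl
  order_Jz j a b := by
    obtain ⟨h0, h1, h2, h3⟩ := toric_Mmat θ k a b
    fin_cases j
    · exact toric_normalOrder θ k h0 (toric_neg θ (toric_zs θ 1)) rfl
    · exact toric_normalOrder θ k h1 (toric_zs θ 0) rfl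
    · exact toric_normalOrder θ k h2 (toric_neg θ (toric_zs θ 3)) rfl
    · exact toric_normalOrder θ k h3 (toric_zs θ 2) rfl
  order_zs j a b := by
    obtain ⟨h0, h1, h2, h3⟩ := toric_Mdag θ k a b
    fin_cases j
    · exact toric_normalOrder θ k h0 (toric_zs θ 0) rfl
    · exact toric_normalOrder θ k h1 (toric_zs θ 1) rfl
    · exact toric_normalOrder θ k h2 (toric_zs θ 2) rfl
    · exact toric_normalOrder θ k h3 (toric_zs θ 3) rfl
  order_Jzs j a b := by
    obtain ⟨h0, h1, h2, h3⟩ := toric_Mdag θ k a b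
    fin_cases j
    · exact toric_normalOrder θ k h0 (toric_neg θ (toric_z θ 1)) rfl
    · exact toric_normalOrder θ k h1 (toric_z θ 0) rfl
    · exact toric_normalOrder θ k h2 (toric_neg θ (toric_z θ 3)) rfl
    · exact toric_normalOrder θ k h3 (toric_z θ 2) rfl
  g_rel := by simp [toric_g, smon_mul]

end

/-! ### Conjugate-linear anti-homomorphisms -/

/-- The opposite algebra of `B` with the conjugate scalar multiplication. Algebra maps
`A → ConjOp B` are the conjugate-linear anti-homomorphisms `A → B`. -/
def ConjOp (B : Type) : Type := Bᵐᵒᵖ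

namespace ConjOp
variable {A B C : Type} [Ring A] [Algebra ℂ A] [Ring B] [Algebra ℂ B] [Ring C] [Algebra ℂ C]

instance : Ring (ConjOp B) := inferInstanceAs (Ring Bᵐᵒᵖ)

instance {B : Type} [CommRing B] : CommRing (ConjOp B) :=
  { (inferInstance : Ring (ConjOp B)) with mul_comm := fun x y => mul_comm (G := Bᵐᵒᵖ) x y }

/-- The underlying element of `B`. -/
def down : ConjOp B ≃+ B := (MulOpposite.opAddEquiv (α := B)).symm

lemma down_mul (x y : ConjOp B) : down (x * y) = down y * down x := rfl

instance : Algebra ℂ (ConjOp B) :=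
  RingHom.toAlgebra' ((algebraMap ℂ Bᵐᵒᵖ).comp (starRingEnd ℂ))
    (fun c x => Algebra.commutes (A := Bᵐᵒᵖ) (starRingEnd ℂ c) x)

lemma down_algebraMap (c : ℂ) :
    down (algebraMap ℂ (ConjOp B) c) = algebraMap ℂ B (starRingEnd ℂ c) := rfl

lemma down_smul (c : ℂ) (x : ConjOp B) : down (c • x) = starRingEnd ℂ c • down x := by
  rw [Algebra.smul_def, down_mul, down_algebraMap, ← Algebra.commutes, ← Algebra.smul_def]

lemma down_symm_mul (x y : B) : down.symm (x * y) = down.symm y * down.symm x := rfl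

/-- The conjugate-linear anti-homomorphism given by an algebra map to `ConjOp B`. -/
def st (s : A →ₐ[ℂ] ConjOp B) : A →+ B := (down (B := B)).toAddMonoidHom.comp s.toRingHom.toAddMonoidHom

lemma st_apply (s : A →ₐ[ℂ] ConjOp B) (a : A) : st s a = down (s a) := rfl

lemma st_mul (s : A →ₐ[ℂ] ConjOp B) (x y : A) : st s (x * y) = st s y * st s x := by
  rw [st_apply, map_mul]; rfl

lemma st_one (s : A →ₐ[ℂ] ConjOp B) : st s 1 = 1 := by
  rw [st_apply, map_one]; rfl

lemma st_smul (s : A →ₐ[ℂ] ConjOp B) (c : ℂ) (x : A) :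
    st s (c • x) = starRingEnd ℂ c • st s x := by
  rw [st_apply, map_smul, down_smul]; rfl

lemma st_algebraMap (s : A →ₐ[ℂ] ConjOp B) (c : ℂ) :
    st s (algebraMap ℂ A c) = algebraMap ℂ B (starRingEnd ℂ c) := by
  rw [st_apply, AlgHom.commutes, down_algebraMap]

/-- A conjugate-linear anti-homomorphism as an algebra map to `ConjOp B`. -/
def ofSt (f : A →+ B) (h1 : f 1 = 1) (hm : ∀ x y, f (x * y) = f y * f x)
    (hs : ∀ (c : ℂ) x, f (c • x) = starRingEnd ℂ c • f x) : A →ₐ[ℂ] ConjOp B :=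
  AlgHom.ofLinearMap
    { toFun := fun x => down.symm (f x)
      map_add' := fun x y => by rw [map_add, map_add]
      map_smul' := fun c x => by
        apply (down (B := B)).injective
        rw [RingHom.id_apply, down_smul, AddEquiv.apply_symm_apply, AddEquiv.apply_symm_apply, hs] }
    (congrArg down.symm h1)
    (fun x y => by
      change down.symm (f (x * y)) = _
      rw [hm]; rfl)

/-- Functoriality of `ConjOp`. -/
def map (f : B →ₐ[ℂ] C) : ConjOp B →ₐ[ℂ] ConjOp C :=
  ofSt ((f.toRingHom.toAddMonoidHom).comp (down (B := B)).toAddMonoidHom)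
    (map_one f) (fun x y => map_mul f (down y) (down x))
    (fun c x => by
      change f (down (c • x)) = _
      rw [down_smul, map_smul]; rfl)

/-- The composition of two conjugate-linear anti-homomorphisms. -/
def comp (s' : B →ₐ[ℂ] ConjOp C) (s : A →ₐ[ℂ] ConjOp B) : A →ₐ[ℂ] C :=
  AlgHom.ofLinearMap
    { toFun := fun a => st s' (st s a)
      map_add' := fun x y => by rw [map_add, map_add]
      map_smul' := fun c x => by rw [st_smul, st_smul, Complex.conj_conj, RingHom.id_apply] }
    (by change st s' (st s 1) = 1; rw [st_one, st_one])
    (fun x y => by change st s' (st s (x * y)) = _; rw [st_mul, st_mul]; rfl)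

lemma comp_apply (s' : B →ₐ[ℂ] ConjOp C) (s : A →ₐ[ℂ] ConjOp B) (a : A) :
    comp s' s a = st s' (st s a) := rfl

section tensor
variable {A' B' : Type} [Ring A'] [Algebra ℂ A'] [Ring B'] [Algebra ℂ B']

/-- Two algebra maps with commuting images give an algebra map on the tensor product. -/
def liftTensor (f : A →ₐ[ℂ] C) (g : B →ₐ[ℂ] C) (h : ∀ a b, f a * g b = g b * f a) :
    A ⊗[ℂ] B →ₐ[ℂ] C := Algebra.TensorProduct.lift f g h

lemma liftTensor_tmul (f : A →ₐ[ℂ] C) (g : B →ₐ[ℂ] C) (h : ∀ a b, f a * g b = g b * f a)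
    (a : A) (b : B) : liftTensor f g h (a ⊗ₜ b) = f a * g b :=
  Algebra.TensorProduct.lift_tmul f g h a b

/-- The tensor product of two conjugate-linear anti-homomorphisms. -/
def tens (s : A →ₐ[ℂ] ConjOp A') (s' : B →ₐ[ℂ] ConjOp B') :
    A ⊗[ℂ] B →ₐ[ℂ] ConjOp (A' ⊗[ℂ] B') :=
  liftTensor ((map Algebra.TensorProduct.includeLeft).comp s)
    ((map Algebra.TensorProduct.includeRight).comp s')
    (fun a b => (down (B := A' ⊗[ℂ] B')).injective (by
      change ((1 : A') ⊗ₜ[ℂ] st s' b) * (st s a ⊗ₜ[ℂ] (1 : B')) =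
        (st s a ⊗ₜ[ℂ] (1 : B')) * ((1 : A') ⊗ₜ[ℂ] st s' b)
      simp))

lemma st_tens_tmul (s : A →ₐ[ℂ] ConjOp A') (s' : B →ₐ[ℂ] ConjOp B') (a : A) (b : B) :
    st (tens s s') (a ⊗ₜ b) = st s a ⊗ₜ st s' b := by
  rw [st_apply, tens, liftTensor_tmul, down_mul]
  change ((1 : A') ⊗ₜ[ℂ] st s' b) * (st s a ⊗ₜ[ℂ] (1 : B')) = _
  simp

lemma st_tens_invol (s : A →ₐ[ℂ] ConjOp A) (s' : B →ₐ[ℂ] ConjOp B)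
    (h : ∀ a, st s (st s a) = a) (h' : ∀ b, st s' (st s' b) = b) (t : A ⊗[ℂ] B) :
    st (tens s s') (st (tens s s') t) = t := by
  induction t with
  | zero => simp
  | add x y hx hy => rw [map_add, map_add, hx, hy]
  | tmul a b => rw [st_tens_tmul, st_tens_tmul, h, h']

end tensor

lemma isStar_st (s : A →ₐ[ℂ] ConjOp A) (h : ∀ a, st s (st s a) = a) : IsStar (st s) where
  add := map_add _
  smul := st_smul s
  mul := st_mul s
  invol := h

end ConjOp

/-! ### Extension of an involution to an adjoined inverse -/

namespace Adj
open ConjOp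
variable {B : Type} [Ring B] [Algebra ℂ B] {n : ℕ} (ρ : Matrix (Fin n) (Fin n) B)

variable (s : B →ₐ[ℂ] ConjOp B) (hs : ∀ i j, st s (ρ i j) = ρ j i)

include hs in
/-- The extension to `B[ρ⁻¹]` of a conjugate-linear anti-homomorphism of `B` fixing `ρ`. -/
def starHom : Adj ρ →ₐ[ℂ] ConjOp (Adj ρ) :=
  -- An anti-homomorphism reverses the products of entries in a matrix product. As `ρ` is hermitian
  -- for `s`, its inverse must therefore be sent to the transposed inverse.
  lift ρ ((ConjOp.map (of ρ)).comp s) (Matrix.of fun i j => down.symm (inv ρ j i))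
    (by
      ext i j
      apply (down (B := Adj ρ)).injective
      have h := congrFun (congrFun (inv_mul ρ) j) i
      rw [Matrix.mul_apply] at h ⊢
      rw [map_sum]
      refine Eq.trans (Finset.sum_congr rfl fun l _ => ?_) (h.trans ?_)
      · rw [down_mul]
        change inv ρ j l * of ρ (st s (ρ i l)) = _
        rw [hs]
        rfl
      · rw [Matrix.one_apply, Matrix.one_apply]
        split_ifs with h1 h2 h2
        · rfl
        · exact absurd h1.symm h2
        · exact absurd h2.symm h1
        · rfl)
    (by
      ext i j
      apply (down (B := Adj ρ)).injective
      have h := congrFun (congrFun (mul_inv ρ) j) i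
      rw [Matrix.mul_apply] at h ⊢
      rw [map_sum]
      refine Eq.trans (Finset.sum_congr rfl fun l _ => ?_) (h.trans ?_)
      · rw [down_mul]
        change of ρ (st s (ρ l j)) * inv ρ l i = _
        rw [hs]
        rfl
      · rw [Matrix.one_apply, Matrix.one_apply]
        split_ifs with h1 h2 h2
        · rfl
        · exact absurd h1.symm h2
        · exact absurd h2.symm h1
        · rfl)

lemma starHom_of (x : B) : st (starHom ρ s hs) (of ρ x) = of ρ (st s x) :=
  congrArg down (lift_of ρ _ _ _ _ x)

lemma starHom_inv (i j : Fin n) : st (starHom ρ s hs) (inv ρ i j) = inv ρ j i :=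
  congrArg down (lift_inv ρ _ _ _ _ i j)

lemma starHom_invol (h : ∀ b, st s (st s b) = b) (x : Adj ρ) :
    st (starHom ρ s hs) (st (starHom ρ s hs) x) = x := by
  obtain ⟨y, rfl⟩ := RingQuot.mkAlgHom_surjective ℂ (AdjRel ρ) x
  change st (starHom ρ s hs) (st (starHom ρ s hs) (mk ρ y)) = mk ρ y
  induction y using FreeAlgebra.induction with
  | grade0 c =>
    rw [AlgHom.commutes, st_algebraMap, st_algebraMap, Complex.conj_conj]
  | grade1 g =>
    obtain b | ⟨i, j⟩ := g
    · change st (starHom ρ s hs) (st (starHom ρ s hs) (of ρ b)) = of ρ b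
      rw [starHom_of, starHom_of, h]
    · change st (starHom ρ s hs) (st (starHom ρ s hs) (inv ρ i j)) = inv ρ i j
      rw [starHom_inv, starHom_inv]
  | mul a b ha hb => rw [map_mul, st_mul, st_mul, ha, hb]
  | add a b ha hb => rw [map_add, map_add, map_add, ha, hb]

end Adj

open ConjOp

/-! ### Star structures on Hopf algebras and bicharacters -/

/-- A conjugate-linear involution making `H` a Hopf `*`-algebra. -/
structure HopfStar (s : H →ₐ[ℂ] ConjOp H) : Prop where
  invol : ∀ h, st s (st s h) = h
  comul : ∀ h, Coalgebra.comul (R := ℂ) (st s h) = st (tens s s) (Coalgebra.comul (R := ℂ) h)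
  counit : ∀ h, Coalgebra.counit (R := ℂ) (st s h) = starRingEnd ℂ (Coalgebra.counit (R := ℂ) h)

/-- The functional `h ↦ conj φ(h*)`. -/
def conjFun (s : H →ₐ[ℂ] ConjOp H) : WithConv (H →ₗ[ℂ] ℂ) →+ WithConv (H →ₗ[ℂ] ℂ) where
  toFun φ := WithConv.toConv
    { toFun := fun h => starRingEnd ℂ (φ.ofConv (st s h))
      map_add' := by intros; simp
      map_smul' := by intros; simp [st_smul] }
  map_zero' := by ext; simp
  map_add' := by intros; ext; simp

section
variable {s : H →ₐ[ℂ] ConjOp H} (hs : HopfStar s)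

lemma conjFun_apply (φ : WithConv (H →ₗ[ℂ] ℂ)) (h : H) :
    (conjFun s φ).ofConv h = starRingEnd ℂ (φ.ofConv (st s h)) := rfl

lemma conjFun_smul (c : ℂ) (φ : WithConv (H →ₗ[ℂ] ℂ)) :
    conjFun s (c • φ) = starRingEnd ℂ c • conjFun s φ := by
  ext; simp [conjFun_apply]

namespace HopfStar
include hs

lemma conjFun_one : conjFun s 1 = 1 := by
  ext h
  simp [conjFun_apply, LinearMap.convOne_def, hs.counit]

lemma conjFun_mul (φ ψ : WithConv (H →ₗ[ℂ] ℂ)) :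
    conjFun s (φ * ψ) = conjFun s φ * conjFun s ψ := by
  ext h
  rw [conjFun_apply, LinearMap.convMul_apply, LinearMap.convMul_apply, hs.comul]
  generalize Coalgebra.comul (R := ℂ) h = t
  induction t with
  | zero => simp
  | add x y hx hy => simp only [map_add, hx, hy]
  | tmul x y => simp [st_tens_tmul, conjFun_apply]

/-- The bicharacter `(h,g) ↦ conj F(g*,h*)`. -/
def conj (F : Bichar H) : Bichar H where
  left := AlgHom.ofLinearMap
    { toFun := fun h => conjFun s (F.right (st s h))
      map_add' := by intros; simp
      map_smul' := by intros; simp [st_smul, conjFun_smul] }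
    (by simp [st_one, hs.conjFun_one])
    (by intro x y; simp [st_mul, hs.conjFun_mul, mul_comm])
  right := AlgHom.ofLinearMap
    { toFun := fun h => conjFun s (F.left (st s h))
      map_add' := by intros; simp
      map_smul' := by intros; simp [st_smul, conjFun_smul] }
    (by simp [st_one, hs.conjFun_one])
    (by intro x y; simp [st_mul, hs.conjFun_mul, mul_comm])
  left_eq_right h g := congrArg (starRingEnd ℂ) (F.left_eq_right (st s g) (st s h)).symm

lemma conj_left (F : Bichar H) (h : H) : (hs.conj F).left h = conjFun s (F.right (st s h)) := rfl

lemma conj_right (F : Bichar H) (h : H) : (hs.conj F).right h = conjFun s (F.left (st s h)) := rfl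

lemma conj_flip (F : Bichar H) : hs.conj F.flip = (hs.conj F).flip := rfl

lemma conj_triv : hs.conj (Bichar.triv H) = Bichar.triv H := by
  ext1
  ext1 h
  rw [conj_left, Bichar.triv_right, Bichar.triv_left, conjFun_smul, hs.counit, Complex.conj_conj,
    hs.conjFun_one]

lemma conj_conv (F G : Bichar H) : hs.conj (F.conv G) = (hs.conj F).conv (hs.conj G) := by
  ext1
  ext1 h
  rw [conj_left]
  change conjFun s ((WithConv.toConv F.right * WithConv.toConv G.right).ofConv (st s h)) =
    (WithConv.toConv (hs.conj F).left * WithConv.toConv (hs.conj G).left).ofConv h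
  rw [AlgHom.convMul_apply, AlgHom.convMul_apply, hs.comul]
  generalize Coalgebra.comul (R := ℂ) h = t
  induction t with
  | zero => simp
  | add x y hx hy => simp only [map_add, hx, hy]
  | tmul x y =>
    rw [st_tens_tmul]
    simp [hs.conjFun_mul, conj_left]

end HopfStar
end

/-! ### Triangularity and reality of the universal form -/

namespace Bichar

lemma eq_inv {F G : Bichar H} (h : F.conv G = triv H) : G = F.inv := by
  have h1 : F.inv.conv (F.conv G) = F.inv.conv (triv H) := by rw [h]
  rw [conv_triv, ← conv_assoc, F.inv.conv_comm, conv_inv, conv_comm, conv_triv] at h1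
  exact h1

lemma flip_conv (F G : Bichar H) : (F.conv G).flip = F.flip.conv G.flip := rfl

lemma flip_inv (F : Bichar H) : F.inv.flip = F.flip.inv := by
  apply eq_inv
  rw [← flip_conv, conv_inv]
  rfl

/-- Flipping the convolution of the flip of `F` with `F⁻¹` interchanges the roles of `F` and its
flip, which yields the inverse: `R` is triangular. -/
lemma R_flip (F : Bichar H) : F.R.flip = F.R.inv := by
  apply eq_inv
  rw [R, flip_conv, flip_inv, conv_comm, conv_assoc, ← conv_assoc F.flip.inv, F.flip.inv.conv_comm,
    conv_inv, conv_comm (triv H), conv_triv]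
  exact conv_inv F

/-- Triangularity in the form `R(h,g) = R(g, S h)`. It converts the action by the left slot of `R`
into one by the right slot, through which `▷` is defined. -/
lemma R_left (F : Bichar H) (h : H) : F.R.left h = F.R.right (HopfAlgebra.antipode ℂ h) := by
  have h1 : F.R.flip.inv = F.R := by
    rw [← flip_inv, ← R_flip]
    rfl
  rw [← h1]
  rw [h1]
  conv_lhs => rw [← h1]
  rfl

end Bichar

/-- Conjugation of bicharacters respects convolution, flip and hence inverses, out of which `R` is
built. -/
lemma HopfStar.conj_R {s : H →ₐ[ℂ] ConjOp H} (hs : HopfStar s) {F : Bichar H} (hF : hs.conj F = F) :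
    hs.conj F.R = F.R := by
  have h : hs.conj F.inv = F.inv := by
    apply Bichar.eq_inv
    conv_lhs => rw [← hF]
    rw [← hs.conj_conv, hF, Bichar.conv_inv, hs.conj_triv]
  rw [Bichar.R, hs.conj_conv, hs.conj_flip, hF, h]

/-! ### Star structures on comodule algebras -/

section
variable {A : Type} [Ring A] [Algebra ℂ A] (F : Bichar H)

/-- `(h ⊗ a, g ⊗ b) ↦ F(h,g) a b`. -/
def twPair : H ⊗[ℂ] A →ₗ[ℂ] H ⊗[ℂ] A →ₗ[ℂ] A :=
  TensorProduct.lift (LinearMap.mk₂ ℂ (fun h a => LinearMap.mulLeft ℂ a ∘ₗ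
      (TensorProduct.lid ℂ A).toLinearMap ∘ₗ (F.left h).ofConv.rTensor A)
    (by
      intros
      ext
      simp only [map_add, WithConv.ofConv_add, LinearMap.rTensor_add]
      exact mul_add _ _ _)
    (by
      intros
      refine LinearMap.ext fun t => ?_
      simp only [map_smul, WithConv.ofConv_smul, LinearMap.rTensor_smul, LinearMap.comp_apply,
        LinearMap.smul_apply, LinearEquiv.coe_coe])
    (by intros; ext; simp [add_mul])
    (by intros; ext; simpa using smul_comm _ _ _))

lemma twPair_tmul (h g : H) (a b : A) :
    twPair F (h ⊗ₜ a) (g ⊗ₜ b) = (F.left h).ofConv g • (a * b) := by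
  change a * ((F.left h).ofConv g • b) = _
  rw [mul_smul_comm]

/-- This form treats the two arguments symmetrically, which suits anti-homomorphisms better than the
definition through `opT`. -/
lemma twMul_eq_pair (δ : Coaction H A) (a b : A) :
    δ.twMul F a b = twPair F (δ.coact a) (δ.coact b) := by
  rw [Coaction.twMul_apply]
  generalize δ.coact a = t
  induction t with
  | zero => simp
  | add x y hx hy => simp only [map_add, LinearMap.add_apply, hx, hy]
  | tmul h c => rfl

end

/-- A conjugate-linear involution on a comodule algebra for which the coaction is a `*`-map. -/
structure ComodStar {A : Type} [Ring A] [Algebra ℂ A] (s : H →ₐ[ℂ] ConjOp H) (δ : Coaction H A)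
    (σ : A →ₐ[ℂ] ConjOp A) : Prop where
  invol : ∀ a, st σ (st σ a) = a
  coact : ∀ a, δ.coact (st σ a) = st (tens s σ) (δ.coact a)

namespace ComodStar
variable {s : H →ₐ[ℂ] ConjOp H} (hs : HopfStar s) {A : Type} [CommRing A] [Algebra ℂ A]
  {δ : Coaction H A} {σ : A →ₐ[ℂ] ConjOp A} (hσ : ComodStar s δ σ)

include hs hσ

lemma st_lact (φ : WithConv (H →ₗ[ℂ] ℂ)) (a : A) :
    st σ (δ.lact φ a) = δ.lact (conjFun s φ) (st σ a) := by
  rw [Coaction.lact_apply, Coaction.lact_apply, hσ.coact]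
  generalize δ.coact a = t
  induction t with
  | zero => simp
  | add x y hx hy => simp only [map_add, hx, hy]
  | tmul h a => simp [st_tens_tmul, st_smul, conjFun_apply, hs.invol]

/-- Classically the star reverses products. The twist factor follows suit because `conj F(h,g) =
F(g*,h*)`. -/
lemma st_twMul {F : Bichar H} (hF : hs.conj F = F) (a b : A) :
    st σ (δ.twMul F a b) = δ.twMul F (st σ b) (st σ a) := by
  rw [twMul_eq_pair, twMul_eq_pair, hσ.coact, hσ.coact]
  generalize δ.coact a = t
  generalize δ.coact b = u
  induction t with
  | zero => simp
  | add x y hx hy => simp only [map_add, LinearMap.add_apply, hx, hy]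
  | tmul h c =>
    induction u with
    | zero => simp
    | add x y hx hy => simp only [map_add, LinearMap.add_apply, hx, hy]
    | tmul g c' =>
      have h1 : starRingEnd ℂ ((F.left h).ofConv g) = (F.left (st s g)).ofConv (st s h) := by
        conv_rhs => rw [← hF]
        rw [hs.conj_left, conjFun_apply, hs.invol, hs.invol, F.left_eq_right]
      rw [st_tens_tmul, st_tens_tmul, twPair_tmul, twPair_tmul, st_smul, st_mul, h1]

/-- The star structure of the twisted comodule algebra. -/
def tw {F : Bichar H} (hF : hs.conj F = F) : Tw F δ →ₐ[ℂ] ConjOp (Tw F δ) :=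
  ofSt (((Tw.mk F δ).toAddEquiv.toAddMonoidHom.comp (st σ)).comp
      (Tw.mk F δ).symm.toAddEquiv.toAddMonoidHom)
    (congrArg (Tw.mk F δ) (st_one σ))
    (fun x y => congrArg (Tw.mk F δ) (hσ.st_twMul hs hF ((Tw.mk F δ).symm x) ((Tw.mk F δ).symm y)))
    (fun c x => congrArg (Tw.mk F δ) (st_smul σ c ((Tw.mk F δ).symm x)))

variable {F : Bichar H} (hF : hs.conj F = F)

lemma tw_invol (a : Tw F δ) : st (hσ.tw hs hF) (st (hσ.tw hs hF) a) = a :=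
  congrArg (Tw.mk F δ) (hσ.invol ((Tw.mk F δ).symm a))

/-- Conjugation carries `R(·,h)` to `R(h*,·)`, since `R` is real, and triangularity rewrites this as
`R(·,S(h*))`. -/
lemma tw_act (h : H) (a : Tw F δ) : st (hσ.tw hs hF) (Tw.act F δ h a) =
    Tw.act F δ (HopfAlgebra.antipode ℂ (st s h)) (st (hσ.tw hs hF) a) := by
  have h1 := hσ.st_lact hs (F.R.right h) ((Tw.mk F δ).symm a)
  have h2 : conjFun s (F.R.right h) = F.R.right (HopfAlgebra.antipode ℂ (st s h)) := by
    rw [← Bichar.R_left]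
    conv_rhs => rw [← hs.conj_R hF]
    rw [hs.conj_left, hs.invol]
  rw [h2] at h1
  exact congrArg (Tw.mk F δ) h1

end ComodStar

open ConjOp

/-! ### The universal property of the smash product -/

namespace Smash
variable {A : Type} [Ring A] [Algebra ℂ A] (F : Bichar H) (δ : Coaction H A)

/-- The map `h ⊗ h' ↦ f(h ▷ b) g(h')`. -/
def crossMap {E : Type} [Ring E] [Algebra ℂ E] (f : Tw F δ →ₐ[ℂ] E) (g : H →ₐ[ℂ] E) (b : Tw F δ) :
    H ⊗[ℂ] H →ₗ[ℂ] E :=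
  LinearMap.mul' ℂ E ∘ₗ TensorProduct.map (f.toLinearMap ∘ₗ (Tw.act F δ).toLinearMap.flip b)
    g.toLinearMap

lemma crossMap_tmul {E : Type} [Ring E] [Algebra ℂ E] (f : Tw F δ →ₐ[ℂ] E) (g : H →ₐ[ℂ] E)
    (b : Tw F δ) (x y : H) : crossMap F δ f g b (x ⊗ₜ y) = f (Tw.act F δ x b) * g y := rfl

lemma inH_mul_inA_eq_crossMap (h : H) (b : Tw F δ) : inH F δ h * inA F δ b =
    crossMap F δ (inA F δ) (inH F δ) b (Coalgebra.comul (R := ℂ) h) := by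
  rw [inH_mul_inA]
  conv_rhs => rw [← (ℛ ℂ h).eq]
  simp [crossMap_tmul, inA_mul_inH]

/-- The universal property of the smash product. -/
def lift {E : Type} [Ring E] [Algebra ℂ E] (f : Tw F δ →ₐ[ℂ] E) (g : H →ₐ[ℂ] E)
    (hfg : ∀ h b, g h * f b = crossMap F δ f g b (Coalgebra.comul (R := ℂ) h)) :
    Smash F δ →ₐ[ℂ] E :=
  -- Multiplicativity is tested on products `(a h)(b g')`; the hypothesis `hfg` says that `h` is
  -- moved past `b` by the same rule in `E` as in the smash product.
  have hmul : ∀ (L : Smash F δ →ₗ[ℂ] E), (∀ a h, L (inA F δ a * inH F δ h) = f a * g h) →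
      ∀ x y, L (x * y) = L x * L y := by
    intro L hL x y
    have h1 : ∀ (a b : Tw F δ) (h : H) (t : H ⊗[ℂ] H), L (inA F δ a *
        crossMap F δ (inA F δ) (inH F δ) b t * inH F δ h) =
        f a * crossMap F δ f g b t * g h := by
      intro a b h t
      induction t with
      | zero => simp
      | add x y hx hy => simp only [map_add, mul_add, add_mul, hx, hy]
      | tmul x y =>
        rw [crossMap_tmul, crossMap_tmul, ← mul_assoc, ← map_mul, mul_assoc, ← map_mul, hL,
          map_mul, map_mul]
        simp only [mul_assoc]
    induction x using Smash.induction_mul with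
    | h0 => simp
    | hadd x y hx hy => rw [add_mul, map_add, map_add, hx, hy, add_mul]
    | hmul a h =>
      induction y using Smash.induction_mul with
      | h0 => simp
      | hadd x y hx hy => rw [mul_add, map_add, map_add, hx, hy, mul_add]
      | hmul b g' =>
        rw [show inA F δ a * inH F δ h * (inA F δ b * inH F δ g') =
          inA F δ a * (inH F δ h * inA F δ b) * inH F δ g' by simp only [mul_assoc],
          inH_mul_inA_eq_crossMap, h1, hL, hL, ← hfg]
        simp only [mul_assoc]
  AlgHom.ofLinearMap (LinearMap.mul' ℂ E ∘ₗ TensorProduct.map f.toLinearMap g.toLinearMap ∘ₗ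
      (mk F δ).symm.toLinearMap)
    (by
      change f 1 * g 1 = 1
      rw [map_one, map_one, one_mul])
    (hmul _ (fun a h => by
      rw [inA_mul_inH]
      rfl))

lemma lift_inA_mul_inH {E : Type} [Ring E] [Algebra ℂ E] (f : Tw F δ →ₐ[ℂ] E) (g : H →ₐ[ℂ] E)
    (hfg) (a : Tw F δ) (h : H) : lift F δ f g hfg (inA F δ a * inH F δ h) = f a * g h := by
  rw [inA_mul_inH]
  rfl

lemma lift_inA {E : Type} [Ring E] [Algebra ℂ E] (f : Tw F δ →ₐ[ℂ] E) (g : H →ₐ[ℂ] E)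
    (hfg) (a : Tw F δ) : lift F δ f g hfg (inA F δ a) = f a := by
  have := lift_inA_mul_inH F δ f g hfg a 1
  rwa [map_one, mul_one, map_one, mul_one] at this

lemma lift_inH {E : Type} [Ring E] [Algebra ℂ E] (f : Tw F δ →ₐ[ℂ] E) (g : H →ₐ[ℂ] E)
    (hfg) (h : H) : lift F δ f g hfg (inH F δ h) = g h := by
  have := lift_inA_mul_inH F δ f g hfg 1 h
  rwa [map_one, one_mul, map_one, one_mul] at this

/-- `h₂ (S(h₁) ▷ b) = b h`. -/
lemma inH_mul_act_antipode (h : H) (b : Tw F δ) :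
    LinearMap.mul' ℂ (Smash F δ) (TensorProduct.comm ℂ _ _ (TensorProduct.map
      ((inA F δ).toLinearMap ∘ₗ (Tw.act F δ).toLinearMap.flip b ∘ₗ HopfAlgebra.antipode ℂ)
      (inH F δ).toLinearMap (Coalgebra.comul (R := ℂ) h))) = inA F δ b * inH F δ h := by
  let E : H ⊗[ℂ] (H ⊗[ℂ] H) →ₗ[ℂ] Smash F δ := crossMap F δ (inA F δ) (inH F δ) b ∘ₗ
    (LinearMap.mul' ℂ H ∘ₗ (HopfAlgebra.antipode ℂ).rTensor H).rTensor H ∘ₗ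
    (TensorProduct.assoc ℂ H H H).symm.toLinearMap
  have hE : ∀ x y z, E (x ⊗ₜ (y ⊗ₜ z)) =
      inA F δ (Tw.act F δ (HopfAlgebra.antipode ℂ x * y) b) * inH F δ z := fun x y z => rfl
  have h1 : ∀ t : H ⊗[ℂ] H, LinearMap.mul' ℂ (Smash F δ) (TensorProduct.comm ℂ _ _
      (TensorProduct.map ((inA F δ).toLinearMap ∘ₗ (Tw.act F δ).toLinearMap.flip b ∘ₗ
        HopfAlgebra.antipode ℂ) (inH F δ).toLinearMap t)) =
      E ((Coalgebra.comul (R := ℂ)).lTensor H t) := by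
    intro t
    induction t with
    | zero => simp
    | add x y hx hy => simp only [map_add, hx, hy]
    | tmul x y =>
      rw [TensorProduct.map_tmul, TensorProduct.comm_tmul, LinearMap.mul'_apply,
        LinearMap.lTensor_tmul]
      change inH F δ y * inA F δ (Tw.act F δ (HopfAlgebra.antipode ℂ x) b) = _
      rw [inH_mul_inA_eq_crossMap]
      generalize Coalgebra.comul (R := ℂ) y = u
      induction u with
      | zero => simp
      | add x y hx hy => simp only [map_add, TensorProduct.tmul_add, hx, hy]
      | tmul y z =>
        rw [crossMap_tmul, hE, mul_comm, map_mul]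
        rfl
  -- Coassociativity brings `S(h₁)` next to `h₂`, and the antipode axiom then contracts the pair.
  rw [h1, ← Coalgebra.coassoc_apply]
  have h2 : ∀ t : H ⊗[ℂ] H, E (TensorProduct.assoc ℂ H H H ((Coalgebra.comul (R := ℂ)).rTensor H t)) =
      crossMap F δ (inA F δ) (inH F δ) b
        ((Algebra.linearMap ℂ H ∘ₗ Coalgebra.counit (R := ℂ)).rTensor H t) := by
    intro t
    induction t with
    | zero => simp
    | add x y hx hy => simp only [map_add, hx, hy]
    | tmul x y =>
      rw [LinearMap.rTensor_tmul]
      simp only [E, LinearMap.comp_apply, LinearEquiv.coe_coe, LinearEquiv.symm_apply_apply,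
        LinearMap.rTensor_tmul]
      rw [HopfAlgebra.mul_antipode_rTensor_comul_apply]
      rfl
  rw [h2]
  have h3 := congrArg (fun u : ℂ ⊗[ℂ] H => crossMap F δ (inA F δ) (inH F δ) b
    ((Algebra.linearMap ℂ H).rTensor H u)) (Coalgebra.rTensor_counit_comul (R := ℂ) h)
  rw [LinearMap.rTensor_comp]
  refine h3.trans ?_
  simp [crossMap_tmul]

end Smash

namespace ComodStar
variable {s : H →ₐ[ℂ] ConjOp H} (hs : HopfStar s) {A : Type} [CommRing A] [Algebra ℂ A]
  {δ : Coaction H A} {σ : A →ₐ[ℂ] ConjOp A} (hσ : ComodStar s δ σ) {F : Bichar H}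
  (hF : hs.conj F = F)
include hs hσ

/-- The adjoint of `(h₁ ▷ b) h₂` is `h₂* (S(h₁*) ▷ b*)` by `tw_act`, which equals `b* h*` by
`inH_mul_act_antipode`; so the adjoints respect the cross relation. -/
lemma smash_covariant (h : H) (b : Tw F δ) : (ConjOp.map (Smash.inH F δ)).comp s h *
    (ConjOp.map (Smash.inA F δ)).comp (hσ.tw hs hF) b =
    Smash.crossMap F δ ((ConjOp.map (Smash.inA F δ)).comp (hσ.tw hs hF))
      ((ConjOp.map (Smash.inH F δ)).comp s) b (Coalgebra.comul (R := ℂ) h) := by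
  apply (down (B := Smash F δ)).injective
  rw [down_mul]
  change Smash.inA F δ (st (hσ.tw hs hF) b) * Smash.inH F δ (st s h) = _
  rw [← Smash.inH_mul_act_antipode, hs.comul]
  generalize Coalgebra.comul (R := ℂ) h = t
  induction t with
  | zero => simp
  | add x y hx hy => simp only [map_add, hx, hy]
  | tmul x y =>
    rw [Smash.crossMap_tmul, st_tens_tmul, TensorProduct.map_tmul, TensorProduct.comm_tmul,
      LinearMap.mul'_apply, down_mul]
    change _ = Smash.inH F δ (st s y) * Smash.inA F δ (st (hσ.tw hs hF) (Tw.act F δ x b))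
    rw [hσ.tw_act hs hF]
    rfl

/-- The star structure `(a h)* = h* a*` of the smash product. -/
def smash : Smash F δ →ₐ[ℂ] ConjOp (Smash F δ) :=
  Smash.lift F δ ((ConjOp.map (Smash.inA F δ)).comp (hσ.tw hs hF))
    ((ConjOp.map (Smash.inH F δ)).comp s) (hσ.smash_covariant hs hF)

lemma smash_inA (a : Tw F δ) :
    st (hσ.smash hs hF) (Smash.inA F δ a) = Smash.inA F δ (st (hσ.tw hs hF) a) :=
  congrArg down (Smash.lift_inA F δ _ _ (hσ.smash_covariant hs hF) a)

lemma smash_inH (h : H) :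
    st (hσ.smash hs hF) (Smash.inH F δ h) = Smash.inH F δ (st s h) :=
  congrArg down (Smash.lift_inH F δ _ _ (hσ.smash_covariant hs hF) h)

lemma smash_invol (x : Smash F δ) : st (hσ.smash hs hF) (st (hσ.smash hs hF) x) = x := by
  induction x using Smash.induction_mul with
  | h0 => simp
  | hadd x y hx hy => rw [map_add, map_add, hx, hy]
  | hmul a h =>
    rw [st_mul, st_mul, smash_inA, smash_inA, smash_inH, smash_inH, hσ.tw_invol, hs.invol]

section big
variable {C : Type} [CommRing C] [Algebra ℂ C] {ε : Coaction H C} {κ : C →ₐ[ℂ] ConjOp C}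
  (hκ : ComodStar s ε κ)
include hκ

/-- The star structure of `(A_F ⋊ H) ⊗ C_F`. -/
def big : Big F δ ε →ₐ[ℂ] ConjOp (Big F δ ε) := tens (hσ.smash hs hF) (hκ.tw hs hF)

lemma big_invol (x : Big F δ ε) : st (hσ.big hs hF hκ) (st (hσ.big hs hF hκ) x) = x :=
  st_tens_invol _ _ (hσ.smash_invol hs hF) (hκ.tw_invol hs hF) x

lemma big_bosA (a : A) : st (hσ.big hs hF hκ) (bosA F δ ε (Tw.mk F δ a)) =
    bosA F δ ε (Tw.mk F δ (st σ a)) := by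
  change st (tens _ _) (Smash.inA F δ (Tw.mk F δ a) ⊗ₜ 1) = _
  rw [st_tens_tmul, smash_inA, st_one]
  rfl

lemma big_bosC (c : C) : st (hσ.big hs hF hκ) (bosC F δ ε (Tw.mk F ε c)) =
    bosC F δ ε (Tw.mk F ε (st κ c)) := by
  change st (tens _ _) (Algebra.TensorProduct.map (Smash.inH F δ) (AlgHom.id ℂ (Tw F ε))
    ((Tw.mk F ε).toLinearMap.lTensor H (ε.coact c))) = Algebra.TensorProduct.map (Smash.inH F δ)
    (AlgHom.id ℂ (Tw F ε)) ((Tw.mk F ε).toLinearMap.lTensor H (ε.coact (st κ c)))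
  rw [hκ.coact]
  generalize ε.coact c = t
  induction t with
  | zero => simp
  | add x y hx hy => simp only [map_add, hx, hy]
  | tmul h c =>
    rw [st_tens_tmul, LinearMap.lTensor_tmul, LinearMap.lTensor_tmul,
      Algebra.TensorProduct.map_tmul, Algebra.TensorProduct.map_tmul, st_tens_tmul, smash_inH]
    rfl

/-- The star turns `μ(a ⊗ c)`, a product of the images of `a` and `c`, into one in the opposite
order; `R` puts it back into normal order. -/
lemma big_mu (t : A ⊗[ℂ] C) : st (hσ.big hs hF hκ) (mu F δ ε t) =
    mu F δ ε (Coaction.ord δ ε F.R (st (tens σ κ) t)) := by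
  induction t with
  | zero => simp
  | add x y hx hy => simp only [map_add, hx, hy]
  | tmul a c =>
    rw [mu_tmul, st_mul, hσ.big_bosA hs hF hκ, hσ.big_bosC hs hF hκ, bosC_mul_bosA, st_tens_tmul]

include hF in
-- The star reverses the word `a c`, and the value of the reversed word in the twisted tensor
-- product is given by the flip of `F`.
lemma st_ord (t : A ⊗[ℂ] C) : st (tens σ κ) (Coaction.ord δ ε F t) =
    Coaction.ord δ ε F.flip (st (tens σ κ) t) := by
  induction t with
  | zero => simp
  | add x y hx hy => simp only [map_add, hx, hy]
  | tmul a c =>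
    rw [st_tens_tmul, Coaction.ord_tmul, Coaction.ord_tmul, hκ.coact]
    generalize ε.coact c = u
    induction u with
    | zero => simp
    | add x y hx hy => simp only [map_add, hx, hy]
    | tmul h c =>
      rw [LinearMap.rTensor_tmul, st_tens_tmul, st_tens_tmul, LinearMap.rTensor_tmul,
        Coaction.lactR_apply, Coaction.lactR_apply, hσ.st_lact hs]
      congr 3
      conv_rhs => rw [← hF]
      rw [← hs.conj_flip, hs.conj_right, hs.invol]
      rfl

/-- Write `t` as `ord F u`. The star of `bos t` acquires the reordering `R` by `big_mu`, while that
of `t` acquires the flip by `st_ord`. The two agree because reordering by `R` is reordering by the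
flip of `F` followed by `F⁻¹`. -/
lemma big_bos (t : A ⊗[ℂ] C) : st (hσ.big hs hF hκ) (bos F δ ε (Tw.mk F _ t)) =
    bos F δ ε (Tw.mk F _ (st (tens σ κ) t)) := by
  have h : ∀ u : A ⊗[ℂ] C, Coaction.ord δ ε F.R u =
      Coaction.ord δ ε F.inv (Coaction.ord δ ε F.flip u) := by
    intro u
    rw [← Coaction.ord_ord_R, Coaction.ord_inv_ord]
  obtain ⟨u, rfl⟩ : ∃ u, Coaction.ord δ ε F u = t := ⟨_, Coaction.ord_ord_inv δ ε F t⟩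
  rw [bos_ord, hσ.big_mu hs hF hκ, h, hσ.st_ord hs hF hκ]
  rfl

end big
end ComodStar

open ConjOp

/-! ### The star structures on the classical comodule algebras -/

/-- The involution `1 ↔ 2`, `3 ↔ 4` of the indices. -/
def bar : Fin 4 → Fin 4 := ![1, 0, 3, 2]

/-- The signs in `M^j† = ± N^{bar j}`. -/
def dagSign : Fin 4 → ℂ := ![-1, 1, -1, 1]

lemma bar_bar (j : Fin 4) : bar (bar j) = j := by fin_cases j <;> rfl

lemma dagSign_mul_self (j : Fin 4) : dagSign j * dagSign j = 1 := by fin_cases j <;> simp [dagSign]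

lemma dagSign_bar (j : Fin 4) : dagSign (bar j) = -dagSign j := by
  fin_cases j <;> simp [dagSign, bar]

lemma conj_dagSign (j : Fin 4) : starRingEnd ℂ (dagSign j) = dagSign j := by
  fin_cases j <;> simp [dagSign]

lemma Mdag_eq_smul (k : ℕ) (j : Fin 4) (b : Fin k) (a : Fin (2 * k + 2)) :
    Mdag k j b a = dagSign j • Nmat k (bar j) b a := by
  fin_cases j
  · exact (neg_one_smul ℂ (Nmat k 1 b a)).symm
  · exact (one_smul ℂ (Nmat k 0 b a)).symm
  · exact (neg_one_smul ℂ (Nmat k 3 b a)).symm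
  · exact (one_smul ℂ (Nmat k 2 b a)).symm

/-- The sign of the adjoint of a generator of `A[M_k]`. -/
def genSign {k : ℕ} (p : Fin 4 × Gen k) : ℂ := Sum.elim (fun _ => dagSign p.1) (fun _ => -dagSign p.1) p.2

/-- The star structure on the free algebra. -/
def starMPoly (k : ℕ) : MPoly k →ₐ[ℂ] ConjOp (MPoly k) :=
  MvPolynomial.aeval fun p => down.symm
    (genSign p • MvPolynomial.X (bar p.1, Sum.elim (fun q => Sum.inr q.swap) (fun q => Sum.inl q.swap) p.2))

lemma starMPoly_inl (k : ℕ) (j : Fin 4) (q) : st (starMPoly k) (MvPolynomial.X (j, Sum.inl q)) =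
    dagSign j • MvPolynomial.X (bar j, Sum.inr q.swap) :=
  congrArg down (MvPolynomial.aeval_X _ _)

lemma starMPoly_inr (k : ℕ) (j : Fin 4) (q) : st (starMPoly k) (MvPolynomial.X (j, Sum.inr q)) =
    (-dagSign j) • MvPolynomial.X (bar j, Sum.inl q.swap) :=
  congrArg down (MvPolynomial.aeval_X _ _)

/-- The involution permutes the monad equations up to sign, so it passes to the quotient `A[M_k]`.
-/
lemma starMPoly_monadRel (k : ℕ) (j l : Fin 4) (d b : Fin k) :
    st (starMPoly k) (monadRel k j l d b) =
      (-(dagSign j * dagSign l)) • monadRel k (bar l) (bar j) b d := by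
  simp only [monadRel, map_sum, map_add, st_mul, starMPoly_inl, starMPoly_inr, Prod.swap_prod_mk,
    Finset.smul_sum]
  refine Finset.sum_congr rfl fun r _ => ?_
  simp only [smul_mul_smul_comm, smul_add]
  congr 2 <;> ring

/-- The star structure on `A[M_k]`. -/
def starAM (k : ℕ) : AM k →ₐ[ℂ] ConjOp (AM k) :=
  Ideal.Quotient.liftₐ (monadIdeal k)
    ((ConjOp.map (Ideal.Quotient.mkₐ ℂ (monadIdeal k))).comp (starMPoly k)) (by
    intro a ha
    refine Submodule.span_induction ?_ (map_zero _) (fun x y _ _ hx hy => by rw [map_add, hx, hy, add_zero])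
      (fun c x _ hx => by rw [smul_eq_mul, map_mul, hx, mul_zero]) ha
    rintro _ ⟨j, l, d, b, rfl⟩
    apply (down (B := AM k)).injective
    change Ideal.Quotient.mkₐ ℂ (monadIdeal k) (st (starMPoly k) (monadRel k j l d b)) = 0
    rw [starMPoly_monadRel, map_smul]
    have : Ideal.Quotient.mkₐ ℂ (monadIdeal k) (monadRel k (bar l) (bar j) b d) = 0 :=
      Ideal.Quotient.eq_zero_iff_mem.mpr (Ideal.subset_span ⟨_, _, _, _, rfl⟩)
    rw [this, smul_zero])

lemma starAM_mk (k : ℕ) (p : MPoly k) : st (starAM k) (Ideal.Quotient.mk _ p) =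
    Ideal.Quotient.mk _ (st (starMPoly k) p) := rfl

lemma starAM_Mmat (k : ℕ) (j : Fin 4) (a : Fin (2 * k + 2)) (b : Fin k) :
    st (starAM k) (Mmat k j a b) = Mdag k j b a := by
  rw [Mdag_eq_smul, Mmat, Matrix.of_apply, starAM_mk, starMPoly_inl]
  exact map_smul (Ideal.Quotient.mkₐ ℂ (monadIdeal k)) _ _

lemma starAM_Nmat (k : ℕ) (j : Fin 4) (d : Fin k) (c : Fin (2 * k + 2)) :
    st (starAM k) (Nmat k j d c) = (-dagSign j) • Mmat k (bar j) c d := by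
  rw [Nmat, Matrix.of_apply, starAM_mk, starMPoly_inr]
  exact map_smul (Ideal.Quotient.mkₐ ℂ (monadIdeal k)) _ _

lemma starAM_Mdag (k : ℕ) (j : Fin 4) (a : Fin (2 * k + 2)) (b : Fin k) :
    st (starAM k) (Mdag k j b a) = Mmat k j a b := by
  rw [Mdag_eq_smul, st_smul, conj_dagSign, starAM_Nmat, smul_smul, dagSign_bar, neg_neg,
    dagSign_mul_self, one_smul, bar_bar]

lemma AM_algHom_ext {k : ℕ} {E : Type} [Ring E] [Algebra ℂ E] {f g : AM k →ₐ[ℂ] E}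
    (hM : ∀ j a b, f (Mmat k j a b) = g (Mmat k j a b))
    (hN : ∀ j a b, f (Nmat k j a b) = g (Nmat k j a b)) : f = g := by
  have : ∀ p : MPoly k, f (Ideal.Quotient.mk _ p) = g (Ideal.Quotient.mk _ p) := by
    intro p
    induction p using MvPolynomial.induction_on with
    | C c =>
      change f (algebraMap ℂ _ c) = g (algebraMap ℂ _ c)
      rw [AlgHom.commutes, AlgHom.commutes]
    | add p q hp hq => rw [map_add, map_add, map_add, hp, hq]
    | mul_X p i hp =>
      rw [map_mul, map_mul, map_mul, hp]
      congr 1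
      obtain ⟨j, ⟨a, b⟩ | ⟨a, b⟩⟩ := i
      · exact hM j a b
      · exact hN j a b
  refine AlgHom.ext fun x => ?_
  obtain ⟨p, rfl⟩ := Ideal.Quotient.mk_surjective x
  exact this p

lemma starAM_invol (k : ℕ) (x : AM k) : st (starAM k) (st (starAM k) x) = x := by
  have : ConjOp.comp (starAM k) (starAM k) = AlgHom.id ℂ _ := by
    apply AM_algHom_ext
    · intro j a b
      rw [comp_apply, starAM_Mmat, starAM_Mdag, AlgHom.id_apply]
    · intro j a b
      rw [comp_apply, starAM_Nmat, st_smul, starAM_Mmat, Mdag_eq_smul, bar_bar, dagSign_bar, map_neg,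
        conj_dagSign, smul_smul, neg_mul_neg, dagSign_mul_self, one_smul, AlgHom.id_apply]
  exact DFunLike.congr_fun this x

/-- The star structure on `A[ℂ⁴]`. -/
def starC4 : C4 →ₐ[ℂ] ConjOp C4 :=
  MvPolynomial.aeval fun p => down.symm (MvPolynomial.X (p.1, !p.2))

lemma starC4_z (j : Fin 4) : st starC4 (z j) = zs j := congrArg down (MvPolynomial.aeval_X _ _)

lemma starC4_zs (j : Fin 4) : st starC4 (zs j) = z j := congrArg down (MvPolynomial.aeval_X _ _)

lemma starC4_rr : st starC4 rr = rr := by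
  simp only [rr, map_add, st_mul, starC4_z, starC4_zs]

/-- The star structure on `A₀[ℂ⁴]`. -/
def starC : C4loc →ₐ[ℂ] ConjOp C4loc :=
  IsLocalization.liftAlgHom (M := Submonoid.powers rr)
    (f := (ConjOp.map (IsScalarTower.toAlgHom ℂ C4 C4loc)).comp starC4)
    (by
      rintro ⟨_, n, rfl⟩
      have h : IsUnit (algebraMap C4 C4loc rr) := IsLocalization.Away.algebraMap_isUnit rr
      obtain ⟨u, hu⟩ := h
      change IsUnit (((ConjOp.map (IsScalarTower.toAlgHom ℂ C4 C4loc)).comp starC4) (rr ^ n))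
      rw [map_pow]
      -- As `r` is self-adjoint, its inverse in the localisation also inverts its image under the
      -- star.
      refine IsUnit.pow n (IsUnit.of_mul_eq_one (down.symm (↑u⁻¹ : C4loc)) ?_)
      apply (down (B := C4loc)).injective
      change (↑u⁻¹ : C4loc) * algebraMap C4 C4loc (st starC4 rr) = 1
      rw [starC4_rr, ← hu, Units.inv_mul])

lemma starC_algebraMap (x : C4) : st starC (algebraMap C4 C4loc x) =
    algebraMap C4 C4loc (st starC4 x) := by
  rw [st_apply, starC, IsLocalization.liftAlgHom_apply, IsLocalization.lift_eq]
  rfl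

lemma C4loc_algHom_ext {E : Type} [CommRing E] [Algebra ℂ E] {f g : C4loc →ₐ[ℂ] E}
    (h : ∀ j, f (algebraMap C4 C4loc (z j)) = g (algebraMap C4 C4loc (z j)))
    (h' : ∀ j, f (algebraMap C4 C4loc (zs j)) = g (algebraMap C4 C4loc (zs j))) : f = g := by
  refine IsLocalization.algHom_ext (Submonoid.powers rr) (MvPolynomial.algHom_ext ?_)
  rintro ⟨j, _ | _⟩
  · exact h j
  · exact h' j

lemma starC_invol (x : C4loc) : st starC (st starC x) = x := by
  have : ConjOp.comp starC starC = AlgHom.id ℂ _ := by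
    apply C4loc_algHom_ext
    · intro j
      rw [comp_apply, starC_algebraMap, starC_algebraMap, starC4_z, starC4_zs, AlgHom.id_apply]
    · intro j
      rw [comp_apply, starC_algebraMap, starC_algebraMap, starC4_zs, starC4_z, AlgHom.id_apply]
  exact DFunLike.congr_fun this x

/-- The star structure on `A[ℝ⁴]`. -/
def starR4 : R4 →ₐ[ℂ] ConjOp R4 := MvPolynomial.aeval fun i => down.symm (zeta (bar i))

lemma starR4_zeta (i : Fin 4) : st starR4 (zeta i) = zeta (bar i) :=
  congrArg down (MvPolynomial.aeval_X _ _)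

lemma starR4_invol (x : R4) : st starR4 (st starR4 x) = x := by
  have : ConjOp.comp starR4 starR4 = AlgHom.id ℂ _ := by
    apply MvPolynomial.algHom_ext
    intro i
    change st starR4 (st starR4 (zeta i)) = zeta i
    rw [starR4_zeta, starR4_zeta, bar_bar]
  exact DFunLike.congr_fun this x

open ConjOp

/-! ### Reality of the family -/

namespace Symm

/-- A Hopf `*`-structure on `H` compatible with the bicharacter and the coactions. -/
structure StarData (D : Symm H) (s : H →ₐ[ℂ] ConjOp H) : Prop where
  hopf : HopfStar s
  bichar : hopf.conj D.F = D.F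
  star_A : ∀ i j, st s (D.A i j) = D.As i j
  star_antipode : ∀ i j, st s (HopfAlgebra.antipode ℂ (D.A i j)) = HopfAlgebra.antipode ℂ (D.As i j)
  As_eq : ∀ i j, D.As i j = (dagSign i * dagSign j) • D.A (bar i) (bar j)
  star_g : ∀ i, st s (D.g i) = D.g (bar i)
  star_t : ∀ i, st s (D.t i) = D.t (bar i)

namespace StarData
variable {D : Symm H} {s : H →ₐ[ℂ] ConjOp H} (hD : D.StarData s) (k : ℕ)

lemma sum_bar {M : Type} [AddCommMonoid M] (f : Fin 4 → M) : ∑ i, f (bar i) = ∑ i, f i :=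
  Equiv.sum_comp (⟨bar, bar, bar_bar, bar_bar⟩ : Fin 4 ≃ Fin 4) f

include hD

lemma star_As (i j : Fin 4) : st s (D.As i j) = D.A i j := by
  rw [← hD.star_A, hD.hopf.invol]

/-- By `As_eq` the matrix `A*` is `A` with indices exchanged by `bar` and signs inserted, the same
exchange and signs that express `M†` through `N`. Hence `M†` transforms by `A*`, as the adjoint of
`M` must. -/
lemma coact_Mdag (j : Fin 4) (b : Fin k) (a : Fin (2 * k + 2)) : (D.coM k).coact (Mdag k j b a) =
    ∑ r, HopfAlgebra.antipode ℂ (D.As r j) ⊗ₜ Mdag k r b a := by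
  rw [Mdag_eq_smul, map_smul, coM_Nmat, ← sum_bar, Finset.smul_sum]
  refine Finset.sum_congr rfl fun r _ => ?_
  rw [Mdag_eq_smul, hD.As_eq, map_smul, TensorProduct.smul_tmul_smul]
  congr 1
  rw [mul_right_comm, dagSign_mul_self, one_mul]

lemma comodM : ComodStar s (D.coM k) (starAM k) where
  invol := starAM_invol k
  coact a := by
    have : (ConjOp.map (D.coM k).coact).comp (starAM k) =
        (tens s (starAM k)).comp (D.coM k).coact := by
      apply AM_algHom_ext
      · intro j a b
        apply (down (B := H ⊗[ℂ] AM k)).injective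
        change (D.coM k).coact (st (starAM k) (Mmat k j a b)) =
          st (tens s (starAM k)) ((D.coM k).coact (Mmat k j a b))
        rw [starAM_Mmat, hD.coact_Mdag, coM_Mmat, map_sum]
        refine Finset.sum_congr rfl fun r _ => ?_
        rw [st_tens_tmul, hD.star_antipode, starAM_Mmat]
      · intro j a b
        apply (down (B := H ⊗[ℂ] AM k)).injective
        change (D.coM k).coact (st (starAM k) (Nmat k j a b)) =
          st (tens s (starAM k)) ((D.coM k).coact (Nmat k j a b))
        rw [starAM_Nmat, map_smul, coM_Nmat, coM_Mmat, map_sum, ← sum_bar, Finset.smul_sum]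
        refine Finset.sum_congr rfl fun r _ => ?_
        rw [st_tens_tmul, hD.star_antipode, starAM_Nmat, hD.As_eq, map_smul,
          TensorProduct.smul_tmul_smul]
        congr 1
        linear_combination dagSign j * dagSign_mul_self r
    exact congrArg down (DFunLike.congr_fun this a)

lemma comodC : ComodStar s D.coC starC where
  invol := starC_invol
  coact a := by
    have : (ConjOp.map D.coC.coact).comp starC = (tens s starC).comp D.coC.coact := by
      apply C4loc_algHom_ext
      · intro j
        apply (down (B := H ⊗[ℂ] C4loc)).injective
        change D.coC.coact (st starC (algebraMap C4 C4loc (z j))) =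
          st (tens s starC) (D.coC.coact (algebraMap C4 C4loc (z j)))
        rw [starC_algebraMap, starC4_z, D.coC_coact_algebraMap, D.coC_coact_algebraMap, coC4_z,
          coC4_zs, map_sum, map_sum, map_sum]
        refine Finset.sum_congr rfl fun r _ => ?_
        rw [LinearMap.lTensor_tmul, LinearMap.lTensor_tmul, st_tens_tmul, hD.star_A]
        congr 1
        exact (congrArg _ (starC4_z r).symm).trans (starC_algebraMap (z r)).symm
      · intro j
        apply (down (B := H ⊗[ℂ] C4loc)).injective
        change D.coC.coact (st starC (algebraMap C4 C4loc (zs j))) =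
          st (tens s starC) (D.coC.coact (algebraMap C4 C4loc (zs j)))
        rw [starC_algebraMap, starC4_zs, D.coC_coact_algebraMap, D.coC_coact_algebraMap, coC4_z,
          coC4_zs, map_sum, map_sum, map_sum]
        refine Finset.sum_congr rfl fun r _ => ?_
        rw [LinearMap.lTensor_tmul, LinearMap.lTensor_tmul, st_tens_tmul, hD.star_As]
        congr 1
        exact (congrArg _ (starC4_zs r).symm).trans (starC_algebraMap (zs r)).symm
    exact congrArg down (DFunLike.congr_fun this a)

lemma comodR : ComodStar s D.coR starR4 where
  invol := starR4_invol
  coact a := by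
    have : (ConjOp.map D.coR.coact).comp starR4 = (tens s starR4).comp D.coR.coact := by
      apply MvPolynomial.algHom_ext
      intro i
      apply (down (B := H ⊗[ℂ] R4)).injective
      change D.coR.coact (st starR4 (zeta i)) = st (tens s starR4) (D.coR.coact (zeta i))
      rw [starR4_zeta, coR_zeta, coR_zeta, map_add, st_tens_tmul, st_tens_tmul, hD.star_g,
        hD.star_t, starR4_zeta, st_one]
    exact congrArg down (DFunLike.congr_fun this a)

/-- The star structure on `(A[M_k]_F ⋊ H) ⊗ A₀[ℂ⁴]_F`. -/
def starBC : D.BC k →ₐ[ℂ] ConjOp (D.BC k) := (hD.comodM k).big hD.hopf hD.bichar hD.comodC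

/-- The star structure on `(A[M_k]_F ⋊ H) ⊗ A[ℝ⁴]_F`. -/
def starBR : D.BR k →ₐ[ℂ] ConjOp (D.BR k) := (hD.comodM k).big hD.hopf hD.bichar hD.comodR

lemma smash_par (m : AM k) (h : H) :
    st ((hD.comodM k).smash hD.hopf hD.bichar) (D.par k m 1) = D.par k (st (starAM k) m) 1 ∧
    st ((hD.comodM k).smash hD.hopf hD.bichar) (D.par k 1 h) = D.par k 1 (st s h) := by
  constructor
  · exact (hD.comodM k).smash_inA hD.hopf hD.bichar (Tw.mk D.F (D.coM k) m)
  · exact (hD.comodM k).smash_inH hD.hopf hD.bichar h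

lemma starBC_tmul (x : Smash D.F (D.coM k)) (c : C4loc) :
    st (hD.starBC k) (x ⊗ₜ Tw.mk D.F D.coC c) =
      st ((hD.comodM k).smash hD.hopf hD.bichar) x ⊗ₜ Tw.mk D.F D.coC (st starC c) :=
  st_tens_tmul _ _ _ _

lemma starBR_tmul (x : Smash D.F (D.coM k)) (c : R4) :
    st (hD.starBR k) (x ⊗ₜ Tw.mk D.F D.coR c) =
      st ((hD.comodM k).smash hD.hopf hD.bichar) x ⊗ₜ Tw.mk D.F D.coR (st starR4 c) :=
  st_tens_tmul _ _ _ _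

/-- In general `μ` is not a `*`-map. It is one where normal ordering is trivial, since it then
coincides with `bos`. -/
lemma starBC_mu {x : AM k} {c : C4loc}
    (h : normalOrder D.F (D.coM k) D.coC (x ⊗ₜ c) = x ⊗ₜ c)
    (h' : normalOrder D.F (D.coM k) D.coC (st (starAM k) x ⊗ₜ st starC c) =
      st (starAM k) x ⊗ₜ st starC c) :
    st (hD.starBC k) (mu D.F (D.coM k) D.coC (x ⊗ₜ c)) =
      mu D.F (D.coM k) D.coC (st (starAM k) x ⊗ₜ st starC c) := by
  have h1 := (hD.comodM k).big_bos hD.hopf hD.bichar hD.comodC (x ⊗ₜ c)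
  rw [st_tens_tmul, bos_mk, bos_mk, h, h'] at h1
  exact h1

variable {k} {K : Subalgebra ℂ H} (hA : D.Admissible k K)
include hA

lemma starBC_sigma (a : Fin (2 * k + 2)) (b : Fin k) :
    st (hD.starBC k) (D.sigma k z a b) = D.sigmaStar k zs b a ∧
    st (hD.starBC k) (D.sigma k Jz a b) = D.sigmaStar k Jzs b a := by
  have hz : ∀ j, st starC (algebraMap C4 C4loc (z j)) = algebraMap C4 C4loc (zs j) := fun j =>
    (starC_algebraMap _).trans (congrArg _ (starC4_z j))
  have hJ : ∀ j, st starC (algebraMap C4 C4loc (Jz j)) = algebraMap C4 C4loc (Jzs j) := by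
    intro j
    rw [starC_algebraMap]
    congr 1
    fin_cases j
    · exact (map_neg (st starC4) _).trans (congrArg Neg.neg (starC4_zs 1))
    · exact starC4_zs 0
    · exact (map_neg (st starC4) _).trans (congrArg Neg.neg (starC4_zs 3))
    · exact starC4_zs 2
  simp only [sigma, sigmaStar, Matrix.of_apply, map_sum]
  constructor
  · refine Finset.sum_congr rfl fun j _ => ?_
    rw [hD.starBC_mu k (hA.order_z j a b) (by
      rw [starAM_Mmat, hz]
      exact hA.order_zs j b a), starAM_Mmat, hz]
  · refine Finset.sum_congr rfl fun j _ => ?_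
    rw [hD.starBC_mu k (hA.order_Jz j a b) (by
      rw [starAM_Mmat, hJ]
      exact hA.order_Jzs j b a), starAM_Mmat, hJ]

lemma starBC_V (a : Fin (2 * k + 2)) (b : Fin k ⊕ Fin k) :
    st (hD.starBC k) (D.V k a b) = D.Vs k b a := by
  obtain b | b := b
  · exact (hD.starBC_sigma hA a b).1
  · exact (hD.starBC_sigma hA a b).2

lemma starBC_Vs (a : Fin (2 * k + 2)) (b : Fin k ⊕ Fin k) :
    st (hD.starBC k) (D.Vs k b a) = D.V k a b := by
  rw [← hD.starBC_V hA]
  exact (hD.comodM k).big_invol hD.hopf hD.bichar hD.comodC _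

/-- That `ρ²` is hermitian is the condition for the star to extend to the algebra with `ρ⁻²`
adjoined. -/
lemma starBC_rhoSq (a b : Fin k) : st (hD.starBC k) (D.rhoSq k a b) = D.rhoSq k b a := by
  simp only [rhoSq, Matrix.mul_apply, map_sum, st_mul]
  refine Finset.sum_congr rfl fun c _ => ?_
  rw [(hD.starBC_sigma hA c b).1, ← (hD.starBC_sigma hA c a).1]
  congr 1
  exact (hD.comodM k).big_invol hD.hopf hD.bichar hD.comodC _

omit hA in
lemma starBR_bos (t : AM k ⊗[ℂ] R4) : st (hD.starBR k) (D.bosR k t) =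
    D.bosR k (st (tens (starAM k) starR4) t) :=
  (hD.comodM k).big_bos hD.hopf hD.bichar hD.comodR t

omit hA hD in
lemma star_vec (i : Fin 2) (a : Fin (2 * k + 2)) (b : Fin k) :
    st (tens (starAM k) starR4) (vec k i a b) = vecStar k i b a := by
  obtain ⟨e0, e1⟩ := vec_apply k a b
  obtain ⟨f0, f1⟩ := vecStar_apply k b a
  revert i
  rw [Fin.forall_fin_two, e0, e1, f0, f1]
  simp only [map_add, map_sub, st_tens_tmul, starAM_Mmat, starR4_zeta, st_one]
  exact ⟨rfl, rfl⟩

omit hA hD in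
lemma star_vecStar (i : Fin 2) (a : Fin (2 * k + 2)) (b : Fin k) :
    st (tens (starAM k) starR4) (vecStar k i b a) = vec k i a b := by
  rw [← star_vec, st_tens_invol _ _ (starAM_invol k) starR4_invol]

omit hA in
lemma starBR_ghat (a b : Fin k) : st (hD.starBR k) (D.ghat k a b) = D.ghat k b a := by
  simp only [ghat, Matrix.mul_apply, map_sum, st_mul, Matrix.map_apply, hD.starBR_bos, star_vec,
    star_vecStar]

omit hA hD in
lemma st_one_apply {E : Type} [Ring E] [Algebra ℂ E] (τ : E →ₐ[ℂ] ConjOp E) {m : Type}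
    [DecidableEq m] (a b : m) : st τ ((1 : Matrix m m E) a b) = (1 : Matrix m m E) b a := by
  rw [Matrix.one_apply, Matrix.one_apply]
  by_cases h : a = b
  · rw [if_pos h, if_pos h.symm, st_one]
  · rw [if_neg h, if_neg (Ne.symm h), map_zero]

omit hA hD in
-- The usual `(X G X*)* = X G X*` for hermitian `G`, written entrywise because the star is not
-- assumed to be an instance.
lemma st_sandwich {E : Type} [Ring E] [Algebra ℂ E] {τ : E →ₐ[ℂ] ConjOp E} {m n : Type}
    [Fintype n] {X : Matrix m n E} {G : Matrix n n E} {Y : Matrix n m E}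
    (hX : ∀ a b, st τ (X a b) = Y b a) (hY : ∀ a b, st τ (Y b a) = X a b)
    (hG : ∀ a b, st τ (G a b) = G b a) (a b : m) :
    st τ ((X * G * Y) a b) = (X * G * Y) b a := by
  have h : (X * G * Y) b a = (X * (G * Y)) b a := by rw [Matrix.mul_assoc]
  rw [h]
  simp only [Matrix.mul_apply, map_sum, st_mul, hX, hY, hG]

/-- The star structure on the algebra containing `P̃`. -/
def starLocC : D.LocC k →ₐ[ℂ] ConjOp (D.LocC k) :=
  Adj.starHom (D.rhoSq k) (hD.starBC k) (hD.starBC_rhoSq hA)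

lemma starLocC_ofC (x : D.BC k) :
    st (hD.starLocC hA) (D.ofC k x) = D.ofC k (st (hD.starBC k) x) :=
  Adj.starHom_of _ _ _ x

lemma starLocC_Pt (a b : Fin (2 * k + 2)) :
    st (hD.starLocC hA) (D.Pt k a b) = D.Pt k b a := by
  rw [Pt, Matrix.sub_apply, Matrix.sub_apply, map_sub, st_one_apply]
  congr 1
  refine st_sandwich ?_ ?_ ?_ a b
  · intro a b
    rw [Matrix.map_apply, hD.starLocC_ofC, hD.starBC_V hA, Matrix.map_apply]
  · intro a b
    rw [Matrix.map_apply, hD.starLocC_ofC, hD.starBC_Vs hA, Matrix.map_apply]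
  · rintro (a | a) (b | b)
    · exact Adj.starHom_inv _ _ _ a b
    · exact map_zero _
    · exact map_zero _
    · exact Adj.starHom_inv _ _ _ a b

omit hA

/-- The star structure on the algebra of functions on `ℝ⁴`. -/
def starLocR : D.LocR k →ₐ[ℂ] ConjOp (D.LocR k) :=
  Adj.starHom (D.ghat k) (hD.starBR k) hD.starBR_ghat

lemma starLocR_ofR (x : D.BR k) :
    st hD.starLocR (D.ofR k x) = D.ofR k (st (hD.starBR k) x) :=
  Adj.starHom_of _ _ _ x

lemma starLocR_PR (a b : Fin (2 * k + 2)) : st hD.starLocR (D.PR k a b) = D.PR k b a := by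
  rw [PR, Matrix.sub_apply, Matrix.sub_apply, map_sub, st_one_apply, Matrix.sum_apply,
    Matrix.sum_apply, map_sum]
  congr 1
  refine Finset.sum_congr rfl fun i _ => st_sandwich ?_ ?_ ?_ a b
  · intro a b
    simp only [Matrix.map_apply, hD.starLocR_ofR, hD.starBR_bos, star_vec]
  · intro a b
    simp only [Matrix.map_apply, hD.starLocR_ofR, hD.starBR_bos, star_vecStar]
  · exact fun a b => Adj.starHom_inv _ _ _ a b

lemma hasStar (hA : D.Admissible k K) : D.HasStar k where
  onC := by
    have h1 : ∀ x y : Smash D.F (D.coM k), st ((hD.comodM k).smash hD.hopf hD.bichar) x = y →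
        st (hD.starLocC hA) (D.ofC k (x ⊗ₜ 1)) = D.ofC k (y ⊗ₜ 1) := by
      rintro x y rfl
      have h := hD.starBC_tmul k x 1
      rw [st_one] at h
      rw [hD.starLocC_ofC]
      exact congrArg _ h
    refine ⟨st (hD.starLocC hA), isStar_st _ (Adj.starHom_invol _ _ _
      ((hD.comodM k).big_invol hD.hopf hD.bichar hD.comodC)), ?_, ?_, ?_, ?_, hD.starLocC_Pt hA⟩
    · intro j a b
      refine h1 _ _ ?_
      rw [(hD.smash_par k _ 1).1, starAM_Mmat]
    · intro i l
      refine h1 _ _ ?_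
      rw [(hD.smash_par k 0 _).2, hD.star_A]
    · intro i
      rw [hD.starLocC_ofC, hD.starBC_tmul, st_one, starC_algebraMap, starC4_z]
    · intro a b
      rw [hD.starLocC_ofC, hD.starBC_V hA]
  onR := by
    have h1 : ∀ x y : Smash D.F (D.coM k), st ((hD.comodM k).smash hD.hopf hD.bichar) x = y →
        st hD.starLocR (D.ofR k (x ⊗ₜ 1)) = D.ofR k (y ⊗ₜ 1) := by
      rintro x y rfl
      have h := hD.starBR_tmul k x 1
      rw [st_one] at h
      rw [hD.starLocR_ofR]
      exact congrArg _ h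
    refine ⟨st hD.starLocR, isStar_st _ (Adj.starHom_invol _ _ _
      ((hD.comodM k).big_invol hD.hopf hD.bichar hD.comodR)), ?_, ?_, ?_, ?_, hD.starLocR_PR⟩
    · intro j a b
      refine h1 _ _ ?_
      rw [(hD.smash_par k _ 1).1, starAM_Mmat]
    · intro i l
      refine h1 _ _ ?_
      rw [(hD.smash_par k 0 _).2, hD.star_A]
    · rw [hD.starLocR_ofR, hD.starBR_tmul, st_one, starR4_zeta]
      rfl
    · rw [hD.starLocR_ofR, hD.starBR_tmul, st_one, starR4_zeta]
      rfl

end StarData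
end Symm

open ConjOp

/-! ### The star structures of the two symmetry Hopf algebras -/

lemma ι_eq_sum_tau (v : Fin 4 → ℂ) : SymmetricAlgebra.ι ℂ (Fin 4 → ℂ) v = ∑ i, v i • tau i := by
  conv_lhs => rw [pi_eq_sum_univ' v]
  simp only [map_sum, map_smul]
  rfl

lemma HMoy_algHom_ext {E : Type} [Ring E] [Algebra ℂ E] {f g : HMoy →ₐ[ℂ] E}
    (h : ∀ i, f (tau i) = g (tau i)) : f = g := by
  refine AlgHom.ext fun x => ?_
  induction x using SymmetricAlgebra.induction with
  | algebraMap c => rw [AlgHom.commutes, AlgHom.commutes]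
  | ι v => simp only [ι_eq_sum_tau, map_sum, map_smul, h]
  | mul x y hx hy => rw [map_mul, map_mul, hx, hy]
  | add x y hx hy => rw [map_add, map_add, hx, hy]

/-- The generators are primitive, so `F(τ_i,·)` is an `ε`-derivation and is determined by its values
on the `τ_j`. -/
lemma Bichar.moy_ext {F G : Bichar HMoy}
    (h : ∀ i j, (F.left (tau i)).ofConv (tau j) = (G.left (tau i)).ofConv (tau j)) : F = G := by
  ext1
  refine HMoy_algHom_ext fun i => WithConv.ofConv_injective (LinearMap.ext fun x => ?_)
  have h1 : ∀ (B : Bichar HMoy) (x : HMoy),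
      (B.left x).ofConv 1 = Coalgebra.counit (R := ℂ) x := by
    intro B x
    rw [B.left_eq_right, map_one]
    rfl
  have hmul : ∀ (B : Bichar HMoy) (x y : HMoy), (B.left (tau i)).ofConv (x * y) =
      (B.left (tau i)).ofConv x * (B.left 1).ofConv y +
        (B.left 1).ofConv x * (B.left (tau i)).ofConv y := by
    intro B x y
    simp only [B.left_eq_right, map_mul]
    rw [LinearMap.convMul_apply, comul_tau]
    simp
  induction x using SymmetricAlgebra.induction with
  | algebraMap c => rw [Algebra.algebraMap_eq_smul_one, map_smul, map_smul, h1, h1]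
  | ι v => simp only [ι_eq_sum_tau, map_sum, map_smul, h]
  | mul x y hx hy => rw [hmul, hmul, hx, hy, map_one, map_one]
  | add x y hx hy => rw [map_add, map_add, hx, hy]

/-- The star structure `t_j ↔ t_j*` of the translation group. -/
def starMoy : HMoy →ₐ[ℂ] ConjOp HMoy :=
  SymmetricAlgebra.lift (Fintype.linearCombination ℂ fun i => down.symm (tau (bar i)))

lemma starMoy_tau (i : Fin 4) : st starMoy (tau i) = tau (bar i) := by
  rw [st_apply, starMoy, tau, SymmetricAlgebra.lift_ι_apply, Fintype.linearCombination_apply_single,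
    one_smul]
  rfl

/-- Complex conjugation. -/
def starComplex : ℂ →ₐ[ℂ] ConjOp ℂ := Algebra.ofId ℂ _

lemma hopfStar_starMoy : HopfStar starMoy where
  invol x := by
    have : ConjOp.comp starMoy starMoy = AlgHom.id ℂ _ := by
      refine HMoy_algHom_ext fun i => ?_
      rw [comp_apply, starMoy_tau, starMoy_tau, bar_bar, AlgHom.id_apply]
    exact DFunLike.congr_fun this x
  comul x := by
    have : (ConjOp.map (Bialgebra.comulAlgHom ℂ HMoy)).comp starMoy =
        (tens starMoy starMoy).comp (Bialgebra.comulAlgHom ℂ HMoy) := by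
      refine HMoy_algHom_ext fun i => (down (B := HMoy ⊗[ℂ] HMoy)).injective ?_
      change Coalgebra.comul (R := ℂ) (st starMoy (tau i)) =
        st (tens starMoy starMoy) (Coalgebra.comul (R := ℂ) (tau i))
      rw [starMoy_tau, comul_tau, comul_tau, map_add, st_tens_tmul, st_tens_tmul, starMoy_tau, st_one]
    exact congrArg down (DFunLike.congr_fun this x)
  counit x := by
    have : (ConjOp.map (Bialgebra.counitAlgHom ℂ HMoy)).comp starMoy =
        starComplex.comp (Bialgebra.counitAlgHom ℂ HMoy) := by
      refine HMoy_algHom_ext fun i => (down (B := ℂ)).injective ?_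
      change Coalgebra.counit (R := ℂ) (st starMoy (tau i)) =
        st starComplex (Coalgebra.counit (R := ℂ) (tau i))
      rw [starMoy_tau, counit_tau, counit_tau, map_zero]
    exact congrArg down (DFunLike.congr_fun this x)

section
variable {ħ : ℝ} {α β : ℂ}

/-- Exchanging the arguments and applying `bar` to both leaves the antisymmetric blocks of the
matrix unchanged, so only the reality of `iħα` and `iħβ` is needed. -/
lemma conj_moyMatrix (hα : (Complex.I * ħ * α).im = 0) (hβ : (Complex.I * ħ * β).im = 0)
    (i j : Fin 4) : starRingEnd ℂ (moyMatrix ħ α β (bar j) (bar i)) = moyMatrix ħ α β i j := by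
  have hα' := Complex.conj_eq_iff_im.mpr hα
  have hβ' := Complex.conj_eq_iff_im.mpr hβ
  rw [moyMatrix]
  generalize Complex.I * ħ * α = a at *
  generalize Complex.I * ħ * β = b at *
  fin_cases i <;> fin_cases j <;> simp [bar, map_div₀, hα', hβ', Complex.conj_ofNat]

lemma starData_moyal (hα : (Complex.I * ħ * α).im = 0) (hβ : (Complex.I * ħ * β).im = 0) :
    (moyal ħ α β).StarData starMoy where
  hopf := hopfStar_starMoy
  bichar := by
    refine Bichar.moy_ext fun i j => ?_
    have hF : (moyal ħ α β).F = moyBichar (moyMatrix ħ α β) := rfl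
    rw [hopfStar_starMoy.conj_left, conjFun_apply, starMoy_tau, starMoy_tau, hF,
      ← Bichar.left_eq_right, tau_values, tau_values, conj_moyMatrix hα hβ]
  star_A := by
    have hA : (moyal ħ α β).A =
      !![1, 0, 0, 0; 0, 1, 0, 0; tau 1, tau 3, 1, 0; -tau 2, tau 0, 0, 1] := rfl
    have hAs : (moyal ħ α β).As =
      !![1, 0, 0, 0; 0, 1, 0, 0; tau 0, tau 2, 1, 0; -tau 3, tau 1, 0, 1] := rfl
    rw [hA, hAs]
    intro i j
    fin_cases i <;> fin_cases j <;> simp [st_one, starMoy_tau, bar]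
  star_antipode := by
    have hA : (moyal ħ α β).A =
      !![1, 0, 0, 0; 0, 1, 0, 0; tau 1, tau 3, 1, 0; -tau 2, tau 0, 0, 1] := rfl
    have hAs : (moyal ħ α β).As =
      !![1, 0, 0, 0; 0, 1, 0, 0; tau 0, tau 2, 1, 0; -tau 3, tau 1, 0, 1] := rfl
    rw [hA, hAs]
    intro i j
    fin_cases i <;> fin_cases j <;> simp [st_one, starMoy_tau, bar, antipode_tau]
  As_eq := by
    have hA : (moyal ħ α β).A =
      !![1, 0, 0, 0; 0, 1, 0, 0; tau 1, tau 3, 1, 0; -tau 2, tau 0, 0, 1] := rfl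
    have hAs : (moyal ħ α β).As =
      !![1, 0, 0, 0; 0, 1, 0, 0; tau 0, tau 2, 1, 0; -tau 3, tau 1, 0, 1] := rfl
    rw [hA, hAs]
    intro i j
    fin_cases i <;> fin_cases j <;> simp [bar, dagSign]
  star_g _ := st_one _
  star_t := starMoy_tau

end

/-- The star structure `s_j* = s_j⁻¹` of the torus. -/
def starTor : HTor →ₐ[ℂ] ConjOp HTor :=
  AddMonoidAlgebra.lift ℂ (ConjOp HTor) (Fin 2 → ℤ)
    { toFun := fun m => down.symm (AddMonoidAlgebra.single (-m.toAdd) 1)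
      map_one' := congrArg down.symm (by rw [AddMonoidAlgebra.one_def, toAdd_one, neg_zero])
      map_mul' := fun x y => by
        rw [← down_symm_mul, AddMonoidAlgebra.single_mul_single, toAdd_mul, neg_add_rev, one_mul] }

lemma starTor_single (m : Fin 2 → ℤ) : st starTor (AddMonoidAlgebra.single m 1) =
    AddMonoidAlgebra.single (-m) 1 := by
  rw [st_apply, starTor, AddMonoidAlgebra.lift_single, one_smul]
  rfl

lemma starTor_smon (m n : ℤ) : st starTor (smon m n) = smon (-m) (-n) := by
  rw [smon, starTor_single, smon]
  congr 1
  exact Matrix.neg_cons _ _ |>.trans (by rw [Matrix.neg_cons, Matrix.neg_empty])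

lemma HTor_algHom_ext {E : Type} [Ring E] [Algebra ℂ E] {f g : HTor →ₐ[ℂ] E}
    (h : ∀ m, f (AddMonoidAlgebra.single m 1) = g (AddMonoidAlgebra.single m 1)) : f = g := by
  have : f.toLinearMap = g.toLinearMap :=
    AddMonoidAlgebra.lhom_ext' fun m => LinearMap.ext_ring (h m)
  exact AlgHom.ext fun x => DFunLike.congr_fun this x

lemma hopfStar_starTor : HopfStar starTor where
  invol x := by
    have : ConjOp.comp starTor starTor = AlgHom.id ℂ _ := by
      refine HTor_algHom_ext fun m => ?_
      rw [comp_apply, starTor_single, starTor_single, neg_neg, AlgHom.id_apply]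
    exact DFunLike.congr_fun this x
  comul x := by
    have : (ConjOp.map (Bialgebra.comulAlgHom ℂ HTor)).comp starTor =
        (tens starTor starTor).comp (Bialgebra.comulAlgHom ℂ HTor) := by
      refine HTor_algHom_ext fun m => (down (B := HTor ⊗[ℂ] HTor)).injective ?_
      change Coalgebra.comul (R := ℂ) (st starTor (AddMonoidAlgebra.single m 1)) =
        st (tens starTor starTor) (Coalgebra.comul (R := ℂ) (AddMonoidAlgebra.single m 1 : HTor))
      rw [starTor_single, Tor.comul_single, Tor.comul_single, st_tens_tmul, starTor_single]
    exact congrArg down (DFunLike.congr_fun this x)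
  counit x := by
    have : (ConjOp.map (Bialgebra.counitAlgHom ℂ HTor)).comp starTor =
        starComplex.comp (Bialgebra.counitAlgHom ℂ HTor) := by
      refine HTor_algHom_ext fun m => (down (B := ℂ)).injective ?_
      change Coalgebra.counit (R := ℂ) (st starTor (AddMonoidAlgebra.single m 1)) =
        st starComplex (Coalgebra.counit (R := ℂ) (AddMonoidAlgebra.single m 1 : HTor))
      rw [starTor_single, Tor.counit_single, Tor.counit_single, st_one]
    exact congrArg down (DFunLike.congr_fun this x)

/-- Conjugation changes the sign of `i` in the exponent; the antisymmetry of `Θ` undoes this when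
the arguments are exchanged, and the two minus signs on the arguments cancel. -/
lemma conj_chi (Θ : Matrix (Fin 2) (Fin 2) ℝ) (m n : Fin 2 → ℤ) (h : Θ.transpose = -Θ) :
    starRingEnd ℂ (Tor.chi Θ (-n) (-m)) = Tor.chi Θ m n := by
  have h' : ∀ i j, Θ j i = -Θ i j := fun i j => congrFun (congrFun h i) j
  rw [Tor.chi, Tor.chi, ← Complex.exp_conj]
  congr 1
  simp only [map_mul, map_sum, Complex.conj_I, Complex.conj_ofReal, Pi.neg_apply, Int.cast_neg,
    map_neg, map_intCast]
  rw [Finset.sum_comm, neg_mul, neg_mul, ← mul_neg, ← Finset.sum_neg_distrib]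
  congr 1
  refine Finset.sum_congr rfl fun i _ => ?_
  rw [← Finset.sum_neg_distrib]
  refine Finset.sum_congr rfl fun j _ => ?_
  rw [h' i j]
  push_cast
  ring

lemma starData_toric (θ : ℝ) : (toric θ).StarData starTor where
  hopf := hopfStar_starTor
  bichar := by
    ext1
    refine HTor_algHom_ext fun m => WithConv.ofConv_injective
      (AddMonoidAlgebra.lhom_ext' fun n => LinearMap.ext_ring ?_)
    have hF : (toric θ).F = Tor.bichar !![0, θ / 2; -(θ / 2), 0] := rfl
    change ((hopfStar_starTor.conj (toric θ).F).left (AddMonoidAlgebra.single m 1)).ofConv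
      (AddMonoidAlgebra.single n 1) = ((toric θ).F.left (AddMonoidAlgebra.single m 1)).ofConv
      (AddMonoidAlgebra.single n 1)
    rw [hopfStar_starTor.conj_left, conjFun_apply, starTor_single, starTor_single, hF,
      ← Bichar.left_eq_right]
    change starRingEnd ℂ ((Tor.left _ _).ofConv _) = (Tor.left _ _).ofConv _
    rw [Tor.left_single, Tor.left_single, Tor.char_single, Tor.char_single, conj_chi]
    ext i j
    fin_cases i <;> fin_cases j <;> simp
  star_A := by
    have hA : (toric θ).A = Matrix.diagonal ![smon 1 0, smon (-1) 0, smon 0 1, smon 0 (-1)] := rfl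
    have hAs : (toric θ).As = Matrix.diagonal ![smon (-1) 0, smon 1 0, smon 0 (-1), smon 0 1] := rfl
    rw [hA, hAs]
    intro i j
    fin_cases i <;> fin_cases j <;> simp [starTor_smon]
  star_antipode := by
    have hA : (toric θ).A = Matrix.diagonal ![smon 1 0, smon (-1) 0, smon 0 1, smon 0 (-1)] := rfl
    have hAs : (toric θ).As = Matrix.diagonal ![smon (-1) 0, smon 1 0, smon 0 (-1), smon 0 1] := rfl
    rw [hA, hAs]
    intro i j
    fin_cases i <;> fin_cases j <;> simp [starTor_smon, antipode_smon]
  As_eq := by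
    have hA : (toric θ).A = Matrix.diagonal ![smon 1 0, smon (-1) 0, smon 0 1, smon 0 (-1)] := rfl
    have hAs : (toric θ).As = Matrix.diagonal ![smon (-1) 0, smon 1 0, smon 0 (-1), smon 0 1] := rfl
    rw [hA, hAs]
    intro i j
    fin_cases i <;> fin_cases j <;> simp [bar, dagSign]
  star_g i := by
    rw [toric_g]
    fin_cases i <;> simp [starTor_smon, bar]
  star_t _ := by
    rw [toric_t, toric_t, map_zero]

end ADHM

end

theorem mainTheorem8 (k : ℕ) :
    (∀ (ħ : ℝ) (α β : ℂ), (ADHM.moyal ħ α β).IsInstantonFamily k ∧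
      ((Complex.I * ħ * α).im = 0 → (Complex.I * ħ * β).im = 0 →
        (ADHM.moyal ħ α β).HasStar k)) ∧
    (∀ θ : ℝ, (ADHM.toric θ).IsInstantonFamily k ∧ (ADHM.toric θ).HasStar k) :=
  ⟨fun ħ α β => ⟨(ADHM.admissible_moyal ħ α β k).isInstantonFamily, fun hα hβ =>
    (ADHM.starData_moyal hα hβ).hasStar (ADHM.admissible_moyal ħ α β k)⟩,
  fun θ => ⟨(ADHM.admissible_toric θ k).isInstantonFamily,
    (ADHM.starData_toric θ).hasStar (ADHM.admissible_toric θ k)⟩⟩
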